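/- **Setting.** Let $F$ be a number field of degree $n\ge 2$ with discriminant $\Delta_F$ and ring of integers $O_F$; let $\sigma$ run over its infinite places, $\deg\sigma\in\{1,2\}$, let $r_2$ be the number of complex places, and put $\partial_F=(2/\pi)^{r_2}\sqrt{|\Delta_F|}$. On $F_{\mathbb R}=F\otimes\mathbb R$ use $\|x\|^2=\sum_\sigma\deg(\sigma)|x_\sigma|^2$ and $N(u)=\prod_\sigma u_\sigma^{\deg\sigma}$ for $u\in\prod_\sigma\mathbb R_{>0}$. An Arakelov divisor $W=(I,v)$ consists of a fractional ideal $I\neq0$ and $v\in\prod_\sigma\mathbb R_{>0}$; its lattice is $vI\subset F_{\mathbb R}$, its degree is $d=-\log(N(v)N(I))$, and $$h^0(W)=\log\sum_{f\in I}e^{-\pi\|fv\|^2}.$$ For an ideal $J$ let $d(J)$ be the divisor $(J,(N(J)^{-1/n})_\sigma)$. An LLL-reduction of $(I,u)$ computes an LLL-reduced basis of $uI$ with first vector $b_1=uf$, and returns $J=f^{-1}I$ and $s=|b_1|N(J)^{1/n}$. **Algorithm.** Input: $F$ (given by an integral basis of $O_F$, that is, its multiplication table, its images in $F_{\mathbb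 R}$, the degrees of the infinite places, and $\Delta_F$), a $\mathbb Z$-basis of $I$ (by integer coordinates over a common denominator), the coordinates of $v$, and $\delta$. 1. *Good divisor.* Let $u=e^{d/n}v$. (i) LLL-reduce $(I,N(I)^{-1/n})$ to $J_1,s_1$. (ii) Write $N(I)^{1/n}u=(e^{-w_\sigma})_\sigma$, take the least $t\ge0$ with $n2^{-t}|w_\sigma|<\log\partial_F$ for all $\sigma$, LLL-reduce $(O_F,(e^{-2^{-t}w_\sigma})_\sigma)$, and then $t$ times replace the current pair $(J',\omega)$ by the LLL-reduction of $(J'^2,(\omega N(J')^{-1/n})^2)$; this gives $J_2,s_2$. (iii) LLL-reduce $d(J_1)+d(J_2)$ to $J,s_3$. Let $s=s_1s_2s_3$. 2. *Poisson summation.* Compute an LLL-reduced basis $b_1,\dots,b_n$ of $L=e^{-d/n}N(J)^{-1/n}sJ$, its Gram–Schmidt orthogonalization $b_i^*$, $A_{ii}=\|b_i^*\|^2$ and $A_{ij}=\langle b_i,b_j^*\rangle/\|b_j^*\|^2$ ($j<i$). Let $k\ge0$ be the largest index with $\|b_j^*\|<1$ for all $j\le k$. Let $c_1,\dots,c_k$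 be the basis dual to $b_1,\dots,b_k$ in their real span, $c_i^*$ its Gram–Schmidt orthogonalization, $C_{ii}=\|c_i^*\|^2$, $C_{ij}=\langle c_i,c_j^*\rangle/\|c_j^*\|^2$ ($j<i$). Put $\gamma=\prod_{i\le k}\|b_i^*\|$ and $Q=Q_1+2iQ_2$, where $$Q_1(x)=\sum_{j>k}A_{jj}\Big(x_j+\sum_{t>j}A_{tj}x_t\Big)^2+\sum_{i\le k}C_{ii}\Big(x_i+\sum_{i<r\le k}C_{ri}x_r\Big)^2,\qquad Q_2(x)=\sum_{l\le k}\sum_{j>k}\sum_{i\le k}A_{ji}\langle c_l,b_i^*\rangle x_lx_j .$$ 3. *Short vectors.* Let $M=\frac1{\pi-1}\big(\log(1/\delta)+(n+1)\log3+(\tfrac{n(n+1)}2-1)\log2\big)$, find all $x\in\mathbb Z^n$ with $Q_1(x)\le M$ by Fincke–Pohst enumeration, and return $\log\big(\gamma^{-1}\sum_{Q_1(x)\le M}e^{-\pi Q(x)}\big)$. Running time is counted as follows: arithmetic on integers costs schoolbook bit time, an exact operation on real numbers ($+,-,\times,/$, comparison, $\sqrt{\ },\exp,\log,\cos$) costs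 one unit, and conversion between integers and reals (rounding included) costs the bit length of the integer. **Proposition.** Fix $n\ge2$ and $c\in\mathbb N$. There is a constant $C$, depending only on $n$ and $c$, such that the following holds for every number field $F$ of degree $n$, every $W=(I,v)$ and every $0<\delta<1$. Suppose that the data have size at most $|\Delta_F|^c$: the absolute values at the infinite places of the elements of the integral basis, the integer coordinates and the common denominator of the basis of $I$, and the numbers $|\log v_\sigma|$ are all at most $|\Delta_F|^c$. Then the algorithm halts, its output differs from $h^0(W)$ by at most $\delta$, and its running time is at most $$C\,\big((1+\log(1/\delta))\cdot\log|\Delta_F|\big)^{C}.$$ -/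

import Mathlib

/-!
# Arakelov divisors, the function `h⁰`, and an algorithm approximating it, with its step count
-/

open scoped NumberField

/-- An Arakelov divisor of `F`: a (nonzero) fractional ideal together with a positive real number
at every infinite place. -/
structure ArakelovDivisor (F : Type*) [Field F] [NumberField F] where
  /-- the finite part -/
  ideal : (FractionalIdeal (nonZeroDivisors (𝓞 F)) F)ˣ
  /-- the infinite part -/
  u : NumberField.InfinitePlace F → ℝ
  u_pos : ∀ w, 0 < u w

namespace ArakelovDivisor

variable {F : Type*} [Field F] [NumberField F]

/-- `‖f‖_D² = ‖u f‖² = ∑_σ deg(σ) |u_σ σ(f)|²`. -/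
noncomputable def sqNorm (D : ArakelovDivisor F) (f : F) : ℝ :=
  ∑ w : NumberField.InfinitePlace F, (w.mult : ℝ) * (D.u w * w f) ^ 2

/-- `h⁰(D) = log ∑_{f ∈ I} exp (-π ‖f‖_D²)`. -/
noncomputable def h0 (D : ArakelovDivisor F) : ℝ :=
  Real.log (∑' f : {f : F // f ∈ (D.ideal : FractionalIdeal (nonZeroDivisors (𝓞 F)) F)},
    Real.exp (-Real.pi * D.sqNorm f.1))

end ArakelovDivisor

namespace ArakelovAlg

noncomputable section

/-! ## The machine model

A computation either diverges (`none`) or halts with a value and the time it has used.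
Programs touch integers and real numbers only through the primitive operations below.
Operations on exact integers are charged by bit length (schoolbook arithmetic), an exact
operation on real numbers is charged one unit, and passing between real numbers and integers
is charged the bit length of the integer. Every pass through a loop costs one unit. -/

/-- Computations with a running time. -/
def Comp (α : Type) : Type := Option (α × ℕ)

/-- A primitive operation with result `a` and price `c`. -/
def prim {α : Type} (a : α) (c : ℕ) : Comp α := some (a, c)

instance : Monad Comp where
  pure a := some (a, 0)
  bind x f := Option.bind x fun p => Option.bind (f p.1) fun q => some (q.1, p.2 + q.2)

/-- At most `k` passes through the loop with body `f` that ends when `f` returns a result;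
`none` if this is not enough. -/
def loopFuel {σ α : Type} (f : σ → Comp (σ ⊕ α)) : ℕ → σ → Comp α
  | 0, _ => none
  | k + 1, s => do
    let y ← f s
    let a ← (match y with
      | Sum.inl s' => loopFuel f k s'
      | Sum.inr a => pure a)
    prim a 1

open Classical in
/-- While loop: apply `f` to the state until it returns a result. It diverges if no number of
passes suffices; otherwise the value and the time do not depend on the (sufficient) fuel. -/
def repeatUntil {σ α : Type} (s : σ) (f : σ → Comp (σ ⊕ α)) : Comp α :=
  if h : ∃ k, loopFuel f k s ≠ none then loopFuel f (Nat.find h) s else none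

/-- Bit length of an integer, with its sign. -/
def bits (z : ℤ) : ℕ := Nat.size z.natAbs + 1

def iadd (a b : ℤ) : Comp ℤ := prim (a + b) (bits a + bits b)
def isub (a b : ℤ) : Comp ℤ := prim (a - b) (bits a + bits b)
def imul (a b : ℤ) : Comp ℤ := prim (a * b) (bits a * bits b)
def idiv (a b : ℤ) : Comp ℤ := prim (a / b) (bits a * bits b)
def imod (a b : ℤ) : Comp ℤ := prim (a % b) (bits a * bits b)
def iabs (a : ℤ) : Comp ℤ := prim |a| (bits a)
def iisZero (a : ℤ) : Comp Bool := prim (decide (a = 0)) (bits a)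

def radd (x y : ℝ) : Comp ℝ := prim (x + y) 1
def rsub (x y : ℝ) : Comp ℝ := prim (x - y) 1
def rmul (x y : ℝ) : Comp ℝ := prim (x * y) 1
def rdiv (x y : ℝ) : Comp ℝ := prim (x / y) 1
def rneg (x : ℝ) : Comp ℝ := prim (-x) 1
def rabs (x : ℝ) : Comp ℝ := prim |x| 1
def rsqrt (x : ℝ) : Comp ℝ := prim (Real.sqrt x) 1
def rexp (x : ℝ) : Comp ℝ := prim (Real.exp x) 1
def rlog (x : ℝ) : Comp ℝ := prim (Real.log x) 1
def rcos (x : ℝ) : Comp ℝ := prim (Real.cos x) 1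
def rpi : Comp ℝ := prim Real.pi 1
open Classical in
def rlt (x y : ℝ) : Comp Bool := prim (decide (x < y)) 1

def ofInt (z : ℤ) : Comp ℝ := prim (z : ℝ) (bits z)
def rround (x : ℝ) : Comp ℤ := prim (round x) (bits (round x))
def rfloor (x : ℝ) : Comp ℤ := prim ⌊x⌋ (bits ⌊x⌋)
def rceil (x : ℝ) : Comp ℤ := prim ⌈x⌉ (bits ⌈x⌉)

/-! ## Loops over an index range -/

/-- Compute the entries of a vector one after the other. -/
def tab {α : Type} : (m : ℕ) → (Fin m → Comp α) → Comp (Fin m → α)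
  | 0, _ => pure Fin.elim0
  | m + 1, f => do
    let x ← f 0
    let xs ← tab m fun i => f i.succ
    prim (Fin.cons x xs) 1

/-- Update a state for `i = 0, …, m - 1`. -/
def foldFin {σ : Type} : (m : ℕ) → (Fin m → σ → Comp σ) → σ → Comp σ
  | 0, _, s => pure s
  | m + 1, f, s => do
    let s' ← f 0 s
    let s'' ← foldFin m (fun i => f i.succ) s'
    prim s'' 1

def isum (m : ℕ) (f : Fin m → Comp ℤ) : Comp ℤ :=
  foldFin m (fun i s => do iadd s (← f i)) 0

def rsum (m : ℕ) (f : Fin m → Comp ℝ) : Comp ℝ :=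
  foldFin m (fun i s => do radd s (← f i)) 0

/-- Determinant by expansion along the first row, over integers or reals. -/
def det {R : Type} (zero one : R) (add sub mul : R → R → Comp R) :
    (m : ℕ) → (Fin m → Fin m → R) → Comp R
  | 0, _ => pure one
  | m + 1, A =>
    foldFin (m + 1) (fun j s => do
      let d ← det zero one add sub mul m fun a b => A a.succ (j.succAbove b)
      let t ← mul (A 0 j) d
      if Even (j : ℕ) then add s t else sub s t) zero

def idet (m : ℕ) (A : Fin m → Fin m → ℤ) : Comp ℤ := det 0 1 iadd isub imul m A
def rdet (m : ℕ) (A : Fin m → Fin m → ℝ) : Comp ℝ := det 0 1 radd rsub rmul m A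

/-- Greatest common divisor by Euclid's algorithm. -/
def igcd (a b : ℤ) : Comp ℤ :=
  repeatUntil (a, b) fun s => do
    if ← iisZero s.2 then
      let g ← iabs s.1
      pure (Sum.inr g)
    else
      let m ← imod s.1 s.2
      pure (Sum.inl (s.2, m))

/-! ## The input -/

/-- What the algorithm is given. The field of degree `n` is given by an integral basis `ω`:
its multiplication table, its images in `F_ℝ`, the degrees of the `r` infinite places, and the
discriminant. Elements of `F_ℝ` are stored by real and imaginary part at each infinite place.
The ideal `I` has the basis `(∑ i, num j i • ω i) / den`. -/
structure Input (n : ℕ) where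
  r : ℕ
  deg : Fin r → ℤ
  disc : ℤ
  table : Fin n → Fin n → Fin n → ℤ
  emb : Fin n → Fin r → ℝ × ℝ
  num : Fin n → Fin n → ℤ
  den : ℤ
  v : Fin r → ℝ
  δ : ℝ

/-- Ideals inside the algorithm: basis vectors `(∑ i, num j i • ω i) / den`. -/
structure IdealRep (n : ℕ) where
  num : Fin n → Fin n → ℤ
  den : ℤ

variable {n : ℕ}

/-! ## Linear algebra in `F_ℝ` -/

abbrev Vec (r : ℕ) := Fin r → ℝ × ℝ

/-- `⟨x, y⟩ = ∑_σ deg(σ) Re (x_σ conj(y_σ))`. -/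
def innerProd (inp : Input n) (x y : Vec inp.r) : Comp ℝ :=
  rsum inp.r fun σ => do
    let a ← rmul (x σ).1 (y σ).1
    let b ← rmul (x σ).2 (y σ).2
    let s ← radd a b
    let d ← ofInt (inp.deg σ)
    rmul d s

/-- `x - c y`. -/
def subSmul (inp : Input n) (x : Vec inp.r) (c : ℝ) (y : Vec inp.r) : Comp (Vec inp.r) :=
  tab inp.r fun σ => do
    let a ← rmul c (y σ).1
    let b ← rmul c (y σ).2
    let a' ← rsub (x σ).1 a
    let b' ← rsub (x σ).2 b
    pure (a', b')

/-- `⟨x, y⟩ / ‖y‖²`. -/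
def projCoeff (inp : Input n) (x y : Vec inp.r) : Comp ℝ := do
  let a ← innerProd inp x y
  let b ← innerProd inp y y
  rdiv a b

/-- Gram-Schmidt orthogonalization (without normalization). -/
def gramSchmidt (inp : Input n) : (m : ℕ) → (Fin m → Vec inp.r) → Comp (Fin m → Vec inp.r)
  | 0, _ => pure Fin.elim0
  | m + 1, b => do
    let bs ← gramSchmidt inp m fun i => b i.castSucc
    let x ← foldFin m (fun j x => do
      let c ← projCoeff inp (b (Fin.last m)) (bs j)
      subSmul inp x c (bs j)) (b (Fin.last m))
    prim (Fin.snoc bs x : Fin (m + 1) → Vec inp.r) 1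

/-- The vectors `u · ∑ i, N j i • ω i` of `F_ℝ`. -/
def realBasis (inp : Input n) (u : Fin inp.r → ℝ) (N : Fin n → Fin n → ℤ) :
    Comp (Fin n → Vec inp.r) :=
  tab n fun j => tab inp.r fun σ => do
    let x ← rsum n fun i => do
      let c ← ofInt (N j i)
      rmul c (inp.emb i σ).1
    let y ← rsum n fun i => do
      let c ← ofInt (N j i)
      rmul c (inp.emb i σ).2
    let x' ← rmul (u σ) x
    let y' ← rmul (u σ) y
    pure (x', y')

/-! ## The LLL algorithm -/

/-- Subtract from the `k`-th basis vector suitable integer multiples of the vectors with indices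
`j - 1, …, 1, 0`. -/
def sizeReduce (inp : Input n) (u : Fin inp.r → ℝ) (k : Fin n) :
    (j : ℕ) → j ≤ n → (Fin n → Fin n → ℤ) → Comp (Fin n → Fin n → ℤ)
  | 0, _, N => pure N
  | j + 1, hj, N => do
    let b ← realBasis inp u N
    let bs ← gramSchmidt inp n b
    let μ ← projCoeff inp (b k) (bs ⟨j, hj⟩)
    let q ← rround μ
    let row ← tab n fun i => do
      let t ← imul q (N ⟨j, hj⟩ i)
      isub (N k i) t
    sizeReduce inp u k j (Nat.le_of_succ_le hj) (Function.update N k row)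

/-- LLL reduction (with parameter `3/4`) of the basis `realBasis inp u N` of a lattice in `F_ℝ`,
acting on the coefficient vectors. The counter of the main loop starts at the second vector. -/
def lll (inp : Input n) (u : Fin inp.r → ℝ) (N₀ : Fin n → Fin n → ℤ) :
    Comp (Fin n → Fin n → ℤ) :=
  repeatUntil (N₀, 1) fun s =>
    if h : s.2 < n then do
      let k : Fin n := ⟨s.2, h⟩
      let k' : Fin n := ⟨s.2 - 1, lt_of_le_of_lt (Nat.sub_le _ _) h⟩
      let N ← sizeReduce inp u k s.2 h.le s.1
      let b ← realBasis inp u N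
      let bs ← gramSchmidt inp n b
      let A ← innerProd inp (bs k) (bs k)
      let A' ← innerProd inp (bs k') (bs k')
      let μ ← projCoeff inp (b k) (bs k')
      let μ2 ← rmul μ μ
      let three ← ofInt 3
      let four ← ofInt 4
      let q ← rdiv three four
      let c ← rsub q μ2
      let bound ← rmul c A'
      if ← rlt A bound then
        pure (Sum.inl (fun i => N (Equiv.swap k k' i), max (s.2 - 1) 1))
      else
        pure (Sum.inl (N, s.2 + 1))
    else pure (Sum.inr s.1)

/-! ## Arithmetic of ideals -/

/-- Product of two elements given by their coordinates in the integral basis. -/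
def mulElt (inp : Input n) (x y : Fin n → ℤ) : Comp (Fin n → ℤ) :=
  tab n fun k => isum n fun i => isum n fun j => do
    let a ← imul (x i) (y j)
    imul a (inp.table i j k)

/-- Cancel common factors of the numerators and the denominator. -/
def lowestTerms (J : IdealRep n) : Comp (IdealRep n) := do
  let g ← foldFin n (fun j g => foldFin n (fun i g => igcd g (J.num j i)) g) J.den
  let num ← tab n fun j => tab n fun i => idiv (J.num j i) g
  let den ← idiv J.den g
  pure ⟨num, den⟩

/-- Insert an integer vector into a triangular system of generators: for each coordinate, Euclid's
algorithm on that coordinate of the corresponding row and of the vector. -/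
def insertRow (H : Fin n → Fin n → ℤ) (x : Fin n → ℤ) : Comp (Fin n → Fin n → ℤ) := do
  let s ← foldFin n (fun i (s : (Fin n → Fin n → ℤ) × (Fin n → ℤ)) => do
    let p ← repeatUntil (s.1 i, s.2) fun p => do
      if ← iisZero (p.2 i) then pure (Sum.inr p)
      else
        let q ← idiv (p.1 i) (p.2 i)
        let row ← tab n fun l => do
          let t ← imul q (p.2 l)
          isub (p.1 l) t
        pure (Sum.inl (p.2, row))
    pure (Function.update s.1 i p.1, p.2)) (H, x)
  pure s.1

/-- Product of two ideals: a triangular basis of the lattice spanned by all products of basis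
elements. -/
def mulIdeal (inp : Input n) (J₁ J₂ : IdealRep n) : Comp (IdealRep n) := do
  let H ← foldFin n (fun a H => foldFin n (fun b H => do
    let x ← mulElt inp (J₁.num a) (J₂.num b)
    insertRow H x) H) (fun _ _ => 0)
  let den ← imul J₁.den J₂.den
  lowestTerms ⟨H, den⟩

/-- `log N(J)`. -/
def logNorm (J : IdealRep n) : Comp ℝ := do
  let d ← idet n J.num
  let a ← rlog (← rabs (← ofInt d))
  let b ← rlog (← ofInt J.den)
  let c ← rmul (← ofInt n) b
  rsub a c

/-- `N(J)^(e/n)` for an integer `e`. -/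
def normRoot (J : IdealRep n) (e : ℤ) : Comp ℝ := do
  let l ← logNorm J
  let m ← rmul (← ofInt e) l
  rexp (← rdiv m (← ofInt n))

/-- The LLL-reduced basis of the lattice `u J`, as coefficients over `J.den` and as vectors. -/
def lllBasis (inp : Input n) (J : IdealRep n) (u : Fin inp.r → ℝ) :
    Comp ((Fin n → Fin n → ℤ) × (Fin n → Vec inp.r)) := do
  let d ← ofInt J.den
  let u' ← tab inp.r fun σ => rdiv (u σ) d
  let N ← lll inp u' J.num
  let b ← realBasis inp u' N
  pure (N, b)

/-- LLL-reduction of the divisor `(I, u)`: with `b₁ = u f` the first vector of the LLL-reduced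
basis of `u I`, return the ideal `J = f⁻¹ I` (the quotients of the basis by `f` are computed by
Cramer's rule from the matrix of multiplication by `f`) and `s = |b₁| N(J)^(1/n)`. -/
def lllReduction (inp : Input n) (I : IdealRep n) (u : Fin inp.r → ℝ) (hn : 0 < n) :
    Comp (IdealRep n × (Fin inp.r → ℝ)) := do
  let (N, b) ← lllBasis inp I u
  let f := N ⟨0, hn⟩
  let b₁ := b ⟨0, hn⟩
  let A ← tab n fun k => tab n fun j => isum n fun i => imul (f i) (inp.table i j k)
  let num ← tab n fun j => tab n fun i =>
    idet n fun k l => if l = i then N j k else A k l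
  let den ← iabs (← idet n A)
  let J ← lowestTerms ⟨num, den⟩
  let c ← normRoot J 1
  let s ← tab inp.r fun σ => do
    let x2 ← rmul (b₁ σ).1 (b₁ σ).1
    let y2 ← rmul (b₁ σ).2 (b₁ σ).2
    let a ← rsqrt (← radd x2 y2)
    rmul a c
  pure (J, s)

/-- The unit ideal `O_F`. -/
def unitIdeal : IdealRep n := ⟨fun j i => if j = i then 1 else 0, 1⟩

/-! ## Step 1: a good divisor -/

/-- `log ∂_F = log ((2/π)^(r₂) √|Δ_F|)`. -/
def logPartial (inp : Input n) : Comp ℝ := do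
  let r₂ ← ofInt (← isub n inp.r)
  let c ← rlog (← rdiv (← ofInt 2) (← rpi))
  let a ← rmul r₂ c
  let l ← rlog (← ofInt (← iabs inp.disc))
  let b ← rdiv l (← ofInt 2)
  radd a b

/-- The jump algorithm for `(O_F, exp (-w))` of degree `0`. Find the smallest `t ≥ 0` such that
`z = 2^(-t) w` satisfies `n |z_σ| < log ∂_F` for all `σ`; reduce `(O_F, exp (-z))`; then double
and reduce `t` times. Returns `J` and `s` with `(O_F, exp (-w)) = d(J) + (O_F, s)` in `Pic⁰`. -/
def jump (inp : Input n) (w : Fin inp.r → ℝ) (hn : 0 < n) :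
    Comp (IdealRep n × (Fin inp.r → ℝ)) := do
  let lp ← logPartial inp
  let (t, z) ← repeatUntil ((0 : ℤ), w) fun (t, z) => do
    let ok ← foldFin inp.r (fun σ ok => do
      let a ← rmul (← ofInt n) (← rabs (z σ))
      let c ← rlt a lp
      pure (ok && c)) true
    if ok then pure (Sum.inr (t, z))
    else
      let t' ← iadd t 1
      let z' ← tab inp.r fun σ => do rdiv (z σ) (← ofInt 2)
      pure (Sum.inl (t', z'))
  let ω ← tab inp.r fun σ => do rexp (← rneg (z σ))
  let D₀ ← lllReduction inp unitIdeal ω hn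
  repeatUntil (t, D₀) fun (i, J, s) => do
    if ← iisZero i then pure (Sum.inr (J, s))
    else
      let c ← normRoot J (-1)
      let vv ← tab inp.r fun σ => do
        let a ← rmul (s σ) c
        rmul a a
      let JJ ← mulIdeal inp J J
      let D ← lllReduction inp JJ vv hn
      let i' ← isub i 1
      pure (Sum.inl (i', D))

/-- Returns the degree `d` of `W = (I, v)`, an ideal `J`, and `s` such that
`W = (J, e^(-d/n) N(J)^(-1/n) s)` in `Pic`. -/
def goodDivisor (inp : Input n) (hn : 0 < n) :
    Comp (ℝ × IdealRep n × (Fin inp.r → ℝ)) := do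
  let I : IdealRep n := ⟨inp.num, inp.den⟩
  let lI ← logNorm I
  let lv ← rsum inp.r fun σ => do rmul (← ofInt (inp.deg σ)) (← rlog (inp.v σ))
  let d ← rneg (← radd lv lI)
  -- the reduction of `(I, N(I)^(-1/n))`
  let c ← normRoot I (-1)
  let u₁ ← tab inp.r fun _ => pure c
  let (J₁, s₁) ← lllReduction inp I u₁ hn
  -- the jump to `(O_F, N(I)^(1/n) u)` with `u = e^(d/n) v`
  let sh ← rdiv (← radd d lI) (← ofInt n)
  let w ← tab inp.r fun σ => do rneg (← radd (← rlog (inp.v σ)) sh)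
  let (J₂, s₂) ← jump inp w hn
  -- the reduction of the sum of the two divisors
  let J₁₂ ← mulIdeal inp J₁ J₂
  let c₁ ← normRoot J₁ (-1)
  let c₂ ← normRoot J₂ (-1)
  let u₃ ← tab inp.r fun _ => rmul c₁ c₂
  let (J, s₃) ← lllReduction inp J₁₂ u₃ hn
  let s ← tab inp.r fun σ => do rmul (← rmul (s₁ σ) (s₂ σ)) (s₃ σ)
  pure (d, J, s)

/-! ## Step 2: Poisson summation -/

/-- The largest `k` such that the first `k` entries are all smaller than `1`. -/
def leadingSmall : (m : ℕ) → (Fin m → ℝ) → Comp (Fin (m + 1))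
  | 0, _ => pure 0
  | m + 1, A => do
    if ← rlt (A 0) (← ofInt 1) then
      let k ← leadingSmall m fun i => A i.succ
      prim k.succ 1
    else pure 0

/-- The result of the Poisson step:
`Q₁(x) = ∑ i, diag i * (x i + ∑ j > i, off i j * x j)²`, `Q₂(x) = ∑ l j, mixed l j * x l * x j`,
and `γ`. -/
structure Forms (n : ℕ) where
  diag : Fin n → ℝ
  off : Fin n → Fin n → ℝ
  mixed : Fin n → Fin n → ℝ
  γ : ℝ

/-- The forms attached to an LLL-reduced basis `b` of a lattice. With `k = 0` (the case
`‖b₁‖ ≥ 1`) the form `Q₁` is the form `q` of the lattice, `Q₂ = 0` and `γ = 1`. -/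
def poissonForms (inp : Input n) (b : Fin n → Vec inp.r) : Comp (Forms n) := do
  let bs ← gramSchmidt inp n b
  let A ← tab n fun i => innerProd inp (bs i) (bs i)
  let μ ← tab n fun i => tab n fun j => projCoeff inp (b i) (bs j)
  let k ← leadingSmall n A
  let hk : (k : ℕ) ≤ n := Nat.le_of_lt_succ k.isLt
  let em : Fin k → Fin n := Fin.castLE hk
  -- the dual basis `c`, the columns of `B G⁻¹`
  let G ← tab k fun i => tab k fun j => innerProd inp (b (em i)) (b (em j))
  let dG ← rdet k G
  let c ← tab k fun l => do
    let y ← tab k fun i => do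
      let e ← rdet k fun p q => if q = i then (if p = l then 1 else 0) else G p q
      rneg (← rdiv e dG)
    foldFin k (fun i x => subSmul inp x (y i) (b (em i))) (fun _ => (0, 0))
  let cs ← gramSchmidt inp k c
  let C ← tab k fun i => innerProd inp (cs i) (cs i)
  let ν ← tab k fun i => tab k fun j => projCoeff inp (c i) (cs j)
  let cb ← tab k fun l => tab k fun i => innerProd inp (c l) (bs (em i))
  let diag ← tab n fun i =>
    if h : (i : ℕ) < k then pure (C ⟨i, h⟩) else pure (A i)
  let off ← tab n fun i => tab n fun j =>
    if hi : (i : ℕ) < k then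
      if hj : (j : ℕ) < k then pure (ν ⟨j, hj⟩ ⟨i, hi⟩) else pure 0
    else pure (μ j i)
  let mixed ← tab n fun l => tab n fun j =>
    if hl : (l : ℕ) < k then
      if (j : ℕ) < k then pure 0
      else rsum k fun i => rmul (μ j (em i)) (cb ⟨l, hl⟩ i)
    else pure 0
  let p ← foldFin k (fun i p => rmul p (A (em i))) 1
  let γ ← rsqrt p
  pure ⟨diag, off, mixed, γ⟩

/-! ## Step 3: short vectors -/

/-- `∑_{j > i} off i j * x j`. -/
def centre (Q : Forms n) (x : Fin n → ℤ) (i : Fin n) : Comp ℝ :=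
  rsum n fun j => if i < j then do rmul (Q.off i j) (← ofInt (x j)) else pure 0

/-- Concatenate the lists `f y, f (y + 1), …` (`m` of them). -/
def forRange {β : Type} (f : ℤ → Comp (List β)) : (m : ℕ) → ℤ → Comp (List β)
  | 0, _ => pure []
  | m + 1, y => do
    let l ← f y
    let y' ← iadd y 1
    let l' ← forRange f m y'
    prim (l ++ l') (l.length + 1)

/-- Fincke-Pohst enumeration. The coordinates with index at least `m` of `x` are fixed; return
all completions for which the remaining squares add up to at most `T`. -/
def enumerate (Q : Forms n) : (m : ℕ) → m ≤ n → (Fin n → ℤ) → ℝ → Comp (List (Fin n → ℤ))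
  | 0, _, x, _ => pure [x]
  | m + 1, hm, x, T => do
    let i : Fin n := ⟨m, hm⟩
    let U ← centre Q x i
    let Z ← rsqrt (← rdiv T (Q.diag i))
    let lo ← rceil (← rneg (← radd Z U))
    let hi ← rfloor (← rsub Z U)
    let cnt ← isub (← iadd hi 1) lo
    forRange (fun y => do
      let a ← radd (← ofInt y) U
      let a2 ← rmul a a
      let T' ← rsub T (← rmul (Q.diag i) a2)
      enumerate Q m (Nat.le_of_succ_le hm) (Function.update x i y) T') cnt.toNat lo

/-- The real part `exp (-π Q₁(x)) cos (2 π Q₂(x))` of `exp (-π Q(x))`, `Q = Q₁ + 2 i Q₂`. (The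
imaginary parts cancel in the sum over the list, which is stable under changing the sign of the
first `k` coordinates.) -/
def term (Q : Forms n) (x : Fin n → ℤ) : Comp ℝ := do
  let q₁ ← rsum n fun i => do
    let a ← radd (← ofInt (x i)) (← centre Q x i)
    rmul (Q.diag i) (← rmul a a)
  let q₂ ← rsum n fun l => rsum n fun j => do
    let a ← rmul (← ofInt (x l)) (← ofInt (x j))
    rmul (Q.mixed l j) a
  let pi ← rpi
  let e ← rexp (← rneg (← rmul pi q₁))
  let c ← rcos (← rmul (← rmul (← ofInt 2) pi) q₂)
  rmul e c

def sumTerms (Q : Forms n) : List (Fin n → ℤ) → Comp ℝ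
  | [] => pure 0
  | x :: l => do
    let a ← term Q x
    let s ← sumTerms Q l
    radd a s

/-- `M = (log (1/δ) + (n+1) log 3 + (n(n+1)/2 - 1) log 2) / (π - 1)`. -/
def cutoff (n : ℕ) (δ : ℝ) : Comp ℝ := do
  let one ← ofInt 1
  let a ← rlog (← rdiv one δ)
  let b ← rmul (← ofInt (n + 1)) (← rlog (← ofInt 3))
  let c ← rmul (← ofInt (n * (n + 1) / 2 - 1)) (← rlog (← ofInt 2))
  let s ← radd (← radd a b) c
  rdiv s (← rsub (← rpi) one)

/-! ## The whole algorithm -/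

/-- Approximate `h⁰(W)`. -/
def computeH0 (hn : 0 < n) (inp : Input n) : Comp ℝ := do
  -- 1. a good divisor
  let (d, J, s) ← goodDivisor inp hn
  -- 2. an LLL-reduced basis of `L = e^(-d/n) N(J)^(-1/n) s J`, and Poisson summation
  let e ← rexp (← rneg (← rdiv d (← ofInt n)))
  let c ← rmul e (← normRoot J (-1))
  let u ← tab inp.r fun σ => rmul c (s σ)
  let (_, b) ← lllBasis inp J u
  let Q ← poissonForms inp b
  -- 3. the short vectors
  let M ← cutoff n inp.δ
  let l ← enumerate Q n le_rfl (fun _ => 0) M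
  let S ← sumTerms Q l
  rlog (← rdiv S Q.γ)

/-- `HaltsWith c x T`: the computation `c` halts with output `x` after time `T`. -/
def HaltsWith {α : Type} (c : Comp α) (x : α) (T : ℕ) : Prop := c = some (x, T)

/-! ## The input that belongs to a divisor -/

variable {F : Type*} [Field F] [NumberField F]

/-- The input that belongs to the field `F` with integral basis `ω` and infinite places numbered
by `p`, the ideal with basis `(∑ i, num j i • ω i) / den`, the vector `v`, and the error `δ`. -/
def mkInput {r : ℕ} (ω : Module.Basis (Fin n) ℤ (𝓞 F)) (p : Fin r ≃ NumberField.InfinitePlace F)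
    (num : Fin n → Fin n → ℤ) (den : ℕ) (v : NumberField.InfinitePlace F → ℝ) (δ : ℝ) :
    Input n where
  r := r
  deg σ := (p σ).mult
  disc := NumberField.discr F
  table i j k := ω.repr (ω i * ω j) k
  emb i σ := (((p σ).embedding (ω i : F)).re, ((p σ).embedding (ω i : F)).im)
  num := num
  den := den
  v σ := v (p σ)
  δ := δ

/-- The elements `(∑ i, num j i • ω i) / den` form a `ℤ`-basis of `I` (`n` generators of a group of
rank `n`). -/
def IsIdealBasis (ω : Module.Basis (Fin n) ℤ (𝓞 F))
    (I : FractionalIdeal (nonZeroDivisors (𝓞 F)) F) (num : Fin n → Fin n → ℤ) (den : ℕ) : Prop :=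
  0 < den ∧ ∀ x : F, x ∈ I ↔
    ∃ m : Fin n → ℤ, x = ∑ j, (m j : F) * ((∑ i, (num j i : F) * (ω i : F)) / (den : F))

/-- The data have size at most `B`: the absolute values of the integral basis, the numerators and
the denominator of the basis of the ideal, and the coordinates of the vector `v` in the
exponential scale, i.e. the `w_σ` with `v_σ = exp (-w_σ)`. -/
def SizeLE (ω : Module.Basis (Fin n) ℤ (𝓞 F)) (num : Fin n → Fin n → ℤ) (den : ℕ)
    (v : NumberField.InfinitePlace F → ℝ) (B : ℝ) : Prop :=
  (∀ (i : Fin n) (w : NumberField.InfinitePlace F), w (ω i : F) ≤ B) ∧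
  (∀ j i, |(num j i : ℝ)| ≤ B) ∧ (den : ℝ) ≤ B ∧
  (∀ w, |Real.log (v w)| ≤ B)

end

end ArakelovAlg

/-!
The logarithm of a theta sum is computed in polynomial time because lattice reduction is used twice to
replace arbitrary data by data whose size is controlled by the field, or even by the degree alone.

*Time.* The predicate `Runs c T P` says that a computation halts within time `T` with a result that
satisfies `P`; it is closed under composition, and loops are treated with an invariant and a variant
(`Runs.repeatUntil`). All time bounds are polynomials (`PolyBdd`) in a number `X` such that the integers
that occur are at most `2 ^ X`.

*Lattice reduction* (`lll_runs`). The Gram-Schmidt norms never exceed the largest length `s` of the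
initial vectors, and their product is constant. Hence they stay above `s / 2 ^ Y` when the determinant
is at least `s ^ (2 * n) / 4 ^ Y`, which bounds the number of exchanges through the usual potential, as
well as the coordinates of all intermediate bases. For an ideal, `Y` is polynomial in the size of its
basis (`lllBasis_runs`).

*Good divisor.* If `f` is the first vector of a reduced basis of a divisor `(I, u)` of degree zero, then
the norm of `u f` is the index of the ring of integers in `f⁻¹ I`, hence at least `1`. As no `|u f|` is
large, none is small, and `f⁻¹ I` has a basis in lowest terms whose size is bounded by the data of the
field, independently of the size of `I` (`reduced_sized`, `lllReduction_runs`). Therefore sizes do not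
accumulate in the repeated squaring of the jump algorithm (`jump_runs`), which takes linearly many
squarings because `log ∂_F` is bounded away from `0` (`one_div_twelve_le_logDiscr`). The result is a
lattice isometric to the given one, up to a known scalar, with a description of polynomial size
(`goodDivisor_runs`).

*Poisson summation.* Let `b` be a reduced basis and `k` the number of its leading Gram-Schmidt vectors
shorter than `1`. Poisson summation over the span of `b₁, …, b_k`, one coordinate at a time
(`poisson_tri`), turns the theta sum `Θ` into `γ⁻¹ ∑ exp (-π Q₁) cos (2 π Q₂)`, and `γ Θ ≥ 1`, since the
sublattice alone contributes the theta sum of its dual, in which the zero vector contributes `1`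
(`theta_hybrid`). Dual vectors of short vectors are long, and the Gram-Schmidt vectors from
index `k + 1` on are not short in a reduced basis. So the pivots of `Q₁` are at least `2 ^ (-i)`, and
its off-diagonal coefficients are bounded in terms of `n` (`HybridForms.diag_ge`,
`HybridForms.abs_off_le`).

*Enumeration.* By the bound for the pivots `∑ exp (-Q₁)` is at most a constant, so the terms with
`Q₁ > M` contribute at most `exp (-(π - 1) M)` times this constant (`HybridForms.truncation`). The choice
of `M` makes this `(2 / 3) ^ (n + 1) δ` (`exp_radius`), which changes the logarithm of a number that is at
least `1` by at most `δ`. The same bounds show that the enumeration meets polynomially many points with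
small coordinates (`enumerate_runs`). The parts are put together in `computeH0_runs`, and `X` may be
taken proportional to `(1 + log (1 / δ)) log |Δ|`, since `|Δ| ≥ 3`.
-/

namespace ArakelovAlg

/-! ### Polynomially bounded functions -/

/-- Monotone functions of a size parameter that are bounded by a power of the parameter. -/
@[fun_prop]
def PolyBdd (f : ℕ → ℕ) : Prop := Monotone f ∧ ∃ k, ∀ X, f X ≤ (X + 2) ^ k

@[fun_prop]
theorem PolyBdd.id' : PolyBdd fun X => X :=
  ⟨monotone_id, 1, fun X => by simp⟩

@[fun_prop]
theorem PolyBdd.const (a : ℕ) : PolyBdd fun _ => a :=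
  ⟨monotone_const, a, fun X => a.lt_two_pow_self.le.trans (Nat.pow_le_pow_left (by omega) a)⟩

@[fun_prop]
theorem PolyBdd.add {f g : ℕ → ℕ} (hf : PolyBdd f) (hg : PolyBdd g) :
    PolyBdd fun X => f X + g X := by
  obtain ⟨hf, k, hk⟩ := hf
  obtain ⟨hg, l, hl⟩ := hg
  refine ⟨hf.add hg, max k l + 1, fun X => ?_⟩
  have h1 : (X + 2) ^ k ≤ (X + 2) ^ max k l := Nat.pow_le_pow_right (by omega) (le_max_left _ _)
  have h2 : (X + 2) ^ l ≤ (X + 2) ^ max k l := Nat.pow_le_pow_right (by omega) (le_max_right _ _)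
  have := hk X
  have := hl X
  rw [pow_succ]
  nlinarith

@[fun_prop]
theorem PolyBdd.mul {f g : ℕ → ℕ} (hf : PolyBdd f) (hg : PolyBdd g) :
    PolyBdd fun X => f X * g X := by
  obtain ⟨hf, k, hk⟩ := hf
  obtain ⟨hg, l, hl⟩ := hg
  refine ⟨hf.mul hg (fun _ => zero_le) (fun _ => zero_le), k + l, fun X => ?_⟩
  rw [pow_add]
  exact Nat.mul_le_mul (hk X) (hl X)

@[fun_prop]
theorem PolyBdd.comp {f g : ℕ → ℕ} (hf : PolyBdd f) (hg : PolyBdd g) :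
    PolyBdd fun X => f (g X) := by
  obtain ⟨hf, k, hk⟩ := hf
  obtain ⟨hg, l, hl⟩ := hg
  refine ⟨hf.comp hg, (l + 2) * k, fun X => (hk _).trans ?_⟩
  rw [pow_mul]
  refine Nat.pow_le_pow_left ?_ k
  have := hl X
  have h1 : 1 ≤ (X + 2) ^ l := Nat.one_le_pow _ _ (by omega)
  have h2 : 2 ^ 2 ≤ (X + 2) ^ 2 := Nat.pow_le_pow_left (by omega) 2
  rw [pow_add]
  nlinarith

@[fun_prop]
theorem PolyBdd.pow {f : ℕ → ℕ} (hf : PolyBdd f) (m : ℕ) : PolyBdd fun X => f X ^ m := by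
  induction m with
  | zero => simpa using PolyBdd.const 1
  | succ m ih => simpa only [pow_succ] using ih.mul hf

theorem PolyBdd.iterate {f : ℕ → ℕ} (hf : PolyBdd f) (m : ℕ) : PolyBdd (f^[m]) := by
  induction m with
  | zero => exact PolyBdd.id'
  | succ m ih => rw [Function.iterate_succ']; exact hf.comp ih

/-! ### A logic of running times -/

/-- The computation `c` halts within time `T`, with a result that satisfies `P`. -/
def Runs {α : Type} (c : Comp α) (T : ℕ) (P : α → Prop) : Prop :=
  ∃ a t, c = some (a, t) ∧ t ≤ T ∧ P a

section Runs

variable {α β σ : Type}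

theorem Runs.mono {c : Comp α} {T T' : ℕ} {P Q : α → Prop} (h : Runs c T P) (hT : T ≤ T')
    (hPQ : ∀ a, P a → Q a) : Runs c T' Q := by
  obtain ⟨a, t, h, ht, ha⟩ := h
  exact ⟨a, t, h, ht.trans hT, hPQ a ha⟩

theorem Runs.le {c : Comp α} {T T' : ℕ} {P : α → Prop} (h : Runs c T P) (hT : T ≤ T') :
    Runs c T' P := h.mono hT fun _ => id

theorem Runs.imp {c : Comp α} {T : ℕ} {P Q : α → Prop} (h : Runs c T P)
    (hPQ : ∀ a, P a → Q a) : Runs c T Q := h.mono le_rfl hPQ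

theorem Runs.pure {a : α} {P : α → Prop} (h : P a) : Runs (pure a : Comp α) 0 P :=
  ⟨a, 0, rfl, le_rfl, h⟩

theorem Runs.prim {a : α} {c : ℕ} {P : α → Prop} (h : P a) : Runs (ArakelovAlg.prim a c) c P :=
  ⟨a, c, rfl, le_rfl, h⟩

theorem Runs.bind {c : Comp α} {f : α → Comp β} {P : α → Prop} {Q : β → Prop} {T₁ T₂ : ℕ}
    (h₁ : Runs c T₁ P) (h₂ : ∀ a, P a → Runs (f a) T₂ Q) : Runs (c >>= f) (T₁ + T₂) Q := by
  obtain ⟨a, t, rfl, ht, ha⟩ := h₁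
  obtain ⟨b, t', hb, ht', hb'⟩ := h₂ a ha
  refine ⟨b, t + t', ?_, add_le_add ht ht', hb'⟩
  change Option.bind (some (a, t)) _ = _
  simp [hb]

theorem Runs.bind_eq {c : Comp α} {f : α → Comp β} {v : α} {Q : β → Prop} {T₁ T₂ : ℕ}
    (h₁ : Runs c T₁ (· = v)) (h₂ : Runs (f v) T₂ Q) : Runs (c >>= f) (T₁ + T₂) Q :=
  h₁.bind fun _ ha => ha ▸ h₂

theorem Runs.prim_bind {a : α} {c : ℕ} {f : α → Comp β} {Q : β → Prop} {T : ℕ}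
    (h : Runs (f a) T Q) : Runs (ArakelovAlg.prim a c >>= f) (c + T) Q :=
  (Runs.prim (P := (· = a)) rfl).bind_eq h

theorem Runs.foldFin {m : ℕ} {f : Fin m → σ → Comp σ} {c : ℕ} (I : ℕ → σ → Prop)
    (h : ∀ (i : Fin m) s, I i s → Runs (f i s) c (I (i + 1))) :
    ∀ s, I 0 s → Runs (foldFin m f s) (m * (c + 1)) (I m) := by
  induction m generalizing I with
  | zero => exact fun s hs => (Runs.pure hs).le (by omega)
  | succ m ih =>
    intro s hs
    refine Runs.le ((h 0 s hs).bind fun s' hs' => (ih (f := fun i => f i.succ)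
      (fun k => I (k + 1)) (fun i s hi => ?_) s' hs').bind fun s'' hs'' => Runs.prim hs'') ?_
    · simpa using h i.succ s (by simpa using hi)
    · ring_nf; omega

theorem Runs.tab {m : ℕ} {f : Fin m → Comp α} {c : ℕ} {P : Fin m → α → Prop}
    (h : ∀ i, Runs (f i) c (P i)) : Runs (tab m f) (m * (c + 1)) (fun v => ∀ i, P i (v i)) := by
  induction m with
  | zero => exact (Runs.pure fun i => i.elim0).le (by omega)
  | succ m ih =>
    refine Runs.le ((h 0).bind fun x hx => (ih (f := fun i => f i.succ) (fun i => h i.succ)).bind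
      fun xs hxs => Runs.prim fun i => ?_) ?_
    · refine Fin.cases ?_ (fun i => ?_) i
      · simpa using hx
      · simpa using hxs i
    · ring_nf; omega

theorem Runs.tab_eq {m : ℕ} {f : Fin m → Comp α} {c : ℕ} {g : Fin m → α}
    (h : ∀ i, Runs (f i) c (· = g i)) : Runs (ArakelovAlg.tab m f) (m * (c + 1)) (· = g) :=
  (Runs.tab h).imp fun _ ha => funext ha

theorem Runs.rsum_eq {m : ℕ} {f : Fin m → Comp ℝ} {c : ℕ} {g : Fin m → ℝ}
    (h : ∀ i, Runs (f i) c (· = g i)) :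
    Runs (rsum m f) (m * (c + 2)) (· = ∑ i, g i) := by
  refine Runs.mono (Runs.foldFin (c := c + 1)
    (fun k s => s = ∑ i with i.val < k, g i) (fun i s hs => ?_) 0 (by simp)) le_rfl ?_
  · refine (h i).bind_eq (Runs.prim ?_)
    have : (Finset.univ.filter fun j : Fin m => j.val < i + 1) =
        insert i (Finset.univ.filter fun j : Fin m => j.val < i) := by
      ext j; simp [Fin.ext_iff]; omega
    rw [this, Finset.sum_insert (by simp), hs, add_comm]
  · rintro a rfl
    congr 1; ext i; simp

theorem loopFuel_succ_of_eq_some {f : σ → Comp (σ ⊕ α)} {k : ℕ} {s : σ} {x : α × ℕ}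
    (h : loopFuel f k s = some x) : loopFuel f (k + 1) s = some x := by
  induction k generalizing s x with
  | zero => cases h
  | succ k ih =>
    rw [loopFuel] at h ⊢
    rcases hf : f s with _ | ⟨y, t⟩
    · rw [hf] at h; exact h
    rw [hf] at h
    rcases y with s' | a
    · rcases hl : loopFuel f k s' with _ | ⟨b, t'⟩
      · change Option.bind (some _) _ = _ at h
        simp [bind, hl] at h
      · have h2 := ih hl
        change Option.bind (some _) _ = _ at h ⊢
        simp only [bind, Option.bind_some, hl, h2] at h ⊢
        exact h
    · exact h

theorem loopFuel_of_le {f : σ → Comp (σ ⊕ α)} {k l : ℕ} (hkl : k ≤ l) {s : σ} {x : α × ℕ}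
    (h : loopFuel f k s = some x) : loopFuel f l s = some x := by
  induction l, hkl using Nat.le_induction with
  | base => exact h
  | succ l _ ih => exact loopFuel_succ_of_eq_some ih

/-- A loop with an invariant `I` whose variant `V` decreases at each pass. -/
theorem Runs.repeatUntil {f : σ → Comp (σ ⊕ α)} {c : ℕ} {P : α → Prop} (I : σ → Prop) (V : σ → ℕ)
    (h : ∀ s, I s → Runs (f s) c (Sum.elim (fun s' => I s' ∧ V s' < V s) P)) (s : σ) (hs : I s) :
    Runs (repeatUntil s f) ((V s + 1) * (c + 1)) P := by
  have key : ∀ k s, I s → V s < k → Runs (loopFuel f k s) ((V s + 1) * (c + 1)) P := by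
    intro k
    induction k with
    | zero => intro s _ h; omega
    | succ k ih =>
      intro s hs hV
      rw [loopFuel]
      refine Runs.le (T := c + (V s * (c + 1) + 1)) ((h s hs).bind fun y hy => ?_) (by ring_nf; omega)
      refine Runs.bind (P := P) ?_ fun a ha => Runs.prim ha
      rcases y with s' | a
      · refine (ih s' hy.1 (by have := hy.2; omega)).le (Nat.mul_le_mul_right _ hy.2)
      · exact (Runs.pure (P := P) hy).le (by omega)
  obtain ⟨a, t, ha, ht, hP⟩ := key _ s hs (Nat.lt_succ_self _)
  have hex : ∃ k, loopFuel f k s ≠ none := ⟨_, ha ▸ Option.some_ne_none _⟩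
  refine ⟨a, t, ?_, ht, hP⟩
  have hr : ∃ k, ArakelovAlg.repeatUntil s f = loopFuel f k s ∧ loopFuel f k s ≠ none := by
    unfold ArakelovAlg.repeatUntil
    refine ⟨_, dif_pos hex, ?_⟩
    have hspec : ∀ _ : DecidablePred fun k => loopFuel f k s ≠ none,
      loopFuel f (Nat.find hex) s ≠ none := fun _ => Nat.find_spec hex
    exact hspec _
  obtain ⟨k, hk, hne⟩ := hr
  obtain ⟨x, hx⟩ := Option.ne_none_iff_exists'.mp hne
  have h1 := loopFuel_of_le (le_max_left k (V s + 1)) hx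
  have h2 := loopFuel_of_le (le_max_right k (V s + 1)) ha
  exact hk.trans (hx.trans (h1.symm.trans h2))

end Runs

/-! ### Integers of bounded size -/

theorem bits_le {z : ℤ} {X : ℕ} (h : |z| ≤ 2 ^ X) : bits z ≤ X + 2 := by
  have : z.natAbs < 2 ^ (X + 1) := by
    zify
    rw [pow_succ]
    have : (0 : ℤ) < 2 ^ X := by positivity
    omega
  have := Nat.size_le.mpr this
  unfold bits
  omega

theorem abs_le_two_pow_mono {z : ℤ} {X Y : ℕ} (h : |z| ≤ 2 ^ X) (hXY : X ≤ Y) : |z| ≤ 2 ^ Y :=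
  h.trans (pow_le_pow_right₀ (by norm_num) hXY)

theorem abs_mul_le_two_pow {a b : ℤ} {X Y : ℕ} (ha : |a| ≤ 2 ^ X) (hb : |b| ≤ 2 ^ Y) :
    |a * b| ≤ 2 ^ (X + Y) := by
  rw [abs_mul, pow_add]
  exact mul_le_mul ha hb (abs_nonneg _) (by positivity)

theorem abs_sum_le_two_pow {ι : Type*} (s : Finset ι) {m : ℕ} (hm : s.card ≤ m) {g : ι → ℤ} {X : ℕ}
    (h : ∀ i ∈ s, |g i| ≤ 2 ^ X) : |∑ i ∈ s, g i| ≤ 2 ^ (X + m) := by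
  refine (Finset.abs_sum_le_sum_abs _ _).trans ((Finset.sum_le_card_nsmul _ _ _ h).trans ?_)
  rw [nsmul_eq_mul, pow_add, mul_comm]
  gcongr
  exact_mod_cast hm.trans m.lt_two_pow_self.le

theorem isum_runs {m : ℕ} {f : Fin m → Comp ℤ} {c X : ℕ} {g : Fin m → ℤ}
    (h : ∀ i, Runs (f i) c (· = g i)) (hg : ∀ i, |g i| ≤ 2 ^ X) :
    Runs (isum m f) (m * (c + (2 * X + m + 4) + 1)) (· = ∑ i, g i) := by
  refine Runs.mono (Runs.foldFin (c := c + (2 * X + m + 4))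
    (fun k s => s = ∑ i with i.val < k, g i) (fun i s hs => ?_) 0 (by simp)) le_rfl ?_
  · refine (h i).bind_eq (Runs.le (Runs.prim ?_) ?_)
    · have : (Finset.univ.filter fun j : Fin m => j.val < i + 1) =
          insert i (Finset.univ.filter fun j : Fin m => j.val < i) := by
        ext j; simp [Fin.ext_iff]; omega
      rw [this, Finset.sum_insert (by simp), hs, add_comm]
    · have h1 := bits_le (hg i)
      have h2 : bits s ≤ X + m + 2 := bits_le (hs ▸ abs_sum_le_two_pow _
        ((Finset.card_filter_le _ _).trans (by simp)) fun i _ => hg i)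
      omega
  · rintro a rfl
    congr 1; ext i; simp

/-! ### Determinants -/

theorem rdet_runs (m : ℕ) : ∃ c, ∀ A : Fin m → Fin m → ℝ,
    Runs (rdet m A) c (· = (Matrix.of A).det) := by
  induction m with
  | zero => exact ⟨0, fun A => Runs.pure (by simp)⟩
  | succ m ih =>
    obtain ⟨c, hc⟩ := ih
    refine ⟨(m + 1) * (c + (1 + 1) + 1), fun A => ?_⟩
    refine Runs.mono (Runs.foldFin (c := c + (1 + 1)) (fun k s => s = ∑ j : Fin (m + 1) with j.val < k,
      (-1) ^ (j : ℕ) * A 0 j * ((Matrix.of A).submatrix Fin.succ j.succAbove).det)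
      (fun j s hs => ?_) 0 (by simp)) le_rfl ?_
    · have : (Finset.univ.filter fun l : Fin (m + 1) => l.val < j + 1) =
          insert j (Finset.univ.filter fun l : Fin (m + 1) => l.val < j) := by
        ext l; simp [Fin.ext_iff]; omega
      rw [this, Finset.sum_insert (by simp), ← hs]
      refine (hc _).bind_eq (Runs.prim_bind ?_)
      by_cases hj : Even (j : ℕ)
      · rw [if_pos hj]
        refine Runs.prim ?_
        rw [hj.neg_one_pow, one_mul, add_comm]
        rfl
      · rw [if_neg hj]
        refine Runs.prim ?_
        rw [(Nat.not_even_iff_odd.mp hj).neg_one_pow, neg_one_mul, neg_mul]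
        exact (neg_add_eq_sub _ _).symm
    · rintro a rfl
      rw [Matrix.det_succ_row_zero, Finset.filter_true_of_mem fun j _ => j.isLt]
      rfl

theorem abs_det_le_two_pow {m : ℕ} (A : Matrix (Fin m) (Fin m) ℤ) {X : ℕ}
    (h : ∀ i j, |A i j| ≤ 2 ^ X) : |A.det| ≤ 2 ^ (m * m + m * X) := by
  have := Matrix.det_le (abv := AbsoluteValue.abs) (A := A) (x := 2 ^ X) h
  refine this.trans ?_
  rw [pow_add, nsmul_eq_mul, Fintype.card_fin, mul_comm m X, pow_mul, pow_mul]
  gcongr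
  have h1 : m.factorial ≤ m ^ m := Nat.factorial_le_pow m
  have h2 : m ^ m ≤ (2 ^ m) ^ m := Nat.pow_le_pow_left m.lt_two_pow_self.le m
  exact_mod_cast h1.trans h2

/-- Expansion along the first row: the number of steps is a constant for each `m`, and the minors have
polynomially bounded entries. -/
theorem idet_runs (m : ℕ) : ∃ c, PolyBdd c ∧ ∀ (X : ℕ) (A : Fin m → Fin m → ℤ),
    (∀ i j, |A i j| ≤ 2 ^ X) → Runs (idet m A) (c X) (· = (Matrix.of A).det) := by
  induction m with
  | zero => exact ⟨fun _ => 0, by fun_prop, fun X A _ => Runs.pure (by simp)⟩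
  | succ m ih =>
    obtain ⟨c, hc, H⟩ := ih
    let Y : ℕ → ℕ := fun X => X + (m * m + m * X) + (m + 1)
    refine ⟨fun X => (m + 1) * (c X + ((X + 2) * (Y X + 2) + 2 * (Y X + 2)) + 1), by fun_prop,
      fun X A hA => ?_⟩
    have hdet (j : Fin (m + 1)) :
        |((Matrix.of A).submatrix Fin.succ j.succAbove).det| ≤ 2 ^ (m * m + m * X) :=
      abs_det_le_two_pow _ fun _ _ => hA _ _
    have hprod (j : Fin (m + 1)) : |A 0 j * ((Matrix.of A).submatrix Fin.succ j.succAbove).det| ≤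
        2 ^ (X + (m * m + m * X)) := abs_mul_le_two_pow (hA 0 j) (hdet j)
    refine Runs.mono (Runs.foldFin (c := c X + ((X + 2) * (Y X + 2) + 2 * (Y X + 2)))
      (fun k s => s = ∑ j : Fin (m + 1) with j.val < k,
      (-1) ^ (j : ℕ) * (A 0 j * ((Matrix.of A).submatrix Fin.succ j.succAbove).det))
      (fun j s hs => ?_) 0 (by simp)) le_rfl ?_
    · have : (Finset.univ.filter fun l : Fin (m + 1) => l.val < j + 1) =
          insert j (Finset.univ.filter fun l : Fin (m + 1) => l.val < j) := by
        ext l; simp [Fin.ext_iff]; omega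
      rw [this, Finset.sum_insert (by simp), ← hs]
      have hs' : bits s ≤ Y X + 2 := by
        refine bits_le (hs ▸ abs_sum_le_two_pow _ ((Finset.card_filter_le _ _).trans (by simp)) ?_)
        intro i _
        rw [abs_mul, abs_pow, abs_neg, abs_one, one_pow, one_mul]
        exact hprod i
      have ht' := bits_le (abs_le_two_pow_mono (hprod j) (show _ ≤ Y X by simp only [Y]; omega))
      refine (H X _ fun _ _ => hA _ _).bind_eq (Runs.bind_eq (Runs.le (Runs.prim rfl)
        (T' := (X + 2) * (Y X + 2)) (Nat.mul_le_mul (bits_le (hA 0 j))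
        (bits_le (abs_le_two_pow_mono (hdet j) (by simp only [Y]; omega))))) ?_)
      by_cases hj : Even (j : ℕ)
      · rw [if_pos hj]
        refine Runs.le (T := _ + _) (Runs.prim ?_) ((Nat.add_le_add hs' ht').trans_eq (two_mul _).symm)
        rw [hj.neg_one_pow, one_mul, add_comm]
        rfl
      · rw [if_neg hj]
        refine Runs.le (T := _ + _) (Runs.prim ?_) ((Nat.add_le_add hs' ht').trans_eq (two_mul _).symm)
        rw [(Nat.not_even_iff_odd.mp hj).neg_one_pow, neg_one_mul]
        exact (neg_add_eq_sub _ _).symm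
    · rintro a rfl
      rw [Matrix.det_succ_row_zero, Finset.filter_true_of_mem fun j _ => j.isLt]
      simp only [mul_assoc]
      rfl

end ArakelovAlg

namespace ArakelovAlg

/-! ### Euclid's algorithm -/

/-- A bound for the number of steps of Euclid's algorithm on `(a, b)`, with remainders in
`[0, |b|)`. -/
def euclidVar (a b : ℤ) : ℕ :=
  if b = 0 then 0
  else if 0 < b ∧ b ≤ a then Nat.log 2 (a * b).natAbs + 1
  else if 0 < b then Nat.log 2 (b * b).natAbs + 2
  else Nat.log 2 (b * b).natAbs + 3

/-- While both arguments are in order the product `a * b` at least halves in each step; the cases of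
`euclidVar` count the one or two steps that bring the arguments into order. -/
theorem euclidVar_lt {a b : ℤ} (hb : b ≠ 0) : euclidVar b (a % b) < euclidVar a b := by
  have hr0 := Int.emod_nonneg a hb
  have hr1 := Int.emod_lt_abs a hb
  have heq := Int.mul_ediv_add_emod a b
  set r := a % b with hr
  set q := a / b
  rcases hr0.eq_or_lt with h0 | h0
  · rw [← h0]
    simp only [euclidVar, if_true, if_neg hb]
    split_ifs <;> omega
  rcases lt_or_gt_of_ne hb with hneg | hpos
  · rw [abs_of_neg hneg] at hr1
    have h1 : ¬(0 < r ∧ r ≤ b) := by omega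
    have h2 : ¬(0 < b ∧ b ≤ a) := by omega
    simp only [euclidVar, if_neg hb, if_neg h0.ne', if_neg h1, if_neg h2, if_pos h0, if_neg hneg.not_gt]
    have : Nat.log 2 (r * r).natAbs ≤ Nat.log 2 (b * b).natAbs := by
      refine Nat.log_mono_right ?_
      rw [Int.natAbs_mul, Int.natAbs_mul]
      exact Nat.mul_le_mul (by omega) (by omega)
    omega
  · rw [abs_of_pos hpos] at hr1
    have h1 : 0 < r ∧ r ≤ b := ⟨h0, hr1.le⟩
    by_cases hba : b ≤ a
    · simp only [euclidVar, if_neg hb, if_neg h0.ne', if_pos h1, if_pos (And.intro hpos hba)]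
      have hbr : (b * r).natAbs ≠ 0 := Int.natAbs_ne_zero.mpr (mul_pos hpos h0).ne'
      have h2 : Nat.log 2 ((b * r).natAbs * 2) ≤ Nat.log 2 (a * b).natAbs := by
        refine Nat.log_mono_right ?_
        have hq : 1 ≤ q := by
          by_contra hq
          have : b * q ≤ 0 := mul_nonpos_of_nonneg_of_nonpos hpos.le (by omega)
          omega
        have : b ≤ b * q := le_mul_of_one_le_right hpos.le hq
        have h3 : 2 * r ≤ a := by omega
        zify
        rw [abs_of_pos (mul_pos hpos h0), abs_of_pos (mul_pos (by omega) hpos)]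
        nlinarith
      rw [Nat.log_mul_base (by norm_num) hbr] at h2
      omega
    · have h2 : ¬(0 < b ∧ b ≤ a) := by omega
      simp only [euclidVar, if_neg hb, if_neg h0.ne', if_pos h1, if_neg h2, if_pos hpos]
      have : Nat.log 2 (b * r).natAbs ≤ Nat.log 2 (b * b).natAbs := by
        refine Nat.log_mono_right ?_
        rw [Int.natAbs_mul, Int.natAbs_mul]
        exact Nat.mul_le_mul le_rfl (by omega)
      omega

theorem euclidVar_le {a b : ℤ} {X : ℕ} (ha : |a| ≤ 2 ^ X) (hb : |b| ≤ 2 ^ X) :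
    euclidVar a b ≤ 2 * X + 3 := by
  have h {x y : ℤ} (hx : |x| ≤ 2 ^ X) (hy : |y| ≤ 2 ^ X) : Nat.log 2 (x * y).natAbs ≤ 2 * X := by
    have : (x * y).natAbs ≤ 2 ^ (2 * X) := by
      zify
      rw [two_mul]
      exact abs_mul_le_two_pow hx hy
    exact (Nat.log_mono_right this).trans (by rw [Nat.log_pow (by norm_num)])
  have := h ha hb
  have := h hb hb
  unfold euclidVar
  split_ifs <;> omega

theorem igcd_runs : ∃ c, PolyBdd c ∧ ∀ (X : ℕ) (a b : ℤ), |a| ≤ 2 ^ X → |b| ≤ 2 ^ X →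
    Runs (igcd a b) (c X) (· = (Int.gcd a b : ℤ)) := by
  refine ⟨fun X => (2 * X + 4) * ((X + 2) + ((X + 2) * (X + 2)) + 1), by fun_prop,
    fun X a b ha hb => ?_⟩
  refine Runs.le (Runs.repeatUntil (c := (X + 2) + ((X + 2) * (X + 2)))
    (fun s => Int.gcd s.1 s.2 = Int.gcd a b ∧ |s.1| ≤ 2 ^ X ∧ |s.2| ≤ 2 ^ X)
    (fun s => euclidVar s.1 s.2) ?_ (a, b) ⟨rfl, ha, hb⟩) ?_
  · rintro ⟨x, y⟩ ⟨h1, h2, h3⟩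
    simp only at h1 h2 h3 ⊢
    refine Runs.bind_eq (Runs.le (Runs.prim rfl) (bits_le h3)) ?_
    by_cases hy : y = 0
    · subst hy
      simp only [decide_true, if_true]
      refine Runs.le (Runs.prim_bind (T := 0) (Runs.pure ?_)) ?_
      · simp only [Sum.elim_inr]
        rw [← h1]; simp
      · have := bits_le h2
        nlinarith
    · simp only [hy, decide_false, Bool.false_eq_true, if_false]
      refine Runs.le (Runs.prim_bind (T := 0) (Runs.pure ?_))
        (by simpa using Nat.mul_le_mul (bits_le h2) (bits_le h3))
      simp only [Sum.elim_inl]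
      refine ⟨⟨?_, h3, ?_⟩, euclidVar_lt hy⟩
      · rw [← h1, Int.gcd_comm y (x % y), Int.gcd_emod, Int.gcd_comm]
      · rw [abs_of_nonneg (Int.emod_nonneg x hy)]
        exact (Int.emod_lt_abs x hy).le.trans h3
  · exact Nat.mul_le_mul_right _ (by have := euclidVar_le ha hb; simp only; omega)

/-! ### Ideals given by integer matrices -/

variable {n : ℕ}

/-- The numerators and the denominator of `J` are at most `2 ^ X`. -/
def IdealRep.Sized (J : IdealRep n) (X : ℕ) : Prop :=
  (∀ j i, |J.num j i| ≤ 2 ^ X) ∧ |J.den| ≤ 2 ^ X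

/-- Division by the common content: the entries do not grow, and afterwards no integer divides the
denominator and all numerators. -/
theorem lowestTerms_runs (n : ℕ) : ∃ c, PolyBdd c ∧ ∀ (X : ℕ) (J : IdealRep n), J.Sized X → 0 < J.den →
    Runs (lowestTerms J) (c X) fun J' => J'.Sized X ∧ 0 < J'.den ∧
      (∃ g : ℤ, 0 < g ∧ J.den = g * J'.den ∧ ∀ j i, J.num j i = g * J'.num j i) ∧
      ∀ d, d ∣ J'.den → (∀ j i, d ∣ J'.num j i) → d ∣ 1 := by
  obtain ⟨c, hc, H⟩ := igcd_runs
  refine ⟨fun X => n * (n * (c X + 1) + 1) + (n * (n * ((X + 2) * (X + 2) + 1) + 1) +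
    (X + 2) * (X + 2)), by fun_prop, fun X J hJ hden => ?_⟩
  let I : ℕ → ℕ → ℤ → Prop := fun k l g => 0 < g ∧ |g| ≤ 2 ^ X ∧ g ∣ J.den ∧
    (∀ j i : Fin n, (j.val < k ∨ j.val = k ∧ i.val < l) → g ∣ J.num j i) ∧
    ∀ d, d ∣ J.den → (∀ j i : Fin n, (j.val < k ∨ j.val = k ∧ i.val < l) → d ∣ J.num j i) → d ∣ g
  refine Runs.bind (P := I n 0) (Runs.foldFin (fun k => I k 0) (fun j g hg => ?_) _ ?_) ?_
  · refine Runs.imp (Runs.foldFin (fun l => I j l) (fun i g hg => ?_) g hg) fun a ha => ?_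
    · obtain ⟨h1, h2, h3, h4, h5⟩ := hg
      refine (H X g (J.num j i) h2 (hJ.1 j i)).imp ?_
      rintro a rfl
      have hd1 := Int.gcd_dvd_left (a := g) (b := J.num j i)
      have hd2 := Int.gcd_dvd_right (a := g) (b := J.num j i)
      have hpos : 0 < (Int.gcd g (J.num j i) : ℤ) := by
        exact_mod_cast Int.gcd_pos_of_ne_zero_left _ h1.ne'
      refine ⟨hpos, ?_, hd1.trans h3, fun j' i' h => ?_, fun d hd hd' => ?_⟩
      · rw [abs_of_pos hpos]
        exact (Int.le_of_dvd h1 hd1).trans (by rwa [abs_of_pos h1] at h2)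
      · by_cases hji : j' = j ∧ i' = i
        · rw [hji.1, hji.2]; exact hd2
        · refine hd1.trans (h4 j' i' ?_)
          rcases h with h | h
          · exact Or.inl h
          · refine Or.inr ⟨h.1, ?_⟩
            have : i'.val ≠ i.val := fun h' => hji ⟨Fin.ext h.1, Fin.ext h'⟩
            omega
      · refine Int.dvd_coe_gcd (h5 d hd fun j' i' h => hd' j' i' (by omega)) (hd' j i ?_)
        exact Or.inr ⟨rfl, Nat.lt_succ_self _⟩
    · obtain ⟨h1, h2, h3, h4, h5⟩ := ha
      exact ⟨h1, h2, h3, fun j' i' h => h4 j' i' (by omega),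
        fun d hd hd' => h5 d hd fun j' i' h => hd' j' i' (by omega)⟩
  · exact ⟨hden, hJ.2, dvd_rfl, fun j i h => by omega, fun d hd _ => hd⟩
  · rintro g ⟨h1, h2, h3, h4, h5⟩
    have h4' : ∀ j i, g ∣ J.num j i := fun j i => h4 j i (Or.inl j.isLt)
    refine Runs.bind_eq (Runs.tab_eq (g := fun j i => J.num j i / g) fun j =>
      Runs.tab_eq fun i => Runs.le (Runs.prim rfl)
      (Nat.mul_le_mul (bits_le (hJ.1 j i)) (bits_le h2))) (Runs.le (T := _ + 0) (Runs.bind_eq (Runs.le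
      (Runs.prim rfl) (Nat.mul_le_mul (bits_le hJ.2) (bits_le h2))) (Runs.pure ?_)) (by simp))
    have hdiv {a : ℤ} (h : |a| ≤ 2 ^ X) : |a / g| ≤ 2 ^ X := by
      refine le_trans ?_ h
      rw [Int.abs_eq_natAbs, Int.abs_eq_natAbs]
      exact_mod_cast Int.natAbs_ediv_le_natAbs a g
    obtain ⟨e, he⟩ := h3
    have he' : J.den / g = e := by rw [he]; exact Int.mul_ediv_cancel_left _ h1.ne'
    refine ⟨⟨fun j i => hdiv (hJ.1 j i), hdiv hJ.2⟩, ?_, ⟨g, h1, ?_, fun j i => ?_⟩,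
      fun d hd hd' => ?_⟩
    · simp only [he']; rw [he] at hden; exact pos_of_mul_pos_right hden h1.le
    · simp only [he']; exact he
    · exact (Int.mul_ediv_cancel' (h4' j i)).symm
    · simp only [he'] at hd
      have : g * d ∣ g := by
        refine h5 _ (he ▸ mul_dvd_mul_left g hd) fun j i _ => ?_
        rw [← Int.mul_ediv_cancel' (h4' j i)]
        exact mul_dvd_mul_left g (hd' j i)
      have := Int.le_of_dvd h1 this
      exact (mul_dvd_mul_iff_left h1.ne').mp (by simpa using ‹g * d ∣ g›)

/-! ### Triangular bases -/

theorem span_insert_range_eq (H : Fin n → Fin n → ℤ) (x : Fin n → ℤ) (i : Fin n) :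
    Submodule.span ℤ (insert x (Set.range H)) =
      Submodule.span ℤ (H '' {i}ᶜ) ⊔ Submodule.span ℤ {H i, x} := by
  rw [← Submodule.span_union]
  congr 1
  rw [← Set.image_univ, ← Set.compl_union_self {i}, Set.image_union, Set.image_singleton]
  ext v; simp only [Set.mem_insert_iff, Set.mem_union, Set.mem_singleton_iff]; tauto

/-- One run of Euclid's algorithm on the `i`-th coordinates of two vectors. -/
theorem euclidRows_runs (n : ℕ) : ∃ c, PolyBdd c ∧ ∀ (X : ℕ) (i : Fin n) (a b : Fin n → ℤ),
    (∀ l, |a l| ≤ 2 ^ X) → (∀ l, |b l| ≤ 2 ^ X) →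
    Runs (repeatUntil (a, b) fun p => do
      if ← iisZero (p.2 i) then pure (Sum.inr p)
      else
        let q ← idiv (p.1 i) (p.2 i)
        let row ← tab n fun l => do
          let t ← imul q (p.2 l)
          isub (p.1 l) t
        pure (Sum.inl (p.2, row))) (c X) fun p : (Fin n → ℤ) × (Fin n → ℤ) => p.2 i = 0 ∧
      (∀ l, |p.1 l| ≤ 2 ^ (6 * X + 6)) ∧ (∀ l, |p.2 l| ≤ 2 ^ (6 * X + 6)) ∧
      (∀ l, a l = 0 → b l = 0 → p.1 l = 0 ∧ p.2 l = 0) ∧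
      Submodule.span ℤ {p.1, p.2} = Submodule.span ℤ {a, b} := by
  let Y : ℕ → ℕ := fun X => 6 * X + 6
  refine ⟨fun X => (2 * X + 4) * ((Y X + 2) + ((Y X + 2) * (Y X + 2) +
    (n * ((Y X + 2) * (Y X + 2) + (Y X + 2 + (2 * Y X + 2)) + 1))) + 1), by fun_prop,
    fun X i a b ha hb => ?_⟩
  have h3 : (3 : ℤ) ^ (2 * X + 3) ≤ 2 ^ (4 * X + 6) := by
    calc (3 : ℤ) ^ (2 * X + 3) ≤ 4 ^ (2 * X + 3) := pow_le_pow_left₀ (by norm_num) (by norm_num) _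
      _ = 2 ^ (2 * (2 * X + 3)) := by rw [pow_mul]; norm_num
      _ = 2 ^ (4 * X + 6) := by ring_nf
  -- `E` bounds all coordinates. One step multiplies `E` by at most `1 + |x i / y i|` while
  -- `max |x i| |y i|` shrinks by nearly the same factor, so that the loss is at most `3` per step.
  refine Runs.le (Runs.repeatUntil
    (c := (Y X + 2) + ((Y X + 2) * (Y X + 2) +
    (n * ((Y X + 2) * (Y X + 2) + (Y X + 2 + (2 * Y X + 2)) + 1))))
    (fun s : (Fin n → ℤ) × (Fin n → ℤ) => (∃ E : ℤ, 1 ≤ E ∧ (∀ l, |s.1 l| ≤ E) ∧ (∀ l, |s.2 l| ≤ E) ∧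
      E * max (max |s.1 i| |s.2 i|) 1 * 3 ^ euclidVar (s.1 i) (s.2 i) ≤ 2 ^ (6 * X + 6)) ∧
      (∀ l, a l = 0 → b l = 0 → s.1 l = 0 ∧ s.2 l = 0) ∧
      Submodule.span ℤ {s.1, s.2} = Submodule.span ℤ {a, b})
    (fun s => euclidVar (s.1 i) (s.2 i)) ?_ (a, b) ?_) ?_
  · rintro ⟨x, y⟩ ⟨⟨E, hE1, hEx, hEy, hE⟩, hz, hspan⟩
    simp only at hEx hEy hE hz hspan ⊢
    have hpow : (1 : ℤ) ≤ 3 ^ euclidVar (x i) (y i) := one_le_pow₀ (by norm_num)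
    have hm : (1 : ℤ) ≤ max (max |x i| |y i|) 1 := le_max_right _ _
    have hEY : E ≤ 2 ^ Y X := by
      refine le_trans ?_ hE
      calc E = E * 1 * 1 := by ring
        _ ≤ _ := by gcongr
    have hx l := (hEx l).trans hEY
    have hy l := (hEy l).trans hEY
    refine Runs.bind_eq (Runs.le (Runs.prim rfl) (bits_le (hy i))) ?_
    by_cases hyi : y i = 0
    · simp only [hyi, decide_true, if_true]
      exact (Runs.pure ⟨hyi, hx, hy, hz, hspan⟩).le (Nat.zero_le _)
    · simp only [hyi, decide_false, Bool.false_eq_true, if_false]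
      have hq : |x i / y i| ≤ 2 ^ Y X := by
        refine le_trans ?_ (hx i)
        rw [Int.abs_eq_natAbs, Int.abs_eq_natAbs]
        exact_mod_cast Int.natAbs_ediv_le_natAbs (x i) (y i)
      refine Runs.bind_eq (Runs.le (Runs.prim rfl)
        (Nat.mul_le_mul (bits_le (hx i)) (bits_le (hy i)))) (Runs.le (T := _ + 0)
        (Runs.bind_eq (Runs.tab_eq (g := fun l => x l - x i / y i * y l)
        fun l => Runs.bind_eq (Runs.le (Runs.prim rfl)
        (Nat.mul_le_mul (bits_le hq) (bits_le (hy l)))) (Runs.le (Runs.prim rfl)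
        (add_le_add (bits_le (hx l)) (bits_le (X := 2 * Y X) ?_)))) (Runs.pure ?_)) (by simp))
      · rw [two_mul]; exact abs_mul_le_two_pow hq (hy l)
      simp only [Sum.elim_inl]
      have hmod : x i - x i / y i * y i = x i % y i := by
        rw [Int.emod_def, mul_comm]
      refine ⟨⟨⟨E * (1 + |x i / y i|), ?_, fun l => (hEy l).trans ?_, fun l => ?_, ?_⟩, ?_, ?_⟩, ?_⟩
      · nlinarith [abs_nonneg (x i / y i)]
      · nlinarith [abs_nonneg (x i / y i)]
      · refine (abs_sub _ _).trans ?_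
        rw [abs_mul]
        have := mul_le_mul_of_nonneg_left (hEy l) (abs_nonneg (x i / y i))
        have := hEx l
        nlinarith
      · rw [hmod]
        refine le_trans ?_ hE
        have hlt := euclidVar_lt (a := x i) hyi
        have hb1 : 1 ≤ |y i| := Int.one_le_abs hyi
        have hmax : max (max |y i| |x i % y i|) 1 = |y i| := by
          rw [max_eq_left (a := |y i|), max_eq_left hb1]
          rw [abs_of_nonneg (Int.emod_nonneg _ hyi)]
          exact (Int.emod_lt_abs _ hyi).le
        rw [hmax]
        have hqb : |x i / y i| * |y i| ≤ |x i| + |y i| := by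
          rw [← abs_mul]
          have h1 := Int.mul_ediv_add_emod (x i) (y i)
          have h2 : x i / y i * y i = x i - x i % y i := by rw [mul_comm]; omega
          rw [h2]
          refine (abs_sub _ _).trans (add_le_add le_rfl ?_)
          rw [abs_of_nonneg (Int.emod_nonneg _ hyi)]
          exact (Int.emod_lt_abs _ hyi).le
        have h3' : (1 + |x i / y i|) * |y i| ≤ 3 * max (max |x i| |y i|) 1 := by
          have h1 : |x i| ≤ max (max |x i| |y i|) 1 := (le_max_left _ _).trans (le_max_left _ _)
          have h2 : |y i| ≤ max (max |x i| |y i|) 1 := (le_max_right _ _).trans (le_max_left _ _)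
          linarith
        calc E * (1 + |x i / y i|) * |y i| * 3 ^ euclidVar (y i) (x i % y i)
            = E * ((1 + |x i / y i|) * |y i|) * 3 ^ euclidVar (y i) (x i % y i) := by ring
          _ ≤ E * (3 * max (max |x i| |y i|) 1) * 3 ^ euclidVar (y i) (x i % y i) := by gcongr
          _ = E * max (max |x i| |y i|) 1 * 3 ^ (euclidVar (y i) (x i % y i) + 1) := by ring
          _ ≤ _ := by gcongr; norm_num; omega
      · intro l hal hbl
        obtain ⟨h1, h2⟩ := hz l hal hbl
        simp [h1, h2]
      · rw [← hspan]
        have he : (fun l => x l - x i / y i * y l) = x - (x i / y i) • y := by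
          ext l; simp
        rw [he]
        refine le_antisymm (Submodule.span_le.mpr ?_) (Submodule.span_le.mpr ?_)
        · rintro v (rfl | rfl)
          · exact Submodule.subset_span (by simp)
          · exact Submodule.sub_mem _ (Submodule.subset_span (by simp))
              (Submodule.smul_mem _ _ (Submodule.subset_span (by simp)))
        · rintro v (rfl | rfl)
          · have h1 : v - (v i / y i) • y ∈ Submodule.span ℤ {y, v - (v i / y i) • y} :=
              Submodule.subset_span (by simp)
            have h2 : y ∈ Submodule.span ℤ {y, v - (v i / y i) • y} :=
              Submodule.subset_span (by simp)
            simpa using Submodule.add_mem _ h1 (Submodule.smul_mem _ (v i / y i) h2)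
          · exact Submodule.subset_span (by simp)
      · simp only [hmod]
        exact euclidVar_lt hyi
  · refine ⟨⟨2 ^ X, one_le_pow₀ (by norm_num), ha, hb, ?_⟩, fun l h1 h2 => ⟨h1, h2⟩, rfl⟩
    have h1 : max (max |a i| |b i|) 1 ≤ (2 : ℤ) ^ X :=
      max_le (max_le (ha i) (hb i)) (one_le_pow₀ (by norm_num))
    calc (2 : ℤ) ^ X * max (max |a i| |b i|) 1 * 3 ^ euclidVar (a i) (b i)
        ≤ 2 ^ X * 2 ^ X * 3 ^ (2 * X + 3) := by
          gcongr
          · norm_num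
          · exact euclidVar_le (ha i) (hb i)
      _ ≤ 2 ^ X * 2 ^ X * 2 ^ (4 * X + 6) := by gcongr
      _ = _ := by ring
  · exact Nat.mul_le_mul_right _ (by have := euclidVar_le (ha i) (hb i); simp only; omega)

/-- The growth of the exponents in one run of Euclid's algorithm. -/
def rowGrowth (X : ℕ) : ℕ := 6 * X + 6

theorem polyBdd_rowGrowth : PolyBdd rowGrowth := by unfold rowGrowth; fun_prop

theorem le_iterate_rowGrowth (X : ℕ) {k m : ℕ} (h : k ≤ m) : rowGrowth^[k] X ≤ rowGrowth^[m] X :=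
  Function.monotone_iterate_of_id_le (fun X => by simp only [rowGrowth, id]; omega) h X

/-- Insertion of a vector into a triangular basis, by one run of Euclid's algorithm for each coordinate.
The exponents of the entries grow by a bounded number of iterations of `rowGrowth`. -/
theorem insertRow_runs (n : ℕ) : ∃ c, PolyBdd c ∧ ∀ (X : ℕ) (H : Fin n → Fin n → ℤ) (x : Fin n → ℤ),
    (∀ i l, |H i l| ≤ 2 ^ X) → (∀ l, |x l| ≤ 2 ^ X) → (∀ i l, l < i → H i l = 0) →
    Runs (insertRow H x) (c X) fun H' => (∀ i l, |H' i l| ≤ 2 ^ (rowGrowth^[n] X)) ∧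
      (∀ i l, l < i → H' i l = 0) ∧
      Submodule.span ℤ (Set.range H') = Submodule.span ℤ (insert x (Set.range H)) := by
  obtain ⟨c, hc, He⟩ := euclidRows_runs n
  have hpoly := polyBdd_rowGrowth.iterate n
  refine ⟨fun X => n * (c (rowGrowth^[n] X) + 1), by fun_prop, fun X H x hH hx htri => ?_⟩
  refine Runs.le (T := _ + 0) (Runs.bind (Runs.foldFin (c := c (rowGrowth^[n] X)) (fun k (s : (Fin n → Fin n → ℤ) × (Fin n → ℤ)) =>
    (∀ i l, |s.1 i l| ≤ 2 ^ (rowGrowth^[k] X)) ∧ (∀ l, |s.2 l| ≤ 2 ^ (rowGrowth^[k] X)) ∧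
    (∀ i l, l < i → s.1 i l = 0) ∧ (∀ l : Fin n, l.val < k → s.2 l = 0) ∧
    Submodule.span ℤ (insert s.2 (Set.range s.1)) = Submodule.span ℤ (insert x (Set.range H)))
    (fun i s hs => ?_) (H, x) ⟨hH, hx, htri, fun l h => by omega, rfl⟩) ?_) (by simp)
  · obtain ⟨h1, h2, h3, h4, h5⟩ := hs
    refine Runs.le (T := c (rowGrowth^[n] X) + 0) (Runs.bind
      ((He _ i _ _ (h1 i) h2).le (hc.1 (le_iterate_rowGrowth X i.isLt.le))) ?_) (by simp)
    rintro p ⟨g1, g2, g3, g4, g5⟩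
    refine Runs.pure ?_
    have hmono {z : ℤ} (hz : |z| ≤ 2 ^ (rowGrowth^[i] X)) : |z| ≤ 2 ^ (rowGrowth^[i + 1] X) :=
      abs_le_two_pow_mono hz (le_iterate_rowGrowth X (Nat.le_succ _))
    have hsucc : 6 * rowGrowth^[i] X + 6 = rowGrowth^[i + 1] X := by
      rw [Function.iterate_succ_apply']; rfl
    rw [hsucc] at g2 g3
    refine ⟨fun j l => ?_, g3, fun j l hl => ?_, fun l hl => ?_, ?_⟩
    · by_cases hj : j = i
      · subst hj; simpa using g2 l
      · simpa [Function.update_of_ne hj] using hmono (h1 j l)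
    · by_cases hj : j = i
      · subst hj; simpa using (g4 l (h3 j l hl) (h4 l hl)).1
      · simpa [Function.update_of_ne hj] using h3 j l hl
    · rcases Nat.lt_succ_iff_lt_or_eq.mp hl with h | h
      · exact (g4 l (h3 i l h) (h4 l h)).2
      · rw [Fin.ext h]; exact g1
    · rw [← h5, span_insert_range_eq _ _ i, span_insert_range_eq _ _ i, ← g5]
      simp only [Function.update_self]
      congr 2
      refine Set.image_congr fun j hj => ?_
      rw [Function.update_of_ne hj]
  · rintro ⟨H', x'⟩ ⟨h1, h2, h3, h4, h5⟩
    refine Runs.pure ⟨h1, h3, ?_⟩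
    have : x' = 0 := funext fun l => h4 l l.isLt
    rw [← h5, this]
    exact Submodule.span_insert_zero.symm

/-- The product of two coordinate vectors according to the multiplication table. -/
def tableMul (inp : Input n) (x y : Fin n → ℤ) : Fin n → ℤ :=
  fun k => ∑ i, ∑ j, x i * y j * inp.table i j k

theorem mulElt_runs (n : ℕ) : ∃ c, PolyBdd c ∧ ∀ (X : ℕ) (inp : Input n) (x y : Fin n → ℤ),
    (∀ i j k, |inp.table i j k| ≤ 2 ^ X) → (∀ l, |x l| ≤ 2 ^ X) → (∀ l, |y l| ≤ 2 ^ X) →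
    Runs (mulElt inp x y) (c X) (fun z => z = tableMul inp x y ∧ ∀ l, |z l| ≤ 2 ^ (3 * X + 2 * n)) := by
  let c₁ : ℕ → ℕ := fun X => (X + 2) * (X + 2) + (2 * X + 2) * (X + 2)
  let c₂ : ℕ → ℕ := fun X => n * (c₁ X + (2 * (3 * X) + n + 4) + 1)
  refine ⟨fun X => n * (n * (c₂ X + (2 * (3 * X + n) + n + 4) + 1) + 1), by fun_prop,
    fun X inp x y ht hx hy => ?_⟩
  have h2 i j : |x i * y j| ≤ 2 ^ (2 * X) := by
    rw [two_mul]; exact abs_mul_le_two_pow (hx i) (hy j)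
  have h3 i j k : |x i * y j * inp.table i j k| ≤ 2 ^ (3 * X) := by
    rw [show 3 * X = 2 * X + X by ring]; exact abs_mul_le_two_pow (h2 i j) (ht i j k)
  have h4 i k : |∑ j, x i * y j * inp.table i j k| ≤ 2 ^ (3 * X + n) :=
    abs_sum_le_two_pow _ (by simp) fun j _ => h3 i j k
  refine Runs.imp (Runs.tab_eq (g := tableMul inp x y) fun k => isum_runs (X := 3 * X + n)
    (fun i => isum_runs (X := 3 * X) (g := fun j => x i * y j * inp.table i j k)
    (fun j => Runs.bind_eq (Runs.le (Runs.prim rfl) (Nat.mul_le_mul (bits_le (hx i)) (bits_le (hy j))))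
      (Runs.le (Runs.prim rfl) (Nat.mul_le_mul (bits_le (h2 i j)) (bits_le (ht i j k)))))
    fun j => h3 i j k) fun i => h4 i k) ?_
  rintro z rfl
  refine ⟨rfl, fun l => ?_⟩
  rw [two_mul n, ← add_assoc]
  exact abs_sum_le_two_pow _ (by simp) fun i _ => h4 i l

/-- Multiplication of ideals: the `n ^ 2` products of basis vectors are inserted one after the other into
a triangular basis. The entries are not reduced on the way, which is harmless because the number
`n ^ 3` of runs of Euclid's algorithm is constant. -/
theorem mulIdeal_runs (n : ℕ) : ∃ c g, PolyBdd c ∧ PolyBdd g ∧ ∀ (X : ℕ) (inp : Input n)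
    (J₁ J₂ : IdealRep n), (∀ i j k, |inp.table i j k| ≤ 2 ^ X) → J₁.Sized X → J₂.Sized X →
    0 < J₁.den → 0 < J₂.den →
    Runs (mulIdeal inp J₁ J₂) (c X) fun J => J.Sized (g X) ∧ 0 < J.den ∧ ∃ d : ℤ, 0 < d ∧
      J₁.den * J₂.den = d * J.den ∧
      Submodule.span ℤ (Set.range fun j => d • J.num j) =
        Submodule.span ℤ {v | ∃ a b, v = tableMul inp (J₁.num a) (J₂.num b)} := by
  obtain ⟨c₁, hc₁, H₁⟩ := mulElt_runs n
  obtain ⟨c₂, hc₂, H₂⟩ := insertRow_runs n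
  obtain ⟨c₃, hc₃, H₃⟩ := lowestTerms_runs n
  have hpoly := polyBdd_rowGrowth.iterate (n * (n * n))
  let g : ℕ → ℕ := fun X => rowGrowth^[n * (n * n)] (3 * X + 2 * n)
  refine ⟨fun X => n * (n * (c₁ X + c₂ (g X) + 1) + 1) + ((X + 2) * (X + 2) + c₃ (g X)), g,
    by fun_prop, by fun_prop, fun X inp J₁ J₂ ht hJ₁ hJ₂ hd₁ hd₂ => ?_⟩
  let S : ℕ → ℕ → Set (Fin n → ℤ) := fun k l => {v | ∃ a b : Fin n,
    (a.val < k ∨ a.val = k ∧ b.val < l) ∧ v = tableMul inp (J₁.num a) (J₂.num b)}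
  let I : ℕ → ℕ → (Fin n → Fin n → ℤ) → Prop := fun k l H =>
    (∀ i j, |H i j| ≤ 2 ^ (rowGrowth^[n * (k * n + l)] (3 * X + 2 * n))) ∧
    (∀ i j, j < i → H i j = 0) ∧ Submodule.span ℤ (Set.range H) = Submodule.span ℤ (S k l)
  refine Runs.bind (P := I n 0) (Runs.foldFin (fun k => I k 0) (fun a H hH => ?_) _ ?_) ?_
  · refine Runs.imp (Runs.foldFin (fun l => I a l) (fun b H hH => ?_) H hH) fun H hH => ?_
    · obtain ⟨h1, h2, h3⟩ := hH
      refine Runs.bind (H₁ X inp _ _ ht (hJ₁.1 a) (hJ₂.1 b)) ?_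
      rintro x ⟨hx, hxs⟩
      have hle : a.val * n + b ≤ n * n := by
        have ha := a.isLt
        have hb := b.isLt
        nlinarith
      refine (H₂ _ H x h1 (fun l => abs_le_two_pow_mono (hxs l)
        (le_iterate_rowGrowth (3 * X + 2 * n) (Nat.zero_le _))) h2).mono
        (hc₂.1 (le_iterate_rowGrowth _ (Nat.mul_le_mul_left n hle))) ?_
      rintro H' ⟨g1, g2, g3⟩
      refine ⟨fun i j => ?_, g2, ?_⟩
      · have := g1 i j
        rwa [← Function.iterate_add_apply, show n + n * (a * n + b) = n * (a * n + (b + 1)) by ring]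
          at this
      · rw [g3, Submodule.span_insert, h3, ← Submodule.span_insert]
        congr 1
        ext v
        simp only [S, Set.mem_insert_iff, Set.mem_ofPred_eq]
        constructor
        · rintro (rfl | ⟨a', b', h, rfl⟩)
          · exact ⟨a, b, by omega, hx⟩
          · exact ⟨a', b', by omega, rfl⟩
        · rintro ⟨a', b', h, rfl⟩
          by_cases hab : a' = a ∧ b' = b
          · left; rw [hab.1, hab.2, hx]
          · right
            refine ⟨a', b', ?_, rfl⟩
            rcases h with h | h
            · exact Or.inl h
            · have : b'.val ≠ b.val := fun h' => hab ⟨Fin.ext h.1, Fin.ext h'⟩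
              omega
    · obtain ⟨h1, h2, h3⟩ := hH
      refine ⟨fun i j => ?_, h2, ?_⟩
      · rw [show n * ((a + 1) * n + 0) = n * (a * n + n) by ring]; exact h1 i j
      · rw [h3]
        congr 1
        ext v
        simp only [S, Set.mem_ofPred_eq]
        constructor <;> rintro ⟨a', b', h, rfl⟩ <;> exact ⟨a', b', by omega, rfl⟩
  · refine ⟨fun i j => by simp, fun i j _ => rfl, ?_⟩
    have hS : S 0 0 = ∅ := by
      ext v
      simp [S]
    rw [hS, Submodule.span_empty, Submodule.span_eq_bot]
    rintro _ ⟨i, rfl⟩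
    rfl
  · rintro H ⟨h1, h2, h3⟩
    have hmul : n * (n * n + 0) = n * (n * n) := by ring
    rw [hmul] at h1
    refine Runs.bind_eq (Runs.le (Runs.prim rfl) (Nat.mul_le_mul (bits_le hJ₁.2) (bits_le hJ₂.2))) ?_
    refine (H₃ (g X) ⟨H, J₁.den * J₂.den⟩ ⟨h1, ?_⟩ (mul_pos hd₁ hd₂)).imp ?_
    · refine abs_le_two_pow_mono (abs_mul_le_two_pow hJ₁.2 hJ₂.2) (le_trans ?_
        (le_iterate_rowGrowth (3 * X + 2 * n) (Nat.zero_le _)))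
      simp only [Function.iterate_zero, id]
      omega
    · rintro J ⟨g1, g2, ⟨d, hd, hd1, hd2⟩, -⟩
      refine ⟨g1, g2, d, hd, hd1, ?_⟩
      have hr : (fun j => d • J.num j) = H := by
        ext j i
        simpa using (hd2 j i).symm
      rw [hr, h3]
      congr 1
      ext v
      simp only [S, Set.mem_ofPred_eq]
      constructor
      · rintro ⟨a', b', h, rfl⟩; exact ⟨a', b', rfl⟩
      · rintro ⟨a', b', rfl⟩; exact ⟨a', b', Or.inl a'.isLt, rfl⟩

end ArakelovAlg

namespace GramSchmidtLLL

/-! ### Gram-Schmidt orthogonalization and LLL-reduced bases -/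

section GramSchmidt

open InnerProductSpace

variable {E : Type*} [NormedAddCommGroup E] [InnerProductSpace ℝ E] {n : ℕ}

/-- The Gram-Schmidt coefficients. -/
noncomputable def gsCoeff (b : Fin n → E) (i j : Fin n) : ℝ :=
  inner ℝ (b i) (gramSchmidt ℝ b j) / inner ℝ (gramSchmidt ℝ b j) (gramSchmidt ℝ b j)

/-- `b` is size-reduced and satisfies the Lovász condition with parameter `3/4`. -/
structure LLLReduced (b : Fin n → E) : Prop where
  size : ∀ i j, j < i → |gsCoeff b i j| ≤ 1 / 2
  lovasz : ∀ i j : Fin n, j.val + 1 = i.val →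
    (3 / 4 - gsCoeff b i j ^ 2) * ‖gramSchmidt ℝ b j‖ ^ 2 ≤ ‖gramSchmidt ℝ b i‖ ^ 2

theorem gs_eq_sub (b : Fin n → E) (i : Fin n) : gramSchmidt ℝ b i =
    b i - ∑ j ∈ Finset.Iio i, gsCoeff b i j • gramSchmidt ℝ b j := by
  rw [gramSchmidt_def]
  congr 1
  refine Finset.sum_congr rfl fun j _ => ?_
  rw [Submodule.starProjection_singleton, gsCoeff, real_inner_comm, real_inner_self_eq_norm_sq]
  rfl

theorem sub_gs_mem (b : Fin n → E) (i : Fin n) :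
    b i - gramSchmidt ℝ b i ∈ Submodule.span ℝ (b '' Set.Iio i) := by
  rw [← span_gramSchmidt_Iio, gs_eq_sub, sub_sub_cancel]
  exact Submodule.sum_mem _ fun j hj => Submodule.smul_mem _ _
    (Submodule.subset_span ⟨j, Finset.mem_Iio.mp hj, rfl⟩)

theorem inner_gs_of_mem (b : Fin n → E) (i : Fin n) {w : E}
    (hw : w ∈ Submodule.span ℝ (b '' Set.Iio i)) : inner ℝ (gramSchmidt ℝ b i) w = 0 := by
  rw [← span_gramSchmidt_Iio] at hw
  induction hw using Submodule.span_induction with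
  | mem x hx =>
    obtain ⟨j, hj, rfl⟩ := hx
    exact gramSchmidt_orthogonal ℝ b (ne_of_gt hj)
  | zero => simp
  | add x y _ _ hx hy => rw [inner_add_right, hx, hy, add_zero]
  | smul a x _ hx => rw [inner_smul_right, hx, mul_zero]

theorem gs_eq_of {b : Fin n → E} {i : Fin n} {v : E}
    (h₁ : b i - v ∈ Submodule.span ℝ (b '' Set.Iio i))
    (h₂ : ∀ w ∈ Submodule.span ℝ (b '' Set.Iio i), inner ℝ v w = 0) :
    gramSchmidt ℝ b i = v := by
  have h3 : gramSchmidt ℝ b i - v ∈ Submodule.span ℝ (b '' Set.Iio i) := by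
    have := Submodule.sub_mem _ h₁ (sub_gs_mem b i)
    simpa using this
  have h4 : inner ℝ (gramSchmidt ℝ b i - v) (gramSchmidt ℝ b i - v) = 0 := by
    conv_lhs => rw [inner_sub_left]
    rw [inner_gs_of_mem b i h3, h₂ _ h3, sub_zero]
  exact sub_eq_zero.mp (inner_self_eq_zero.mp h4)

theorem gs_congr {b b' : Fin n → E} {i : Fin n}
    (h₁ : b' i - b i ∈ Submodule.span ℝ (b '' Set.Iio i))
    (h₂ : Submodule.span ℝ (b' '' Set.Iio i) = Submodule.span ℝ (b '' Set.Iio i)) :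
    gramSchmidt ℝ b' i = gramSchmidt ℝ b i := by
  refine gs_eq_of ?_ fun w hw => inner_gs_of_mem b i (h₂ ▸ hw)
  rw [h₂]
  have := Submodule.add_mem _ h₁ (sub_gs_mem b i)
  simpa using this

theorem inner_gs_self (b : Fin n → E) (i : Fin n) :
    inner ℝ (b i) (gramSchmidt ℝ b i) = ‖gramSchmidt ℝ b i‖ ^ 2 := by
  have := inner_gs_of_mem b i (sub_gs_mem b i)
  rw [inner_sub_right, real_inner_self_eq_norm_sq, real_inner_comm] at this
  linarith

theorem inner_gs_of_lt (b : Fin n → E) {i j : Fin n} (h : i < j) :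
    inner ℝ (b i) (gramSchmidt ℝ b j) = 0 := by
  rw [real_inner_comm]
  exact gramSchmidt_inv_triangular ℝ b h

theorem gs_norm_pos {b : Fin n → E} (hb : LinearIndependent ℝ b) (i : Fin n) :
    0 < ‖gramSchmidt ℝ b i‖ := norm_pos_iff.mpr (gramSchmidt_ne_zero i hb)

theorem gsCoeff_self {b : Fin n → E} (hb : LinearIndependent ℝ b) (i : Fin n) :
    gsCoeff b i i = 1 := by
  rw [gsCoeff, inner_gs_self, real_inner_self_eq_norm_sq, div_self]
  exact (pow_pos (gs_norm_pos hb i) 2).ne'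

theorem gsCoeff_of_lt (b : Fin n → E) {i j : Fin n} (h : i < j) : gsCoeff b i j = 0 := by
  rw [gsCoeff, inner_gs_of_lt b h, zero_div]

theorem eq_sum_gsCoeff {b : Fin n → E} (hb : LinearIndependent ℝ b) (i : Fin n) :
    b i = ∑ j, gsCoeff b i j • gramSchmidt ℝ b j := by
  have h := gs_eq_sub b i
  have h1 : ∑ j, gsCoeff b i j • gramSchmidt ℝ b j =
      ∑ j ∈ Finset.Iic i, gsCoeff b i j • gramSchmidt ℝ b j := by
    symm
    refine Finset.sum_subset (Finset.subset_univ _) fun j _ hj => ?_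
    rw [gsCoeff_of_lt b (by simpa using hj), zero_smul]
  have h2 : Finset.Iic i = insert i (Finset.Iio i) := by
    ext j; simp [le_iff_eq_or_lt]
  rw [h1, h2, Finset.sum_insert (by simp), gsCoeff_self hb, one_smul, h]
  abel

theorem inner_sum_gs (b : Fin n → E) (x y : Fin n → ℝ) :
    inner ℝ (∑ j, x j • gramSchmidt ℝ b j) (∑ j, y j • gramSchmidt ℝ b j) =
      ∑ j, x j * y j * ‖gramSchmidt ℝ b j‖ ^ 2 := by
  rw [sum_inner]
  refine Finset.sum_congr rfl fun i _ => ?_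
  rw [inner_sum, Finset.sum_eq_single i]
  · rw [inner_smul_left, inner_smul_right, real_inner_self_eq_norm_sq]; simp; ring
  · intro j _ hj
    rw [inner_smul_left, inner_smul_right, gramSchmidt_orthogonal ℝ b hj.symm]; simp
  · simp

theorem norm_sq_sum {b : Fin n → E} (hb : LinearIndependent ℝ b) (x : Fin n → ℝ) :
    ‖∑ i, x i • b i‖ ^ 2 =
      ∑ j, ‖gramSchmidt ℝ b j‖ ^ 2 * (∑ i, x i * gsCoeff b i j) ^ 2 := by
  have : ∑ i, x i • b i = ∑ j, (∑ i, x i * gsCoeff b i j) • gramSchmidt ℝ b j := by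
    simp_rw [Finset.sum_smul, mul_smul]
    rw [Finset.sum_comm]
    refine Finset.sum_congr rfl fun i _ => ?_
    rw [← Finset.smul_sum, ← eq_sum_gsCoeff hb i]
  rw [this, ← real_inner_self_eq_norm_sq, inner_sum_gs]
  refine Finset.sum_congr rfl fun j _ => by ring

theorem norm_sq_eq {b : Fin n → E} (hb : LinearIndependent ℝ b) (i : Fin n) :
    ‖b i‖ ^ 2 = ∑ j, ‖gramSchmidt ℝ b j‖ ^ 2 * gsCoeff b i j ^ 2 := by
  have := norm_sq_sum hb (Pi.single i 1)
  simpa [Pi.single_apply] using this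

theorem gs_norm_le (b : Fin n → E) (i : Fin n) : ‖gramSchmidt ℝ b i‖ ≤ ‖b i‖ := by
  rcases eq_or_ne (gramSchmidt ℝ b i) 0 with h | h
  · rw [h, norm_zero]; exact norm_nonneg _
  have h1 := inner_gs_self b i
  have h2 := real_inner_le_norm (b i) (gramSchmidt ℝ b i)
  rw [h1, sq] at h2
  exact le_of_mul_le_mul_right h2 (norm_pos_iff.mpr h)

theorem abs_gsCoeff_le {b : Fin n → E} (hb : LinearIndependent ℝ b) (i j : Fin n) :
    |gsCoeff b i j| ≤ ‖b i‖ / ‖gramSchmidt ℝ b j‖ := by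
  have hpos := gs_norm_pos hb j
  rw [gsCoeff, real_inner_self_eq_norm_sq, abs_div, abs_of_pos (pow_pos hpos 2),
    div_le_div_iff₀ (pow_pos hpos 2) hpos]
  have := abs_real_inner_le_norm (b i) (gramSchmidt ℝ b j)
  nlinarith

theorem det_gram_eq {b : Fin n → E} (hb : LinearIndependent ℝ b) :
    (Matrix.gram ℝ b).det = ∏ i, ‖gramSchmidt ℝ b i‖ ^ 2 := by
  have h : Matrix.gram ℝ b = Matrix.of (gsCoeff b) *
      Matrix.diagonal (fun i => ‖gramSchmidt ℝ b i‖ ^ 2) * (Matrix.of (gsCoeff b)).transpose := by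
    ext i j
    rw [Matrix.gram_apply, eq_sum_gsCoeff hb i, eq_sum_gsCoeff hb j, inner_sum_gs,
      Matrix.mul_apply]
    refine Finset.sum_congr rfl fun k _ => ?_
    rw [Matrix.mul_diagonal, Matrix.transpose_apply, Matrix.of_apply, Matrix.of_apply]
    ring
  have hU : (Matrix.of (gsCoeff b)).det = 1 := by
    rw [Matrix.det_of_isLowerTriangular]
    · simp [gsCoeff_self hb]
    · intro i j hij
      exact gsCoeff_of_lt b hij
  rw [h, Matrix.det_mul, Matrix.det_mul, Matrix.det_transpose, hU, Matrix.det_diagonal]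
  simp

/-- Subtracting a multiple of an earlier vector does not change the orthogonalization. -/
theorem gs_update {b : Fin n → E} {j k : Fin n} (hjk : j < k) (q : ℝ) :
    gramSchmidt ℝ (Function.update b k (b k - q • b j)) = gramSchmidt ℝ b := by
  set b' := Function.update b k (b k - q • b j) with hb'
  have hne : ∀ i, i ≠ k → b' i = b i := fun i hi => Function.update_of_ne hi _ _
  have hk : b' k = b k - q • b j := Function.update_self _ _ _
  ext1 i
  refine gs_congr ?_ ?_
  · by_cases hi : i = k
    · rw [hi, hk, sub_sub_cancel_left]
      exact Submodule.neg_mem _ (Submodule.smul_mem _ _ (Submodule.subset_span ⟨j, hjk, rfl⟩))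
    · rw [hne i hi, sub_self]; exact Submodule.zero_mem _
  · refine le_antisymm (Submodule.span_le.mpr ?_) (Submodule.span_le.mpr ?_)
    · rintro _ ⟨l, hl, rfl⟩
      by_cases hlk : l = k
      · rw [hlk, hk]
        exact Submodule.sub_mem _ (Submodule.subset_span ⟨k, hlk ▸ hl, rfl⟩)
          (Submodule.smul_mem _ _ (Submodule.subset_span ⟨j, hjk.trans (hlk ▸ hl), rfl⟩))
      · rw [hne l hlk]; exact Submodule.subset_span ⟨l, hl, rfl⟩
    · rintro _ ⟨l, hl, rfl⟩
      by_cases hlk : l = k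
      · have h1 : b l = b' k + q • b' j := by rw [hlk, hk, hne j hjk.ne]; abel
        rw [h1]
        exact Submodule.add_mem _ (Submodule.subset_span ⟨k, hlk ▸ hl, rfl⟩)
          (Submodule.smul_mem _ _ (Submodule.subset_span ⟨j, hjk.trans (hlk ▸ hl), rfl⟩))
      · rw [← hne l hlk]; exact Submodule.subset_span ⟨l, hl, rfl⟩

theorem gsCoeff_update {b : Fin n → E} {j k : Fin n} (hjk : j < k) (q : ℝ) (l : Fin n) :
    gsCoeff (Function.update b k (b k - q • b j)) k l = gsCoeff b k l - q * gsCoeff b j l := by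
  rw [gsCoeff, gs_update hjk, Function.update_self, inner_sub_left, inner_smul_left, gsCoeff,
    gsCoeff]
  simp only [conj_trivial]
  ring

theorem image_comp_swap {α : Type*} {b : Fin n → α} {k k' i : Fin n} (h : k' < i ↔ k < i) :
    (b ∘ Equiv.swap k k') '' Set.Iio i = b '' Set.Iio i := by
  rw [Set.image_comp]
  congr 1
  ext l
  simp only [Set.mem_image, Set.mem_Iio]
  constructor
  · rintro ⟨m, hm, rfl⟩
    rcases eq_or_ne m k with rfl | h1
    · rw [Equiv.swap_apply_left]; exact h.mpr hm
    rcases eq_or_ne m k' with rfl | h2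
    · rw [Equiv.swap_apply_right]; exact h.mp hm
    rwa [Equiv.swap_apply_of_ne_of_ne h1 h2]
  · intro hl
    refine ⟨Equiv.swap k k' l, ?_, Equiv.swap_apply_self _ _ _⟩
    rcases eq_or_ne l k with rfl | h1
    · rw [Equiv.swap_apply_left]; exact h.mpr hl
    rcases eq_or_ne l k' with rfl | h2
    · rw [Equiv.swap_apply_right]; exact h.mp hl
    rwa [Equiv.swap_apply_of_ne_of_ne h1 h2]

theorem gs_swap_of_ne (b : Fin n → E) {k k' i : Fin n} (hkk : k'.val + 1 = k.val) (hik : i ≠ k)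
    (hik' : i ≠ k') : gramSchmidt ℝ (b ∘ Equiv.swap k k') i = gramSchmidt ℝ b i := by
  refine gs_congr ?_ ?_
  · simp [Equiv.swap_apply_of_ne_of_ne hik hik']
  · rw [image_comp_swap]
    rw [Fin.lt_def, Fin.lt_def]
    have : i.val ≠ k.val := fun h => hik (Fin.ext h)
    omega

theorem gs_swap_left {b : Fin n → E} {k k' : Fin n} (hkk : k'.val + 1 = k.val) :
    gramSchmidt ℝ (b ∘ Equiv.swap k k') k' =
      gramSchmidt ℝ b k + gsCoeff b k k' • gramSchmidt ℝ b k' := by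
  have hlt : k' < k := by rw [Fin.lt_def]; omega
  have himg : (b ∘ Equiv.swap k k') '' Set.Iio k' = b '' Set.Iio k' :=
    image_comp_swap (by simp [hlt.le])
  have hIio : Finset.Iio k = insert k' (Finset.Iio k') := by
    ext j; simp only [Finset.mem_Iio, Finset.mem_insert, Fin.lt_def, Fin.ext_iff]; omega
  refine gs_eq_of ?_ ?_
  · rw [himg]
    have h := gs_eq_sub b k
    rw [hIio, Finset.sum_insert (by simp)] at h
    have : (b ∘ Equiv.swap k k') k' - (gramSchmidt ℝ b k + gsCoeff b k k' • gramSchmidt ℝ b k') =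
        ∑ j ∈ Finset.Iio k', gsCoeff b k j • gramSchmidt ℝ b j := by
      rw [Function.comp_apply, Equiv.swap_apply_right, h]; abel
    rw [this, ← span_gramSchmidt_Iio]
    exact Submodule.sum_mem _ fun j hj => Submodule.smul_mem _ _
      (Submodule.subset_span ⟨j, Finset.mem_Iio.mp hj, rfl⟩)
  · rw [himg]
    intro w hw
    rw [inner_add_left, inner_smul_left, inner_gs_of_mem b k' hw, inner_gs_of_mem b k]
    · simp
    · exact Submodule.span_mono (Set.image_mono (Set.Iio_subset_Iio hlt.le)) hw

theorem norm_gs_swap_left {b : Fin n → E} {k k' : Fin n} (hkk : k'.val + 1 = k.val) :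
    ‖gramSchmidt ℝ (b ∘ Equiv.swap k k') k'‖ ^ 2 =
      ‖gramSchmidt ℝ b k‖ ^ 2 + gsCoeff b k k' ^ 2 * ‖gramSchmidt ℝ b k'‖ ^ 2 := by
  have hne : k ≠ k' := by intro h; rw [h] at hkk; omega
  rw [gs_swap_left hkk, ← real_inner_self_eq_norm_sq, inner_add_left, inner_add_right,
    inner_add_right, inner_smul_left, inner_smul_left, inner_smul_right, inner_smul_right,
    gramSchmidt_orthogonal ℝ b hne, gramSchmidt_orthogonal ℝ b hne.symm,
    real_inner_self_eq_norm_sq, real_inner_self_eq_norm_sq]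
  simp
  ring

theorem det_gram_comp_equiv (b : Fin n → E) (e : Equiv.Perm (Fin n)) :
    (Matrix.gram ℝ (b ∘ e)).det = (Matrix.gram ℝ b).det :=
  Matrix.det_submatrix_equiv_self e (Matrix.gram ℝ b)

theorem norm_gs_swap_mul {b : Fin n → E} (hb : LinearIndependent ℝ b) {k k' : Fin n}
    (hkk : k'.val + 1 = k.val) :
    ‖gramSchmidt ℝ (b ∘ Equiv.swap k k') k'‖ ^ 2 * ‖gramSchmidt ℝ (b ∘ Equiv.swap k k') k‖ ^ 2 =
      ‖gramSchmidt ℝ b k'‖ ^ 2 * ‖gramSchmidt ℝ b k‖ ^ 2 := by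
  have hne : k' ≠ k := by intro h; rw [h] at hkk; omega
  have h1 := det_gram_comp_equiv b (Equiv.swap k k')
  rw [det_gram_eq hb, det_gram_eq (hb.comp _ (Equiv.injective _))] at h1
  have h2 (f : Fin n → ℝ) : ∏ i, f i = f k' * f k * ∏ i ∈ (Finset.univ.erase k').erase k, f i := by
    rw [mul_assoc, Finset.mul_prod_erase _ f (by simp [hne.symm]),
      Finset.mul_prod_erase _ f (by simp)]
  rw [h2, h2 fun i => ‖gramSchmidt ℝ b i‖ ^ 2] at h1
  have h3 : ∏ i ∈ (Finset.univ.erase k').erase k, ‖gramSchmidt ℝ (b ∘ Equiv.swap k k') i‖ ^ 2 =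
      ∏ i ∈ (Finset.univ.erase k').erase k, ‖gramSchmidt ℝ b i‖ ^ 2 := by
    refine Finset.prod_congr rfl fun i hi => ?_
    simp only [Finset.mem_erase] at hi
    rw [gs_swap_of_ne b hkk hi.1 hi.2.1]
  rw [h3] at h1
  refine mul_right_cancel₀ (Finset.prod_pos fun i _ => ?_).ne' h1
  exact pow_pos (gs_norm_pos hb i) 2

/-- If the Lovász condition fails then exchanging two neighbours shortens the first of the two
orthogonalized vectors by a definite factor; all stay below any common bound. -/
theorem norm_gs_swap_le {b : Fin n → E} (hb : LinearIndependent ℝ b) {k k' : Fin n}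
    (hkk : k'.val + 1 = k.val) {s : ℝ} (hs : ∀ i, ‖gramSchmidt ℝ b i‖ ≤ s)
    (hlov : ‖gramSchmidt ℝ b k‖ ^ 2 < (3 / 4 - gsCoeff b k k' ^ 2) * ‖gramSchmidt ℝ b k'‖ ^ 2) :
    ‖gramSchmidt ℝ (b ∘ Equiv.swap k k') k'‖ ^ 2 < 3 / 4 * ‖gramSchmidt ℝ b k'‖ ^ 2 ∧
    ∀ i, ‖gramSchmidt ℝ (b ∘ Equiv.swap k k') i‖ ≤ s := by
  have hb' := hb.comp _ (Equiv.swap k k').injective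
  have h1 := norm_gs_swap_left (b := b) hkk
  have h2 := norm_gs_swap_mul hb hkk
  have p1 := pow_pos (gs_norm_pos hb k) 2
  have p2 := pow_pos (gs_norm_pos hb k') 2
  have p3 := pow_pos (gs_norm_pos hb' k) 2
  have p4 := pow_pos (gs_norm_pos hb' k') 2
  have hlt : ‖gramSchmidt ℝ (b ∘ Equiv.swap k k') k'‖ ^ 2 < 3 / 4 * ‖gramSchmidt ℝ b k'‖ ^ 2 := by
    rw [h1]; linarith
  refine ⟨hlt, fun i => ?_⟩
  have hs0 : 0 ≤ s := (norm_nonneg _).trans (hs k)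
  by_cases hi : i = k
  · subst hi
    refine le_trans ?_ (hs k')
    refine le_of_sq_le_sq ?_ (norm_nonneg _)
    have h5 : ‖gramSchmidt ℝ b i‖ ^ 2 ≤ ‖gramSchmidt ℝ (b ∘ Equiv.swap i k') k'‖ ^ 2 := by
      rw [h1]; nlinarith [mul_nonneg (sq_nonneg (gsCoeff b i k')) p2.le]
    by_contra! hcon
    have := mul_lt_mul' h5 hcon p2.le p4
    nlinarith
  · by_cases hi' : i = k'
    · subst hi'
      refine le_trans ?_ (hs i)
      exact le_of_sq_le_sq (by linarith) (norm_nonneg _)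
    · rw [gs_swap_of_ne b hkk hi hi']; exact hs i

theorem gs_norm_sq_ge {b : Fin n → E} (hb : LinearIndependent ℝ b) {s : ℝ}
    (hs : ∀ i, ‖gramSchmidt ℝ b i‖ ≤ s) (i : Fin n) :
    (Matrix.gram ℝ b).det ≤ ‖gramSchmidt ℝ b i‖ ^ 2 * (s ^ 2) ^ (n - 1) := by
  rw [det_gram_eq hb, ← Finset.mul_prod_erase _ _ (Finset.mem_univ i)]
  refine mul_le_mul_of_nonneg_left ?_ (by positivity)
  refine (Finset.prod_le_prod (fun _ _ => by positivity) fun j _ =>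
    pow_le_pow_left₀ (norm_nonneg _) (hs j) 2).trans_eq ?_
  rw [Finset.prod_const, Finset.card_erase_of_mem (Finset.mem_univ _), Finset.card_univ,
    Fintype.card_fin]

/-- The potential that measures the progress of the LLL algorithm. -/
noncomputable def lllPotential (b : Fin n → E) (a : ℝ) : ℝ :=
  ∑ i : Fin n, ((n : ℝ) - i) * Real.log (‖gramSchmidt ℝ b i‖ ^ 2 / a)

/-- An exchange in the LLL algorithm lowers the potential by a definite amount: the product of the two
squared Gram-Schmidt norms concerned is unchanged, the first one drops by the factor `3 / 4`. -/
theorem lllPotential_swap {b : Fin n → E} (hb : LinearIndependent ℝ b) {k k' : Fin n}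
    (hkk : k'.val + 1 = k.val) {a : ℝ} (ha : 0 < a)
    (h : ‖gramSchmidt ℝ (b ∘ Equiv.swap k k') k'‖ ^ 2 < 3 / 4 * ‖gramSchmidt ℝ b k'‖ ^ 2) :
    lllPotential (b ∘ Equiv.swap k k') a + Real.log (4 / 3) ≤ lllPotential b a := by
  have hb' := hb.comp _ (Equiv.swap k k').injective
  have hne : k' ≠ k := by intro h; rw [h] at hkk; omega
  have p1 := pow_pos (gs_norm_pos hb k) 2
  have p2 := pow_pos (gs_norm_pos hb k') 2
  have p3 := pow_pos (gs_norm_pos hb' k) 2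
  have p4 := pow_pos (gs_norm_pos hb' k') 2
  have hmul := norm_gs_swap_mul hb hkk
  have h2 (f : Fin n → ℝ) : ∑ i, f i = f k' + f k + ∑ i ∈ (Finset.univ.erase k').erase k, f i := by
    rw [add_assoc, Finset.add_sum_erase _ f (by simp [hne.symm]),
      Finset.add_sum_erase _ f (by simp)]
  have hlogmul := congrArg Real.log hmul
  rw [Real.log_mul p4.ne' p3.ne', Real.log_mul p2.ne' p1.ne'] at hlogmul
  have hloglt := Real.log_lt_log p4 h
  rw [Real.log_mul (by norm_num) p2.ne'] at hloglt
  have h34 : Real.log (3 / 4) = -Real.log (4 / 3) := by rw [← Real.log_inv]; norm_num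
  rw [lllPotential, lllPotential, h2, h2 fun i : Fin n =>
    ((n : ℝ) - i) * Real.log (‖gramSchmidt ℝ b i‖ ^ 2 / a)]
  have h3 : ∑ i ∈ (Finset.univ.erase k').erase k,
      ((n : ℝ) - i) * Real.log (‖gramSchmidt ℝ (b ∘ Equiv.swap k k') i‖ ^ 2 / a) =
      ∑ i ∈ (Finset.univ.erase k').erase k,
      ((n : ℝ) - i) * Real.log (‖gramSchmidt ℝ b i‖ ^ 2 / a) := by
    refine Finset.sum_congr rfl fun i hi => ?_
    simp only [Finset.mem_erase] at hi
    rw [gs_swap_of_ne b hkk hi.1 hi.2.1]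
  rw [h3, Real.log_div p4.ne' ha.ne', Real.log_div p3.ne' ha.ne', Real.log_div p2.ne' ha.ne',
    Real.log_div p1.ne' ha.ne']
  have hk : (k : ℝ) = k' + 1 := by exact_mod_cast hkk.symm
  rw [hk]
  have h5 : Real.log (‖gramSchmidt ℝ (b ∘ Equiv.swap k k') k‖ ^ 2) =
      Real.log (‖gramSchmidt ℝ b k'‖ ^ 2) + Real.log (‖gramSchmidt ℝ b k‖ ^ 2) -
      Real.log (‖gramSchmidt ℝ (b ∘ Equiv.swap k k') k'‖ ^ 2) := by linarith
  rw [h5]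
  nlinarith

theorem lllPotential_nonneg {b : Fin n → E} {a : ℝ} (ha : 0 < a)
    (h : ∀ i, a ≤ ‖gramSchmidt ℝ b i‖ ^ 2) : 0 ≤ lllPotential b a := by
  refine Finset.sum_nonneg fun i _ => mul_nonneg ?_ (Real.log_nonneg ((one_le_div ha).mpr (h i)))
  have : (i : ℝ) ≤ n := by exact_mod_cast i.isLt.le
  linarith

theorem lllPotential_le {b : Fin n → E} {a c : ℝ} (ha : 0 < a)
    (h : ∀ i, a ≤ ‖gramSchmidt ℝ b i‖ ^ 2) (hc : ∀ i, ‖gramSchmidt ℝ b i‖ ^ 2 ≤ a * c) :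
    lllPotential b a ≤ n * (n * Real.log c) := by
  have h1 : ∀ i : Fin n, ((n : ℝ) - i) * Real.log (‖gramSchmidt ℝ b i‖ ^ 2 / a) ≤
      n * Real.log c := by
    intro i
    have h0 : 0 ≤ Real.log (‖gramSchmidt ℝ b i‖ ^ 2 / a) :=
      Real.log_nonneg ((one_le_div ha).mpr (h i))
    have h2 : Real.log (‖gramSchmidt ℝ b i‖ ^ 2 / a) ≤ Real.log c := by
      refine Real.log_le_log (div_pos (ha.trans_le (h i)) ha) ?_
      rw [div_le_iff₀ ha, mul_comm]; exact hc i
    refine mul_le_mul (by simp) h2 h0 (by simp)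
  refine (Finset.sum_le_sum fun i _ => h1 i).trans ?_
  simp

/-! ### Bounds for reduced bases -/

theorem norm_sq_le_of_size {b : Fin n → E} (hb : LinearIndependent ℝ b) {i : Fin n}
    (h : ∀ j, j < i → |gsCoeff b i j| ≤ 1 / 2) :
    ‖b i‖ ^ 2 ≤ ∑ j ∈ Finset.Iic i, ‖gramSchmidt ℝ b j‖ ^ 2 := by
  rw [norm_sq_eq hb, ← Finset.sum_subset (Finset.subset_univ (Finset.Iic i))]
  · refine Finset.sum_le_sum fun j hj => mul_le_of_le_one_right (by positivity) ?_
    rcases (Finset.mem_Iic.mp hj).eq_or_lt with rfl | hlt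
    · rw [gsCoeff_self hb]; norm_num
    · have := h j hlt
      rw [← sq_abs]
      nlinarith [abs_nonneg (gsCoeff b i j)]
  · intro j _ hj
    rw [gsCoeff_of_lt b (by simpa using hj)]; simp

theorem norm_le_of_size {b : Fin n → E} (hb : LinearIndependent ℝ b) {i : Fin n} {s : ℝ}
    (hs : ∀ j, ‖gramSchmidt ℝ b j‖ ≤ s) (h : ∀ j, j < i → |gsCoeff b i j| ≤ 1 / 2) :
    ‖b i‖ ≤ n * s := by
  have hs0 : 0 ≤ s := (norm_nonneg _).trans (hs i)
  have hn : (1 : ℝ) ≤ n := by exact_mod_cast (Nat.zero_le _).trans_lt i.isLt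
  refine le_of_sq_le_sq ((norm_sq_le_of_size hb h).trans ?_) (by positivity)
  refine (Finset.sum_le_sum fun j _ => pow_le_pow_left₀ (norm_nonneg _) (hs j) 2).trans ?_
  rw [Finset.sum_const, nsmul_eq_mul]
  have : ((Finset.Iic i).card : ℝ) ≤ n := by
    exact_mod_cast (Finset.card_le_univ _).trans (by simp)
  nlinarith [sq_nonneg s, mul_nonneg (sub_nonneg.mpr hn) (sq_nonneg s)]

theorem LLLReduced.norm_gs_le {b : Fin n → E} (h : LLLReduced b) {i j : Fin n} (hij : i ≤ j) :
    ‖gramSchmidt ℝ b i‖ ^ 2 ≤ 2 ^ (j.val - i.val) * ‖gramSchmidt ℝ b j‖ ^ 2 := by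
  obtain ⟨j, hj⟩ := j
  have hij' : i.val ≤ j := hij
  induction j, hij' using Nat.le_induction with
  | base => simp
  | succ m hm ih =>
    have h1 := ih (by omega) hm
    have h2 := h.lovasz ⟨m + 1, hj⟩ ⟨m, by omega⟩ rfl
    have h3 := h.size ⟨m + 1, hj⟩ ⟨m, by omega⟩ (by simp [Fin.lt_def])
    have h4 : gsCoeff b ⟨m + 1, hj⟩ ⟨m, by omega⟩ ^ 2 ≤ 1 / 4 := by
      rw [← sq_abs]; nlinarith [abs_nonneg (gsCoeff b ⟨m + 1, hj⟩ ⟨m, by omega⟩)]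
    have h5 : ‖gramSchmidt ℝ b ⟨m, by omega⟩‖ ^ 2 ≤ 2 * ‖gramSchmidt ℝ b ⟨m + 1, hj⟩‖ ^ 2 := by
      nlinarith [sq_nonneg ‖gramSchmidt ℝ b ⟨m, by omega⟩‖]
    have h6 : m + 1 - i.val = (m - i.val) + 1 := by omega
    simp only at h1 ⊢
    rw [h6, pow_succ (2 : ℝ), mul_assoc]
    exact h1.trans (by gcongr)

theorem LLLReduced.norm_gs_le' {b : Fin n → E} (h : LLLReduced b) {i j : Fin n} (hij : i ≤ j) :
    ‖gramSchmidt ℝ b i‖ ^ 2 ≤ 2 ^ n * ‖gramSchmidt ℝ b j‖ ^ 2 :=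
  (h.norm_gs_le hij).trans (mul_le_mul_of_nonneg_right
    (pow_le_pow_right₀ (by norm_num) (by have := j.isLt; omega)) (by positivity))

/-- The first vector of a reduced basis is short. -/
theorem LLLReduced.norm_sq_pow_le {b : Fin n → E} (h : LLLReduced b) (hb : LinearIndependent ℝ b)
    (hn : 0 < n) : (‖b ⟨0, hn⟩‖ ^ 2) ^ n ≤ 2 ^ (n * n) * (Matrix.gram ℝ b).det := by
  have h0 : gramSchmidt ℝ b ⟨0, hn⟩ = b ⟨0, hn⟩ := by
    rw [gs_eq_sub, Finset.sum_eq_zero, sub_zero]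
    intro j hj
    exact absurd (Finset.mem_Iio.mp hj) (by simp [Fin.lt_def])
  rw [det_gram_eq hb, pow_mul]
  calc (‖b ⟨0, hn⟩‖ ^ 2) ^ n = ∏ _i : Fin n, ‖b ⟨0, hn⟩‖ ^ 2 := by simp
    _ ≤ ∏ i : Fin n, 2 ^ n * ‖gramSchmidt ℝ b i‖ ^ 2 := by
        refine Finset.prod_le_prod (fun _ _ => by positivity) fun i _ => ?_
        rw [← h0]
        exact h.norm_gs_le' (by simp [Fin.le_def])
    _ = _ := by rw [Finset.prod_mul_distrib]; simp

end GramSchmidt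

end GramSchmidtLLL

namespace ArakelovAlg

open GramSchmidtLLL

variable {n : ℕ}

/-! ### Linear algebra programs -/

/-- The vector space `F_ℝ` with its euclidean structure: real and imaginary parts, scaled by the
square roots of the degrees of the places. -/
noncomputable def toE {r : ℕ} (deg : Fin r → ℤ) : Vec r →ₗ[ℝ] EuclideanSpace ℝ (Fin r × Fin 2) where
  toFun x := WithLp.toLp 2 fun p => √(deg p.1 : ℝ) * (if p.2 = 0 then (x p.1).1 else (x p.1).2)
  map_add' x y := by
    ext p
    simp only [Pi.add_apply, Prod.fst_add, Prod.snd_add, PiLp.add_apply]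
    split_ifs <;> ring
  map_smul' c x := by
    ext p
    simp only [Pi.smul_apply, Prod.smul_fst, Prod.smul_snd, smul_eq_mul, RingHom.id_apply,
      PiLp.smul_apply]
    split_ifs <;> ring

theorem inner_toE {r : ℕ} {deg : Fin r → ℤ} (h : ∀ σ, 0 ≤ deg σ) (x y : Vec r) :
    inner ℝ (toE deg x) (toE deg y) =
      ∑ σ, (deg σ : ℝ) * ((x σ).1 * (y σ).1 + (x σ).2 * (y σ).2) := by
  rw [PiLp.inner_apply, Fintype.sum_prod_type]
  refine Finset.sum_congr rfl fun σ _ => ?_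
  have h1 : √(deg σ : ℝ) * √(deg σ : ℝ) = deg σ := Real.mul_self_sqrt (by exact_mod_cast h σ)
  rw [Fin.sum_univ_two]
  simp only [toE, LinearMap.coe_mk, AddHom.coe_mk, Real.inner_apply, if_true,
    one_ne_zero, if_false]
  linear_combination ((x σ).1 * (y σ).1 + (x σ).2 * (y σ).2) * h1

/-- The infinite places have degree `1` or `2`, and there are at most `n` of them. -/
structure Input.Wf (inp : Input n) : Prop where
  deg : ∀ σ, inp.deg σ = 1 ∨ inp.deg σ = 2
  r_le : inp.r ≤ n

theorem Input.Wf.deg_nonneg {inp : Input n} (h : inp.Wf) (σ : Fin inp.r) : 0 ≤ inp.deg σ := by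
  rcases h.deg σ with h | h <;> omega

theorem Input.Wf.bits_deg {inp : Input n} (h : inp.Wf) (σ : Fin inp.r) : bits (inp.deg σ) ≤ 3 := by
  refine bits_le (X := 1) ?_
  rcases h.deg σ with h | h <;> rw [h] <;> norm_num

theorem innerProd_runs {inp : Input n} (h : inp.Wf) (x y : Vec inp.r) :
    Runs (innerProd inp x y) (9 * n) (· = inner ℝ (toE inp.deg x) (toE inp.deg y)) := by
  rw [inner_toE h.deg_nonneg]
  refine Runs.le (Runs.rsum_eq (c := 7) fun σ => ?_) (by have := h.r_le; omega)
  refine Runs.le (Runs.prim_bind (Runs.prim_bind (Runs.prim_bind (Runs.prim_bind (Runs.prim rfl))))) ?_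
  have := h.bits_deg σ
  omega

theorem subSmul_runs {inp : Input n} (h : inp.Wf) (x : Vec inp.r) (c : ℝ) (y : Vec inp.r) :
    Runs (subSmul inp x c y) (5 * n) (· = x - c • y) := by
  refine Runs.le (Runs.tab_eq (c := 4) fun σ => ?_) (by have := h.r_le; omega)
  exact Runs.le (Runs.prim_bind (Runs.prim_bind (Runs.prim_bind (Runs.prim_bind (Runs.pure rfl)))))
    (by omega)

theorem projCoeff_runs {inp : Input n} (h : inp.Wf) (x y : Vec inp.r) :
    Runs (projCoeff inp x y) (18 * n + 1) (· = inner ℝ (toE inp.deg x) (toE inp.deg y) /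
      inner ℝ (toE inp.deg y) (toE inp.deg y)) :=
  Runs.le ((innerProd_runs h x y).bind_eq ((innerProd_runs h y y).bind_eq (Runs.prim rfl))) (by omega)

theorem gs_castSucc {E : Type*} [NormedAddCommGroup E] [InnerProductSpace ℝ E] {m : ℕ}
    (b : Fin (m + 1) → E) (j : Fin m) :
    InnerProductSpace.gramSchmidt ℝ b j.castSucc =
      InnerProductSpace.gramSchmidt ℝ (fun i => b i.castSucc) j := by
  have himg : b '' Set.Iio j.castSucc = (fun i : Fin m => b i.castSucc) '' Set.Iio j := by
    ext v
    constructor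
    · rintro ⟨i, hi, rfl⟩
      have hi' : i.val < j.val := hi
      exact ⟨⟨i, hi'.trans j.isLt⟩, hi', rfl⟩
    · rintro ⟨i, hi, rfl⟩
      exact ⟨i.castSucc, hi, rfl⟩
  refine gs_eq_of ?_ fun w hw => inner_gs_of_mem _ _ (himg ▸ hw)
  rw [himg]
  exact sub_gs_mem (fun i => b i.castSucc) j

/-- The time of the Gram-Schmidt program. -/
def gsTime (n m : ℕ) : ℕ := m * (n * (23 * n + 2) + 1)

/-- The program computes the Gram-Schmidt orthogonalization of Mathlib. -/
theorem gramSchmidt_runs {inp : Input n} (h : inp.Wf) {m : ℕ} (hm : m ≤ n) (b : Fin m → Vec inp.r) :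
    Runs (gramSchmidt inp m b) (gsTime n m) fun bs => ∀ j, toE inp.deg (bs j) =
      InnerProductSpace.gramSchmidt ℝ (fun i => toE inp.deg (b i)) j := by
  induction m with
  | zero => exact (Runs.pure fun j => j.elim0).le (Nat.zero_le _)
  | succ m ih =>
    let B : Fin (m + 1) → EuclideanSpace ℝ (Fin inp.r × Fin 2) := fun i => toE inp.deg (b i)
    refine Runs.le ((ih (by omega) fun i => b i.castSucc).bind fun bs hbs =>
      (Runs.foldFin (c := 23 * n + 1) (fun k x => toE inp.deg x = B (Fin.last m) -
        ∑ j : Fin m with j.val < k, gsCoeff B (Fin.last m) j.castSucc •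
          InnerProductSpace.gramSchmidt ℝ B j.castSucc)
        (fun j x hx => ?_) _ ?_).bind fun x hx => Runs.prim ?_) ?_
    · refine Runs.le ((projCoeff_runs h _ _).bind_eq ((subSmul_runs h _ _ _).imp ?_)) (by omega)
      rintro y rfl
      have : (Finset.univ.filter fun l : Fin m => l.val < j + 1) =
          insert j (Finset.univ.filter fun l : Fin m => l.val < j) := by
        ext l; simp [Fin.ext_iff]; omega
      rw [this, Finset.sum_insert (by simp), map_sub, map_smul, hx, hbs j,
        ← gs_castSucc B j, gsCoeff]
      abel
    · simp [B]
    · intro j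
      refine Fin.lastCases ?_ (fun j => ?_) j
      · rw [Fin.snoc_last, hx, gs_eq_sub B (Fin.last m), Finset.filter_true_of_mem fun j _ => j.isLt]
        congr 1
        refine (Finset.sum_bij (fun j _ => j.castSucc) ?_ ?_ ?_ ?_)
        · intro j _; simp
        · intro i _ j _ hij; exact Fin.castSucc_injective _ hij
        · intro j hj
          have hj' : j < Fin.last m := Finset.mem_Iio.mp hj
          exact ⟨⟨j, hj'⟩, Finset.mem_univ _, rfl⟩
        · intro j _; rfl
      · rw [Fin.snoc_castSucc, hbs j]
        exact (gs_castSucc B j).symm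
    · have : m * (23 * n + 2) ≤ n * (23 * n + 2) := Nat.mul_le_mul_right _ (by omega)
      simp only [gsTime]
      rw [add_mul, one_mul, show 23 * n + 1 + 1 = 23 * n + 2 by ring]
      omega

/-- The vector `u · ∑ i, x i • ω i`. -/
noncomputable def vecOf (inp : Input n) (u : Fin inp.r → ℝ) (x : Fin n → ℤ) : Vec inp.r :=
  fun σ => (u σ * ∑ i, (x i : ℝ) * (inp.emb i σ).1, u σ * ∑ i, (x i : ℝ) * (inp.emb i σ).2)

theorem realBasis_runs {inp : Input n} (h : inp.Wf) (u : Fin inp.r → ℝ) {N : Fin n → Fin n → ℤ}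
    {X : ℕ} (hN : ∀ j i, |N j i| ≤ 2 ^ X) :
    Runs (realBasis inp u N) (n * (n * (n * (2 * X + 10) + 3) + 1)) (· = fun j => vecOf inp u (N j)) := by
  refine Runs.le (Runs.tab_eq (c := n * (n * (2 * X + 10) + 3)) fun j => Runs.le (Runs.tab_eq
    (c := n * (2 * X + 10) + 2) fun σ => ?_) ?_) le_rfl
  · have hs (f : Fin n → ℝ) : Runs (rsum n fun i => do let c ← ofInt (N j i); rmul c (f i))
        (n * (X + 5)) (· = ∑ i, (N j i : ℝ) * f i) :=
      Runs.rsum_eq (c := X + 3) fun i => Runs.le (Runs.prim_bind (Runs.prim rfl))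
        (by have := bits_le (hN j i); omega)
    refine Runs.le ((hs _).bind_eq ((hs _).bind_eq (Runs.prim_bind (Runs.prim_bind
      (Runs.pure rfl))))) ?_
    ring_nf; omega
  · exact Nat.mul_le_mul h.r_le (by omega)

/-- The lattice vector with coordinates `x`. -/
noncomputable def latVec (inp : Input n) (u : Fin inp.r → ℝ) (x : Fin n → ℤ) :
    EuclideanSpace ℝ (Fin inp.r × Fin 2) := toE inp.deg (vecOf inp u x)

theorem latVec_eq_sum (inp : Input n) (u : Fin inp.r → ℝ) (x : Fin n → ℤ) :
    latVec inp u x = ∑ i, (x i : ℝ) • toE inp.deg (fun σ => u σ • inp.emb i σ) := by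
  rw [latVec]
  simp_rw [← map_smul]
  rw [← map_sum]
  congr 1
  ext σ
  · simp [vecOf, Finset.mul_sum, Prod.fst_sum]
    exact Finset.sum_congr rfl fun i _ => by ring
  · simp [vecOf, Finset.mul_sum, Prod.snd_sum]
    exact Finset.sum_congr rfl fun i _ => by ring

theorem latVec_sub_mul (inp : Input n) (u : Fin inp.r → ℝ) (x y : Fin n → ℤ) (q : ℤ) :
    latVec inp u (fun i => x i - q * y i) = latVec inp u x - (q : ℝ) • latVec inp u y := by
  simp only [latVec_eq_sum, Int.cast_sub, Int.cast_mul, sub_smul, Finset.sum_sub_distrib,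
    Finset.smul_sum, mul_smul]

/-! ### The LLL algorithm -/

theorem span_range_update {R M ι : Type*} [DecidableEq ι] [CommRing R] [AddCommGroup M] [Module R M] (b : ι → M)
    {j k : ι} (hjk : j ≠ k) (q : R) :
    Submodule.span R (Set.range (Function.update b k (b k - q • b j))) =
      Submodule.span R (Set.range b) := by
  refine le_antisymm (Submodule.span_le.mpr ?_) (Submodule.span_le.mpr ?_)
  · rintro _ ⟨l, rfl⟩
    by_cases hl : l = k
    · subst hl
      rw [Function.update_self]
      exact Submodule.sub_mem _ (Submodule.subset_span ⟨l, rfl⟩)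
        (Submodule.smul_mem _ _ (Submodule.subset_span ⟨j, rfl⟩))
    · rw [Function.update_of_ne hl]; exact Submodule.subset_span ⟨l, rfl⟩
  · rintro _ ⟨l, rfl⟩
    by_cases hl : l = k
    · subst hl
      have h1 : b l = Function.update b l (b l - q • b j) l +
          q • Function.update b l (b l - q • b j) j := by
        rw [Function.update_self, Function.update_of_ne hjk]; abel
      have h2 := Submodule.add_mem (Submodule.span R (Set.range (Function.update b l (b l - q • b j))))
        (Submodule.subset_span ⟨l, rfl⟩) (Submodule.smul_mem _ q (Submodule.subset_span ⟨j, rfl⟩))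
      rwa [← h1] at h2
    · exact Submodule.subset_span ⟨l, Function.update_of_ne hl _ _⟩

theorem linearIndependent_of_span_eq {K V ι : Type*} [Fintype ι] [Field K] [AddCommGroup V] [Module K V]
    {b b' : ι → V} (hb : LinearIndependent K b)
    (h : Submodule.span K (Set.range b') = Submodule.span K (Set.range b)) :
    LinearIndependent K b' := by
  rw [linearIndependent_iff_card_eq_finrank_span] at hb ⊢
  rw [hb, Set.finrank, Set.finrank, h]

theorem latVec_update (inp : Input n) (u : Fin inp.r → ℝ) (N : Fin n → Fin n → ℤ) (j k : Fin n)
    (q : ℤ) : (fun i => latVec inp u (Function.update N k (fun i => N k i - q * N j i) i)) =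
      Function.update (fun i => latVec inp u (N i)) k
        (latVec inp u (N k) - (q : ℝ) • latVec inp u (N j)) := by
  ext1 i
  by_cases hi : i = k
  · subst hi; rw [Function.update_self, Function.update_self, latVec_sub_mul]
  · rw [Function.update_of_ne hi, Function.update_of_ne hi]

theorem abs_entry_le {inp : Input n} {u : Fin inp.r → ℝ} {κ s : ℝ} {Y Z : ℕ}
    (hκ : ∀ (x : Fin n → ℤ) i, |(x i : ℝ)| ≤ κ * ‖latVec inp u x‖) (hκ0 : 0 ≤ κ)
    (hκs : κ * s ≤ 2 ^ Y)
    {x : Fin n → ℤ} (hx : ‖latVec inp u x‖ ≤ n * s * 2 ^ Z) (i : Fin n) :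
    |x i| ≤ 2 ^ (Y + n + Z) := by
  have h1 : |(x i : ℝ)| ≤ 2 ^ (Y + n + Z) := by
    calc |(x i : ℝ)| ≤ κ * ‖latVec inp u x‖ := hκ x i
      _ ≤ κ * (n * s * 2 ^ Z) := by gcongr
      _ = (κ * s) * n * 2 ^ Z := by ring
      _ ≤ 2 ^ Y * 2 ^ n * 2 ^ Z := by
        gcongr
        exact_mod_cast n.lt_two_pow_self.le
      _ = _ := by rw [pow_add, pow_add]
  exact_mod_cast h1

/-- Size reduction of the `k`-th vector against the vectors with index below `j`. The orthogonalization
is unchanged, and the length of the vector grows at most by the factor `2 ^ (Y + n + 1)` in each of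
the remaining steps, which keeps the rounded coefficients and the coordinates small. -/
theorem sizeReduce_runs (n : ℕ) : ∃ c, PolyBdd c ∧ ∀ (Y : ℕ) (inp : Input n) (u : Fin inp.r → ℝ)
    (s κ : ℝ) (k : Fin n), inp.Wf → 0 < s → 0 ≤ κ →
    (∀ (x : Fin n → ℤ) i, |(x i : ℝ)| ≤ κ * ‖latVec inp u x‖) → κ * s ≤ 2 ^ Y →
    ∀ (j : ℕ) (hj : j ≤ n) (N : Fin n → Fin n → ℤ), j ≤ k →
    LinearIndependent ℝ (fun i => latVec inp u (N i)) →
    (∀ i, s ≤ ‖InnerProductSpace.gramSchmidt ℝ (fun i => latVec inp u (N i)) i‖ * 2 ^ Y) →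
    (∀ i, i ≠ k → ‖latVec inp u (N i)‖ ≤ n * s) →
    ‖latVec inp u (N k)‖ ≤ n * s * 2 ^ ((Y + n + 1) * (n - j)) →
    (∀ l, l < k → j ≤ l → |gsCoeff (fun i => latVec inp u (N i)) k l| ≤ 1 / 2) →
    Runs (sizeReduce inp u k j hj N) (j * c Y) fun N' => (∀ i, i ≠ k → N' i = N i) ∧
      LinearIndependent ℝ (fun i => latVec inp u (N' i)) ∧
      InnerProductSpace.gramSchmidt ℝ (fun i => latVec inp u (N' i)) =
        InnerProductSpace.gramSchmidt ℝ (fun i => latVec inp u (N i)) ∧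
      Submodule.span ℤ (Set.range N') = Submodule.span ℤ (Set.range N) ∧
      ∀ l, l < k → |gsCoeff (fun i => latVec inp u (N' i)) k l| ≤ 1 / 2 := by
  let W : ℕ → ℕ := fun Y => Y + n + (Y + n + 1) * n
  let c : ℕ → ℕ := fun Y => n * (n * (n * (2 * W Y + 10) + 3) + 1) + (gsTime n n +
    ((18 * n + 1) + (W Y + Y + 1 + 2 + (n * ((W Y + Y + 1 + 2) * (W Y + 2) +
      (W Y + 2 + (2 * W Y + Y + 1 + 2)) + 1)))))
  refine ⟨c, by simp only [c, W]; fun_prop, fun Y inp u s κ k hwf hs hκ0 hκ hκs j => ?_⟩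
  induction j with
  | zero =>
    intro hj N _ hli _ _ _ hcoef
    exact (Runs.pure ⟨fun _ _ => rfl, hli, rfl, rfl, fun l hl => hcoef l hl (Nat.zero_le _)⟩).le
      (Nat.zero_le _)
  | succ j ih =>
    intro hj N hjk hli hgs hrow hrowk hcoef
    set b : Fin n → EuclideanSpace ℝ (Fin inp.r × Fin 2) := fun i => latVec inp u (N i) with hb
    let jj : Fin n := ⟨j, hj⟩
    have hjjk : jj < k := by rw [Fin.lt_def]; exact hjk
    have hn1 : (1 : ℝ) ≤ n := by exact_mod_cast (Nat.zero_le _).trans_lt k.isLt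
    have hWle : Y + n + (Y + n + 1) * (n - (j + 1)) ≤ W Y :=
      Nat.add_le_add_left (Nat.mul_le_mul_left _ (by omega)) _
    have hrow' : ∀ i, ‖latVec inp u (N i)‖ ≤ n * s * 2 ^ ((Y + n + 1) * (n - (j + 1))) := by
      intro i
      by_cases hi : i = k
      · rw [hi]; exact hrowk
      · exact (hrow i hi).trans (le_mul_of_one_le_right (by positivity) (one_le_pow₀ (by norm_num)))
    have hent : ∀ i l, |N i l| ≤ 2 ^ W Y := fun i l =>
      abs_le_two_pow_mono (abs_entry_le hκ hκ0 hκs (hrow' i) l) hWle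
    rw [sizeReduce]
    refine Runs.le (T := n * (n * (n * (2 * W Y + 10) + 3) + 1) + (gsTime n n +
      ((18 * n + 1) + (W Y + Y + 1 + 2 + (n * ((W Y + Y + 1 + 2) * (W Y + 2) +
      (W Y + 2 + (2 * W Y + Y + 1 + 2)) + 1) + j * c Y))))) ?_ (by
        rw [add_mul (j : ℕ), one_mul]; simp only [c]; omega)
    refine (realBasis_runs hwf u hent).bind_eq ?_
    refine (gramSchmidt_runs hwf le_rfl _).bind fun bs hbs => ?_
    refine (projCoeff_runs hwf _ _).bind_eq ?_
    have hμ : (inner ℝ (toE inp.deg (vecOf inp u (N k))) (toE inp.deg (bs ⟨j, hj⟩)) /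
        inner ℝ (toE inp.deg (bs ⟨j, hj⟩)) (toE inp.deg (bs ⟨j, hj⟩)) : ℝ) = gsCoeff b k jj := by
      rw [hbs]; rfl
    rw [hμ]
    set q : ℤ := round (gsCoeff b k jj) with hq
    have hround : |gsCoeff b k jj - q| ≤ 1 / 2 := abs_sub_round _
    have hgpos := gs_norm_pos hli jj
    have hqle : |(q : ℝ)| ≤ n * 2 ^ ((Y + n + 1) * (n - (j + 1))) * 2 ^ Y + 1 := by
      have h1 : |(q : ℝ)| ≤ |gsCoeff b k jj| + 1 / 2 := by
        have := abs_sub_abs_le_abs_sub (q : ℝ) (gsCoeff b k jj)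
        rw [abs_sub_comm] at this
        linarith
      have h2 : |gsCoeff b k jj| ≤ n * 2 ^ ((Y + n + 1) * (n - (j + 1))) * 2 ^ Y := by
        refine (abs_gsCoeff_le hli k jj).trans ?_
        rw [div_le_iff₀ hgpos]
        calc ‖b k‖ ≤ n * s * 2 ^ ((Y + n + 1) * (n - (j + 1))) := hrow' k
          _ ≤ n * (‖InnerProductSpace.gramSchmidt ℝ b jj‖ * 2 ^ Y) *
              2 ^ ((Y + n + 1) * (n - (j + 1))) := by gcongr; exact hgs jj
          _ = _ := by ring
      linarith
    have hqZ : |q| ≤ 2 ^ (W Y + Y + 1) := by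
      have h3 : |(q : ℝ)| ≤ 2 ^ (W Y + Y + 1) := by
        refine hqle.trans ?_
        have h4 : (n : ℝ) * 2 ^ ((Y + n + 1) * (n - (j + 1))) * 2 ^ Y ≤ 2 ^ (W Y + Y) := by
          calc (n : ℝ) * 2 ^ ((Y + n + 1) * (n - (j + 1))) * 2 ^ Y
              ≤ 2 ^ n * 2 ^ ((Y + n + 1) * (n - (j + 1))) * 2 ^ Y := by
                gcongr; exact_mod_cast n.lt_two_pow_self.le
            _ = 2 ^ (n + (Y + n + 1) * (n - (j + 1)) + Y) := by rw [pow_add, pow_add]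
            _ ≤ _ := pow_le_pow_right₀ (by norm_num) (by omega)
        have h5 : (1 : ℝ) ≤ 2 ^ (W Y + Y) := one_le_pow₀ (by norm_num)
        rw [pow_succ]; linarith
      exact_mod_cast h3
    refine Runs.bind_eq (Runs.le (Runs.prim rfl) (bits_le hqZ)) ?_
    refine Runs.bind_eq (Runs.tab_eq (g := fun i => N k i - q * N jj i) fun i => Runs.bind_eq
      (Runs.le (Runs.prim rfl) (Nat.mul_le_mul (bits_le hqZ) (bits_le (hent _ i))))
      (Runs.le (Runs.prim rfl) (Nat.add_le_add (bits_le (hent k i)) (bits_le (X := 2 * W Y + Y + 1) ?_)))) ?_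
    · have := abs_mul_le_two_pow hqZ (hent jj i)
      rwa [show W Y + Y + 1 + W Y = 2 * W Y + Y + 1 by ring] at this
    set N' := Function.update N k (fun i => N k i - q * N jj i) with hN'
    have hupd : (fun i => latVec inp u (N' i)) = Function.update b k (b k - (q : ℝ) • b jj) :=
      latVec_update inp u N jj k q
    have hgs' : InnerProductSpace.gramSchmidt ℝ (fun i => latVec inp u (N' i)) =
        InnerProductSpace.gramSchmidt ℝ b := by rw [hupd]; exact gs_update hjjk _
    have hli' : LinearIndependent ℝ (fun i => latVec inp u (N' i)) := by
      refine linearIndependent_of_span_eq hli ?_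
      rw [hupd]; exact span_range_update b hjjk.ne _
    have hspan' : Submodule.span ℤ (Set.range N') = Submodule.span ℤ (Set.range N) := by
      have : N' = Function.update N k (N k - q • N jj) := by
        rw [hN']; congr 1
      rw [this]; exact span_range_update N hjjk.ne q
    have hne : ∀ i, i ≠ k → N' i = N i := fun i hi => Function.update_of_ne hi _ _
    refine (ih (by omega) N' (by omega) hli' (by rw [hgs']; exact hgs)
      (fun i hi => by rw [hne i hi]; exact hrow i hi) ?_ ?_).imp ?_
    · have h1 : latVec inp u (N' k) = b k - (q : ℝ) • b jj := by
        have := congrFun hupd k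
        rwa [Function.update_self] at this
      rw [h1]
      have h2 : ‖b jj‖ ≤ n * s := hrow jj hjjk.ne
      have h3 : n - j = (n - (j + 1)) + 1 := by omega
      set τ : ℝ := 2 ^ ((Y + n + 1) * (n - (j + 1))) with hτ
      have hτ1 : 1 ≤ τ := one_le_pow₀ (by norm_num)
      have h4 : (2 : ℝ) ^ ((Y + n + 1) * (n - j)) = τ * 2 ^ (Y + n + 1) := by
        rw [h3, mul_add, mul_one, pow_add]
      rw [h4]
      have h2Y : (1 : ℝ) ≤ 2 ^ Y := one_le_pow₀ (by norm_num)
      have h2n : (n : ℝ) + 1 ≤ 2 ^ n := by exact_mod_cast n.lt_two_pow_self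
      calc ‖b k - (q : ℝ) • b jj‖ ≤ ‖b k‖ + |(q : ℝ)| * ‖b jj‖ := by
            refine (norm_sub_le _ _).trans ?_
            rw [norm_smul, Real.norm_eq_abs]
        _ ≤ n * s * τ + (n * τ * 2 ^ Y + 1) * (n * s) := by
            gcongr
        _ = n * s * (τ + (n * τ * 2 ^ Y + 1)) := by ring
        _ ≤ n * s * (τ * 2 ^ Y + (n * τ * 2 ^ Y + τ * 2 ^ Y)) := by
            gcongr
            · exact le_mul_of_one_le_right (by linarith) h2Y
            · nlinarith
        _ = n * s * (τ * (2 ^ Y * (n + 2))) := by ring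
        _ ≤ n * s * (τ * (2 ^ Y * (2 ^ n * 2))) := by gcongr; linarith
        _ = n * s * (τ * 2 ^ (Y + n + 1)) := by rw [pow_succ, pow_add]; ring
    · intro l hl hjl
      rw [hupd, gsCoeff_update hjjk]
      rcases eq_or_lt_of_le hjl with h | h
      · have : l = jj := Fin.ext h.symm
        rw [this, gsCoeff_self hli, mul_one]; exact hround
      · rw [gsCoeff_of_lt b (show jj < l from h), mul_zero, sub_zero]
        exact hcoef l hl h
    · rintro N'' ⟨g1, g2, g3, g4, g5⟩
      exact ⟨fun i hi => (g1 i hi).trans (hne i hi), g2, g3.trans hgs', g4.trans hspan', g5⟩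

theorem floor_potential_swap {x y : ℝ} (hx : 0 ≤ x) (h : x + Real.log (4 / 3) ≤ y) :
    ⌊x / Real.log (4 / 3)⌋₊ + 1 ≤ ⌊y / Real.log (4 / 3)⌋₊ := by
  have hl : 0 < Real.log (4 / 3) := Real.log_pos (by norm_num)
  rw [← Nat.floor_add_one (by positivity)]
  refine Nat.floor_le_floor ?_
  rw [le_div_iff₀ hl, add_mul, div_mul_cancel₀ _ hl.ne', one_mul]
  exact h

/-- The LLL algorithm, for a lattice whose basis vectors have norm at most `s` and whose determinant
is not too small compared to `s`. The constant `κ` controls coordinates by norms. -/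
theorem lll_runs (n : ℕ) : ∃ c, PolyBdd c ∧ ∀ (Y : ℕ) (inp : Input n) (u : Fin inp.r → ℝ)
    (s κ : ℝ) (N₀ : Fin n → Fin n → ℤ), inp.Wf → 0 < s → 0 ≤ κ →
    (∀ (x : Fin n → ℤ) i, |(x i : ℝ)| ≤ κ * ‖latVec inp u x‖) → κ * s ≤ 2 ^ Y →
    LinearIndependent ℝ (fun i => latVec inp u (N₀ i)) →
    (∀ i, ‖latVec inp u (N₀ i)‖ ≤ s) →
    (s ^ 2) ^ n ≤ (Matrix.gram ℝ (fun i => latVec inp u (N₀ i))).det * 4 ^ Y →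
    Runs (lll inp u N₀) (c Y) fun N =>
      LinearIndependent ℝ (fun i => latVec inp u (N i)) ∧
      LLLReduced (fun i => latVec inp u (N i)) ∧
      Submodule.span ℤ (Set.range N) = Submodule.span ℤ (Set.range N₀) ∧
      ∀ i j, |N i j| ≤ 2 ^ (Y + n) := by
  obtain ⟨c, hc, H⟩ := sizeReduce_runs n
  let R : ℕ → ℕ := fun Y => n * (n * (n * (2 * (Y + n) + 10) + 3) + 1)
  let T : ℕ → ℕ := fun Y => n * c Y + (R Y + (gsTime n n + (9 * n + (9 * n + ((18 * n + 1) + 20)))))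
  refine ⟨fun Y => (n + 2 * (5 * n * n * Y) + 1) * (T Y + 1), by simp only [T, R]; fun_prop,
    fun Y inp u s κ N₀ hwf hs hκ0 hκ hκs hli₀ hs₀ hdet => ?_⟩
  set d := (Matrix.gram ℝ (fun i => latVec inp u (N₀ i))).det with hd
  -- all Gram-Schmidt vectors stay below `s` and the determinant is constant, so that `a` is a lower
  -- bound for their squared norms throughout; it makes the potential nonnegative
  let a : ℝ := s ^ 2 / 4 ^ Y
  have ha : 0 < a := by positivity
  have hlower : ∀ N : Fin n → Fin n → ℤ, LinearIndependent ℝ (fun i => latVec inp u (N i)) →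
      (Matrix.gram ℝ (fun i => latVec inp u (N i))).det = d →
      (∀ i, ‖InnerProductSpace.gramSchmidt ℝ (fun i => latVec inp u (N i)) i‖ ≤ s) →
      ∀ i, s ^ 2 ≤ ‖InnerProductSpace.gramSchmidt ℝ (fun i => latVec inp u (N i)) i‖ ^ 2 * 4 ^ Y := by
    intro N hli hdN hgs i
    have h1 := gs_norm_sq_ge hli hgs i
    rw [hdN] at h1
    have hn : n = (n - 1) + 1 := by have := i.isLt; omega
    have h2 : (s ^ 2) ^ (n - 1) * s ^ 2 ≤ (s ^ 2) ^ (n - 1) *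
        (‖InnerProductSpace.gramSchmidt ℝ (fun i => latVec inp u (N i)) i‖ ^ 2 * 4 ^ Y) := by
      calc (s ^ 2) ^ (n - 1) * s ^ 2 = (s ^ 2) ^ n := by rw [← pow_succ, ← hn]
        _ ≤ d * 4 ^ Y := hdet
        _ ≤ (‖InnerProductSpace.gramSchmidt ℝ (fun i => latVec inp u (N i)) i‖ ^ 2 *
            (s ^ 2) ^ (n - 1)) * 4 ^ Y := by gcongr
        _ = _ := by ring
    exact le_of_mul_le_mul_left h2 (by positivity)
  let pot : (Fin n → Fin n → ℤ) → ℕ := fun N =>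
    ⌊lllPotential (fun i => latVec inp u (N i)) a / Real.log (4 / 3)⌋₊
  let I : (Fin n → Fin n → ℤ) × ℕ → Prop := fun st =>
    1 ≤ st.2 ∧ LinearIndependent ℝ (fun i => latVec inp u (st.1 i)) ∧
    (Matrix.gram ℝ (fun i => latVec inp u (st.1 i))).det = d ∧
    (∀ i, ‖InnerProductSpace.gramSchmidt ℝ (fun i => latVec inp u (st.1 i)) i‖ ≤ s) ∧
    (∀ i, ‖latVec inp u (st.1 i)‖ ≤ n * s) ∧
    Submodule.span ℤ (Set.range st.1) = Submodule.span ℤ (Set.range N₀) ∧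
    (∀ i j, i.val < st.2 → j < i → |gsCoeff (fun i => latVec inp u (st.1 i)) i j| ≤ 1 / 2) ∧
    ∀ i j : Fin n, i.val < st.2 → j.val + 1 = i.val →
      (3 / 4 - gsCoeff (fun i => latVec inp u (st.1 i)) i j ^ 2) *
        ‖InnerProductSpace.gramSchmidt ℝ (fun i => latVec inp u (st.1 i)) j‖ ^ 2 ≤
        ‖InnerProductSpace.gramSchmidt ℝ (fun i => latVec inp u (st.1 i)) i‖ ^ 2
  have hent : ∀ N : Fin n → Fin n → ℤ, (∀ i, ‖latVec inp u (N i)‖ ≤ n * s) →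
      ∀ i j, |N i j| ≤ 2 ^ (Y + n) := fun N hN i j => by
    have := abs_entry_le (Z := 0) hκ hκ0 hκs (by simpa using hN i) j
    simpa using this
  -- an exchange moves the index back by at most one and lowers `pot` by at least one
  refine Runs.le (Runs.repeatUntil (c := T Y) I (fun st => (n - st.2) + 2 * pot st.1) ?_ (N₀, 1) ?_) ?_
  · rintro ⟨N, k⟩ ⟨hk1, hli, hdN, hgs, hrow, hspan, hsize, hlov⟩
    simp only at hk1 hli hdN hgs hrow hspan hsize hlov ⊢
    by_cases hk : k < n
    swap
    · rw [dif_neg hk]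
      refine (Runs.pure ?_).le (Nat.zero_le _)
      refine ⟨hli, ⟨fun i j => hsize i j (by omega), fun i j => hlov i j (by omega)⟩, hspan, hent N hrow⟩
    rw [dif_pos hk]
    let kk : Fin n := ⟨k, hk⟩
    let kk' : Fin n := ⟨k - 1, lt_of_le_of_lt (Nat.sub_le _ _) hk⟩
    have hkk : kk'.val + 1 = kk.val := Nat.sub_add_cancel hk1
    have hn1 : (1 : ℝ) ≤ n := by exact_mod_cast (Nat.zero_le _).trans_lt hk
    have hlow := hlower N hli hdN hgs
    refine Runs.bind ((H Y inp u s κ kk hwf hs hκ0 hκ hκs k hk.le N le_rfl hli (fun i => ?_)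
      (fun i _ => hrow i) ((hrow kk).trans (le_mul_of_one_le_right (by positivity)
        (one_le_pow₀ (by norm_num)))) (fun l hl hl' => absurd hl (not_lt.mpr hl'))).le
        (Nat.mul_le_mul_right _ hk.le)) ?_
    · refine le_of_sq_le_sq ((hlow i).trans_eq ?_) (by positivity)
      rw [mul_pow, ← pow_mul, mul_comm Y 2, pow_mul]; norm_num
    rintro M ⟨hMne, hMli, hMgs, hMspan, hMsize⟩
    have hMco : ∀ i j, i ≠ kk → gsCoeff (fun i => latVec inp u (M i)) i j =
        gsCoeff (fun i => latVec inp u (N i)) i j := by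
      intro i j hi
      rw [gsCoeff, gsCoeff, hMgs, hMne i hi]
    have hMgs' : ∀ i, ‖InnerProductSpace.gramSchmidt ℝ (fun i => latVec inp u (M i)) i‖ ≤ s := by
      rw [hMgs]; exact hgs
    have hMd : (Matrix.gram ℝ (fun i => latVec inp u (M i))).det = d := by
      rw [← hdN, det_gram_eq hMli, det_gram_eq hli, hMgs]
    have hMrow : ∀ i, ‖latVec inp u (M i)‖ ≤ n * s := by
      intro i
      by_cases hi : i = kk
      · subst hi
        exact norm_le_of_size hMli hMgs' hMsize
      · rw [hMne i hi]; exact hrow i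
    have hMpot : lllPotential (fun i => latVec inp u (M i)) a =
        lllPotential (fun i => latVec inp u (N i)) a := by
      rw [lllPotential, lllPotential, hMgs]
    refine (realBasis_runs hwf u (hent M hMrow)).bind_eq ?_
    refine (gramSchmidt_runs hwf le_rfl _).bind fun bs hbs => ?_
    replace hbs : ∀ j, toE inp.deg (bs j) =
      InnerProductSpace.gramSchmidt ℝ (fun i => latVec inp u (M i)) j := hbs
    refine (innerProd_runs hwf _ _).bind_eq ?_
    refine (innerProd_runs hwf _ _).bind_eq ?_
    refine (projCoeff_runs hwf _ _).bind_eq ?_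
    rw [hbs, hbs, real_inner_self_eq_norm_sq, real_inner_self_eq_norm_sq]
    have hco : (inner ℝ (toE inp.deg (vecOf inp u (M kk)))
        (InnerProductSpace.gramSchmidt ℝ (fun i => latVec inp u (M i)) kk') /
        ‖InnerProductSpace.gramSchmidt ℝ (fun i => latVec inp u (M i)) kk'‖ ^ 2 : ℝ) =
        gsCoeff (fun i => latVec inp u (M i)) kk kk' := by
      rw [gsCoeff, real_inner_self_eq_norm_sq]; rfl
    rw [hco]
    have h3 : bits 3 ≤ 4 := bits_le (X := 2) (by norm_num)
    have h4 : bits 4 ≤ 4 := bits_le (X := 2) (by norm_num)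
    refine Runs.le (Runs.prim_bind (Runs.prim_bind (Runs.prim_bind (Runs.prim_bind (Runs.prim_bind
      (Runs.prim_bind (Runs.prim_bind (T := 0) ?_))))))) (by omega)
    push_cast
    by_cases hlt : ‖InnerProductSpace.gramSchmidt ℝ (fun i => latVec inp u (M i)) kk‖ ^ 2 <
        (3 / 4 - gsCoeff (fun i => latVec inp u (M i)) kk kk' *
          gsCoeff (fun i => latVec inp u (M i)) kk kk') *
        ‖InnerProductSpace.gramSchmidt ℝ (fun i => latVec inp u (M i)) kk'‖ ^ 2
    · rw [if_pos (decide_eq_true hlt)]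
      refine Runs.pure ?_
      rw [← sq] at hlt
      obtain ⟨g1, g2⟩ := norm_gs_swap_le hMli hkk hMgs' hlt
      set M' : Fin n → Fin n → ℤ := fun i => M (Equiv.swap kk kk' i) with hM'
      have hcomp : (fun i => latVec inp u (M' i)) =
          (fun i => latVec inp u (M i)) ∘ Equiv.swap kk kk' := rfl
      have hli' : LinearIndependent ℝ (fun i => latVec inp u (M' i)) :=
        hMli.comp _ (Equiv.swap kk kk').injective
      have hd' : (Matrix.gram ℝ (fun i => latVec inp u (M' i))).det = d := by
        rw [hcomp, det_gram_comp_equiv, hMd]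
      have hgsne : ∀ i, i ≠ kk → i ≠ kk' →
          InnerProductSpace.gramSchmidt ℝ (fun i => latVec inp u (M' i)) i =
          InnerProductSpace.gramSchmidt ℝ (fun i => latVec inp u (N i)) i := by
        intro i hi hi'
        rw [hcomp, gs_swap_of_ne _ hkk hi hi', hMgs]
      have hM'ne : ∀ i, i ≠ kk → i ≠ kk' → M' i = N i := fun i hi hi' => by
        rw [hM']; simp only [Equiv.swap_apply_of_ne_of_ne hi hi']; exact hMne i hi
      have hlt' : ∀ i : Fin n, i.val < max (k - 1) 1 → ∀ j : Fin n, j < i →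
          (i ≠ kk ∧ i ≠ kk') ∧ (j ≠ kk ∧ j ≠ kk') := by
        intro i hi j hji
        have : j.val < i.val := hji
        have e1 : kk.val = k := rfl
        have e2 : kk'.val = k - 1 := rfl
        refine ⟨⟨?_, ?_⟩, ⟨?_, ?_⟩⟩ <;> intro h <;> rw [Fin.ext_iff] at h <;> omega
      have hco' : ∀ i : Fin n, i.val < max (k - 1) 1 → ∀ j : Fin n, j < i →
          gsCoeff (fun i => latVec inp u (M' i)) i j = gsCoeff (fun i => latVec inp u (N i)) i j := by
        intro i hi j hji
        obtain ⟨⟨e1, e2⟩, ⟨e3, e4⟩⟩ := hlt' i hi j hji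
        rw [gsCoeff, gsCoeff, hgsne j e3 e4, hM'ne i e1 e2]
      have hkmax : ∀ i : Fin n, ∀ j : Fin n, j < i → i.val < max (k - 1) 1 → i.val < k := by
        intro i j hji hi
        have : j.val < i.val := hji
        omega
      refine ⟨⟨le_max_right _ _, hli', hd', g2, fun i => hMrow _, ?_, ?_, ?_⟩, ?_⟩
      · rw [← hspan, ← hMspan]
        congr 1
        exact (Equiv.swap kk kk').surjective.range_comp M
      · intro i j hi hji
        rw [hco' i hi j hji]
        exact hsize i j (hkmax i j hji hi) hji
      · intro i j hi hji
        have hji' : j < i := by rw [Fin.lt_def]; omega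
        obtain ⟨⟨e1, e2⟩, ⟨e3, e4⟩⟩ := hlt' i hi j hji'
        rw [hco' i hi j hji', hgsne i e1 e2, hgsne j e3 e4]
        exact hlov i j (hkmax i j hji' hi) hji
      · have h5 : 0 ≤ lllPotential (fun i => latVec inp u (M' i)) a := by
          refine lllPotential_nonneg ha fun i => ?_
          rw [div_le_iff₀ (by positivity)]
          exact hlower M' hli' hd' g2 i
        have h6 := floor_potential_swap h5 ((lllPotential_swap hMli hkk ha g1).trans_eq hMpot)
        simp only [pot]
        omega
    · rw [if_neg (by simpa using hlt)]
      refine Runs.pure ?_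
      rw [← sq] at hlt
      refine ⟨⟨by omega, hMli, hMd, hMgs', hMrow, hMspan.trans hspan, ?_, ?_⟩, ?_⟩
      · intro i j hi hji
        rcases Nat.lt_succ_iff_lt_or_eq.mp hi with h | h
        · rw [hMco i j (fun h' => by rw [h'] at h; exact lt_irrefl _ h)]
          exact hsize i j h hji
        · have : i = kk := Fin.ext h
          subst this
          exact hMsize j hji
      · intro i j hi hji
        rcases Nat.lt_succ_iff_lt_or_eq.mp hi with h | h
        · rw [hMco i j (fun h' => by rw [h'] at h; exact lt_irrefl _ h), hMgs]
          exact hlov i j h hji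
        · have e1 : i = kk := Fin.ext h
          have e2 : j = kk' := Fin.ext (show j.val = k - 1 by have h' : i.val = k := h; omega)
          rw [e1, e2]
          exact not_lt.mp hlt
      · simp only [pot, hMpot]
        omega
  · refine ⟨le_rfl, hli₀, rfl, fun i => (gs_norm_le _ i).trans (hs₀ i), fun i => (hs₀ i).trans ?_,
      rfl, fun i j hi hji => ?_, fun i j hi hji => ?_⟩
    · have hn1 : (1 : ℝ) ≤ n := by exact_mod_cast (Nat.zero_le _).trans_lt i.isLt
      nlinarith
    · have : j.val < i.val := hji
      simp only at hi; omega
    · simp only at hi; omega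
  · refine Nat.mul_le_mul_right _ ?_
    have hgs₀ : ∀ i, ‖InnerProductSpace.gramSchmidt ℝ (fun i => latVec inp u (N₀ i)) i‖ ≤ s :=
      fun i => (gs_norm_le _ i).trans (hs₀ i)
    have hl : 0 < Real.log (4 / 3) := Real.log_pos (by norm_num)
    have h1 : lllPotential (fun i => latVec inp u (N₀ i)) a ≤ n * (n * Real.log (4 ^ Y)) := by
      refine lllPotential_le ha (fun i => ?_) fun i => ?_
      · rw [div_le_iff₀ (by positivity)]
        exact hlower N₀ hli₀ rfl hgs₀ i
      · simp only [a]
        rw [div_mul_cancel₀ _ (by positivity)]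
        exact pow_le_pow_left₀ (norm_nonneg _) (hgs₀ i) 2
    have h2 : Real.log 4 ≤ 5 * Real.log (4 / 3) := by
      have : Real.log 4 ≤ Real.log ((4 / 3) ^ 5) := Real.log_le_log (by norm_num) (by norm_num)
      rwa [Real.log_pow] at this
    have h3 : pot N₀ ≤ 5 * n * n * Y := by
      refine Nat.floor_le_of_le ?_
      rw [div_le_iff₀ hl]
      refine h1.trans ?_
      rw [Real.log_pow]
      push_cast
      calc (n : ℝ) * (n * (Y * Real.log 4)) ≤ n * (n * (Y * (5 * Real.log (4 / 3)))) := by gcongr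
        _ = _ := by ring
    simp only
    omega

end ArakelovAlg

namespace ArakelovAlg

set_option linter.unusedSectionVars false

open GramSchmidtLLL NumberField

variable {n r : ℕ} {F : Type*} [Field F] [NumberField F]

/-! ### The geometry of the number field -/

theorem sum_embeddings_eq (g : InfinitePlace F → ℝ) (x y : F) :
    ∑ φ : F →+* ℂ, (g (InfinitePlace.mk φ) : ℂ) * (φ x * star (φ y)) =
      ((∑ w : InfinitePlace F, (w.mult : ℝ) *
        (g w * (w.embedding x * star (w.embedding y)).re) : ℝ) : ℂ) := by
  classical
  rw [← Finset.sum_fiberwise_of_maps_to (s := Finset.univ) (t := Finset.univ)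
    (g := fun φ : F →+* ℂ => InfinitePlace.mk φ) (fun _ _ => Finset.mem_univ _), Complex.ofReal_sum]
  refine Finset.sum_congr rfl fun w _ => ?_
  have hset : (Finset.univ.filter fun φ : F →+* ℂ => InfinitePlace.mk φ = w) =
      {w.embedding, ComplexEmbedding.conjugate w.embedding} := by
    ext φ
    simp only [Finset.mem_filter, Finset.mem_univ, true_and, Finset.mem_insert,
      Finset.mem_singleton]
    conv_lhs => rw [← InfinitePlace.mk_embedding w, eq_comm, InfinitePlace.mk_eq_iff]
    rw [eq_comm, @eq_comm _ φ (ComplexEmbedding.conjugate _)]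
  have hconj : ∀ z, ComplexEmbedding.conjugate w.embedding z = star (w.embedding z) := fun z => rfl
  rw [hset]
  by_cases hw : w.IsReal
  · rw [InfinitePlace.conjugate_embedding_eq_of_isReal hw, Finset.pair_eq_singleton,
      Finset.sum_singleton, InfinitePlace.mk_embedding, hw.mult_eq_one]
    have h1 : ∀ z, ((w.embedding z).re : ℂ) = w.embedding z := fun z => by
      rw [← InfinitePlace.embedding_of_isReal_apply hw, Complex.ofReal_re]
    rw [← h1 x, ← h1 y]
    simp
  · rw [Finset.sum_pair, InfinitePlace.mk_conjugate_eq, InfinitePlace.mk_embedding, hconj, hconj,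
      InfinitePlace.mult, if_neg hw]
    · apply Complex.ext
      · simp; ring
      · simp; ring
    · intro h
      exact hw (InfinitePlace.isReal_iff.mpr (ComplexEmbedding.isReal_iff.mpr h.symm))

/-- The image of `u x` in `F_ℝ`. -/
noncomputable def fVec (p : Fin r ≃ InfinitePlace F) (u : Fin r → ℝ) :
    F →+ EuclideanSpace ℝ (Fin r × Fin 2) where
  toFun x := toE (fun σ => ((p σ).mult : ℤ))
    (fun σ => (u σ * ((p σ).embedding x).re, u σ * ((p σ).embedding x).im))
  map_zero' := by
    rw [← map_zero (toE fun σ => ((p σ).mult : ℤ))]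
    congr 1
    ext σ <;> simp
  map_add' x y := by
    rw [← map_add]
    congr 1
    ext σ <;> simp [mul_add]

theorem fVec_apply (p : Fin r ≃ InfinitePlace F) (u : Fin r → ℝ) (x : F) :
    fVec p u x = toE (fun σ => ((p σ).mult : ℤ))
      (fun σ => (u σ * ((p σ).embedding x).re, u σ * ((p σ).embedding x).im)) := rfl

theorem inner_fVec (p : Fin r ≃ InfinitePlace F) (u : Fin r → ℝ) (x y : F) :
    inner ℝ (fVec p u x) (fVec p u y) =
      ∑ σ, ((p σ).mult : ℝ) * (u σ ^ 2 * ((p σ).embedding x * star ((p σ).embedding y)).re) := by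
  rw [fVec_apply, fVec_apply, inner_toE fun σ => Int.natCast_nonneg _]
  refine Finset.sum_congr rfl fun σ _ => ?_
  simp only [Int.cast_natCast, RCLike.star_def, Complex.mul_re, Complex.conj_re, Complex.conj_im]
  ring

theorem norm_fVec_sq (p : Fin r ≃ InfinitePlace F) (u : Fin r → ℝ) (x : F) :
    ‖fVec p u x‖ ^ 2 = ∑ σ, ((p σ).mult : ℝ) * (u σ * p σ x) ^ 2 := by
  rw [← real_inner_self_eq_norm_sq, inner_fVec]
  refine Finset.sum_congr rfl fun σ _ => ?_
  rw [← InfinitePlace.norm_embedding_eq, mul_pow, RCLike.star_def, Complex.mul_conj,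
    Complex.ofReal_re, Complex.normSq_eq_norm_sq]

theorem mul_place_le_norm_fVec (p : Fin r ≃ InfinitePlace F) (u : Fin r → ℝ) (x : F) (σ : Fin r) : u σ * p σ x ≤ ‖fVec p u x‖ := by
  refine le_of_sq_le_sq ?_ (norm_nonneg _)
  rw [norm_fVec_sq]
  have h1 : (1 : ℝ) ≤ (p σ).mult := by exact_mod_cast (p σ).mult_pos
  calc (u σ * p σ x) ^ 2 ≤ ((p σ).mult : ℝ) * (u σ * p σ x) ^ 2 :=
        le_mul_of_one_le_left (sq_nonneg _) h1
    _ ≤ _ := Finset.single_le_sum (f := fun σ => ((p σ).mult : ℝ) * (u σ * p σ x) ^ 2)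
        (fun _ _ => by positivity) (Finset.mem_univ σ)

theorem norm_fVec_sq_le (p : Fin r ≃ InfinitePlace F) {u : Fin r → ℝ} (hu : ∀ σ, 0 < u σ)
    (x : F) {m : ℝ} (hm : ∀ σ, u σ * p σ x ≤ m) : ‖fVec p u x‖ ^ 2 ≤ Module.finrank ℚ F * m ^ 2 := by
  rw [norm_fVec_sq, ← InfinitePlace.sum_mult_eq, ← p.sum_comp, Nat.cast_sum, Finset.sum_mul]
  refine Finset.sum_le_sum fun σ _ => ?_
  have h0 : 0 ≤ u σ * p σ x := mul_nonneg (hu σ).le (apply_nonneg _ _)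
  gcongr
  exact hm σ

/-- The norm on `∏ σ, ℝ_{>0}`. -/
noncomputable def placeNorm (p : Fin r ≃ InfinitePlace F) (u : Fin r → ℝ) : ℝ :=
  ∏ σ, u σ ^ (p σ).mult

/-- The squared covolume of the lattice spanned by `u y₁, …, u yₙ`. -/
noncomputable def vol (p : Fin r ≃ InfinitePlace F) (u : Fin r → ℝ) (y : Fin n → F) : ℝ :=
  (Matrix.gram ℝ fun i => fVec p u (y i)).det

theorem vol_mul_left (p : Fin r ≃ InfinitePlace F) (u : Fin r → ℝ) (h : F) (y : Fin n → F) :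
    vol p u (fun i => h * y i) = vol p (fun σ => u σ * p σ h) y := by
  unfold vol
  congr 1
  ext i j
  simp only [Matrix.gram, Matrix.of_apply, inner_fVec]
  refine Finset.sum_congr rfl fun σ _ => ?_
  have h1 : (p σ).embedding (h * y i) * star ((p σ).embedding (h * y j)) =
      ((p σ h ^ 2 : ℝ) : ℂ) * ((p σ).embedding (y i) * star ((p σ).embedding (y j))) := by
    rw [map_mul, map_mul, star_mul', ← InfinitePlace.norm_embedding_eq, ← Complex.normSq_eq_norm_sq,
      ← Complex.mul_conj, RCLike.star_def]
    ring
  rw [h1, Complex.re_ofReal_mul]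
  ring

theorem vol_sum (p : Fin r ≃ InfinitePlace F) (u : Fin r → ℝ) (P : Fin n → Fin n → ℤ)
    (y : Fin n → F) : vol p u (fun j => ∑ i, (P j i : F) * y i) =
      ((Matrix.of P).det : ℝ) ^ 2 * vol p u y := by
  have h1 : ∀ j, fVec p u (∑ i, (P j i : F) * y i) = ∑ i, (P j i : ℝ) • fVec p u (y i) := by
    intro j
    rw [map_sum]
    refine Finset.sum_congr rfl fun i _ => ?_
    rw [← zsmul_eq_mul, map_zsmul, Int.cast_smul_eq_zsmul]
  have h2 : (Matrix.gram ℝ fun j => fVec p u (∑ i, (P j i : F) * y i)) =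
      (Matrix.of P).map (Int.cast : ℤ → ℝ) * (Matrix.gram ℝ fun i => fVec p u (y i)) *
        ((Matrix.of P).map (Int.cast : ℤ → ℝ)).transpose := by
    ext j k
    rw [Matrix.mul_apply]
    simp only [Matrix.gram, Matrix.of_apply, Matrix.mul_apply, Matrix.transpose_apply,
      Matrix.map_apply, h1, sum_inner, inner_sum, real_inner_smul_left, real_inner_smul_right,
      Finset.sum_mul]
    refine Finset.sum_congr rfl fun a _ => Finset.sum_congr rfl fun b _ => ?_
    ring
  have h3 : ((Matrix.of P).map (Int.cast : ℤ → ℝ)).det = ((Matrix.of P).det : ℝ) :=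
    (Int.cast_det (R := ℝ) (Matrix.of P)).symm
  rw [vol, h2, Matrix.det_mul, Matrix.det_mul, Matrix.det_transpose, h3, vol]
  ring

/-- The matrix of the complex embeddings of an integral basis. -/
noncomputable def embMatrix (ω : Module.Basis (Fin n) ℤ (𝓞 F)) (e : Fin n ≃ (F →+* ℂ)) :
    Matrix (Fin n) (Fin n) ℂ := Matrix.of fun i j => e j (ω i : F)

theorem norm_det_embMatrix_sq (ω : Module.Basis (Fin n) ℤ (𝓞 F)) (e : Fin n ≃ (F →+* ℂ)) :
    ‖(embMatrix ω e).det‖ ^ 2 = |(discr F : ℝ)| := by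
  have h1 := Algebra.discr_eq_det_embeddingsMatrixReindex_pow_two ℚ ℂ
    (ω.localizationLocalization ℚ (nonZeroDivisors ℤ) F) (e.trans (RingHom.equivRatAlgHom F ℂ))
  rw [Algebra.discr_localizationLocalization, discr_eq_discr] at h1
  have h2 : Algebra.embeddingsMatrixReindex ℚ ℂ (ω.localizationLocalization ℚ (nonZeroDivisors ℤ) F)
      (e.trans (RingHom.equivRatAlgHom F ℂ)) = embMatrix ω e := by
    ext i j
    simp [Algebra.embeddingsMatrixReindex, embMatrix, Algebra.embeddingsMatrix]
  rw [h2] at h1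
  rw [← norm_pow, ← h1]
  simp

theorem card_embeddings_equiv (ω : Module.Basis (Fin n) ℤ (𝓞 F)) : Nonempty (Fin n ≃ (F →+* ℂ)) := by
  refine ⟨Fintype.equivOfCardEq ?_⟩
  rw [Embeddings.card F ℂ, Fintype.card_fin, ← RingOfIntegers.rank, Module.finrank_eq_card_basis ω,
    Fintype.card_fin]

/-- The covolume of the ring of integers. The Gram matrix is `A * D * Aᴴ`, with `A` the matrix of the
complex embeddings and `D` the diagonal matrix of the `u σ ^ 2`: the weight of a place is the number
of embeddings above it. -/
theorem vol_basis (ω : Module.Basis (Fin n) ℤ (𝓞 F)) (p : Fin r ≃ InfinitePlace F) (u : Fin r → ℝ) :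
    vol p u (fun i => (ω i : F)) = |(discr F : ℝ)| * placeNorm p u ^ 2 := by
  obtain ⟨e⟩ := card_embeddings_equiv ω
  let g : InfinitePlace F → ℝ := fun w => u (p.symm w) ^ 2
  let D : Matrix (Fin n) (Fin n) ℂ := Matrix.diagonal fun j => (g (InfinitePlace.mk (e j)) : ℂ)
  have h1 : (Matrix.gram ℝ fun i => fVec p u (ω i : F)).map (algebraMap ℝ ℂ) =
      embMatrix ω e * D * (embMatrix ω e).conjTranspose := by
    ext i j
    simp only [Matrix.map_apply, Matrix.gram, Matrix.of_apply, inner_fVec]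
    rw [Matrix.mul_apply]
    simp only [D, Matrix.mul_diagonal, Matrix.conjTranspose_apply, embMatrix, Matrix.of_apply]
    have h2 := sum_embeddings_eq g (ω i : F) (ω j : F)
    rw [← e.sum_comp, ← p.sum_comp] at h2
    simp only [g, Equiv.symm_apply_apply] at h2
    rw [Complex.coe_algebraMap, ← h2]
    refine Finset.sum_congr rfl fun k _ => ?_
    simp only [g]
    ring
  have h3 : ∏ j, (g (InfinitePlace.mk (e j)) : ℂ) = ((placeNorm p u ^ 2 : ℝ) : ℂ) := by
    classical
    rw [← Complex.ofReal_prod, e.prod_comp (fun φ => g (InfinitePlace.mk φ)),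
      ← Finset.prod_fiberwise_of_maps_to (s := Finset.univ) (t := Finset.univ)
      (g := fun φ : F →+* ℂ => InfinitePlace.mk φ) (fun _ _ => Finset.mem_univ _), placeNorm,
      ← Finset.prod_pow, ← p.prod_comp]
    congr 1
    refine Finset.prod_congr rfl fun σ _ => ?_
    rw [Finset.prod_congr rfl (g := fun _ => u σ ^ 2), Finset.prod_const,
      InfinitePlace.card_filter_mk_eq, ← pow_mul, ← pow_mul, mul_comm]
    intro φ hφ
    rw [Finset.mem_filter] at hφ
    simp only [g, hφ.2, Equiv.symm_apply_apply]
  have h4 : ((vol p u (fun i => (ω i : F)) : ℝ) : ℂ) =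
      ((|(discr F : ℝ)| * placeNorm p u ^ 2 : ℝ) : ℂ) := by
    rw [vol, ← Complex.coe_algebraMap, RingHom.map_det, RingHom.mapMatrix_apply, h1,
      Matrix.det_mul, Matrix.det_mul, Matrix.det_conjTranspose, Matrix.det_diagonal, h3,
      ← norm_det_embMatrix_sq ω e, Complex.coe_algebraMap, Complex.ofReal_mul,
      ← Complex.normSq_eq_norm_sq, ← Complex.mul_conj, RCLike.star_def]
    ring
  exact_mod_cast h4

theorem one_le_abs_discr : (1 : ℝ) ≤ |(discr F : ℝ)| := by
  have := Int.one_le_abs (discr_ne_zero F)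
  exact_mod_cast this

/-- The element of `F` with given integral coordinates. -/
noncomputable def elt (ω : Module.Basis (Fin n) ℤ (𝓞 F)) : (Fin n → ℤ) →+ F where
  toFun x := ∑ i, (x i : F) * (ω i : F)
  map_zero' := by simp
  map_add' x y := by simp [add_mul, Finset.sum_add_distrib]

theorem elt_apply (ω : Module.Basis (Fin n) ℤ (𝓞 F)) (x : Fin n → ℤ) :
    elt ω x = ∑ i, (x i : F) * (ω i : F) := rfl

theorem elt_eq_coe (ω : Module.Basis (Fin n) ℤ (𝓞 F)) (x : Fin n → ℤ) :
    elt ω x = ((∑ i, x i • ω i : 𝓞 F) : F) := by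
  rw [elt_apply, RingOfIntegers.coe_eq_algebraMap, map_sum]
  exact Finset.sum_congr rfl fun i _ => by simp

theorem elt_injective (ω : Module.Basis (Fin n) ℤ (𝓞 F)) : Function.Injective (elt ω) := by
  intro x y h
  rw [elt_eq_coe, elt_eq_coe] at h
  have h1 := RingOfIntegers.coe_injective h
  have h2 := congrArg (fun z => (ω.repr z : Fin n → ℤ)) h1
  simp only [ω.repr_sum_self] at h2
  exact h2

/-- Coordinates in the integral basis are bounded by the absolute values, by Cramer's rule for the
matrix of embeddings, whose determinant is at least `1` in absolute value. -/
theorem abs_coord_le (ω : Module.Basis (Fin n) ℤ (𝓞 F)) {B m : ℝ} (hB : 1 ≤ B)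
    (hω : ∀ i (w : InfinitePlace F), w (ω i : F) ≤ B) {x : Fin n → ℤ}
    (hx : ∀ w : InfinitePlace F, w (elt ω x) ≤ m) (i : Fin n) :
    |(x i : ℝ)| ≤ n.factorial * B ^ n * m := by
  obtain ⟨e⟩ := card_embeddings_equiv ω
  set M := embMatrix ω e with hM
  have hdet : 1 ≤ ‖M.det‖ := by
    rw [← one_le_sq_iff₀ (norm_nonneg _), norm_det_embMatrix_sq]
    exact one_le_abs_discr
  have h1 : M.transpose.mulVec (fun i => (x i : ℂ)) = fun j => e j (elt ω x) := by
    ext j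
    rw [elt_apply, map_sum, Matrix.mulVec, dotProduct]
    refine Finset.sum_congr rfl fun i _ => ?_
    rw [map_mul, map_intCast, mul_comm]
    rfl
  have h2 : (M.transpose.updateCol i (fun j => e j (elt ω x))).det = M.det * x i := by
    rw [← Matrix.cramer_apply, ← h1, Matrix.cramer_eq_adjugate_mulVec, Matrix.mulVec_mulVec,
      Matrix.adjugate_mul, Matrix.det_transpose, Matrix.smul_mulVec, Matrix.one_mulVec]
    rfl
  have hφ : ∀ (φ : F →+* ℂ) (z : F), ‖φ z‖ = InfinitePlace.mk φ z := fun φ z => rfl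
  have hm : 0 ≤ m := (apply_nonneg _ _).trans (hx (InfinitePlace.mk (e i)))
  rcases hm.eq_or_lt with rfl | hm'
  · have hz : elt ω x = 0 := by
      have := (apply_nonneg _ _).antisymm' (hx (InfinitePlace.mk (e i)))
      exact (map_eq_zero _).mp this
    have : x = 0 := elt_injective ω (by rw [hz, map_zero])
    simp [this]
  have h3 : ‖(M.transpose.updateCol i (fun j => e j (elt ω x))).det‖ ≤ n.factorial * B ^ n * m := by
    have h4 : (fun j => e j (elt ω x)) = (m : ℂ) • fun j => (m : ℂ)⁻¹ * e j (elt ω x) := by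
      ext j
      have : (m : ℂ) ≠ 0 := by exact_mod_cast hm'.ne'
      simp [this]
    rw [h4, Matrix.det_updateCol_smul, norm_mul, Complex.norm_real, Real.norm_of_nonneg hm, mul_comm]
    refine mul_le_mul_of_nonneg_right ?_ hm
    let abv : AbsoluteValue ℂ ℝ := ⟨⟨fun z => ‖z‖, norm_mul⟩, norm_nonneg, fun _ => norm_eq_zero,
      norm_add_le⟩
    have h5 := Matrix.det_le (A := M.transpose.updateCol i fun j => (m : ℂ)⁻¹ * e j (elt ω x))
      (abv := abv) (x := B) (fun a b => ?_)
    · rw [Fintype.card_fin, nsmul_eq_mul] at h5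
      exact h5
    · rw [Matrix.updateCol_apply]
      split_ifs
      · change ‖(m : ℂ)⁻¹ * e a (elt ω x)‖ ≤ B
        rw [norm_mul, norm_inv, Complex.norm_real, Real.norm_of_nonneg hm, hφ]
        refine le_trans ?_ hB
        rw [inv_mul_le_one₀ hm']
        exact hx _
      · exact hω b (InfinitePlace.mk (e a))
  rw [h2, norm_mul, Complex.norm_intCast] at h3
  exact (le_mul_of_one_le_left (abs_nonneg _) hdet).trans h3

end ArakelovAlg

namespace ArakelovAlg

set_option linter.unusedSectionVars false

open GramSchmidtLLL NumberField

variable {n r : ℕ} {F : Type*} [Field F] [NumberField F]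

/-! ### Ideals given by bases -/

theorem finrank_of_basis (ω : Module.Basis (Fin n) ℤ (𝓞 F)) : Module.finrank ℚ F = n := by
  rw [← RingOfIntegers.rank, Module.finrank_eq_card_basis ω, Fintype.card_fin]

theorem placeNorm_pos (p : Fin r ≃ InfinitePlace F) {u : Fin r → ℝ} (hu : ∀ σ, 0 < u σ) :
    0 < placeNorm p u := Finset.prod_pos fun σ _ => pow_pos (hu σ) _

theorem placeNorm_mul (p : Fin r ≃ InfinitePlace F) (u v : Fin r → ℝ) :
    placeNorm p (fun σ => u σ * v σ) = placeNorm p u * placeNorm p v := by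
  simp only [placeNorm, mul_pow, Finset.prod_mul_distrib]

theorem placeNorm_const (ω : Module.Basis (Fin n) ℤ (𝓞 F)) (p : Fin r ≃ InfinitePlace F) (c : ℝ) :
    placeNorm p (fun _ => c) = c ^ n := by
  rw [placeNorm, Finset.prod_pow_eq_pow_sum, p.sum_comp, InfinitePlace.sum_mult_eq,
    finrank_of_basis ω]

theorem placeNorm_le (p : Fin r ≃ InfinitePlace F)
    {u v : Fin r → ℝ} (hu : ∀ σ, 0 ≤ u σ) (huv : ∀ σ, u σ ≤ v σ) : placeNorm p u ≤ placeNorm p v :=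
  Finset.prod_le_prod (fun σ _ => pow_nonneg (hu σ) _) fun σ _ => pow_le_pow_left₀ (hu σ) (huv σ) _

/-- The basis vectors of an ideal representation. -/
noncomputable def repVec (ω : Module.Basis (Fin n) ℤ (𝓞 F)) (J : IdealRep n) (j : Fin n) : F :=
  elt ω (J.num j) / (J.den : F)

/-- The norm of the ideal given by a basis. -/
noncomputable def IdealRep.nrm (J : IdealRep n) : ℝ := |((Matrix.of J.num).det : ℝ)| / (J.den : ℝ) ^ n

/-- `J` represents the additive subgroup `S` of `F`. -/
structure Rep (ω : Module.Basis (Fin n) ℤ (𝓞 F)) (J : IdealRep n) (S : Submodule ℤ F) : Prop where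
  den_pos : 0 < J.den
  det_ne : (Matrix.of J.num).det ≠ 0
  span_eq : Submodule.span ℤ (Set.range (repVec ω J)) = S

theorem Rep.nrm_pos {ω : Module.Basis (Fin n) ℤ (𝓞 F)} {J : IdealRep n} {S : Submodule ℤ F}
    (h : Rep ω J S) : 0 < J.nrm := by
  have h1 : (0 : ℝ) < J.den := by exact_mod_cast h.den_pos
  have h2 : ((Matrix.of J.num).det : ℝ) ≠ 0 := by exact_mod_cast h.det_ne
  exact div_pos (abs_pos.mpr h2) (by positivity)

theorem vol_repVec (ω : Module.Basis (Fin n) ℤ (𝓞 F)) (p : Fin r ≃ InfinitePlace F) (u : Fin r → ℝ)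
    (J : IdealRep n) (hJ : 0 < J.den) :
    vol p u (repVec ω J) = |(discr F : ℝ)| * (placeNorm p u * J.nrm) ^ 2 := by
  have h1 : repVec ω J = fun j => (J.den : F)⁻¹ * ∑ i, (J.num j i : F) * (ω i : F) := by
    ext j
    rw [repVec, elt_apply, div_eq_inv_mul]
  have hd : (0 : ℝ) < J.den := by exact_mod_cast hJ
  have h2 : ∀ σ, p σ (J.den : F)⁻¹ = (J.den : ℝ)⁻¹ := fun σ => by
    rw [map_inv₀, ← InfinitePlace.norm_embedding_eq, map_intCast, Complex.norm_intCast,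
      abs_of_pos hd]
  rw [h1, vol_mul_left, vol_sum p _ J.num, vol_basis]
  simp only [h2]
  rw [placeNorm_mul, placeNorm_const ω, IdealRep.nrm, mul_pow, mul_pow, div_pow, sq_abs,
    inv_pow]
  field_simp

theorem exists_int_matrix {y y' : Fin n → F}
    (h : Submodule.span ℤ (Set.range y') ≤ Submodule.span ℤ (Set.range y)) :
    ∃ P : Fin n → Fin n → ℤ, y' = fun j => ∑ i, (P j i : F) * y i := by
  have h1 : ∀ j, ∃ c : Fin n → ℤ, ∑ i, c i • y i = y' j := fun j =>
    Submodule.mem_span_range_iff_exists_fun ℤ |>.mp (h (Submodule.subset_span ⟨j, rfl⟩))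
  choose P hP using h1
  refine ⟨P, funext fun j => ?_⟩
  rw [← hP]
  simp [zsmul_eq_mul]

theorem vol_eq_of_span_eq (p : Fin r ≃ InfinitePlace F) (u : Fin r → ℝ) {y y' : Fin n → F}
    (h : Submodule.span ℤ (Set.range y') = Submodule.span ℤ (Set.range y)) :
    vol p u y' = vol p u y := by
  obtain ⟨P, hP⟩ := exists_int_matrix h.le
  obtain ⟨Q, hQ⟩ := exists_int_matrix h.ge
  have h1 : vol p u y' = ((Matrix.of P).det : ℝ) ^ 2 * vol p u y := by rw [hP, vol_sum]
  have h2 : vol p u y = ((Matrix.of Q).det : ℝ) ^ 2 * vol p u y' := by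
    conv_lhs => rw [hQ, vol_sum]
  by_cases h0 : vol p u y = 0
  · rw [h1, h0, mul_zero]
  have h3 : ((Matrix.of Q).det : ℝ) ^ 2 * ((Matrix.of P).det : ℝ) ^ 2 = 1 := by
    rw [h1, ← mul_assoc] at h2
    exact mul_right_cancel₀ h0 (by rw [one_mul]; exact h2.symm)
  have h4 : (Matrix.of Q).det ^ 2 * (Matrix.of P).det ^ 2 = 1 := by exact_mod_cast h3
  have h5 : (Matrix.of P).det ^ 2 = 1 := by
    have : IsUnit ((Matrix.of P).det ^ 2) := IsUnit.of_mul_eq_one_right _ h4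
    exact (Int.isUnit_iff.mp this).resolve_right fun h => by
      have := sq_nonneg (Matrix.of P).det
      omega
  have h6 : ((Matrix.of P).det : ℝ) ^ 2 = 1 := by exact_mod_cast h5
  rw [h1, h6, one_mul]

/-- The group `h S`. -/
noncomputable def scaleS (h : F) (S : Submodule ℤ F) : Submodule ℤ F := S.map (LinearMap.mulLeft ℤ h)

theorem scaleS_span (h : F) {ι : Type*} (y : ι → F) :
    scaleS h (Submodule.span ℤ (Set.range y)) =
      Submodule.span ℤ (Set.range fun i => h * y i) := by
  rw [scaleS, Submodule.map_span, ← Set.range_comp]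
  rfl

theorem mem_scaleS {h : F} (hh : h ≠ 0) {S : Submodule ℤ F} {x : F} :
    x ∈ scaleS h S ↔ h⁻¹ * x ∈ S := by
  rw [scaleS, Submodule.mem_map]
  constructor
  · rintro ⟨y, hy, rfl⟩
    rw [LinearMap.mulLeft_apply, inv_mul_cancel_left₀ hh]
    exact hy
  · intro hx
    exact ⟨_, hx, by rw [LinearMap.mulLeft_apply, mul_inv_cancel_left₀ hh]⟩

theorem scaleS_scaleS (g h : F) (S : Submodule ℤ F) : scaleS g (scaleS h S) = scaleS (g * h) S := by
  rw [scaleS, scaleS, scaleS, ← Submodule.map_comp, LinearMap.mulLeft_mul]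

theorem scaleS_one (S : Submodule ℤ F) : scaleS 1 S = S := by
  rw [scaleS, LinearMap.mulLeft_one, Submodule.map_id]

theorem nrm_scaleS {ω : Module.Basis (Fin n) ℤ (𝓞 F)} (p : Fin r ≃ InfinitePlace F)
    {J J' : IdealRep n} (hJ : 0 < J.den) (hJ' : 0 < J'.den) {h : F}
    (hspan : Submodule.span ℤ (Set.range (repVec ω J')) =
      scaleS h (Submodule.span ℤ (Set.range (repVec ω J)))) :
    J'.nrm = placeNorm p (fun σ => p σ h) * J.nrm := by
  rw [scaleS_span] at hspan
  have h1 := vol_eq_of_span_eq p (fun _ => 1) hspan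
  rw [vol_mul_left, vol_repVec ω p _ J' hJ', vol_repVec ω p _ J hJ, placeNorm_mul,
    placeNorm_const ω, one_pow, one_mul, one_mul] at h1
  have h2 : (0 : ℝ) < |(discr F : ℝ)| := zero_lt_one.trans_le one_le_abs_discr
  have h3 := mul_left_cancel₀ h2.ne' h1
  have h4 : ∀ {J : IdealRep n}, 0 < J.den → 0 ≤ J.nrm := fun {J} hJ => by
    have : (0 : ℝ) < J.den := by exact_mod_cast hJ
    exact div_nonneg (abs_nonneg _) (by positivity)
  exact (pow_left_inj₀ (h4 hJ') (mul_nonneg (Finset.prod_nonneg fun _ _ => by positivity)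
    (h4 hJ)) two_ne_zero).mp h3

theorem placeNorm_elt_pos (p : Fin r ≃ InfinitePlace F) {h : F} (hh : h ≠ 0) :
    0 < placeNorm p (fun σ => p σ h) := placeNorm_pos p fun _ => InfinitePlace.pos_iff.mpr hh

theorem Rep.of_span_eq {ω : Module.Basis (Fin n) ℤ (𝓞 F)} (p : Fin r ≃ InfinitePlace F)
    {J J' : IdealRep n} {S : Submodule ℤ F} (hJ : Rep ω J S) (hJ' : 0 < J'.den) {h : F} (hh : h ≠ 0)
    (hspan : Submodule.span ℤ (Set.range (repVec ω J')) = scaleS h S) : Rep ω J' (scaleS h S) := by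
  refine ⟨hJ', fun h0 => ?_, hspan⟩
  rw [← hJ.span_eq] at hspan
  have h1 := nrm_scaleS p hJ.den_pos hJ' hspan
  rw [IdealRep.nrm, h0, Int.cast_zero, abs_zero, zero_div] at h1
  exact (mul_pos (placeNorm_elt_pos p hh) hJ.nrm_pos).ne h1

theorem Rep.nrm_eq {ω : Module.Basis (Fin n) ℤ (𝓞 F)} (p : Fin r ≃ InfinitePlace F)
    {J J' : IdealRep n} {S : Submodule ℤ F} (hJ : Rep ω J S) {h : F} (hJ' : Rep ω J' (scaleS h S)) :
    J'.nrm = placeNorm p (fun σ => p σ h) * J.nrm :=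
  nrm_scaleS p hJ.den_pos hJ'.den_pos (by rw [hJ.span_eq, hJ'.span_eq])

/-- Stability under multiplication by integral elements. -/
def Stable (S : Submodule ℤ F) : Prop := ∀ (a : 𝓞 F) (x : F), x ∈ S → (a : F) * x ∈ S

theorem Stable.scaleS {S : Submodule ℤ F} (hS : Stable S) (h : F) : Stable (scaleS h S) := by
  rintro a _ ⟨x, hx, rfl⟩
  exact ⟨a * x, hS a x hx, by simp only [LinearMap.mulLeft_apply]; ring⟩

/-! ### The input of a number field -/

theorem fVec_div (p : Fin r ≃ InfinitePlace F) (u : Fin r → ℝ) {d : ℤ} (x : F) :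
    fVec p (fun σ => u σ / (d : ℝ)) x = fVec p u (x / (d : F)) := by
  rw [fVec_apply, fVec_apply]
  congr 1
  have h1 : ∀ σ, (p σ).embedding (x / (d : F)) = (p σ).embedding x / ((d : ℝ) : ℂ) := by simp
  ext σ
  · simp only [h1, Complex.div_ofReal_re]; ring
  · simp only [h1, Complex.div_ofReal_im]; ring


theorem latVec_mkInput (ω : Module.Basis (Fin n) ℤ (𝓞 F)) (p : Fin r ≃ InfinitePlace F)
    (num : Fin n → Fin n → ℤ) (den : ℕ) (v : InfinitePlace F → ℝ) (δ : ℝ) (u : Fin r → ℝ)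
    (x : Fin n → ℤ) : latVec (mkInput ω p num den v δ) u x = fVec p u (elt ω x) := by
  rw [fVec_apply]
  change toE (fun σ => ((p σ).mult : ℤ)) (vecOf (mkInput ω p num den v δ) u x) = _
  have h1 : ∀ σ, (p σ).embedding (elt ω x) = ∑ i, ((x i : ℝ) : ℂ) * (p σ).embedding (ω i : F) := by
    intro σ
    rw [elt_apply, map_sum]
    simp
  refine congrArg _ (funext fun (σ : Fin r) => Prod.ext ?_ ?_)
  · simp only [h1, Complex.re_sum, Complex.re_ofReal_mul]; rfl
  · simp only [h1, Complex.im_sum, Complex.im_ofReal_mul]; rfl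

theorem mkInput_wf (ω : Module.Basis (Fin n) ℤ (𝓞 F)) (p : Fin r ≃ InfinitePlace F)
    (num : Fin n → Fin n → ℤ) (den : ℕ) (v : InfinitePlace F → ℝ) (δ : ℝ) :
    (mkInput ω p num den v δ).Wf := by
  constructor
  · intro σ
    change ((p σ).mult : ℤ) = 1 ∨ ((p σ).mult : ℤ) = 2
    rw [InfinitePlace.mult]
    split_ifs <;> simp
  · change r ≤ n
    rw [← finrank_of_basis ω, ← InfinitePlace.sum_mult_eq, ← p.sum_comp]
    calc r = ∑ _σ : Fin r, 1 := by simp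
      _ ≤ _ := Finset.sum_le_sum fun σ _ => (p σ).mult_pos

theorem elt_tableMul (ω : Module.Basis (Fin n) ℤ (𝓞 F)) (p : Fin r ≃ InfinitePlace F)
    (num : Fin n → Fin n → ℤ) (den : ℕ) (v : InfinitePlace F → ℝ) (δ : ℝ) (x y : Fin n → ℤ) :
    elt ω (tableMul (mkInput ω p num den v δ) x y) = elt ω x * elt ω y := by
  rw [elt_eq_coe, elt_eq_coe, elt_eq_coe, RingOfIntegers.coe_eq_algebraMap,
    RingOfIntegers.coe_eq_algebraMap, RingOfIntegers.coe_eq_algebraMap, ← map_mul]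
  congr 1
  rw [Finset.sum_mul_sum]
  have h1 : ∀ i j, x i • ω i * y j • ω j = (x i * y j) • ∑ k, ω.repr (ω i * ω j) k • ω k := by
    intro i j
    rw [ω.sum_repr, smul_mul_smul_comm]
  simp only [h1, Finset.smul_sum, smul_smul, tableMul, Finset.sum_smul]
  rw [Finset.sum_comm]
  refine Finset.sum_congr rfl fun i _ => ?_
  rw [Finset.sum_comm]
  rfl

theorem abs_table_le (ω : Module.Basis (Fin n) ℤ (𝓞 F)) {B : ℝ} (hB : 1 ≤ B)
    (hω : ∀ i (w : InfinitePlace F), w (ω i : F) ≤ B) (i j k : Fin n) :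
    |(ω.repr (ω i * ω j) k : ℝ)| ≤ n.factorial * B ^ n * B ^ 2 := by
  refine abs_coord_le ω (x := ω.repr (ω i * ω j)) hB hω (fun w => ?_) k
  rw [elt_eq_coe, ω.sum_repr, RingOfIntegers.coe_eq_algebraMap, map_mul, map_mul, sq]
  exact mul_le_mul (hω i w) (hω j w) (apply_nonneg _ _) (zero_le_one.trans hB)

end ArakelovAlg

namespace ArakelovAlg

set_option linter.unusedSectionVars false

open GramSchmidtLLL NumberField

variable {n r : ℕ} {F : Type*} [Field F] [NumberField F]

/-! ### Lattice reduction for ideals -/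

/-- The coordinates of `u x` at the infinite places. -/
noncomputable def placeVec (p : Fin r ≃ InfinitePlace F) (u : Fin r → ℝ) (x : F) : Vec r :=
  fun σ => (u σ * ((p σ).embedding x).re, u σ * ((p σ).embedding x).im)

theorem vecOf_mkInput (ω : Module.Basis (Fin n) ℤ (𝓞 F)) (p : Fin r ≃ InfinitePlace F)
    (num : Fin n → Fin n → ℤ) (den : ℕ) (v : InfinitePlace F → ℝ) (δ : ℝ) (u : Fin r → ℝ)
    (x : Fin n → ℤ) (d : ℤ) : vecOf (mkInput ω p num den v δ) (fun σ : Fin r => u σ / (d : ℝ)) x =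
      placeVec p u (elt ω x / (d : F)) := by
  have h1 : ∀ σ, (p σ).embedding (elt ω x) = ∑ i, ((x i : ℝ) : ℂ) * (p σ).embedding (ω i : F) := by
    intro σ
    rw [elt_apply, map_sum]
    simp
  have h2 : ∀ σ, (p σ).embedding (elt ω x / (d : F)) =
      (p σ).embedding (elt ω x) / ((d : ℝ) : ℂ) := by simp
  refine funext fun (σ : Fin r) => Prod.ext ?_ ?_
  · simp only [placeVec, h2, Complex.div_ofReal_re, h1, Complex.re_sum, Complex.re_ofReal_mul]
    exact div_mul_comm _ _ _ |>.trans (mul_comm _ _)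
  · simp only [placeVec, h2, Complex.div_ofReal_im, h1, Complex.im_sum, Complex.im_ofReal_mul]
    exact div_mul_comm _ _ _ |>.trans (mul_comm _ _)

theorem place_elt_le (ω : Module.Basis (Fin n) ℤ (𝓞 F)) {A B : ℝ} {x : Fin n → ℤ}
    (hω : ∀ i (w : InfinitePlace F), w (ω i : F) ≤ B) (hx : ∀ i, |(x i : ℝ)| ≤ A)
    (w : InfinitePlace F) : w (elt ω x) ≤ n * (A * B) := by
  rw [elt_apply, ← InfinitePlace.norm_embedding_eq, map_sum]
  refine (norm_sum_le _ _).trans ?_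
  calc ∑ i, ‖w.embedding ((x i : F) * (ω i : F))‖ ≤ ∑ _i : Fin n, A * B := by
        refine Finset.sum_le_sum fun i _ => ?_
        rw [map_mul, norm_mul, map_intCast, Complex.norm_intCast, InfinitePlace.norm_embedding_eq]
        exact mul_le_mul (hx i) (hω i w) (apply_nonneg _ _) ((abs_nonneg _).trans (hx i))
    _ = _ := by simp

theorem factorial_le_two_pow (n : ℕ) : n.factorial ≤ 2 ^ (n * n) := by
  calc n.factorial ≤ n ^ n := Nat.factorial_le_pow n
    _ ≤ (2 ^ n) ^ n := Nat.pow_le_pow_left Nat.lt_two_pow_self.le n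
    _ = 2 ^ (n * n) := (pow_mul 2 n n).symm

theorem Rep.linearIndependent {ω : Module.Basis (Fin n) ℤ (𝓞 F)} (p : Fin r ≃ InfinitePlace F)
    {u : Fin r → ℝ} (hu : ∀ σ, 0 < u σ) {J : IdealRep n} {S : Submodule ℤ F} (hJ : Rep ω J S) :
    LinearIndependent ℝ fun j => fVec p u (repVec ω J j) := by
  refine Matrix.linearIndependent_of_det_gram_ne_zero (𝕜 := ℝ) (v := fun j => fVec p u (repVec ω J j)) ?_
  have h1 := vol_repVec ω p u J hJ.den_pos
  rw [vol] at h1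
  rw [h1]
  have h2 : (0 : ℝ) < |(discr F : ℝ)| := zero_lt_one.trans_le one_le_abs_discr
  have h3 := placeNorm_pos p hu
  have h4 := hJ.nrm_pos
  positivity

theorem one_div_le_nrm {ω : Module.Basis (Fin n) ℤ (𝓞 F)} {J : IdealRep n} {S : Submodule ℤ F}
    (hJ : Rep ω J S) : 1 / (J.den : ℝ) ^ n ≤ J.nrm := by
  have h1 : (1 : ℝ) ≤ |((Matrix.of J.num).det : ℝ)| := by
    exact_mod_cast Int.one_le_abs hJ.det_ne
  have h2 : (0 : ℝ) < J.den := by exact_mod_cast hJ.den_pos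
  rw [IdealRep.nrm]
  gcongr

theorem span_repVec (ω : Module.Basis (Fin n) ℤ (𝓞 F)) (N : Fin n → Fin n → ℤ) (d : ℤ) :
    Submodule.span ℤ (Set.range (repVec ω ⟨N, d⟩)) =
      (Submodule.span ℤ (Set.range N)).map
        ((LinearMap.mulRight ℤ ((d : F)⁻¹)).comp (elt ω).toIntLinearMap) := by
  rw [Submodule.map_span, ← Set.range_comp]
  congr 2
  ext j
  simp [repVec, div_eq_mul_inv]

/-- The LLL algorithm on the lattice `u J`. The hypotheses of `lll_runs` are verified with constants that
are invariant under scaling `u`, so only the ratios of the `u σ` need a bound. -/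
theorem lllBasis_runs (n : ℕ) (hn : 0 < n) : ∃ c g, PolyBdd c ∧ PolyBdd g ∧
    ∀ (X : ℕ) (F : Type*) [Field F] [NumberField F] (ω : Module.Basis (Fin n) ℤ (𝓞 F)) (r : ℕ)
    (p : Fin r ≃ InfinitePlace F) (num : Fin n → Fin n → ℤ) (den : ℕ) (v : InfinitePlace F → ℝ)
    (δ : ℝ) (J : IdealRep n) (S : Submodule ℤ F) (u : Fin r → ℝ),
    (∀ i (w : InfinitePlace F), w (ω i : F) ≤ 2 ^ X) → Rep ω J S → J.Sized X → (∀ σ, 0 < u σ) →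
    (∀ σ τ, u σ ≤ 2 ^ X * u τ) →
    Runs (lllBasis (mkInput ω p num den v δ) J u) (c X) fun q =>
      Rep ω ⟨q.1, J.den⟩ S ∧ (IdealRep.mk q.1 J.den).Sized (g X) ∧
      LLLReduced (fun j => fVec p u (repVec ω ⟨q.1, J.den⟩ j)) ∧
      q.2 = fun j => placeVec p u (repVec ω ⟨q.1, J.den⟩ j) := by
  obtain ⟨c, hc, H⟩ := lll_runs n
  let Y : ℕ → ℕ := fun X => 2 * n * n + 4 * n * X + 4 * X + 2 * n
  refine ⟨fun X => (X + 2) + (n * 2 + (c (Y X) +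
    n * (n * (n * (2 * (Y X + n) + 10) + 3) + 1))), fun X => Y X + n, ?_, ?_,
    fun X F _ _ ω r p num den v δ J S u hω hJ hX hu hspread => ?_⟩
  · simp only [Y]; fun_prop
  · simp only [Y]; fun_prop
  set inp := mkInput ω p num den v δ with hinp
  have hwf : inp.Wf := mkInput_wf ω p num den v δ
  have hr : 0 < r := by
    have : Nonempty (InfinitePlace F) := inferInstance
    exact Fin.pos_iff_nonempty.mpr (p.nonempty_congr.mpr this)
  let τ : Fin r := ⟨0, hr⟩
  have hd : (0 : ℝ) < J.den := by exact_mod_cast hJ.den_pos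
  set a : ℝ := u τ / J.den with ha
  have ha0 : 0 < a := div_pos (hu τ) hd
  let u' : Fin r → ℝ := fun σ => u σ / (J.den : ℝ)
  have hu' : ∀ σ, 0 < u' σ := fun σ => div_pos (hu σ) hd
  have hu1 : ∀ σ, u' σ ≤ 2 ^ X * a := fun σ => by
    simp only [u', ha, ← mul_div_assoc]
    exact div_le_div_of_nonneg_right (hspread σ τ) hd.le
  have hu2 : ∀ σ, a ≤ 2 ^ X * u' σ := fun σ => by
    simp only [u', ha, ← mul_div_assoc]
    exact div_le_div_of_nonneg_right (hspread τ σ) hd.le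
  have hlat : ∀ x, latVec inp u' x = fVec p u' (elt ω x) := latVec_mkInput ω p num den v δ u'
  have hlat' : ∀ N : Fin n → Fin n → ℤ,
      (fun j => latVec inp u' (N j)) = fun j => fVec p u (repVec ω ⟨N, J.den⟩ j) := fun N => by
    funext j
    rw [hlat]
    exact fVec_div p u _
  have h2X : (1 : ℝ) ≤ 2 ^ X := one_le_pow₀ one_le_two
  have hnn : (n : ℝ) ≤ 2 ^ n := by exact_mod_cast Nat.lt_two_pow_self.le
  -- integral coordinates are bounded by the length of the lattice vector
  have hκ : ∀ (x : Fin n → ℤ) i,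
      |(x i : ℝ)| ≤ (2 ^ (n * n + X * n + X) / a) * ‖latVec inp u' x‖ := by
    intro x i
    have h1 : ∀ w : InfinitePlace F, w (elt ω x) ≤ 2 ^ X / a * ‖latVec inp u' x‖ := by
      intro w
      obtain ⟨σ, rfl⟩ := p.surjective w
      have h2 := mul_place_le_norm_fVec p u' (elt ω x) σ
      rw [← hlat] at h2
      rw [div_mul_eq_mul_div, le_div_iff₀ ha0]
      calc p σ (elt ω x) * a ≤ p σ (elt ω x) * (2 ^ X * u' σ) := by gcongr; exact hu2 σ
        _ = 2 ^ X * (u' σ * p σ (elt ω x)) := by ring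
        _ ≤ _ := mul_le_mul_of_nonneg_left h2 (by positivity)
    refine (abs_coord_le ω h2X hω h1 i).trans ?_
    rw [← mul_assoc]
    refine mul_le_mul_of_nonneg_right ?_ (norm_nonneg _)
    have h3 : (n.factorial : ℝ) ≤ 2 ^ (n * n) := by exact_mod_cast factorial_le_two_pow n
    rw [pow_add, pow_add, pow_mul 2 X n, mul_div_assoc]
    gcongr
  -- the initial basis vectors are not long compared to `a`
  have hs₀ : ∀ i, ‖latVec inp u' (J.num i)‖ ≤ a * 2 ^ (2 * n + 3 * X) := by
    intro i
    have h1 : ∀ σ, u' σ * p σ (elt ω (J.num i)) ≤ 2 ^ X * a * (n * (2 ^ X * 2 ^ X)) := fun σ =>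
      mul_le_mul (hu1 σ) (place_elt_le ω hω (fun l => by exact_mod_cast hX.1 i l) _)
        (apply_nonneg _ _) (by positivity)
    have h2 := norm_fVec_sq_le p hu' _ h1
    rw [← hlat, finrank_of_basis ω] at h2
    refine le_of_sq_le_sq (h2.trans ?_) (by positivity)
    have hn1 : (1 : ℝ) ≤ n := by exact_mod_cast hn
    calc (n : ℝ) * (2 ^ X * a * (n * (2 ^ X * 2 ^ X))) ^ 2
        ≤ (n : ℝ) ^ 2 * (2 ^ X * a * (n * (2 ^ X * 2 ^ X))) ^ 2 := by
          gcongr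
          nlinarith
      _ = (a * (n ^ 2 * 2 ^ (3 * X))) ^ 2 := by ring
      _ ≤ (a * ((2 ^ n) ^ 2 * 2 ^ (3 * X))) ^ 2 := by gcongr
      _ = _ := by rw [pow_add, pow_mul' 2 2 n]
  -- and the covolume is not small compared to `a`
  have hdet : ((a * 2 ^ (2 * n + 3 * X)) ^ 2) ^ n ≤
      (Matrix.gram ℝ (fun i => latVec inp u' (J.num i))).det * 4 ^ Y X := by
    have h1 := vol_repVec ω p u J hJ.den_pos
    have h1' := (congrArg (fun f : Fin n → EuclideanSpace ℝ (Fin r × Fin 2) =>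
      (Matrix.gram ℝ f).det) (hlat' J.num)).trans h1
    refine le_trans ?_ (mul_le_mul_of_nonneg_right h1'.ge (by positivity))
    have h2 : (a / 2 ^ X) ^ n ≤ placeNorm p u * J.nrm := by
      calc (a / 2 ^ X) ^ n = (u τ / 2 ^ X) ^ n * (1 / (J.den : ℝ) ^ n) := by
            rw [ha, ← one_div_pow, ← mul_pow]; congr 1; ring
        _ ≤ placeNorm p u * J.nrm := by
            refine mul_le_mul ?_ (one_div_le_nrm hJ) (by positivity) (placeNorm_pos p hu).le
            rw [← placeNorm_const ω p]
            refine placeNorm_le p (fun σ => by have := hu τ; positivity) fun σ => ?_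
            rw [div_le_iff₀' (by positivity)]
            exact hspread τ σ
    have h3 : ((a / 2 ^ X) ^ n) ^ 2 ≤ |(discr F : ℝ)| * (placeNorm p u * J.nrm) ^ 2 := by
      refine le_trans ?_ (le_mul_of_one_le_left (sq_nonneg _) one_le_abs_discr)
      gcongr
    refine le_trans ?_ (mul_le_mul_of_nonneg_right h3 (by positivity))
    have h4 : ((a / 2 ^ X) ^ n) ^ 2 = (a ^ 2) ^ n / 2 ^ (2 * X * n) := by
      rw [div_pow, div_pow, ← pow_mul, ← pow_mul, ← pow_mul, ← pow_mul, mul_comm n 2]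
      congr 2
      ring
    rw [h4, mul_pow, mul_pow, div_mul_eq_mul_div, mul_div_assoc]
    refine mul_le_mul_of_nonneg_left ?_ (by positivity)
    rw [le_div_iff₀ (by positivity), ← pow_mul, ← pow_mul, ← pow_add,
      show (4 : ℝ) = 2 ^ 2 by norm_num, ← pow_mul]
    refine pow_le_pow_right₀ one_le_two ?_
    simp only [Y]
    ring_nf
    nlinarith
  have hli₀ : LinearIndependent ℝ fun i => latVec inp u' (J.num i) := by
    have := hJ.linearIndependent p hu
    exact (congrArg (fun f : Fin n → EuclideanSpace ℝ (Fin r × Fin 2) =>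
      LinearIndependent ℝ f) (hlat' J.num)).mpr this
  have hκs : (2 ^ (n * n + X * n + X) / a) * (a * 2 ^ (2 * n + 3 * X)) ≤ (2 : ℝ) ^ Y X := by
    rw [← mul_assoc, div_mul_cancel₀ _ ha0.ne', ← pow_add]
    refine pow_le_pow_right₀ one_le_two ?_
    simp only [Y]
    nlinarith
  have hrun := H (Y X) inp u' _ _ J.num hwf (by positivity) (by positivity) hκ hκs hli₀ hs₀ hdet
  refine Runs.le (Runs.prim_bind (Runs.bind_eq (Runs.tab_eq (c := 1) (g := u') fun σ => Runs.prim rfl)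
    (hrun.bind fun N hN => (realBasis_runs hwf u' hN.2.2.2).bind_eq (Runs.pure ?_)))) ?_
  · obtain ⟨h1, h2, h3, h4⟩ := hN
    have hsp : Submodule.span ℤ (Set.range (repVec ω ⟨N, J.den⟩)) = S := by
      rw [span_repVec, h3, ← span_repVec, ← hJ.span_eq]
    refine ⟨?_, ?_, ?_, ?_⟩
    · have := Rep.of_span_eq p hJ (J' := ⟨N, J.den⟩) hJ.den_pos one_ne_zero (by rw [scaleS_one, hsp])
      rwa [scaleS_one] at this
    · exact ⟨h4, hX.2.trans (pow_le_pow_right₀ one_le_two (by simp only [Y]; nlinarith))⟩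
    · exact (congrArg (fun f : Fin n → EuclideanSpace ℝ (Fin r × Fin 2) => LLLReduced f)
        (hlat' N)).mp h2
    · funext j
      exact vecOf_mkInput ω p num den v δ u (N j) J.den
  · have h1 : bits J.den ≤ X + 2 := bits_le hX.2
    have h2 : r * (1 + 1) ≤ n * 2 := Nat.mul_le_mul_right 2 hwf.r_le
    beta_reduce
    omega

end ArakelovAlg

namespace ArakelovAlg

set_option linter.unusedSectionVars false

open GramSchmidtLLL NumberField

variable {n r : ℕ} {F : Type*} [Field F] [NumberField F]

/-- The `n`-th root of the norm of an ideal. -/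
noncomputable def IdealRep.root (J : IdealRep n) : ℝ := Real.exp (Real.log J.nrm / n)

theorem IdealRep.root_pos (J : IdealRep n) : 0 < J.root := Real.exp_pos _

theorem Rep.root_pow {ω : Module.Basis (Fin n) ℤ (𝓞 F)} {J : IdealRep n} {S : Submodule ℤ F}
    (h : Rep ω J S) (hn : 0 < n) : J.root ^ n = J.nrm := by
  have : (n : ℝ) ≠ 0 := by exact_mod_cast hn.ne'
  rw [IdealRep.root, ← Real.exp_nat_mul, mul_div_cancel₀ _ this, Real.exp_log h.nrm_pos]

theorem logNorm_runs (n : ℕ) : ∃ c, PolyBdd c ∧ ∀ (X : ℕ) (F : Type*) [Field F] [NumberField F]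
    (ω : Module.Basis (Fin n) ℤ (𝓞 F)) (J : IdealRep n) (S : Submodule ℤ F), Rep ω J S → J.Sized X →
    Runs (logNorm J) (c X) (· = Real.log J.nrm) := by
  obtain ⟨c, hc, H⟩ := idet_runs n
  refine ⟨fun X => c X + (n * n + n * X + X + n + 20), by fun_prop,
    fun X F _ _ ω J S hJ hX => ?_⟩
  refine Runs.le ((H X J.num hX.1).bind_eq (Runs.prim_bind (Runs.prim_bind (Runs.prim_bind
    (Runs.prim_bind (Runs.prim_bind (Runs.prim_bind (Runs.prim_bind (Runs.prim ?_))))))))) ?_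
  · have h1 : ((Matrix.of J.num).det : ℝ) ≠ 0 := by exact_mod_cast hJ.det_ne
    have h2 : (J.den : ℝ) ≠ 0 := by exact_mod_cast hJ.den_pos.ne'
    rw [IdealRep.nrm, Real.log_div (abs_ne_zero.mpr h1) (pow_ne_zero _ h2), Real.log_pow]
    simp
  · have h1 := bits_le (abs_det_le_two_pow (Matrix.of J.num) hX.1)
    have h2 := bits_le hX.2
    have h3 : bits (n : ℤ) ≤ n + 2 := bits_le (by
      rw [Nat.abs_cast]; exact_mod_cast Nat.lt_two_pow_self.le)
    beta_reduce
    omega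

theorem normRoot_runs (n : ℕ) : ∃ c, PolyBdd c ∧ ∀ (X : ℕ) (F : Type*) [Field F] [NumberField F]
    (ω : Module.Basis (Fin n) ℤ (𝓞 F)) (J : IdealRep n) (S : Submodule ℤ F), Rep ω J S → J.Sized X →
    Runs (normRoot J 1) (c X) (· = J.root) ∧ Runs (normRoot J (-1)) (c X) (· = J.root⁻¹) := by
  obtain ⟨c, hc, H⟩ := logNorm_runs n
  refine ⟨fun X => c X + (n + 10), by fun_prop, fun X F _ _ ω J S hJ hX => ?_⟩
  have h3 : bits (n : ℤ) ≤ n + 2 := bits_le (by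
    rw [Nat.abs_cast]; exact_mod_cast Nat.lt_two_pow_self.le)
  have h1 : bits 1 ≤ 0 + 2 := bits_le (by norm_num)
  have h2 : bits (-1) ≤ 0 + 2 := bits_le (by norm_num)
  refine ⟨Runs.le ((H X F ω J S hJ hX).bind_eq (Runs.prim_bind (Runs.prim_bind (Runs.prim_bind
    (Runs.prim_bind (Runs.prim ?_)))))) (by beta_reduce; omega), Runs.le ((H X F ω J S hJ hX).bind_eq
    (Runs.prim_bind (Runs.prim_bind (Runs.prim_bind (Runs.prim_bind (Runs.prim ?_)))))) (by beta_reduce; omega)⟩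
  · simp [IdealRep.root]
  · rw [IdealRep.root, ← Real.exp_neg]
    congr 1
    push_cast
    ring

/-! ### The size of reduced ideals -/

/-- A factor of a product of bounded numbers that is at least `1` cannot be small. -/
theorem le_of_one_le_placeNorm (ω : Module.Basis (Fin n) ℤ (𝓞 F)) (p : Fin r ≃ InfinitePlace F)
    {t : Fin r → ℝ} {a : ℝ} (ha : 1 ≤ a) (ht : ∀ σ, 0 < t σ) (hta : ∀ σ, t σ ≤ a)
    (h1 : 1 ≤ placeNorm p t) (σ : Fin r) : 1 / a ^ n ≤ t σ := by
  have ha0 : 0 < a := zero_lt_one.trans_le ha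
  have h2 : placeNorm p (fun σ => t σ / a) ≤ t σ / a := by
    rw [placeNorm, ← Finset.mul_prod_erase _ _ (Finset.mem_univ σ)]
    have hq : ∀ σ, 0 ≤ t σ / a := fun σ => (div_pos (ht σ) ha0).le
    have hq1 : ∀ σ, t σ / a ≤ 1 := fun σ => (div_le_one ha0).mpr (hta σ)
    refine (mul_le_of_le_one_right (pow_nonneg (hq σ) _)
      (Finset.prod_le_one (fun τ _ => pow_nonneg (hq τ) _) fun τ _ => pow_le_one₀ (hq τ) (hq1 τ))).trans ?_
    exact pow_le_of_le_one (hq σ) (hq1 σ) InfinitePlace.mult_ne_zero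
  have h3 : placeNorm p (fun σ => t σ / a) = placeNorm p t * (1 / a ^ n) := by
    simp only [div_eq_mul_inv]
    rw [placeNorm_mul, placeNorm_const ω, one_mul, inv_pow]
  rw [h3] at h2
  calc 1 / a ^ n ≤ placeNorm p t * (1 / a ^ n) := le_mul_of_one_le_left (by positivity) h1
    _ ≤ t σ / a := h2
    _ ≤ t σ := div_le_self (ht σ).le ha

theorem le_two_pow_of_pow_le {x : ℝ} {a k : ℕ} (hx : 0 ≤ x) (hk : k ≠ 0) (h : x ^ k ≤ 2 ^ a) :
    x ≤ 2 ^ a := by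
  refine (pow_le_pow_iff_left₀ hx (by positivity) hk).mp (h.trans ?_)
  exact le_self_pow₀ (one_le_pow₀ one_le_two) hk

/-- In a reduced basis whose first vector has norm at least `1` no vector is long. -/
theorem _root_.GramSchmidtLLL.LLLReduced.norm_sq_le_of_one_le {E : Type*} [NormedAddCommGroup E] [InnerProductSpace ℝ E]
    {b : Fin n → E} (h : LLLReduced b) (hb : LinearIndependent ℝ b) (hn : 0 < n)
    (h1 : 1 ≤ ‖b ⟨0, hn⟩‖) (j : Fin n) :
    ‖b j‖ ^ 2 ≤ n * (2 ^ (n * n) * (Matrix.gram ℝ b).det) := by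
  set A : Fin n → ℝ := fun i => ‖InnerProductSpace.gramSchmidt ℝ b i‖ ^ 2 with hA
  have h0 : InnerProductSpace.gramSchmidt ℝ b ⟨0, hn⟩ = b ⟨0, hn⟩ := by
    rw [gs_eq_sub, Finset.sum_eq_zero, sub_zero]
    intro j hj
    exact absurd (Finset.mem_Iio.mp hj) (by simp [Fin.lt_def])
  have hlow : ∀ i, 1 ≤ 2 ^ n * A i := fun i => by
    have := h.norm_gs_le' (i := ⟨0, hn⟩) (j := i) (by simp [Fin.le_def])
    rw [h0] at this
    exact (one_le_pow₀ h1).trans this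
  have hup : ∀ i, A i ≤ 2 ^ (n * n) * (Matrix.gram ℝ b).det := fun i => by
    have hA0 : 0 ≤ A i := by positivity
    rw [det_gram_eq hb, pow_mul]
    calc A i ≤ A i * ((2 ^ n) * ∏ l ∈ Finset.univ.erase i, 2 ^ n * A l) := by
          refine le_mul_of_one_le_right hA0 ?_
          refine one_le_mul_of_one_le_of_one_le (one_le_pow₀ one_le_two) ?_
          simpa using Finset.prod_le_prod (s := Finset.univ.erase i) (f := fun _ => (1 : ℝ))
            (fun _ _ => zero_le_one) fun l _ => hlow l
      _ = ∏ l, 2 ^ n * A l := by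
          rw [← Finset.mul_prod_erase _ _ (Finset.mem_univ i)]; ring
      _ = _ := by rw [Finset.prod_mul_distrib]; simp [hA]
  refine (norm_sq_le_of_size hb fun l hl => h.size j l hl).trans ?_
  refine (Finset.sum_le_sum fun i _ => hup i).trans ?_
  rw [Finset.sum_const, nsmul_eq_mul]
  refine mul_le_mul_of_nonneg_right ?_ ((by positivity : (0:ℝ) ≤ A j).trans (hup j))
  exact_mod_cast (Finset.card_le_univ _).trans (by simp)

/-- The exponent that bounds the size of a reduced ideal. -/
def reducedSize (n X : ℕ) : ℕ :=
  n * n + n * X + 2 * (n * (n * n + X)) + (n + X + n * n) + (n * n + X)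

/-- The result of reducing a divisor of degree zero has a size that depends on the field alone. The first
basis vector `f` has `∏ |u f| ≥ 1`, as `f⁻¹ S` contains the ring of integers with an index equal to
this product, and `|u f|` is bounded at each place because `f` is short; so `|u f|` is bounded from
below at each place too. The denominator divides the index, and the numerators are coordinates of
elements with bounded absolute values. -/
theorem reduced_sized (hn : 0 < n) {X : ℕ} (ω : Module.Basis (Fin n) ℤ (𝓞 F))
    (p : Fin r ≃ InfinitePlace F) {u : Fin r → ℝ} {J J' : IdealRep n} {S : Submodule ℤ F} {f : F}
    (hω : ∀ i (w : InfinitePlace F), w (ω i : F) ≤ 2 ^ X) (hD : |(discr F : ℝ)| ≤ 2 ^ X)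
    (hJ : Rep ω J S) (hu : ∀ σ, 0 < u σ)
    (hred : LLLReduced fun j => fVec p u (repVec ω J j)) (hdeg : placeNorm p u * J.nrm = 1)
    (hS : Stable S) (hf : f ≠ 0) (hfS : f ∈ S) (hfabs : ∀ σ, p σ f = p σ (repVec ω J ⟨0, hn⟩))
    (hJ' : Rep ω J' (scaleS f⁻¹ S)) (hvec : ∀ j, repVec ω J' j = f⁻¹ * repVec ω J j)
    (hlow : ∀ d, d ∣ J'.den → (∀ j i, d ∣ J'.num j i) → d ∣ 1) :
    J'.Sized (reducedSize n X) ∧ ∀ σ, 1 / 2 ^ reducedSize n X ≤ u σ * p σ f * J'.root ∧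
      u σ * p σ f * J'.root ≤ 2 ^ reducedSize n X := by
  set b := fun j => fVec p u (repVec ω J j) with hb
  have hli : LinearIndependent ℝ b := hJ.linearIndependent p hu
  set D := |(discr F : ℝ)| with hDdef
  have hD1 : 1 ≤ D := one_le_abs_discr
  have hgram : (Matrix.gram ℝ b).det = D := by
    have := vol_repVec ω p u J hJ.den_pos
    rw [hdeg, one_pow, mul_one] at this
    exact this
  set a := n * n + X with ha
  have h2a : (1 : ℝ) ≤ 2 ^ a := one_le_pow₀ one_le_two
  have hfn : ∀ σ, 0 < p σ f := fun σ => InfinitePlace.pos_iff.mpr hf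
  have ht0 : ∀ σ, 0 < u σ * p σ f := fun σ => mul_pos (hu σ) (hfn σ)
  have htb : ∀ σ, u σ * p σ f ≤ ‖b ⟨0, hn⟩‖ := fun σ => by
    rw [hfabs]
    exact mul_place_le_norm_fVec p u _ σ
  have hb0 : ‖b ⟨0, hn⟩‖ ≤ 2 ^ a := by
    have h1 := hred.norm_sq_pow_le hli hn
    rw [hgram, ← pow_mul] at h1
    refine le_two_pow_of_pow_le (norm_nonneg _) (k := 2 * n) (by omega) (h1.trans ?_)
    rw [ha, pow_add]
    gcongr
  have hta : ∀ σ, u σ * p σ f ≤ 2 ^ a := fun σ => (htb σ).trans hb0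
  have hfinv : f⁻¹ ≠ 0 := inv_ne_zero hf
  -- the reduced ideal contains the ring of integers
  obtain ⟨P, hP⟩ : ∃ P : Fin n → Fin n → ℤ,
      (fun i => (ω i : F)) = fun i => ∑ j, (P i j : F) * repVec ω J' j := by
    refine exists_int_matrix ?_
    rw [Submodule.span_le, hJ'.span_eq]
    rintro _ ⟨i, rfl⟩
    rw [SetLike.mem_coe, mem_scaleS hfinv, inv_inv, mul_comm]
    exact hS _ _ hfS
  set dP := (Matrix.of P).det with hdP
  have hnn := placeNorm_elt_pos p hf
  have hnrm : placeNorm p (fun σ => u σ * p σ f) * J'.nrm = 1 := by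
    rw [Rep.nrm_eq p hJ hJ', placeNorm_mul]
    have h1 : placeNorm p (fun σ => p σ f) * placeNorm p (fun σ => p σ f⁻¹) = 1 := by
      rw [← placeNorm_mul]
      have : ∀ σ, p σ f * p σ f⁻¹ = 1 := fun σ => by rw [← map_mul, mul_inv_cancel₀ hf, map_one]
      simp only [this]
      rw [placeNorm_const ω, one_pow]
    linear_combination hdeg + placeNorm p u * J.nrm * h1
  have hdet : |(dP : ℝ)| * J'.nrm = 1 := by
    have h1 : vol p (fun _ => 1) (fun i => (ω i : F)) =
        vol p (fun _ => 1) fun i => ∑ j, (P i j : F) * repVec ω J' j := congrArg _ hP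
    rw [vol_basis, vol_sum, vol_repVec ω p _ J' hJ'.den_pos, placeNorm_const ω, one_pow, one_mul,
      one_pow] at h1
    have h2 : (|(dP : ℝ)| * J'.nrm) ^ 2 = 1 ^ 2 := by
      rw [mul_pow, sq_abs]
      refine mul_left_cancel₀ (zero_lt_one.trans_le hD1).ne' ?_
      linear_combination -h1
    exact (pow_left_inj₀ (mul_nonneg (abs_nonneg _) hJ'.nrm_pos.le) zero_le_one two_ne_zero).mp h2
  have hPN : |(dP : ℝ)| = placeNorm p fun σ => u σ * p σ f :=
    mul_right_cancel₀ hJ'.nrm_pos.ne' (hdet.trans hnrm.symm)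
  have hdP0 : dP ≠ 0 := by
    intro h0
    rw [h0, Int.cast_zero, abs_zero, zero_mul] at hdet
    exact zero_ne_one hdet
  have hN1 : 1 ≤ placeNorm p fun σ => u σ * p σ f := by
    rw [← hPN]
    exact_mod_cast Int.one_le_abs hdP0
  have hPle : |(dP : ℝ)| ≤ 2 ^ (n * a) := by
    rw [hPN, mul_comm n a, pow_mul, ← placeNorm_const ω p]
    exact placeNorm_le p (fun σ => (ht0 σ).le) hta
  -- its denominator divides the index
  have hden : J'.den ∣ dP := by
    have hmat : Matrix.of P * Matrix.of J'.num = J'.den • (1 : Matrix (Fin n) (Fin n) ℤ) := by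
      have hrow : ∀ i, ∑ j, P i j • J'.num j = J'.den • Pi.single i 1 := by
        intro i
        apply elt_injective ω
        have hd : (J'.den : F) ≠ 0 := by exact_mod_cast hJ'.den_pos.ne'
        have h1 : (ω i : F) = elt ω (Pi.single i 1) := by
          rw [elt_apply, Finset.sum_eq_single i] <;> simp +contextual
        have h2 := congrFun hP i
        simp only [h1, repVec] at h2
        rw [map_sum, map_zsmul, h2]
        rw [zsmul_eq_mul, Finset.mul_sum]
        refine Finset.sum_congr rfl fun j _ => ?_
        rw [map_zsmul, zsmul_eq_mul]
        field_simp
      ext i l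
      have := congrFun (hrow i) l
      rw [Matrix.mul_apply]
      simpa [Finset.sum_apply, Matrix.one_apply, Pi.single_apply, eq_comm] using this
    have h1 : ∀ j i, J'.den ∣ dP * J'.num j i := by
      intro j i
      have h2 : dP • Matrix.of J'.num = J'.den • (Matrix.of P).adjugate := by
        calc dP • Matrix.of J'.num = (Matrix.of P).adjugate * Matrix.of P * Matrix.of J'.num := by
              rw [Matrix.adjugate_mul, Matrix.smul_mul, Matrix.one_mul]
          _ = _ := by rw [Matrix.mul_assoc, hmat, Matrix.mul_smul, Matrix.mul_one]
      have h3 := congrFun (congrFun h2 j) i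
      exact ⟨_, h3⟩
    obtain ⟨g, d', p', hg0, hco, hd', hp'⟩ := Int.exists_gcd_one' (m := J'.den) (n := dP)
      (Int.gcd_pos_of_ne_zero_left _ hJ'.den_pos.ne')
    have hg0' : (g : ℤ) ≠ 0 := by exact_mod_cast hg0.ne'
    have h2 : d' ∣ 1 := by
      refine hlow d' ⟨g, hd'⟩ fun j i => ?_
      have h3 := h1 j i
      rw [hd', hp', mul_right_comm] at h3
      exact IsCoprime.dvd_of_dvd_mul_left (Int.isCoprime_iff_gcd_eq_one.mpr hco)
        (Int.dvd_of_mul_dvd_mul_right hg0' h3)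
    rw [hd', hp']
    exact mul_dvd_mul_right (h2.trans (one_dvd _)) _
  have hdpos : (0 : ℝ) < J'.den := by exact_mod_cast hJ'.den_pos
  have hdenle : |J'.den| ≤ |dP| := by
    rw [abs_of_pos hJ'.den_pos]
    exact Int.le_of_dvd (abs_pos.mpr hdP0) ((dvd_abs _ _).mpr hden)
  have hdenle' : (J'.den : ℝ) ≤ 2 ^ (n * a) := by
    refine le_trans ?_ hPle
    rw [abs_of_pos hJ'.den_pos] at hdenle
    exact_mod_cast hdenle
  -- the norm of `u f` is at least `1` and no factor is large, so no factor is small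
  have htlow := le_of_one_le_placeNorm ω p h2a ht0 hta hN1
  have hb1 : 1 ≤ ‖b ⟨0, hn⟩‖ := by
    by_contra hlt
    push Not at hlt
    have h1 := placeNorm_le p (fun σ => (ht0 σ).le) htb
    rw [placeNorm_const ω] at h1
    exact absurd (hN1.trans h1) (not_le.mpr (pow_lt_one₀ (norm_nonneg _) hlt hn.ne'))
  have hbj : ∀ j, ‖b j‖ ≤ 2 ^ (n + X + n * n) := fun j => by
    refine le_two_pow_of_pow_le (norm_nonneg _) two_ne_zero
      ((hred.norm_sq_le_of_one_le hli hn hb1 j).trans ?_)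
    rw [hgram, pow_add, pow_add, mul_assoc, mul_comm ((2 : ℝ) ^ X)]
    have : (n : ℝ) ≤ 2 ^ n := by exact_mod_cast Nat.lt_two_pow_self.le
    gcongr
  have hroot := hJ'.root_pow hn
  have hr0 := J'.root_pos
  have hr1 : J'.root ≤ 1 := by
    refine (pow_le_one_iff_of_nonneg hr0.le hn.ne').mp ?_
    rw [hroot]
    calc J'.nrm ≤ |(dP : ℝ)| * J'.nrm := le_mul_of_one_le_left hJ'.nrm_pos.le (by
            exact_mod_cast Int.one_le_abs hdP0)
      _ = 1 := hdet
  have hr2 : 1 / 2 ^ a ≤ J'.root := by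
    refine (pow_le_pow_iff_left₀ (by positivity) hr0.le hn.ne').mp ?_
    rw [hroot, one_div_pow, ← pow_mul, mul_comm a n, div_le_iff₀ (by positivity), ← hdet, mul_comm]
    exact mul_le_mul_of_nonneg_left hPle hJ'.nrm_pos.le
  have hsz : reducedSize n X = n * n + n * X + 2 * (n * a) + (n + X + n * n) + a := rfl
  have hle1 : n * a + a ≤ reducedSize n X := by omega
  refine ⟨⟨fun j i => ?_, ?_⟩, fun σ => ⟨?_, ?_⟩⟩
  · have h1 : ∀ w : InfinitePlace F, w (elt ω (J'.num j)) ≤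
        2 ^ (n * a) * (2 ^ (n + X + n * n) * 2 ^ (n * a)) := by
      intro w
      obtain ⟨σ, rfl⟩ := p.surjective w
      have h2 : elt ω (J'.num j) = (J'.den : F) * (f⁻¹ * repVec ω J j) := by
        rw [← hvec, repVec, mul_div_cancel₀]
        exact_mod_cast hJ'.den_pos.ne'
      have h3 : p σ (J'.den : F) = J'.den := by
        rw [← InfinitePlace.norm_embedding_eq, map_intCast, Complex.norm_intCast, abs_of_pos hdpos]
      rw [h2, map_mul, map_mul, map_inv₀, h3]
      refine mul_le_mul hdenle' ?_ (by positivity) (by positivity)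
      have h4 := (mul_place_le_norm_fVec p u (repVec ω J j) σ).trans (hbj j)
      have h5 : (p σ f)⁻¹ * p σ (repVec ω J j) =
          (u σ * p σ (repVec ω J j)) * (u σ * p σ f)⁻¹ := by
        have := (hu σ).ne'
        have := (hfn σ).ne'
        field_simp
      rw [h5]
      refine mul_le_mul h4 ?_ (inv_nonneg.mpr (ht0 σ).le) (by positivity)
      rw [inv_le_comm₀ (ht0 σ) (by positivity), mul_comm n a, pow_mul, ← one_div]
      exact htlow σ
    have h2 := abs_coord_le ω (one_le_pow₀ one_le_two) hω h1 i
    have h3 : (n.factorial : ℝ) ≤ 2 ^ (n * n) := by exact_mod_cast factorial_le_two_pow n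
    have h4 : |((J'.num j i : ℤ) : ℝ)| ≤ 2 ^ reducedSize n X := by
      refine h2.trans ?_
      calc (n.factorial : ℝ) * (2 ^ X) ^ n * (2 ^ (n * a) * (2 ^ (n + X + n * n) * 2 ^ (n * a)))
          ≤ 2 ^ (n * n) * (2 ^ X) ^ n * (2 ^ (n * a) * (2 ^ (n + X + n * n) * 2 ^ (n * a))) := by
            gcongr
        _ = 2 ^ (n * n + n * X + 2 * (n * a) + (n + X + n * n)) := by ring
        _ ≤ _ := pow_le_pow_right₀ one_le_two (by omega)
    exact_mod_cast h4
  · refine (Int.cast_le (R := ℝ)).mp ?_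
    rw [abs_of_pos hJ'.den_pos]
    push_cast
    exact hdenle'.trans (pow_le_pow_right₀ one_le_two (by omega))
  · calc (1 : ℝ) / 2 ^ reducedSize n X ≤ 1 / 2 ^ (n * a + a) :=
          one_div_le_one_div_of_le (by positivity) (pow_le_pow_right₀ one_le_two hle1)
      _ = 1 / (2 ^ a) ^ n * (1 / 2 ^ a) := by rw [pow_add, mul_comm n a, pow_mul]; field_simp
      _ ≤ _ := mul_le_mul (htlow σ) hr2 (by positivity) (ht0 σ).le
  · calc u σ * p σ f * J'.root ≤ 2 ^ a * 1 := mul_le_mul (hta σ) hr1 hr0.le (by positivity)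
      _ ≤ _ := by
        rw [mul_one]
        exact pow_le_pow_right₀ one_le_two (by omega)

end ArakelovAlg

namespace ArakelovAlg

set_option linter.unusedSectionVars false

open GramSchmidtLLL NumberField

variable {n r : ℕ} {F : Type*} [Field F] [NumberField F]

theorem abs_table_le_two_pow (ω : Module.Basis (Fin n) ℤ (𝓞 F)) {X : ℕ}
    (hω : ∀ i (w : InfinitePlace F), w (ω i : F) ≤ 2 ^ X) (i j k : Fin n) :
    |ω.repr (ω i * ω j) k| ≤ 2 ^ (n * n + n * X + 2 * X) := by
  have h1 := abs_table_le ω (one_le_pow₀ one_le_two) hω i j k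
  have h3 : (n.factorial : ℝ) ≤ 2 ^ (n * n) := by exact_mod_cast factorial_le_two_pow n
  have h2 : (|(ω.repr (ω i * ω j) k : ℤ)| : ℝ) ≤ 2 ^ (n * n + n * X + 2 * X) := by
    refine h1.trans ?_
    rw [pow_add, pow_add, mul_comm n X, pow_mul _ X n, mul_comm 2 X, pow_mul _ X 2]
    exact mul_le_mul_of_nonneg_right (mul_le_mul_of_nonneg_right h3 (by positivity)) (by positivity)
  exact_mod_cast h2

/-- Reduction of a divisor `(J, u)` of degree zero. The time depends on the size `X` of `J`, the size of
the result only on the size `X₀` of the data of the field. -/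
theorem lllReduction_runs (n : ℕ) (hn : 0 < n) : ∃ c, PolyBdd c ∧
    ∀ (X X₀ : ℕ) (F : Type*) [Field F] [NumberField F] (ω : Module.Basis (Fin n) ℤ (𝓞 F)) (r : ℕ)
    (p : Fin r ≃ InfinitePlace F) (num : Fin n → Fin n → ℤ) (den : ℕ) (v : InfinitePlace F → ℝ)
    (δ : ℝ) (J : IdealRep n) (S : Submodule ℤ F) (u : Fin r → ℝ), X₀ ≤ X →
    (∀ i (w : InfinitePlace F), w (ω i : F) ≤ 2 ^ X₀) → |(discr F : ℝ)| ≤ 2 ^ X₀ →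
    Rep ω J S → J.Sized X → (∀ σ, 0 < u σ) → (∀ σ τ, u σ ≤ 2 ^ X * u τ) →
    placeNorm p u * J.nrm = 1 → Stable S →
    Runs (lllReduction (mkInput ω p num den v δ) J u hn) (c X) fun q =>
      ∃ f : F, f ≠ 0 ∧ Rep ω q.1 (scaleS f⁻¹ S) ∧ q.1.Sized (reducedSize n X₀) ∧
      (q.2 = fun σ => u σ * p σ f * q.1.root) ∧
      ∀ σ : Fin r, 1 / 2 ^ reducedSize n X₀ ≤ q.2 σ ∧ q.2 σ ≤ 2 ^ reducedSize n X₀ := by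
  obtain ⟨c₁, g₁, hc₁, hg₁, H₁⟩ := lllBasis_runs n hn
  obtain ⟨c₂, hc₂, H₂⟩ := idet_runs n
  obtain ⟨c₃, hc₃, H₃⟩ := lowestTerms_runs n
  obtain ⟨c₄, hc₄, H₄⟩ := normRoot_runs n
  let t : ℕ → ℕ := fun X => n * n + n * X + 2 * X
  let Z : ℕ → ℕ := fun X => g₁ X + t X + n
  let Z' : ℕ → ℕ := fun X => n * n + n * Z X
  refine ⟨fun X => c₁ X + (n * (n * (n * ((g₁ X + 2) * (t X + 2) + (2 * (g₁ X + t X) + n + 4) + 1) + 1) + 1) +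
    (n * (n * (c₂ (Z X) + 1) + 1) + (c₂ (Z X) + ((Z' X + 2) + (c₃ (Z' X) + (c₄ (Z' X) + n * 6)))))), ?_,
    fun X X₀ F _ _ ω r p num den v δ J S u hX₀ hω hD hJ hX hu hspread hdeg hS => ?_⟩
  · simp only [t, Z, Z']; fun_prop
  have hωX : ∀ i (w : InfinitePlace F), w (ω i : F) ≤ 2 ^ X := fun i w =>
    (hω i w).trans (pow_le_pow_right₀ one_le_two hX₀)
  set inp := mkInput ω p num den v δ with hinp
  have hwf : inp.Wf := mkInput_wf ω p num den v δ
  refine Runs.le (Runs.bind (H₁ X F ω r p num den v δ J S u hωX hJ hX hu hspread) ?_) le_rfl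
  rintro ⟨N, b⟩ ⟨hRN, hsN, hred, hb⟩
  replace hb : b = fun j => placeVec p u (repVec ω ⟨N, J.den⟩ j) := hb
  replace hRN : Rep ω ⟨N, J.den⟩ S := hRN
  replace hsN : (IdealRep.mk N J.den).Sized (g₁ X) := hsN
  replace hred : LLLReduced (fun j => fVec p u (repVec ω ⟨N, J.den⟩ j)) := hred
  set f₀ : Fin n → ℤ := N ⟨0, hn⟩ with hf₀
  set A : Fin n → Fin n → ℤ := fun k j => ∑ i, f₀ i * inp.table i j k with hA
  have htab : ∀ i j k, |inp.table i j k| ≤ 2 ^ t X := abs_table_le_two_pow ω hωX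
  have hterm : ∀ i j k, |f₀ i * inp.table i j k| ≤ 2 ^ (g₁ X + t X) := fun i j k =>
    abs_mul_le_two_pow (hsN.1 _ i) (htab i j k)
  have hAle : ∀ k j, |A k j| ≤ 2 ^ Z X := fun k j =>
    abs_sum_le_two_pow _ (by simp) fun i _ => hterm i j k
  have hA_runs : Runs (tab n fun k => tab n fun j => isum n fun i => imul (f₀ i) (inp.table i j k))
      (n * (n * (n * ((g₁ X + 2) * (t X + 2) + (2 * (g₁ X + t X) + n + 4) + 1) + 1) + 1)) (· = A) :=
    Runs.tab_eq fun k => Runs.tab_eq fun j => isum_runs (fun i => Runs.le (Runs.prim rfl)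
      (Nat.mul_le_mul (bits_le (hsN.1 _ i)) (bits_le (htab i j k)))) (fun i => hterm i j k)
  set num' : Fin n → Fin n → ℤ := fun j i => (Matrix.of A).cramer (N j) i with hnum'
  have hnum_entry : ∀ j i k l, |(if l = i then N j k else A k l)| ≤ 2 ^ Z X := fun j i k l => by
    split_ifs
    · exact abs_le_two_pow_mono (hsN.1 j k) (by simp only [Z]; omega)
    · exact hAle k l
  have hnum_eq : ∀ j i, Matrix.of (fun k l => if l = i then N j k else A k l) =
      (Matrix.of A).updateCol i (N j) := fun j i => by
    ext k l
    rw [Matrix.updateCol_apply]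
    rfl
  have hnum_runs : Runs (tab n fun j => tab n fun i => idet n fun k l =>
      if l = i then N j k else A k l) (n * (n * (c₂ (Z X) + 1) + 1)) (· = num') :=
    Runs.tab_eq fun j => Runs.tab_eq fun i => by
      have := H₂ (Z X) (fun k l => if l = i then N j k else A k l) (hnum_entry j i)
      rwa [hnum_eq, ← Matrix.cramer_apply] at this
  have hnum'le : ∀ j i, |num' j i| ≤ 2 ^ Z' X := fun j i => by
    simp only [hnum', Matrix.cramer_apply, ← hnum_eq]
    exact abs_det_le_two_pow _ (hnum_entry j i)
  set dA := (Matrix.of A).det with hdA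
  have hdAle : |dA| ≤ 2 ^ Z' X := abs_det_le_two_pow _ hAle
  -- `A` is the matrix of multiplication by `f₀`
  have hmul : ∀ z, elt ω ((Matrix.of A).mulVec z) = elt ω f₀ * elt ω z := by
    intro z
    rw [← elt_tableMul ω p num den v δ]
    congr 1
    ext k
    simp only [Matrix.mulVec, dotProduct, Matrix.of_apply, hA, tableMul, Finset.sum_mul]
    rw [Finset.sum_comm]
    exact Finset.sum_congr rfl fun i _ => Finset.sum_congr rfl fun j _ => by ring
  have hJd : (J.den : F) ≠ 0 := by exact_mod_cast hJ.den_pos.ne'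
  have hy0 : repVec ω ⟨N, J.den⟩ ⟨0, hn⟩ ≠ 0 := by
    intro h0
    have := (hRN.linearIndependent p hu).ne_zero ⟨0, hn⟩
    rw [h0, map_zero] at this
    exact this rfl
  have hf0ne : elt ω f₀ ≠ 0 := by
    intro h0
    apply hy0
    rw [repVec]
    change elt ω f₀ / _ = 0
    rw [h0, zero_div]
  have hdA0 : dA ≠ 0 := by
    intro h0
    obtain ⟨z, hz, hAz⟩ := Matrix.exists_mulVec_eq_zero_iff.mpr h0
    have h1 := hmul z
    rw [hAz, map_zero] at h1
    rcases mul_eq_zero.mp h1.symm with h2 | h2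
    · exact hf0ne h2
    · exact hz (elt_injective ω (by rw [h2, map_zero]))
  have hcr : ∀ j, elt ω f₀ * elt ω (num' j) = (dA : F) * elt ω (N j) := fun j => by
    have h1 : (Matrix.of A).mulVec (num' j) = dA • N j := Matrix.mulVec_cramer _ _
    rw [← hmul, h1, map_zsmul, zsmul_eq_mul]
  have hdA0F : (dA : F) ≠ 0 := by exact_mod_cast hdA0
  -- the sign of the determinant is absorbed into the generator
  obtain ⟨ε, hε, hεd⟩ : ∃ ε : ℤ, (ε = 1 ∨ ε = -1) ∧ |dA| = ε * dA := by
    rcases abs_choice dA with h | h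
    · exact ⟨1, Or.inl rfl, by rw [h, one_mul]⟩
    · exact ⟨-1, Or.inr rfl, by rw [h, neg_one_mul]⟩
  have hε0 : (ε : F) ≠ 0 := by rcases hε with rfl | rfl <;> simp
  set y := repVec ω ⟨N, J.den⟩ with hy
  set f : F := (ε : F) * y ⟨0, hn⟩ with hf
  have hf0 : f ≠ 0 := mul_ne_zero hε0 hy0
  have hfabs : ∀ σ, p σ f = p σ (y ⟨0, hn⟩) := fun σ => by
    rw [hf, ← InfinitePlace.norm_embedding_eq, ← InfinitePlace.norm_embedding_eq, map_mul,
      map_intCast]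
    rcases hε with rfl | rfl <;> simp
  have hfS : f ∈ S := by
    have h1 : y ⟨0, hn⟩ ∈ S := by
      rw [← hRN.span_eq]
      exact Submodule.subset_span ⟨_, rfl⟩
    have := S.smul_mem ε h1
    rwa [zsmul_eq_mul] at this
  refine Runs.bind_eq hA_runs (Runs.bind_eq hnum_runs (Runs.bind_eq (H₂ _ A hAle)
    (Runs.le (Runs.prim_bind (Runs.bind (H₃ (Z' X) ⟨num', |dA|⟩ ⟨hnum'le, ?_⟩ (abs_pos.mpr hdA0)) ?_))
      (Nat.add_le_add_right (bits_le hdAle) _))))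
  · rw [abs_abs]; exact hdAle
  rintro J' ⟨hs', hd', ⟨g, hg0, hgd, hgn⟩, hlow⟩
  have hvec : ∀ j, repVec ω J' j = f⁻¹ * y j := by
    intro j
    have hgF : (g : F) ≠ 0 := by exact_mod_cast hg0.ne'
    have hd'F : (J'.den : F) ≠ 0 := by exact_mod_cast hd'.ne'
    have h1 : elt ω (num' j) = (g : F) * elt ω (J'.num j) := by
      have : num' j = g • J'.num j := funext fun i => hgn j i
      rw [this, map_zsmul, zsmul_eq_mul]
    have h2 : (ε : F) * dA = g * J'.den := by
      rw [hεd] at hgd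
      exact_mod_cast hgd
    have h3 := hcr j
    have hεε : (ε : F) * ε = 1 := by rcases hε with rfl | rfl <;> simp
    rw [h1] at h3
    have hyj : y j = elt ω (N j) / J.den := rfl
    have hy0' : y ⟨0, hn⟩ = elt ω f₀ / J.den := rfl
    rw [repVec, hf, hyj, hy0', eq_inv_mul_iff_mul_eq₀ (by rw [← hy0']; exact hf0)]
    field_simp
    have h4 : (g : F) * (elt ω f₀ * elt ω (J'.num j) * ε) = g * (elt ω (N j) * J'.den) := by
      linear_combination (ε : F) * h3 + elt ω (N j) * h2
    have h5 := mul_left_cancel₀ hgF h4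
    linear_combination h5
  have hspan : Submodule.span ℤ (Set.range (repVec ω J')) = scaleS f⁻¹ S := by
    rw [← hRN.span_eq, scaleS_span]
    congr 2
    exact funext hvec
  have hR' : Rep ω J' (scaleS f⁻¹ S) := Rep.of_span_eq p hRN hd' (inv_ne_zero hf0) hspan
  have hnrm : (IdealRep.mk N J.den).nrm = J.nrm := by
    rw [Rep.nrm_eq p hJ (h := 1) (by rw [scaleS_one]; exact hRN)]
    simp only [map_one]
    rw [placeNorm_const ω, one_pow, one_mul]
  have hfin := reduced_sized hn ω p hω hD hRN hu hred (by rw [hnrm]; exact hdeg) hS hf0 hfS hfabs hR'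
    hvec hlow
  refine Runs.bind_eq (H₄ (Z' X) F ω J' _ hR' hs').1 ?_
  refine Runs.le (Runs.bind_eq (Runs.tab_eq (c := 5) (g := fun σ : Fin r => u σ * p σ f * J'.root)
    fun σ => ?_) (Runs.pure ⟨f, hf0, hR', hfin.1, rfl, hfin.2⟩))
    (Nat.mul_le_mul_right 6 hwf.r_le)
  refine Runs.le (Runs.prim_bind (Runs.prim_bind (Runs.prim_bind (Runs.prim_bind (Runs.prim ?_)))))
    (by norm_num)
  have h1 : (u σ * ((p σ).embedding (y ⟨0, hn⟩)).re) * (u σ * ((p σ).embedding (y ⟨0, hn⟩)).re) +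
      (u σ * ((p σ).embedding (y ⟨0, hn⟩)).im) * (u σ * ((p σ).embedding (y ⟨0, hn⟩)).im) =
      (u σ * p σ f) ^ 2 := by
    rw [hfabs, ← InfinitePlace.norm_embedding_eq, mul_pow, ← Complex.normSq_eq_norm_sq,
      Complex.normSq_apply]
    ring
  have h2 : 0 ≤ u σ * p σ f := mul_nonneg (hu σ).le (apply_nonneg _ _)
  rw [hb]
  change √_ * _ = _
  simp only [placeVec]
  rw [h1, Real.sqrt_sq h2]

end ArakelovAlg

namespace ArakelovAlg

set_option linter.unusedSectionVars false

open GramSchmidtLLL NumberField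

variable {n r : ℕ} {F : Type*} [Field F] [NumberField F]

/-! ### Products of ideals -/

/-- The ring of integers as an additive subgroup of `F`. -/
noncomputable def intS (ω : Module.Basis (Fin n) ℤ (𝓞 F)) : Submodule ℤ F :=
  Submodule.span ℤ (Set.range fun i => (ω i : F))

theorem mem_intS {ω : Module.Basis (Fin n) ℤ (𝓞 F)} {x : F} :
    x ∈ intS ω ↔ ∃ a : 𝓞 F, (a : F) = x := by
  rw [intS, Submodule.mem_span_range_iff_exists_fun]
  constructor
  · rintro ⟨c, rfl⟩
    refine ⟨∑ i, c i • ω i, ?_⟩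
    rw [← elt_eq_coe, elt_apply]
    simp [zsmul_eq_mul]
  · rintro ⟨a, rfl⟩
    refine ⟨ω.repr a, ?_⟩
    have h1 := elt_eq_coe ω (ω.repr a)
    rw [ω.sum_repr, elt_apply] at h1
    rw [← h1]
    simp [zsmul_eq_mul]

theorem stable_intS (ω : Module.Basis (Fin n) ℤ (𝓞 F)) : Stable (intS ω) := by
  intro a x hx
  obtain ⟨b, rfl⟩ := mem_intS.mp hx
  exact mem_intS.mpr ⟨a * b, by simp⟩

theorem Stable.mul_intS (ω : Module.Basis (Fin n) ℤ (𝓞 F)) {S : Submodule ℤ F} (hS : Stable S) :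
    S * intS ω = S := by
  refine le_antisymm (Submodule.mul_le.mpr fun x hx y hy => ?_) fun x hx => ?_
  · obtain ⟨a, rfl⟩ := mem_intS.mp hy
    rw [mul_comm]
    exact hS a x hx
  · have h1 : (1 : F) ∈ intS ω := mem_intS.mpr ⟨1, by simp⟩
    simpa using Submodule.mul_mem_mul hx h1

theorem scaleS_mul_scaleS (g h : F) (S T : Submodule ℤ F) :
    scaleS g S * scaleS h T = scaleS (g * h) (S * T) := by
  refine le_antisymm (Submodule.mul_le.mpr ?_) (Submodule.map_le_iff_le_comap.mpr
    (Submodule.mul_le.mpr fun x hx y hy => ?_))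
  · rintro _ ⟨x, hx, rfl⟩ _ ⟨y, hy, rfl⟩
    exact ⟨x * y, Submodule.mul_mem_mul hx hy, by simp only [LinearMap.mulLeft_apply]; ring⟩
  · rw [Submodule.mem_comap, LinearMap.mulLeft_apply, mul_mul_mul_comm]
    exact Submodule.mul_mem_mul (Submodule.mem_map_of_mem (f := LinearMap.mulLeft ℤ g) hx)
      (Submodule.mem_map_of_mem (f := LinearMap.mulLeft ℤ h) hy)

theorem rep_unitIdeal (ω : Module.Basis (Fin n) ℤ (𝓞 F)) : Rep ω unitIdeal (intS ω) := by
  refine ⟨zero_lt_one, ?_, ?_⟩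
  · have : Matrix.of (unitIdeal : IdealRep n).num = 1 := by
      ext i j
      simp [unitIdeal, Matrix.one_apply]
    rw [this, Matrix.det_one]
    exact one_ne_zero
  · rw [intS]
    congr 2
    ext j
    simp [repVec, elt_apply, unitIdeal]

theorem nrm_unitIdeal : (unitIdeal : IdealRep n).nrm = 1 := by
  have : Matrix.of (unitIdeal : IdealRep n).num = 1 := by
    ext i j
    simp [unitIdeal, Matrix.one_apply]
  rw [IdealRep.nrm, this]
  simp [unitIdeal]

theorem unitIdeal_sized (X : ℕ) : (unitIdeal : IdealRep n).Sized X := by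
  have h : (1 : ℤ) ≤ 2 ^ X := one_le_pow₀ one_le_two
  refine ⟨fun j i => ?_, by simpa [unitIdeal] using h⟩
  simp only [unitIdeal]
  split_ifs
  · simpa using h
  · simp

open scoped Pointwise in
/-- The product of the ideals `h T` and `(g')`. -/
theorem mulIdeal_rep_runs (n : ℕ) : ∃ c g, PolyBdd c ∧ PolyBdd g ∧
    ∀ (X : ℕ) (F : Type*) [Field F] [NumberField F] (ω : Module.Basis (Fin n) ℤ (𝓞 F)) (r : ℕ)
    (p : Fin r ≃ InfinitePlace F) (num : Fin n → Fin n → ℤ) (den : ℕ) (v : InfinitePlace F → ℝ)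
    (δ : ℝ) (J₁ J₂ : IdealRep n) (T : Submodule ℤ F) (h g' : F),
    (∀ i (w : InfinitePlace F), w (ω i : F) ≤ 2 ^ X) → J₁.Sized X → J₂.Sized X → Stable T →
    g' ≠ 0 → Rep ω J₁ (scaleS h T) → Rep ω J₂ (scaleS g' (intS ω)) →
    Runs (mulIdeal (mkInput ω p num den v δ) J₁ J₂) (c X) fun J =>
      Rep ω J (scaleS (h * g') T) ∧ J.Sized (g X) := by
  obtain ⟨c, g, hc, hg, H⟩ := mulIdeal_runs n
  let t : ℕ → ℕ := fun X => n * n + n * X + 2 * X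
  have hXt : ∀ X, X ≤ t X := fun X => by simp only [t]; omega
  refine ⟨fun X => c (t X), fun X => g (t X), by simp only [t]; fun_prop, by simp only [t]; fun_prop,
    fun X F _ _ ω r p num den v δ J₁ J₂ T h g' hω hJ₁ hJ₂ hT hg' hR₁ hR₂ => ?_⟩
  have hmono : ∀ {J : IdealRep n}, J.Sized X → J.Sized (t X) := fun hJ =>
    ⟨fun j i => abs_le_two_pow_mono (hJ.1 j i) (hXt X), abs_le_two_pow_mono hJ.2 (hXt X)⟩
  refine (H (t X) (mkInput ω p num den v δ) J₁ J₂ (abs_table_le_two_pow ω hω) (hmono hJ₁)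
    (hmono hJ₂) hR₁.den_pos hR₂.den_pos).imp ?_
  rintro J ⟨hs, hd, d, hd0, hdd, hspan⟩
  refine ⟨?_, hs⟩
  have hdF : (d : F) ≠ 0 := by exact_mod_cast hd0.ne'
  have hJF : (J.den : F) ≠ 0 := by exact_mod_cast hd.ne'
  have hddF : (J₁.den : F) * J₂.den = d * J.den := by exact_mod_cast hdd
  let L : (Fin n → ℤ) →ₗ[ℤ] F :=
    (LinearMap.mulRight ℤ (((J₁.den : F) * J₂.den)⁻¹)).comp (elt ω).toIntLinearMap
  have h1 := congrArg (Submodule.map L) hspan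
  rw [Submodule.map_span, Submodule.map_span, ← Set.range_comp] at h1
  have h2 : (L ∘ fun j => d • J.num j) = repVec ω J := by
    funext j
    change elt ω (d • J.num j) * _ = _
    rw [map_zsmul, zsmul_eq_mul, hddF, repVec]
    field_simp
  have h3 : L '' {x | ∃ a b, x = tableMul (mkInput ω p num den v δ) (J₁.num a) (J₂.num b)} =
      Set.range (repVec ω J₁) * Set.range (repVec ω J₂) := by
    have key : ∀ a b, L (tableMul (mkInput ω p num den v δ) (J₁.num a) (J₂.num b)) =
        repVec ω J₁ a * repVec ω J₂ b := fun a b => by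
      simp only [L, LinearMap.comp_apply, AddMonoidHom.coe_toIntLinearMap,
        LinearMap.mulRight_apply, elt_tableMul, repVec]
      rw [div_mul_div_comm, div_eq_mul_inv]
    ext x
    rw [Set.mem_mul]
    constructor
    · rintro ⟨_, ⟨a, b, rfl⟩, rfl⟩
      exact ⟨_, ⟨a, rfl⟩, _, ⟨b, rfl⟩, (key a b).symm⟩
    · rintro ⟨_, ⟨a, rfl⟩, _, ⟨b, rfl⟩, rfl⟩
      exact ⟨_, ⟨a, b, rfl⟩, key a b⟩
  rw [h2, h3, ← Submodule.span_mul_span, hR₁.span_eq, hR₂.span_eq, scaleS_mul_scaleS,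
    hT.mul_intS] at h1
  rw [mul_comm, ← scaleS_scaleS]
  refine Rep.of_span_eq p hR₁ hd hg' ?_
  rw [h1, scaleS_scaleS, mul_comm]

/-! ### The jump algorithm -/

/-- The number `log ∂_F`. -/
noncomputable def logDiscr (n r : ℕ) (F : Type*) [Field F] [NumberField F] : ℝ :=
  ((n : ℤ) - (r : ℤ) : ℤ) * Real.log (2 / Real.pi) + Real.log |(discr F : ℝ)| / 2

theorem logPartial_runs (n X : ℕ) (F : Type*) [Field F] [NumberField F]
    (ω : Module.Basis (Fin n) ℤ (𝓞 F)) (r : ℕ) (p : Fin r ≃ InfinitePlace F)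
    (num : Fin n → Fin n → ℤ) (den : ℕ) (v : InfinitePlace F → ℝ) (δ : ℝ)
    (hD : |(discr F : ℝ)| ≤ 2 ^ X) :
    Runs (logPartial (mkInput ω p num den v δ)) (3 * n + 2 * X + 40) (· = logDiscr n r F) := by
  have hwf := mkInput_wf ω p num den v δ
  have hr : r ≤ n := hwf.r_le
  have hbn : bits (n : ℤ) ≤ n + 2 := bits_le (by
    rw [Nat.abs_cast]; exact_mod_cast Nat.lt_two_pow_self.le)
  have hbr : bits (r : ℤ) ≤ n + 2 := bits_le (by
    rw [Nat.abs_cast]; exact_mod_cast (Nat.lt_two_pow_self.le.trans (Nat.pow_le_pow_right two_pos hr)))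
  have hbnr : bits ((n : ℤ) - r) ≤ n + 2 := bits_le (by
    have h1 : (n : ℤ) ≤ 2 ^ n := by exact_mod_cast Nat.lt_two_pow_self.le
    rw [abs_le]; constructor <;> omega)
  have hD' : |discr F| ≤ 2 ^ X := by exact_mod_cast hD
  have hbD := bits_le hD'
  have hbD' : bits |discr F| ≤ X + 2 := bits_le (by rw [abs_abs]; exact hD')
  have hb2 : bits 2 ≤ 1 + 2 := bits_le (by norm_num)
  refine Runs.le (Runs.prim_bind (Runs.prim_bind (Runs.prim_bind (Runs.prim_bind (Runs.prim_bind
    (Runs.prim_bind (Runs.prim_bind (Runs.prim_bind (Runs.prim_bind (Runs.prim_bind (Runs.prim_bind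
    (Runs.prim_bind (Runs.prim ?_))))))))))))) ?_
  · simp [logDiscr, mkInput]
  · change bits (n : ℤ) + bits (r : ℤ) + (bits ((n : ℤ) - r) + (bits 2 + (1 + (1 + (1 + (1 +
      (bits (discr F) + (bits |discr F| + (1 + (bits 2 + (1 + 1))))))))))) ≤ _
    omega

theorem logDiscr_le (ω : Module.Basis (Fin n) ℤ (𝓞 F)) (p : Fin r ≃ InfinitePlace F) :
    logDiscr n r F ≤ Real.log |(discr F : ℝ)| / 2 := by
  have hr : r ≤ n := (mkInput_wf ω p (fun _ _ => 0) 0 (fun _ => 0) 0).r_le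
  have h1 : Real.log (2 / Real.pi) ≤ 0 := Real.log_nonpos (by positivity)
    ((div_le_one Real.pi_pos).mpr Real.two_le_pi)
  have h2 : (0 : ℝ) ≤ (((n : ℤ) - (r : ℤ) : ℤ) : ℝ) := by
    have : (0 : ℤ) ≤ (n : ℤ) - r := by omega
    exact_mod_cast this
  rw [logDiscr]
  nlinarith [mul_nonneg h2 (neg_nonneg.mpr h1)]

/-- `∂_F` is bounded away from `1`, by the lower bounds of Minkowski and Hermite for the
discriminant. -/
theorem one_div_twelve_le_logDiscr (hn : 2 ≤ n) (ω : Module.Basis (Fin n) ℤ (𝓞 F))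
    (p : Fin r ≃ InfinitePlace F) : 1 / 12 ≤ logDiscr n r F := by
  have hfin := finrank_of_basis ω
  have hnr : 2 * ((n : ℤ) - r) ≤ n := by
    have h1 : n ≤ 2 * r := by
      rw [← hfin, ← InfinitePlace.sum_mult_eq, ← p.sum_comp]
      calc ∑ σ, (p σ).mult ≤ ∑ _σ : Fin r, 2 := Finset.sum_le_sum fun σ _ => by
            rw [InfinitePlace.mult]; split_ifs <;> norm_num
        _ = 2 * r := by simp [mul_comm]
    omega
  have hnr' : 2 * (((n : ℤ) - (r : ℤ) : ℤ) : ℝ) ≤ n := by exact_mod_cast hnr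
  have hlog : Real.log (2 / Real.pi) ≤ 0 := Real.log_nonpos (by positivity)
    ((div_le_one Real.pi_pos).mpr Real.two_le_pi)
  have hD : 0 < |(discr F : ℝ)| := zero_lt_one.trans_le one_le_abs_discr
  have h0 : n * Real.log (2 / Real.pi) + Real.log |(discr F : ℝ)| ≤ 2 * logDiscr n r F := by
    rw [logDiscr]
    nlinarith [mul_nonneg (sub_nonneg.mpr hnr') (neg_nonneg.mpr hlog)]
  have hpi := Real.pi_pos
  have hpi4 := Real.pi_lt_d2
  suffices h : 1 / 6 ≤ n * Real.log (2 / Real.pi) + Real.log |(discr F : ℝ)| by linarith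
  rw [← Real.log_pow, ← Real.log_mul (by positivity) hD.ne']
  suffices h : 6 / 5 ≤ (2 / Real.pi) ^ n * |(discr F : ℝ)| by
    have h1 := Real.one_sub_inv_le_log_of_pos
      (show (0 : ℝ) < (2 / Real.pi) ^ n * |(discr F : ℝ)| by positivity)
    have h2 : ((2 / Real.pi) ^ n * |(discr F : ℝ)|)⁻¹ ≤ (6 / 5)⁻¹ :=
      inv_anti₀ (by norm_num) h
    rw [show ((6 : ℝ) / 5)⁻¹ = 5 / 6 by norm_num] at h2
    linarith
  rcases hn.eq_or_lt with rfl | hn3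
  · have h1 := abs_discr_gt_two (K := F) (by omega)
    have h2 : (3 : ℤ) ≤ |discr F| := h1
    have h3 : (3 : ℝ) ≤ |(discr F : ℝ)| := by exact_mod_cast h2
    calc (6 / 5 : ℝ) ≤ (2 / Real.pi) ^ 2 * 3 := by
          rw [div_pow, div_mul_eq_mul_div, div_le_div_iff₀ (by norm_num) (by positivity)]
          nlinarith
      _ ≤ _ := by gcongr
  · have h1 := abs_discr_ge (K := F) (by omega)
    rw [hfin] at h1
    have h2 : (27 / 8 : ℝ) ≤ (3 / 2) ^ n := by
      calc (27 / 8 : ℝ) = (3 / 2) ^ 3 := by norm_num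
        _ ≤ _ := pow_le_pow_right₀ (by norm_num) hn3
    calc (6 / 5 : ℝ) ≤ 4 / 9 * (3 / 2) ^ n := by linarith
      _ = (2 / Real.pi) ^ n * (4 / 9 * (3 * Real.pi / 4) ^ n) := by
          rw [mul_left_comm, ← mul_pow]
          congr 2
          field_simp
          norm_num
      _ ≤ _ := by
          refine mul_le_mul_of_nonneg_left ?_ (by positivity)
          exact_mod_cast h1

theorem placeNorm_exp (p : Fin r ≃ InfinitePlace F) (y : Fin r → ℝ) :
    placeNorm p (fun σ => Real.exp (y σ)) = Real.exp (∑ σ, ((p σ).mult : ℝ) * y σ) := by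
  rw [placeNorm, Real.exp_sum]
  exact Finset.prod_congr rfl fun σ _ => (Real.exp_nat_mul _ _).symm

theorem placeNorm_mul_inv (ω : Module.Basis (Fin n) ℤ (𝓞 F)) (p : Fin r ≃ InfinitePlace F) {f : F}
    (hf : f ≠ 0) : placeNorm p (fun σ => p σ f) * placeNorm p (fun σ => p σ f⁻¹) = 1 := by
  rw [← placeNorm_mul]
  have : ∀ σ, p σ f * p σ f⁻¹ = 1 := fun σ => by rw [← map_mul, mul_inv_cancel₀ hf, map_one]
  simp only [this]
  rw [placeNorm_const ω, one_pow]

end ArakelovAlg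

namespace ArakelovAlg

set_option linter.unusedSectionVars false

open GramSchmidtLLL NumberField

variable {n r : ℕ} {F : Type*} [Field F] [NumberField F]

theorem bits_natCast_le (m : ℕ) : bits (m : ℤ) ≤ m + 2 := bits_le (by
  rw [Nat.abs_cast]; exact_mod_cast Nat.lt_two_pow_self.le)

theorem mul_abs_lt_of_large {n X : ℕ} {x : ℝ} (hx : |x| ≤ 2 ^ X) :
    n * |x / 2 ^ (X + n + 4)| < 1 / 12 := by
  rw [abs_div, abs_of_pos (by positivity : (0 : ℝ) < 2 ^ (X + n + 4)), ← mul_div_assoc,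
    div_lt_div_iff₀ (by positivity) (by norm_num)]
  have h1 : (n : ℝ) ≤ 2 ^ n := by exact_mod_cast Nat.lt_two_pow_self.le
  calc n * |x| * 12 ≤ 2 ^ n * 2 ^ X * 12 := by gcongr
    _ < 2 ^ n * 2 ^ X * 16 := by
      have : (0 : ℝ) < 2 ^ n * 2 ^ X := by positivity
      linarith
    _ = 1 * 2 ^ (X + n + 4) := by ring

/-- The search for the starting scale of the jump algorithm. -/
theorem jump_search_runs (n : ℕ) {r : ℕ} (hr : r ≤ n) (X : ℕ) (w : Fin r → ℝ) (lp : ℝ)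
    (hlp : 1 / 12 ≤ lp) (hw : ∀ σ, |w σ| ≤ 2 ^ X) :
    Runs (repeatUntil ((0 : ℤ), w) fun (t, z) => do
      let ok ← foldFin r (fun σ ok => do
        let a ← rmul (← ofInt n) (← rabs (z σ))
        let c ← rlt a lp
        pure (ok && c)) true
      if ok then pure (Sum.inr (t, z))
      else
        let t' ← iadd t 1
        let z' ← tab r fun σ => do rdiv (z σ) (← ofInt 2)
        pure (Sum.inl (t', z')))
      ((X + n + 4 + 1) * (n * (n + 6) + (X + n + 10) + n * 5 + 1))
      fun q => 0 ≤ q.1 ∧ q.1 ≤ (X + n + 4 : ℕ) ∧ (q.2 = fun σ => w σ / 2 ^ q.1.toNat) ∧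
        ∀ σ, n * |q.2 σ| < lp := by
  set T := X + n + 4 with hT
  refine Runs.le (Runs.repeatUntil (c := n * (n + 6) + (X + n + 10) + n * 5)
    (fun s => 0 ≤ s.1 ∧ s.1 ≤ (T : ℤ) ∧ s.2 = fun σ => w σ / 2 ^ s.1.toNat)
    (fun s => ((T : ℤ) - s.1).toNat) ?_ _ ?_) ?_
  · rintro ⟨t, z⟩ ⟨h0, hT', hz⟩
    replace h0 : 0 ≤ t := h0
    replace hT' : t ≤ T := hT'
    replace hz : z = fun σ => w σ / 2 ^ t.toNat := hz
    change Runs (_ >>= _) _ _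
    refine Runs.le (T := n * (n + 6) + ((X + n + 10) + n * 5)) (Runs.le (Runs.bind (Runs.foldFin (c := n + 5)
      (fun k ok => ok = true ↔ ∀ σ : Fin r, σ.val < k → n * |z σ| < lp) (fun σ ok hok => ?_) true
      (by simp)) fun ok hok => ?_) (Nat.add_le_add_right (Nat.mul_le_mul_right _ hr) _)) (by omega)
    · refine Runs.le (Runs.prim_bind (Runs.prim_bind (Runs.prim_bind (Runs.prim_bind
        (Runs.pure ?_))))) (by have := bits_natCast_le n; omega)
      rw [Bool.and_eq_true, decide_eq_true_eq, hok]
      constructor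
      · rintro ⟨h1, h2⟩ τ hτ
        rcases Nat.lt_succ_iff_lt_or_eq.mp hτ with h | h
        · exact h1 τ h
        · rw [Fin.ext h]; exact h2
      · intro h
        exact ⟨fun τ hτ => h τ (by omega), h σ (by omega)⟩
    · cases ok with
      | true =>
        exact Runs.le (Runs.pure ⟨h0, hT', hz, fun σ => hok.mp rfl σ σ.isLt⟩) (Nat.zero_le _)
      | false =>
        have hlt : t < T := by
          refine lt_of_le_of_ne hT' fun h => ?_
          refine absurd (hok.mpr fun σ _ => ?_) (by simp)
          have h2 := mul_abs_lt_of_large (n := n) (hw σ)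
          rw [hz, h, Int.toNat_natCast]
          exact h2.trans_le hlp
        have htn : (t + 1).toNat = t.toNat + 1 := by omega
        refine Runs.le (Runs.prim_bind (Runs.bind_eq (Runs.tab_eq (c := 4)
          (g := fun σ => w σ / 2 ^ (t + 1).toNat) fun σ => ?_) (Runs.pure ⟨⟨?_, ?_, rfl⟩, ?_⟩))) ?_
        · refine Runs.le (Runs.prim_bind (Runs.prim ?_)) (Nat.add_le_add_right (bits_le (X := 1)
            (by norm_num)) 1)
          rw [hz, htn, pow_succ]
          push_cast
          field_simp
        · change 0 ≤ t + 1
          omega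
        · change t + 1 ≤ (T : ℤ)
          omega
        · change ((T : ℤ) - (t + 1)).toNat < ((T : ℤ) - t).toNat
          omega
        · have h1 : bits t ≤ T + 2 := bits_le (by
            rw [abs_of_nonneg h0]
            have : (T : ℤ) ≤ 2 ^ T := by exact_mod_cast Nat.lt_two_pow_self.le
            omega)
          have h2 : bits 1 ≤ 0 + 2 := bits_le (by norm_num)
          have h3 : r * (4 + 1) ≤ n * 5 := Nat.mul_le_mul_right _ hr
          omega
  · refine ⟨le_rfl, by positivity, ?_⟩
    funext σ
    simp
  · simp [hT]

/-- The jump algorithm: at scale `i` the current pair is the reduction of the divisor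
`(𝓞, exp (-w / 2 ^ i))`, and squaring the divisor followed by a reduction passes from `i` to `i - 1`.
The sizes do not accumulate, because each reduction resets them to a bound that depends on the field
alone. -/
theorem jump_runs (n : ℕ) (hn : 2 ≤ n) (hn' : 0 < n) : ∃ c, PolyBdd c ∧
    ∀ (X : ℕ) (F : Type*) [Field F] [NumberField F] (ω : Module.Basis (Fin n) ℤ (𝓞 F)) (r : ℕ)
    (p : Fin r ≃ InfinitePlace F) (num : Fin n → Fin n → ℤ) (den : ℕ) (v : InfinitePlace F → ℝ)
    (δ : ℝ) (w : Fin r → ℝ), (∀ i (w : InfinitePlace F), w (ω i : F) ≤ 2 ^ X) →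
    |(discr F : ℝ)| ≤ 2 ^ X → (∀ σ, |w σ| ≤ 2 ^ X) → ∑ σ, ((p σ).mult : ℝ) * w σ = 0 →
    Runs (jump (mkInput ω p num den v δ) w hn') (c X) fun q =>
      ∃ g : F, g ≠ 0 ∧ Rep ω q.1 (scaleS g⁻¹ (intS ω)) ∧ q.1.Sized (reducedSize n X) ∧
      (q.2 = fun σ => Real.exp (-w σ) * p σ g * q.1.root) ∧
      ∀ σ : Fin r, 1 / 2 ^ reducedSize n X ≤ q.2 σ ∧ q.2 σ ≤ 2 ^ reducedSize n X := by
  obtain ⟨c₁, hc₁, H₁⟩ := lllReduction_runs n hn'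
  obtain ⟨c₂, hc₂, H₂⟩ := normRoot_runs n
  obtain ⟨c₃, g₃, hc₃, hg₃, H₃⟩ := mulIdeal_rep_runs n
  have hB : PolyBdd (reducedSize n) := by unfold reducedSize; fun_prop
  let B := reducedSize n
  have hB' : PolyBdd B := hB
  have hXB : ∀ X, X ≤ B X := fun X => by simp only [B, reducedSize]; omega
  let Y : ℕ → ℕ := fun X => 4 * B X + g₃ (B X) + X
  refine ⟨fun X => (3 * n + 2 * X + 40) + (((X + n + 4 + 1) * (n * (n + 6) + (X + n + 10) + n * 5 + 1)) +
    (n * 3 + (c₁ X + (X + n + 4 + 1) * ((X + n + 4 + 2) + (c₂ (B X) + (n * 3 + (c₃ (B X) + (c₁ (Y X) +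
      (X + n + 4 + 4))))) + 1)))), ?_,
    fun X F _ _ ω r p num den v δ w hω hD hw hsum => ?_⟩
  · simp only [Y]; fun_prop
  have hwf := mkInput_wf ω p num den v δ
  have hr : r ≤ n := hwf.r_le
  have hlp := one_div_twelve_le_logDiscr hn ω p
  have hlp' := logDiscr_le ω p
  set lp := logDiscr n r F
  set inp := mkInput ω p num den v δ with hinp
  set T := X + n + 4 with hT
  have hD0 : 0 < |(discr F : ℝ)| := zero_lt_one.trans_le one_le_abs_discr
  have hnorm : ∀ t : ℕ, placeNorm p (fun σ => Real.exp (-(w σ / 2 ^ t))) = 1 := fun t => by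
    rw [placeNorm_exp]
    have : ∑ σ, ((p σ).mult : ℝ) * -(w σ / 2 ^ t) = -(∑ σ, ((p σ).mult : ℝ) * w σ) / 2 ^ t := by
      rw [← Finset.sum_neg_distrib, Finset.sum_div]
      exact Finset.sum_congr rfl fun σ _ => by ring
    rw [this, hsum, neg_zero, zero_div, Real.exp_zero]
  refine Runs.bind_eq (logPartial_runs n X F ω r p num den v δ hD) (Runs.bind
    (jump_search_runs n hr X w lp hlp hw) ?_)
  rintro ⟨t, z⟩ ⟨ht0, htT, hz, hsmall⟩
  replace ht0 : 0 ≤ t := ht0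
  replace htT : t ≤ (T : ℤ) := htT
  replace hz : z = fun σ => w σ / 2 ^ t.toNat := hz
  replace hsmall : ∀ σ, n * |z σ| < lp := hsmall
  have hzlp : ∀ σ, |z σ| ≤ Real.log |(discr F : ℝ)| / 2 := fun σ => by
    have h1 : (1 : ℝ) ≤ n := by exact_mod_cast hn'
    have h2 := hsmall σ
    have h3 : |z σ| ≤ n * |z σ| := le_mul_of_one_le_left (abs_nonneg _) h1
    linarith
  -- at the starting scale the exponents are at most `log |Δ| / 2`
  have hspread : ∀ σ τ : Fin r, Real.exp (-z σ) ≤ 2 ^ X * Real.exp (-z τ) := fun σ τ => by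
    have h1 : Real.exp (-z σ) = Real.exp (z τ - z σ) * Real.exp (-z τ) := by
      rw [← Real.exp_add]; congr 1; ring
    rw [h1]
    refine mul_le_mul_of_nonneg_right (le_trans ?_ hD) (Real.exp_pos _).le
    rw [← Real.le_log_iff_exp_le hD0]
    have h2 := abs_le.mp (hzlp σ)
    have h3 := abs_le.mp (hzlp τ)
    linarith
  have hω₀_runs : Runs (tab r fun σ => do rexp (← rneg (z σ))) (n * 3)
      (· = fun σ => Real.exp (-z σ)) :=
    Runs.le (Runs.tab_eq (c := 2) fun σ => Runs.le (Runs.prim_bind (Runs.prim rfl)) le_rfl)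
      (Nat.mul_le_mul_right _ hr)
  have hlll := H₁ X X F ω r p num den v δ unitIdeal (intS ω) (fun σ => Real.exp (-z σ)) le_rfl hω hD
    (rep_unitIdeal ω) (unitIdeal_sized X) (fun σ => Real.exp_pos _) hspread (by
      rw [nrm_unitIdeal, mul_one, hz]; exact hnorm _) (stable_intS ω)
  refine Runs.bind_eq hω₀_runs (Runs.bind hlll ?_)
  rintro ⟨J₀, s₀⟩ ⟨f, hf0, hR₀, hs₀, hu₀, hb₀⟩
  let I : ℤ × IdealRep n × (Fin r → ℝ) → Prop := fun x => 0 ≤ x.1 ∧ x.1 ≤ (T : ℤ) ∧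
    ∃ g : F, g ≠ 0 ∧ Rep ω x.2.1 (scaleS g⁻¹ (intS ω)) ∧ x.2.1.Sized (B X) ∧
      (x.2.2 = fun σ => Real.exp (-(w σ / 2 ^ x.1.toNat)) * p σ g * x.2.1.root) ∧
      ∀ σ : Fin r, 1 / 2 ^ B X ≤ x.2.2 σ ∧ x.2.2 σ ≤ 2 ^ B X
  refine Runs.le (Runs.repeatUntil (c := (T + 2) + (c₂ (B X) + (n * 3 + (c₃ (B X) + (c₁ (Y X) +
      (T + 4)))))) I (fun x => x.1.toNat) ?_ (t, J₀, s₀)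
    ⟨ht0, htT, f, hf0, hR₀, hs₀, by rw [hu₀, hz], hb₀⟩)
    (Nat.mul_le_mul_right _ (by change t.toNat + 1 ≤ T + 1; omega))
  rintro ⟨i, J, s⟩ ⟨hi0, hiT, g, hg0, hR, hJs, hs, hsb⟩
  replace hi0 : 0 ≤ i := hi0
  replace hiT : i ≤ (T : ℤ) := hiT
  replace hR : Rep ω J (scaleS g⁻¹ (intS ω)) := hR
  replace hJs : J.Sized (B X) := hJs
  replace hs : s = fun σ => Real.exp (-(w σ / 2 ^ i.toNat)) * p σ g * J.root := hs
  replace hsb : ∀ σ : Fin r, 1 / 2 ^ B X ≤ s σ ∧ s σ ≤ 2 ^ B X := hsb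
  have hbi : bits i ≤ T + 2 := bits_le (by
    rw [abs_of_nonneg hi0]
    have : (T : ℤ) ≤ 2 ^ T := by exact_mod_cast Nat.lt_two_pow_self.le
    omega)
  change Runs (iisZero i >>= _) _ _
  refine Runs.le (Runs.prim_bind (T := c₂ (B X) + (n * 3 + (c₃ (B X) + (c₁ (Y X) + (T + 4))))) ?_)
    (by omega)
  by_cases hi : i = 0
  · subst hi
    rw [if_pos (by simp)]
    refine Runs.le (Runs.pure ⟨g, hg0, hR, hJs, ?_, hsb⟩) (Nat.zero_le _)
    change s = _
    rw [hs]
    simp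
  rw [if_neg (by simpa using hi)]
  -- the square of the current divisor has degree zero again
  set vv : Fin r → ℝ := fun σ => (s σ * J.root⁻¹) * (s σ * J.root⁻¹) with hvv
  have hr0 := J.root_pos
  have hgpos : ∀ σ, 0 < p σ g := fun σ => InfinitePlace.pos_iff.mpr hg0
  have hspos : ∀ σ, 0 < s σ := fun σ => (by positivity : (0 : ℝ) < 1 / 2 ^ B X).trans_le (hsb σ).1
  have hvv' : vv = fun σ => Real.exp (-(w σ / 2 ^ (i - 1).toNat)) * (p σ g * p σ g) := by
    funext σ
    have h1 : i.toNat = (i - 1).toNat + 1 := by omega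
    have h2 : s σ * J.root⁻¹ = Real.exp (-(w σ / 2 ^ i.toNat)) * p σ g := by
      rw [hs]
      field_simp
    simp only [hvv, h2]
    rw [mul_mul_mul_comm, ← Real.exp_add]
    congr 2
    rw [h1, pow_succ]
    field_simp
    ring
  have hvvpos : ∀ σ, 0 < vv σ := fun σ => by
    have := mul_pos (hspos σ) (inv_pos.mpr hr0)
    exact mul_pos this this
  have hvvs : ∀ σ τ, vv σ ≤ 2 ^ Y X * vv τ := fun σ τ => by
    have h1 : s σ * J.root⁻¹ ≤ 2 ^ (2 * B X) * (s τ * J.root⁻¹) := by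
      rw [← mul_assoc]
      refine mul_le_mul_of_nonneg_right ?_ (inv_pos.mpr hr0).le
      calc s σ ≤ 2 ^ B X := (hsb σ).2
        _ = 2 ^ (2 * B X) * (1 / 2 ^ B X) := by rw [two_mul, pow_add]; field_simp
        _ ≤ _ := mul_le_mul_of_nonneg_left (hsb τ).1 (by positivity)
    calc vv σ ≤ (2 ^ (2 * B X) * (s τ * J.root⁻¹)) * (2 ^ (2 * B X) * (s τ * J.root⁻¹)) :=
          mul_le_mul h1 h1 (mul_pos (hspos σ) (inv_pos.mpr hr0)).le (by
            have := hspos τ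
            positivity)
      _ = 2 ^ (4 * B X) * vv τ := by simp only [hvv]; ring
      _ ≤ _ := mul_le_mul_of_nonneg_right (pow_le_pow_right₀ one_le_two
        (by simp only [Y]; omega)) (hvvpos τ).le
  refine Runs.bind_eq (H₂ (B X) F ω J _ hR hJs).2 (Runs.bind_eq (v := vv) (T₁ := n * 3) ?_ (Runs.bind
    (H₃ (B X) F ω r p num den v δ J J (intS ω) g⁻¹ g⁻¹
      (fun i w => (hω i w).trans (pow_le_pow_right₀ one_le_two (hXB X))) hJs hJs (stable_intS ω)
      (inv_ne_zero hg0) hR hR) ?_))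
  · exact Runs.le (Runs.tab_eq (c := 2) fun σ => Runs.le (Runs.prim_bind (Runs.prim rfl)) le_rfl)
      (Nat.mul_le_mul_right _ hr)
  rintro JJ ⟨hRJJ, hsJJ⟩
  have hsJJ' : JJ.Sized (Y X) := ⟨fun a b => abs_le_two_pow_mono (hsJJ.1 a b)
    (by simp only [Y]; omega), abs_le_two_pow_mono hsJJ.2 (by simp only [Y]; omega)⟩
  have hdeg : placeNorm p vv * JJ.nrm = 1 := by
    rw [Rep.nrm_eq p (rep_unitIdeal ω) hRJJ, nrm_unitIdeal, hvv', placeNorm_mul, hnorm]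
    have h1 := placeNorm_mul_inv ω p (mul_ne_zero hg0 hg0)
    rw [mul_inv] at h1
    simp only [map_mul] at h1 ⊢
    rw [one_mul, mul_one, h1]
  refine Runs.bind (H₁ (Y X) X F ω r p num den v δ JJ _ vv (by simp only [Y]; omega) hω hD hRJJ hsJJ'
    hvvpos hvvs hdeg ((stable_intS ω).scaleS _)) ?_
  rintro ⟨J', s'⟩ ⟨f', hf'0, hR', hs', hu', hb'⟩
  replace hR' : Rep ω J' (scaleS f'⁻¹ (scaleS (g⁻¹ * g⁻¹) (intS ω))) := hR'
  replace hu' : s' = fun σ => vv σ * p σ f' * J'.root := hu'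
  have h1 : bits 1 ≤ 0 + 2 := bits_le (by norm_num)
  refine Runs.le (Runs.prim_bind (Runs.pure ⟨⟨?_, ?_, g * g * f', ?_, ?_, hs', ?_, hb'⟩, ?_⟩)) ?_
  · change 0 ≤ i - 1
    omega
  · change i - 1 ≤ (T : ℤ)
    omega
  · exact mul_ne_zero (mul_ne_zero hg0 hg0) hf'0
  · rw [scaleS_scaleS] at hR'
    have : (g * g * f')⁻¹ = f'⁻¹ * (g⁻¹ * g⁻¹) := by
      rw [mul_inv, mul_inv, mul_comm]
    rw [this]
    exact hR'
  · change s' = fun σ => Real.exp (-(w σ / 2 ^ (i - 1).toNat)) * p σ (g * g * f') * J'.root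
    rw [hu', hvv']
    funext σ
    simp only [map_mul]
    ring
  · change (i - 1).toNat < i.toNat
    omega
  · omega

end ArakelovAlg

namespace ArakelovAlg

set_option linter.unusedSectionVars false

open GramSchmidtLLL NumberField

variable {n r : ℕ} {F : Type*} [Field F] [NumberField F]

/-! ### The good divisor -/

/-- The degree of the divisor `(I, v)`. -/
noncomputable def divDeg (p : Fin r ≃ InfinitePlace F) (I : IdealRep n) (v : Fin r → ℝ) : ℝ :=
  -(∑ σ, ((p σ).mult : ℝ) * Real.log (v σ) + Real.log I.nrm)

/-- The good divisor `J = h⁻¹ I` with `s = |h| v e^(d/n) N(J)^(1/n)`: multiplication by `h`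
maps `J` to `I`, so that up to a scalar the lattice `s J` is isometric to `v I`. The size of `J` and
the ratios of the `s σ` are polynomially bounded. -/
theorem goodDivisor_runs (n : ℕ) (hn : 2 ≤ n) (hn' : 0 < n) : ∃ c g, PolyBdd c ∧ PolyBdd g ∧
    ∀ (X : ℕ) (F : Type*) [Field F] [NumberField F] (ω : Module.Basis (Fin n) ℤ (𝓞 F)) (r : ℕ)
    (p : Fin r ≃ InfinitePlace F) (num : Fin n → Fin n → ℤ) (den : ℕ) (v : InfinitePlace F → ℝ)
    (δ : ℝ) (T : Submodule ℤ F), (∀ i (w : InfinitePlace F), w (ω i : F) ≤ 2 ^ X) →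
    |(discr F : ℝ)| ≤ 2 ^ X → (∀ w, 0 < v w) → (∀ w, |Real.log (v w)| ≤ 2 ^ X) →
    Rep ω ⟨num, den⟩ T → (IdealRep.mk num den).Sized X → Stable T →
    Runs (goodDivisor (mkInput ω p num den v δ) hn') (c X) fun q =>
      q.1 = divDeg p ⟨num, den⟩ (fun σ => v (p σ)) ∧
      ∃ h : F, h ≠ 0 ∧ Rep ω q.2.1 (scaleS h⁻¹ T) ∧ q.2.1.Sized (g X) ∧
      (q.2.2 = fun σ => p σ h * v (p σ) * Real.exp (q.1 / n) * q.2.1.root) ∧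
      ∀ σ τ : Fin r, q.2.2 σ ≤ 2 ^ g X * q.2.2 τ := by
  obtain ⟨c₁, hc₁, H₁⟩ := lllReduction_runs n hn'
  obtain ⟨c₂, hc₂, H₂⟩ := normRoot_runs n
  obtain ⟨c₃, g₃, hc₃, hg₃, H₃⟩ := mulIdeal_rep_runs n
  obtain ⟨c₄, hc₄, H₄⟩ := jump_runs n hn hn'
  obtain ⟨c₅, hc₅, H₅⟩ := logNorm_runs n
  let B : ℕ → ℕ := fun X => reducedSize n (X + 1)
  have hB : PolyBdd B := by simp only [B, reducedSize]; fun_prop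
  have hXB : ∀ X, X + 1 ≤ B X := fun X => by simp only [B, reducedSize]; omega
  let Y : ℕ → ℕ := fun X => g₃ (B X) + X + 1
  refine ⟨fun X => c₅ X + (n * 7 + (2 + (c₂ X + (n * 1 + (c₁ (X + 1) + ((n + 4) + (n * 4 + (c₄ (X + 1) +
    (c₃ (B X) + (c₂ (B X) + (c₂ (B X) + (n * 2 + (c₁ (Y X) + n * 3))))))))))))),
    fun X => 6 * B X, ?_, by fun_prop,
    fun X F _ _ ω r p num den v δ T hω hD hv hlogv hI hIX hT => ?_⟩
  · simp only [Y]; fun_prop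
  have hwf := mkInput_wf ω p num den v δ
  have hr : r ≤ n := hwf.r_le
  have hnR : (0 : ℝ) < n := by exact_mod_cast hn'
  set inp := mkInput ω p num den v δ with hinp
  set I : IdealRep n := ⟨num, den⟩ with hIdef
  have h2X : (2 : ℝ) ^ X ≤ 2 ^ (X + 1) := pow_le_pow_right₀ one_le_two (Nat.le_succ X)
  have hω' : ∀ i (w : InfinitePlace F), w (ω i : F) ≤ 2 ^ (X + 1) := fun i w => (hω i w).trans h2X
  have hD' := hD.trans h2X
  have hIX' : I.Sized (X + 1) := ⟨fun a b => abs_le_two_pow_mono (hIX.1 a b) (Nat.le_succ X),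
    abs_le_two_pow_mono hIX.2 (Nat.le_succ X)⟩
  set lI := Real.log I.nrm with hlI
  set lv := ∑ σ, ((p σ).mult : ℝ) * Real.log (v (p σ)) with hlv
  set d := -(lv + lI) with hd
  set w : Fin r → ℝ := fun σ => -(Real.log (v (p σ)) + (d + lI) / n) with hw
  have hsh : d + lI = -lv := by rw [hd]; ring
  have hmult : ∑ σ, ((p σ).mult : ℝ) = n := by
    rw [← finrank_of_basis ω, ← InfinitePlace.sum_mult_eq, ← p.sum_comp, Nat.cast_sum]
  have hwsum : ∑ σ, ((p σ).mult : ℝ) * w σ = 0 := by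
    have h1 : ∀ σ, ((p σ).mult : ℝ) * w σ =
        lv / n * ((p σ).mult : ℝ) - ((p σ).mult : ℝ) * Real.log (v (p σ)) := fun σ => by
      simp only [hw, hsh]; ring
    simp only [h1]
    rw [Finset.sum_sub_distrib, ← Finset.mul_sum, hmult, ← hlv]
    field_simp
    ring
  have hlvle : |lv| ≤ n * 2 ^ X := by
    rw [← hmult, Finset.sum_mul]
    refine (Finset.abs_sum_le_sum_abs _ _).trans (Finset.sum_le_sum fun σ _ => ?_)
    rw [abs_mul, Nat.abs_cast]
    exact mul_le_mul_of_nonneg_left (hlogv _) (Nat.cast_nonneg _)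
  have hwle : ∀ σ, |w σ| ≤ 2 ^ (X + 1) := fun σ => by
    simp only [hw, hsh, abs_neg]
    refine (abs_add_le _ _).trans ?_
    rw [abs_div, abs_neg, abs_of_pos hnR, pow_succ, mul_two]
    refine add_le_add (hlogv _) ?_
    rw [div_le_iff₀ hnR]
    linarith
  have hrI := I.root_pos
  have hrIn := hI.root_pow hn'
  have hcard : ∀ m, r * m ≤ n * m := fun m => Nat.mul_le_mul_right m hr
  have hlv_runs : Runs (rsum r fun σ => do rmul (← ofInt (inp.deg σ)) (← rlog (inp.v σ))) (n * 7)
      (· = lv) := by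
    refine Runs.le (Runs.rsum_eq (c := 5) fun σ => ?_) (hcard 7)
    refine Runs.le (Runs.prim_bind (Runs.prim_bind (Runs.prim ?_)))
      (by have := hwf.bits_deg σ; omega)
    rfl
  refine Runs.bind_eq (H₅ X F ω I T hI hIX) (Runs.bind_eq hlv_runs (Runs.le (Runs.prim_bind
    (Runs.prim_bind (T := c₂ X + (n * 1 + (c₁ (X + 1) + ((n + 4) + (n * 4 + (c₄ (X + 1) +
    (c₃ (B X) + (c₂ (B X) + (c₂ (B X) + (n * 2 + (c₁ (Y X) + n * 3))))))))))) ?_)) (by omega)))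
  have hroot := (H₂ X F ω I T hI hIX).2
  have hu₁_runs : Runs (tab r fun _ => (pure I.root⁻¹ : Comp ℝ)) (n * 1) (· = fun _ => I.root⁻¹) :=
    Runs.le (Runs.tab_eq (c := 0) fun σ => Runs.pure rfl) (hcard 1)
  have hone : ∀ X : ℕ, (1 : ℝ) ≤ 2 ^ X := fun X => one_le_pow₀ one_le_two
  have hl₁ := H₁ (X + 1) (X + 1) F ω r p num den v δ I T (fun _ => I.root⁻¹) le_rfl hω' hD' hI hIX'
    (fun _ => inv_pos.mpr hrI) (fun _ _ => le_mul_of_one_le_left (inv_pos.mpr hrI).le (hone _)) (by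
      rw [placeNorm_const ω, inv_pow, hrIn, inv_mul_cancel₀ hI.nrm_pos.ne']) hT
  refine Runs.bind_eq hroot (Runs.bind_eq hu₁_runs (Runs.bind hl₁ ?_))
  rintro ⟨J₁, s₁⟩ ⟨f₁, hf₁, hR₁, hJ₁, hs₁, hb₁⟩
  replace hR₁ : Rep ω J₁ (scaleS f₁⁻¹ T) := hR₁
  replace hJ₁ : J₁.Sized (B X) := hJ₁
  replace hs₁ : s₁ = fun σ => I.root⁻¹ * p σ f₁ * J₁.root := hs₁
  replace hb₁ : ∀ σ : Fin r, 1 / 2 ^ B X ≤ s₁ σ ∧ s₁ σ ≤ 2 ^ B X := hb₁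
  have hw_runs : Runs (tab r fun σ => do rneg (← radd (← rlog (inp.v σ)) ((d + lI) / n))) (n * 4)
      (· = w) :=
    Runs.le (Runs.tab_eq (c := 3) fun σ => Runs.le (Runs.prim_bind (Runs.prim_bind (Runs.prim rfl)))
      le_rfl) (hcard 4)
  refine Runs.le (Runs.prim_bind (Runs.prim_bind (Runs.prim_bind (T := n * 4 + (c₄ (X + 1) +
    (c₃ (B X) + (c₂ (B X) + (c₂ (B X) + (n * 2 + (c₁ (Y X) + n * 3))))))) (Runs.bind_eq (v := w) hw_runs
    (Runs.bind (H₄ (X + 1) F ω r p num den v δ w hω' hD' hwle hwsum) ?_)))))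
    (by have := bits_natCast_le n; omega)
  rintro ⟨J₂, s₂⟩ ⟨g, hg, hR₂, hJ₂, hs₂, hb₂⟩
  replace hR₂ : Rep ω J₂ (scaleS g⁻¹ (intS ω)) := hR₂
  replace hJ₂ : J₂.Sized (B X) := hJ₂
  replace hs₂ : s₂ = fun σ => Real.exp (-w σ) * p σ g * J₂.root := hs₂
  replace hb₂ : ∀ σ : Fin r, 1 / 2 ^ B X ≤ s₂ σ ∧ s₂ σ ≤ 2 ^ B X := hb₂
  refine Runs.bind (H₃ (B X) F ω r p num den v δ J₁ J₂ T f₁⁻¹ g⁻¹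
      (fun i w => (hω i w).trans (pow_le_pow_right₀ one_le_two ((Nat.le_succ X).trans (hXB X)))) hJ₁ hJ₂ hT
      (inv_ne_zero hg) hR₁ hR₂) ?_
  rintro J₁₂ ⟨hR₁₂, hJ₁₂⟩
  have hr₁ := J₁.root_pos
  have hr₂ := J₂.root_pos
  have hu₃_runs : Runs (tab r fun _ => rmul J₁.root⁻¹ J₂.root⁻¹) (n * 2)
      (· = fun _ => J₁.root⁻¹ * J₂.root⁻¹) :=
    Runs.le (Runs.tab_eq (c := 1) fun σ => Runs.prim rfl) (hcard 2)
  have hpos₃ : 0 < J₁.root⁻¹ * J₂.root⁻¹ := mul_pos (inv_pos.mpr hr₁) (inv_pos.mpr hr₂)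
  have hdeg₃ : placeNorm p (fun _ => J₁.root⁻¹ * J₂.root⁻¹) * J₁₂.nrm = 1 := by
    have h1 : J₁₂.nrm = J₁.nrm * J₂.nrm := by
      rw [Rep.nrm_eq p hI hR₁₂, Rep.nrm_eq p hI hR₁, Rep.nrm_eq p (rep_unitIdeal ω) hR₂, nrm_unitIdeal]
      simp only [map_mul]
      rw [placeNorm_mul]
      ring
    rw [placeNorm_const ω, mul_pow, inv_pow, inv_pow, hR₁.root_pow hn', hR₂.root_pow hn', h1]
    have := hR₁.nrm_pos.ne'
    have := hR₂.nrm_pos.ne'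
    field_simp
  have hJ₁₂' : J₁₂.Sized (Y X) := ⟨fun a b => abs_le_two_pow_mono (hJ₁₂.1 a b)
    (by simp only [Y]; omega), abs_le_two_pow_mono hJ₁₂.2 (by simp only [Y]; omega)⟩
  refine Runs.bind_eq (H₂ (B X) F ω J₁ _ hR₁ hJ₁).2 (Runs.bind_eq (H₂ (B X) F ω J₂ _ hR₂ hJ₂).2
    (Runs.bind_eq hu₃_runs (Runs.bind (H₁ (Y X) (X + 1) F ω r p num den v δ J₁₂ _ _ (by simp only [Y]; omega)
      hω' hD' hR₁₂ hJ₁₂' (fun _ => hpos₃) (fun _ _ => le_mul_of_one_le_left hpos₃.le (hone _)) hdeg₃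
      (hT.scaleS _)) ?_)))
  rintro ⟨J, s₃⟩ ⟨f₃, hf₃, hR, hJ, hs₃, hb₃⟩
  replace hR : Rep ω J (scaleS f₃⁻¹ (scaleS (f₁⁻¹ * g⁻¹) T)) := hR
  replace hJ : J.Sized (B X) := hJ
  replace hs₃ : s₃ = fun σ => J₁.root⁻¹ * J₂.root⁻¹ * p σ f₃ * J.root := hs₃
  replace hb₃ : ∀ σ : Fin r, 1 / 2 ^ B X ≤ s₃ σ ∧ s₃ σ ≤ 2 ^ B X := hb₃
  refine Runs.le (Runs.bind_eq (Runs.tab_eq (c := 2) (g := fun σ : Fin r => s₁ σ * s₂ σ * s₃ σ) fun σ =>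
    Runs.le (Runs.prim_bind (Runs.prim rfl)) le_rfl) (Runs.pure ⟨rfl, f₃ * (f₁ * g), ?_, ?_, ?_, ?_, ?_⟩))
    (hcard 3)
  · exact mul_ne_zero hf₃ (mul_ne_zero hf₁ hg)
  · rw [scaleS_scaleS] at hR
    rw [mul_inv, mul_inv]
    exact hR
  · exact ⟨fun a b => abs_le_two_pow_mono (hJ.1 a b) (by beta_reduce; omega),
      abs_le_two_pow_mono hJ.2 (by beta_reduce; omega)⟩
  · change (fun σ : Fin r => s₁ σ * s₂ σ * s₃ σ) = fun σ => p σ (f₃ * (f₁ * g)) * v (p σ) *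
      Real.exp (d / n) * J.root
    funext σ
    have h1 : Real.exp (-w σ) = v (p σ) * Real.exp (d / n) * I.root := by
      rw [IdealRep.root, mul_assoc, ← Real.exp_add, ← Real.exp_log (hv (p σ)), ← Real.exp_add]
      congr 1
      simp only [hw, ← hlI]
      ring
    rw [hs₁, hs₂, hs₃]
    simp only [h1, map_mul]
    field_simp
  · intro σ τ
    change s₁ σ * s₂ σ * s₃ σ ≤ 2 ^ (6 * B X) * (s₁ τ * s₂ τ * s₃ τ)
    have hp : ∀ {s : Fin r → ℝ}, (∀ σ : Fin r, 1 / 2 ^ B X ≤ s σ ∧ s σ ≤ 2 ^ B X) → ∀ σ, 0 < s σ :=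
      fun h σ => (by positivity : (0 : ℝ) < 1 / 2 ^ B X).trans_le (h σ).1
    have hq : ∀ {s : Fin r → ℝ}, (∀ σ : Fin r, 1 / 2 ^ B X ≤ s σ ∧ s σ ≤ 2 ^ B X) →
        s σ ≤ 2 ^ (2 * B X) * s τ := fun {s} h => by
      calc s σ ≤ 2 ^ B X := (h σ).2
        _ = 2 ^ (2 * B X) * (1 / 2 ^ B X) := by rw [two_mul, pow_add]; field_simp
        _ ≤ _ := mul_le_mul_of_nonneg_left (h τ).1 (by positivity)
    have p1 := hp hb₁
    have p2 := hp hb₂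
    have p3 := hp hb₃
    calc s₁ σ * s₂ σ * s₃ σ ≤ (2 ^ (2 * B X) * s₁ τ) * (2 ^ (2 * B X) * s₂ τ) *
          (2 ^ (2 * B X) * s₃ τ) := by
          have := p1 σ; have := p1 τ; have := p2 σ; have := p2 τ; have := p3 σ; have := p3 τ
          have := hq hb₁; have := hq hb₂; have := hq hb₃
          gcongr
      _ = _ := by ring

end ArakelovAlg

namespace GramSchmidtLLL

open Finset

/-! ### Gaussian sums over lattices in triangular coordinates -/

/-- A shifted one-dimensional Gaussian sum is bounded uniformly in the shift. -/
theorem gauss_shift {D : ℝ} (hD : 0 < D) (u : ℝ) :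
    Summable (fun m : ℤ => Real.exp (-(D * ((m : ℝ) + u) ^ 2))) ∧
      ∑' m : ℤ, Real.exp (-(D * ((m : ℝ) + u) ^ 2)) ≤ 2 * (1 + 1 / D) := by
  set r := Real.exp (-D) with hr
  have hr0 : 0 ≤ r := (Real.exp_pos _).le
  have hr1 : r < 1 := by rw [hr, Real.exp_lt_one_iff]; linarith
  set v := Int.fract u
  have hv0 : 0 ≤ v := Int.fract_nonneg u
  have hv1 : v < 1 := Int.fract_lt_one u
  have hgeo : Summable fun j : ℕ => r ^ j := summable_geometric_of_lt_one hr0 hr1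
  have hpow : ∀ (j : ℕ) (y : ℝ), (j : ℝ) ≤ |y| → Real.exp (-(D * y ^ 2)) ≤ r ^ j := by
    intro j y hy
    rw [hr, ← Real.exp_nat_mul, Real.exp_le_exp]
    have h1 : (j : ℝ) ≤ (j : ℝ) ^ 2 := by exact_mod_cast Nat.le_self_pow two_ne_zero j
    have h2 : (j : ℝ) ^ 2 ≤ y ^ 2 := by
      rw [← sq_abs y]; exact pow_le_pow_left₀ (Nat.cast_nonneg j) hy 2
    nlinarith
  set f : ℤ → ℝ := fun m => Real.exp (-(D * ((m : ℝ) + v) ^ 2)) with hf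
  have hf1 : ∀ j : ℕ, f j ≤ r ^ j := fun j => hpow j _ (by
    have : (0 : ℝ) ≤ j := Nat.cast_nonneg j
    rw [abs_of_nonneg (by push_cast; linarith)]; push_cast; linarith)
  have hf2 : ∀ j : ℕ, f (-(j + 1 : ℤ)) ≤ r ^ j := fun j => hpow j _ (by
    have : (0 : ℝ) ≤ j := Nat.cast_nonneg j
    rw [abs_of_nonpos (by push_cast; linarith)]; push_cast; linarith)
  have s1 : Summable fun j : ℕ => f j := Summable.of_nonneg_of_le
    (fun _ => (Real.exp_pos _).le) hf1 hgeo
  have s2 : Summable fun j : ℕ => f (-(j + 1 : ℤ)) := Summable.of_nonneg_of_le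
    (fun _ => (Real.exp_pos _).le) hf2 hgeo
  have hs : HasSum f (∑' j : ℕ, f j + ∑' j : ℕ, f (-(j + 1 : ℤ))) :=
    HasSum.of_nat_of_neg_add_one s1.hasSum s2.hasSum
  have hbd : ∑' m, f m ≤ 2 * (1 + 1 / D) := by
    rw [hs.tsum_eq]
    have a1 := s1.tsum_le_tsum hf1 hgeo
    have a2 := s2.tsum_le_tsum hf2 hgeo
    rw [tsum_geometric_of_lt_one hr0 hr1] at a1 a2
    have h3 : r ≤ 1 / (1 + D) := by
      rw [hr, Real.exp_neg, ← one_div]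
      exact one_div_le_one_div_of_le (by linarith) (by linarith [Real.add_one_le_exp D])
    have h4 : (1 - r)⁻¹ ≤ 1 + 1 / D := by
      rw [inv_le_comm₀ (by linarith) (by positivity)]
      have : (1 + 1 / D)⁻¹ = 1 - 1 / (1 + D) := by field_simp; ring
      linarith
    linarith
  have hfe : (fun m : ℤ => Real.exp (-(D * ((m : ℝ) + u) ^ 2))) =
      f ∘ (Equiv.addRight ⌊u⌋) := by
    ext m
    simp only [hf, Function.comp, Equiv.coe_addRight, v, Int.cast_add]
    rw [show (m : ℝ) + ⌊u⌋ + Int.fract u = m + u by linarith [Int.floor_add_fract u]]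
  rw [hfe]
  refine ⟨(Equiv.addRight ⌊u⌋).summable_iff.2 hs.summable, ?_⟩
  exact ((Equiv.addRight ⌊u⌋).tsum_eq f).le.trans hbd

/-- Adding one triangular coordinate to a summable family costs a factor `2 (1 + 1 / D)`. -/
theorem summable_gauss_prod {α : Type*} {g : α → ℝ} (hg : ∀ a, 0 ≤ g a) (hs : Summable g)
    {D : ℝ} (hD : 0 < D) (u : α → ℝ) :
    Summable (fun q : α × ℤ => Real.exp (-(D * ((q.2 : ℝ) + u q.1) ^ 2)) * g q.1) ∧
      ∑' q : α × ℤ, Real.exp (-(D * ((q.2 : ℝ) + u q.1) ^ 2)) * g q.1 ≤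
        2 * (1 + 1 / D) * ∑' a, g a := by
  have h1 : ∀ a, ∑' m : ℤ, Real.exp (-(D * ((m : ℝ) + u a) ^ 2)) * g a ≤
      2 * (1 + 1 / D) * g a := fun a => by
    rw [tsum_mul_right]
    exact mul_le_mul_of_nonneg_right (gauss_shift hD (u a)).2 (hg a)
  have h0 : ∀ a, 0 ≤ ∑' m : ℤ, Real.exp (-(D * ((m : ℝ) + u a) ^ 2)) * g a := fun a =>
    tsum_nonneg fun m => mul_nonneg (Real.exp_pos _).le (hg a)
  have h2 : Summable fun a => ∑' m : ℤ, Real.exp (-(D * ((m : ℝ) + u a) ^ 2)) * g a :=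
    Summable.of_nonneg_of_le h0 h1 (hs.mul_left _)
  have h3 : Summable (fun q : α × ℤ => Real.exp (-(D * ((q.2 : ℝ) + u q.1) ^ 2)) * g q.1) :=
    (summable_prod_of_nonneg (f := fun q : α × ℤ =>
        Real.exp (-(D * ((q.2 : ℝ) + u q.1) ^ 2)) * g q.1)
      fun q => mul_nonneg (Real.exp_pos _).le (hg _)).2
      ⟨fun a => (gauss_shift hD (u a)).1.mul_right (g a), h2⟩
  have h4 := h2.tsum_le_tsum h1 (hs.mul_left _)
  rw [tsum_mul_left] at h4
  exact ⟨h3, h3.tsum_prod.le.trans h4⟩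

/-- `∑_i D_i (x_i + ∑_{j > i} o_ij x_j + t_i)²`. -/
noncomputable def triForm {m : ℕ} (D : Fin m → ℝ) (o : Fin m → Fin m → ℝ) (t : Fin m → ℝ)
    (x : Fin m → ℤ) : ℝ :=
  ∑ i, D i * ((x i : ℝ) + ∑ j, (if i < j then o i j * (x j : ℝ) else 0) + t i) ^ 2

theorem triForm_cons {m : ℕ} (D : Fin (m + 1) → ℝ) (o : Fin (m + 1) → Fin (m + 1) → ℝ)
    (t : Fin (m + 1) → ℝ) (a : ℤ) (x : Fin m → ℤ) :
    triForm D o t (Fin.cons a x) =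
      D 0 * ((a : ℝ) + (∑ j : Fin m, o 0 j.succ * (x j : ℝ) + t 0)) ^ 2 +
      triForm (fun i => D i.succ) (fun i j => o i.succ j.succ) (fun i => t i.succ) x := by
  simp [triForm, Fin.sum_univ_succ, add_assoc, Fin.succ_pos]

theorem triForm_snoc {m : ℕ} (D : Fin (m + 1) → ℝ) (o : Fin (m + 1) → Fin (m + 1) → ℝ)
    (t : Fin (m + 1) → ℝ) (a : ℤ) (x : Fin m → ℤ) :
    triForm D o t (Fin.snoc (α := fun _ => ℤ) x a) =
      triForm (fun i => D i.castSucc) (fun i j => o i.castSucc j.castSucc)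
        (fun i => t i.castSucc + o i.castSucc (Fin.last m) * a) x +
      D (Fin.last m) * ((a : ℝ) + t (Fin.last m)) ^ 2 := by
  simp only [triForm, Fin.sum_univ_castSucc, Fin.snoc_castSucc, Fin.snoc_last,
    Fin.castSucc_lt_last, if_true, Fin.castSucc_lt_castSucc_iff, lt_irrefl, if_false, add_zero]
  have h : ∀ i : Fin m, ¬ Fin.last m < i.castSucc := fun i => not_lt.2 (Fin.le_last _)
  simp only [h, if_false, sum_const_zero, add_zero]
  congr 1
  refine sum_congr rfl fun i _ => ?_
  ring

theorem triForm_summable : ∀ {m : ℕ} {D : Fin m → ℝ} (_ : ∀ i, 0 < D i)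
    (o : Fin m → Fin m → ℝ) (t : Fin m → ℝ),
    Summable (fun x => Real.exp (-triForm D o t x)) ∧
      ∑' x, Real.exp (-triForm D o t x) ≤ ∏ i, (2 * (1 + 1 / D i))
  | 0, D, hD, o, t => by
    refine ⟨(hasSum_fintype _).summable, ?_⟩
    simp [triForm]
  | m + 1, D, hD, o, t => by
    obtain ⟨h1, h2⟩ := triForm_summable (fun i => hD i.succ) (fun i j => o i.succ j.succ)
      (fun i => t i.succ)
    obtain ⟨h3, h4⟩ := summable_gauss_prod (fun x => (Real.exp_pos _).le) h1 (hD 0)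
      fun x => ∑ j : Fin m, o 0 j.succ * (x j : ℝ) + t 0
    let e : (Fin m → ℤ) × ℤ ≃ (Fin (m + 1) → ℤ) :=
      (Equiv.prodComm _ _).trans (Fin.consEquiv fun _ => ℤ)
    have he : (fun x => Real.exp (-triForm D o t x)) ∘ e = fun q : (Fin m → ℤ) × ℤ =>
        Real.exp (-(D 0 * ((q.2 : ℝ) + (∑ j : Fin m, o 0 j.succ * (q.1 j : ℝ) + t 0)) ^ 2)) *
        Real.exp (-triForm (fun i => D i.succ) (fun i j => o i.succ j.succ)
          (fun i => t i.succ) q.1) := by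
      ext q
      change Real.exp (-triForm D o t (Fin.cons q.2 q.1)) = _
      rw [triForm_cons, neg_add, Real.exp_add]
    rw [← he] at h3 h4
    refine ⟨e.summable_iff.1 h3, ?_⟩
    have h5 := e.tsum_eq (fun x => Real.exp (-triForm D o t x))
    rw [← h5, Fin.prod_univ_succ]
    refine h4.trans (mul_le_mul_of_nonneg_left h2 ?_)
    have := hD 0
    positivity

/-! ### Poisson summation in triangular coordinates -/

/-- One-dimensional Poisson summation for a shifted and twisted Gaussian. -/
theorem poisson_one {A : ℝ} (hA : 0 < A) (t s : ℝ) :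
    ∑' m : ℤ, Complex.exp (-(Real.pi * (A * ((m : ℝ) + t) ^ 2) : ℝ) +
        ((2 * Real.pi * (m * s) : ℝ) : ℂ) * Complex.I) =
      ((Real.sqrt A)⁻¹ : ℝ) * ∑' k : ℤ, Complex.exp (-(Real.pi * (((k : ℝ) - s) ^ 2 / A) : ℝ) +
        ((2 * Real.pi * (((k : ℝ) - s) * t) : ℝ) : ℂ) * Complex.I) := by
  have h := Complex.tsum_exp_neg_quadratic (a := (A : ℂ)) (by simpa using hA)
    (-(A * t : ℝ) + (s : ℝ) * Complex.I)
  have hA' : (A : ℂ) ≠ 0 := by exact_mod_cast hA.ne'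
  have e1 : ∀ m : ℤ, Complex.exp (-(Real.pi * (A * ((m : ℝ) + t) ^ 2) : ℝ) +
        ((2 * Real.pi * (m * s) : ℝ) : ℂ) * Complex.I) =
      Complex.exp (-(Real.pi * (A * t ^ 2) : ℝ)) *
      Complex.exp (-Real.pi * A * m ^ 2 +
        2 * Real.pi * (-(A * t : ℝ) + (s : ℝ) * Complex.I) * m) := fun m => by
    rw [← Complex.exp_add]; congr 1; push_cast; ring
  have e2 : ∀ k : ℤ, Complex.exp (-(Real.pi * (((k : ℝ) - s) ^ 2 / A) : ℝ) +
        ((2 * Real.pi * (((k : ℝ) - s) * t) : ℝ) : ℂ) * Complex.I) =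
      Complex.exp (-(Real.pi * (A * t ^ 2) : ℝ)) *
      Complex.exp (-Real.pi / A * (k + Complex.I * (-(A * t : ℝ) + (s : ℝ) * Complex.I)) ^ 2) :=
    fun k => by
    rw [← Complex.exp_add]; congr 1; push_cast; field_simp
    linear_combination (Complex.I ^ 2 * s ^ 2 - s ^ 2 + 2 * k * s - 2 * Complex.I * s * A * t
      + (A * t) ^ 2) * Complex.I_sq
  simp_rw [e1, e2, tsum_mul_left, h]
  have hsq : (A : ℂ) ^ (1 / 2 : ℂ) = (Real.sqrt A : ℝ) := by
    rw [Real.sqrt_eq_rpow, Complex.ofReal_cpow hA.le]; norm_num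
  rw [hsq]
  push_cast
  ring

/-- `ζ` inverts the transpose of the unipotent triangular matrix `1 + o` on integral vectors: these
are the coordinates of the dual lattice. -/
def IsDualCoord {m : ℕ} (o : Fin m → Fin m → ℝ) (ζ : (Fin m → ℤ) → Fin m → ℝ) : Prop :=
  ∀ η i, ζ η i + ∑ j, (if j < i then o j i * ζ η j else 0) = η i

theorem IsDualCoord.castSucc {m : ℕ} {o : Fin (m + 1) → Fin (m + 1) → ℝ}
    {ζ : (Fin (m + 1) → ℤ) → Fin (m + 1) → ℝ} (h : IsDualCoord o ζ) (η : Fin m → ℤ) (a : ℤ)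
    (i : Fin m) :
    ζ (Fin.snoc (α := fun _ => ℤ) η a) i.castSucc +
      ∑ j : Fin m, (if j < i then o j.castSucc i.castSucc *
        ζ (Fin.snoc (α := fun _ => ℤ) η a) j.castSucc else 0) = η i := by
  have := h (Fin.snoc (α := fun _ => ℤ) η a) i.castSucc
  simpa [Fin.sum_univ_castSucc, Fin.castSucc_lt_castSucc_iff,
    not_lt.2 (Fin.le_last i.castSucc)] using this

theorem IsDualCoord.snoc_eq {m : ℕ} {o : Fin (m + 1) → Fin (m + 1) → ℝ}
    {ζ : (Fin (m + 1) → ℤ) → Fin (m + 1) → ℝ} (h : IsDualCoord o ζ) (η : Fin m → ℤ) (a : ℤ) :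
    ∀ i : Fin m, ζ (Fin.snoc (α := fun _ => ℤ) η a) i.castSucc =
      ζ (Fin.snoc (α := fun _ => ℤ) η 0) i.castSucc := by
  intro i
  induction i using WellFoundedLT.induction with
  | _ i ih =>
    have h1 := h.castSucc η a i
    have h2 := h.castSucc η 0 i
    have h3 : ∑ j : Fin m, (if j < i then o j.castSucc i.castSucc *
        ζ (Fin.snoc (α := fun _ => ℤ) η a) j.castSucc else 0) =
        ∑ j : Fin m, (if j < i then o j.castSucc i.castSucc *
        ζ (Fin.snoc (α := fun _ => ℤ) η 0) j.castSucc else 0) := by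
      refine sum_congr rfl fun j _ => ?_
      split_ifs with hj
      · rw [ih j hj]
      · rfl
    linarith

theorem IsDualCoord.init {m : ℕ} {o : Fin (m + 1) → Fin (m + 1) → ℝ}
    {ζ : (Fin (m + 1) → ℤ) → Fin (m + 1) → ℝ} (h : IsDualCoord o ζ) :
    IsDualCoord (fun i j : Fin m => o i.castSucc j.castSucc)
      (fun η i => ζ (Fin.snoc (α := fun _ => ℤ) η 0) i.castSucc) :=
  fun η i => h.castSucc η 0 i

theorem IsDualCoord.last {m : ℕ} {o : Fin (m + 1) → Fin (m + 1) → ℝ}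
    {ζ : (Fin (m + 1) → ℤ) → Fin (m + 1) → ℝ} (h : IsDualCoord o ζ) (η : Fin m → ℤ) (a : ℤ) :
    ζ (Fin.snoc (α := fun _ => ℤ) η a) (Fin.last m) =
      a - ∑ j : Fin m, o j.castSucc (Fin.last m) *
        ζ (Fin.snoc (α := fun _ => ℤ) η 0) j.castSucc := by
  have := h (Fin.snoc (α := fun _ => ℤ) η a) (Fin.last m)
  simp only [Fin.sum_univ_castSucc, Fin.castSucc_lt_last, if_true, lt_irrefl, if_false, add_zero,
    h.snoc_eq η a, Fin.snoc_last] at this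
  linarith

theorem IsDualCoord.summable : ∀ {m : ℕ} {D : Fin m → ℝ} (_ : ∀ i, 0 < D i)
    {o : Fin m → Fin m → ℝ} {ζ : (Fin m → ℤ) → Fin m → ℝ} (_ : IsDualCoord o ζ),
    Summable (fun η => Real.exp (-∑ i, D i * ζ η i ^ 2))
  | 0, D, hD, o, ζ, h => (hasSum_fintype _).summable
  | m + 1, D, hD, o, ζ, h => by
    have h1 := IsDualCoord.summable (fun i => hD i.castSucc) h.init
    have h3 := (summable_gauss_prod (fun x => (Real.exp_pos _).le) h1 (hD (Fin.last m))
      fun η => -∑ j : Fin m, o j.castSucc (Fin.last m) *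
        ζ (Fin.snoc (α := fun _ => ℤ) η 0) j.castSucc).1
    let e : (Fin m → ℤ) × ℤ ≃ (Fin (m + 1) → ℤ) :=
      (Equiv.prodComm _ _).trans (Fin.snocEquiv fun _ => ℤ)
    refine e.summable_iff.1 (h3.congr fun q => Eq.symm ?_)
    change Real.exp (-∑ i, D i * ζ (Fin.snoc (α := fun _ => ℤ) q.1 q.2) i ^ 2) = _
    rw [Fin.sum_univ_castSucc, h.last, neg_add, Real.exp_add, mul_comm, ← sub_eq_add_neg]
    simp only [h.snoc_eq q.1 q.2]

theorem mul_triForm {m : ℕ} (c : ℝ) (D : Fin m → ℝ) (o : Fin m → Fin m → ℝ) (t : Fin m → ℝ)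
    (x : Fin m → ℤ) : c * triForm D o t x = triForm (fun i => c * D i) o t x := by
  simp only [triForm, mul_sum, mul_assoc]

theorem norm_cexp_add (x y : ℝ) : ‖Complex.exp (-(x : ℂ) + (y : ℂ) * Complex.I)‖ =
    Real.exp (-x) := by
  simp [Complex.norm_exp]

/-- Poisson summation for a Gaussian in triangular coordinates, one coordinate at a time. -/
theorem poisson_tri : ∀ {m : ℕ} {A : Fin m → ℝ} (_ : ∀ i, 0 < A i)
    (o : Fin m → Fin m → ℝ) (t : Fin m → ℝ) {ζ : (Fin m → ℤ) → Fin m → ℝ} (_ : IsDualCoord o ζ),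
    ((∑' x, Real.exp (-(Real.pi * triForm A o t x)) : ℝ) : ℂ) =
      ((∏ i, Real.sqrt (A i))⁻¹ : ℝ) * ∑' η, Complex.exp (
        -(Real.pi * ∑ i, ζ η i ^ 2 / A i : ℝ) +
        ((2 * Real.pi * ∑ i, ζ η i * t i : ℝ) : ℂ) * Complex.I)
  | 0, A, hA, o, t, ζ, h => by simp [triForm]
  | m + 1, A, hA, o, t, ζ, h => by
    let e : (Fin m → ℤ) × ℤ ≃ (Fin (m + 1) → ℤ) :=
      (Equiv.prodComm _ _).trans (Fin.snocEquiv fun _ => ℤ)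
    set l := Fin.last m
    set A' : Fin m → ℝ := fun i => A i.castSucc
    set o' : Fin m → Fin m → ℝ := fun i j => o i.castSucc j.castSucc
    set ζ' : (Fin m → ℤ) → Fin m → ℝ := fun η i => ζ (Fin.snoc (α := fun _ => ℤ) η 0) i.castSucc
      with hζ'
    have hA' : ∀ i, 0 < A' i := fun i => hA _
    set s : (Fin m → ℤ) → ℝ := fun η => ∑ j : Fin m, o j.castSucc l * ζ' η j with hs
    set c : ℝ := (∏ i, Real.sqrt (A' i))⁻¹
    -- the sum over the lattice, with the last coordinate outside
    have hsum : Summable (fun x => Real.exp (-(Real.pi * triForm A o t x))) := by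
      simp_rw [mul_triForm]
      exact (triForm_summable (fun i => mul_pos Real.pi_pos (hA i)) o t).1
    have hsplit : ∀ q : ℤ × (Fin m → ℤ), Real.exp (-(Real.pi * triForm A o t
        (Fin.snocEquiv (fun _ => ℤ) q))) =
        Real.exp (-(Real.pi * (A l * ((q.1 : ℝ) + t l) ^ 2))) *
        Real.exp (-(Real.pi * triForm A' o' (fun i => t i.castSucc + o i.castSucc l * q.1) q.2)) := by
      intro q
      change Real.exp (-(Real.pi * triForm A o t (Fin.snoc (α := fun _ => ℤ) q.2 q.1))) = _
      rw [triForm_snoc, ← Real.exp_add]; congr 1; ring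
    have h1 : ∑' x, Real.exp (-(Real.pi * triForm A o t x)) =
        ∑' a : ℤ, Real.exp (-(Real.pi * (A l * ((a : ℝ) + t l) ^ 2))) *
        ∑' x, Real.exp (-(Real.pi * triForm A' o'
          (fun i => t i.castSucc + o i.castSucc l * a) x)) := by
      rw [← (Fin.snocEquiv fun _ => ℤ).tsum_eq]
      have h2 := (Fin.snocEquiv fun _ : Fin (m + 1) => ℤ).summable_iff.2 hsum
      refine h2.tsum_prod.trans (tsum_congr fun a => ?_)
      rw [← tsum_mul_left]
      exact tsum_congr fun x => hsplit (a, x)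
    set G : ℤ → (Fin m → ℤ) → ℂ := fun a η =>
      Complex.exp (-(Real.pi * (A l * ((a : ℝ) + t l) ^ 2) : ℝ)) *
      Complex.exp (-(Real.pi * ∑ i, ζ' η i ^ 2 / A' i : ℝ) +
        ((2 * Real.pi * ∑ i, ζ' η i * (t i.castSucc + o i.castSucc l * a) : ℝ) : ℂ) *
          Complex.I) with hG
    have h2 : ((∑' x, Real.exp (-(Real.pi * triForm A o t x)) : ℝ) : ℂ) =
        c * ∑' a, ∑' η, G a η := by
      rw [h1, Complex.ofReal_tsum, ← tsum_mul_left]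
      refine tsum_congr fun a => ?_
      rw [Complex.ofReal_mul, poisson_tri hA' o' _ h.init, hG, tsum_mul_left, Complex.ofReal_exp,
        mul_left_comm, Complex.ofReal_neg]
    have hζs : Summable fun η => Real.exp (-∑ i, Real.pi / A' i * ζ' η i ^ 2) :=
      h.init.summable fun i => div_pos Real.pi_pos (hA' i)
    have hGs : Summable (Function.uncurry G) := by
      rw [← summable_norm_iff]
      have := Summable.mul_of_nonneg (gauss_shift (mul_pos Real.pi_pos (hA l)) (t l)).1 hζs
        (fun _ => (Real.exp_pos _).le) (fun _ => (Real.exp_pos _).le)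
      refine this.congr fun q => ?_
      simp only [Function.uncurry, hG, norm_mul, norm_cexp_add]
      rw [← Complex.ofReal_neg, ← Complex.ofReal_exp, Complex.norm_real, Real.norm_eq_abs,
        Real.abs_exp, mul_assoc, mul_sum]
      congr 3
      exact sum_congr rfl fun i _ => by ring
    have h3 : ∀ η, ∑' a, G a η = ((Real.sqrt (A l))⁻¹ : ℝ) * ∑' a : ℤ, Complex.exp (
        -(Real.pi * ∑ i, ζ (Fin.snoc (α := fun _ => ℤ) η a) i ^ 2 / A i : ℝ) +
        ((2 * Real.pi * ∑ i, ζ (Fin.snoc (α := fun _ => ℤ) η a) i * t i : ℝ) : ℂ) *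
          Complex.I) := by
      intro η
      set B : ℂ := Complex.exp (-(Real.pi * ∑ i, ζ' η i ^ 2 / A' i : ℝ) +
        ((2 * Real.pi * ∑ i, ζ' η i * t i.castSucc : ℝ) : ℂ) * Complex.I) with hB
      have e1 : ∀ a, G a η = B * Complex.exp (-(Real.pi * (A l * ((a : ℝ) + t l) ^ 2) : ℝ) +
          ((2 * Real.pi * (a * s η) : ℝ) : ℂ) * Complex.I) := fun a => by
        have : ∑ i, ζ' η i * (t i.castSucc + o i.castSucc l * a) =
            ∑ i, ζ' η i * t i.castSucc + a * s η := by
          rw [hs, mul_sum, ← sum_add_distrib]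
          exact sum_congr rfl fun i _ => by ring
        rw [hG, hB, ← Complex.exp_add]
        simp only [this]
        rw [← Complex.exp_add]
        congr 1
        push_cast
        ring
      have e2 : ∀ a : ℤ, Complex.exp (
          -(Real.pi * ∑ i, ζ (Fin.snoc (α := fun _ => ℤ) η a) i ^ 2 / A i : ℝ) +
          ((2 * Real.pi * ∑ i, ζ (Fin.snoc (α := fun _ => ℤ) η a) i * t i : ℝ) : ℂ) *
          Complex.I) = B * Complex.exp (-(Real.pi * (((a : ℝ) - s η) ^ 2 / A l) : ℝ) +
        ((2 * Real.pi * (((a : ℝ) - s η) * t l) : ℝ) : ℂ) * Complex.I) := fun a => by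
        have hl : ζ (Fin.snoc (α := fun _ => ℤ) η a) l = a - s η := h.last η a
        have k1 : ∑ i, ζ (Fin.snoc (α := fun _ => ℤ) η a) i ^ 2 / A i =
            ∑ i, ζ' η i ^ 2 / A' i + ((a : ℝ) - s η) ^ 2 / A l := by
          rw [Fin.sum_univ_castSucc, hl]
          simp only [h.snoc_eq η a, hζ', A', l]
        have k2 : ∑ i, ζ (Fin.snoc (α := fun _ => ℤ) η a) i * t i =
            ∑ i, ζ' η i * t i.castSucc + ((a : ℝ) - s η) * t l := by
          rw [Fin.sum_univ_castSucc, hl]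
          simp only [h.snoc_eq η a, hζ', l]
        rw [hB, ← Complex.exp_add, k1, k2]
        congr 1
        push_cast
        ring
      simp_rw [e1, e2, tsum_mul_left]
      rw [poisson_one (hA l)]
      ring
    have hS : Summable fun η => Complex.exp (-(Real.pi * ∑ i, ζ η i ^ 2 / A i : ℝ) +
        ((2 * Real.pi * ∑ i, ζ η i * t i : ℝ) : ℂ) * Complex.I) := by
      rw [← summable_norm_iff]
      refine (h.summable (fun i => div_pos Real.pi_pos (hA i))).congr fun η => ?_
      rw [norm_cexp_add, mul_sum]
      congr 2
      exact sum_congr rfl fun i _ => by ring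
    rw [h2, ← hGs.tsum_comm]
    simp_rw [h3, tsum_mul_left]
    rw [Fin.prod_univ_castSucc, ← mul_assoc, mul_inv, Complex.ofReal_mul]
    congr 1
    rw [← e.tsum_eq]
    exact (e.summable_iff.2 hS).tsum_prod.symm

end GramSchmidtLLL

namespace GramSchmidtLLL

open Finset InnerProductSpace

variable {E : Type*} [NormedAddCommGroup E] [InnerProductSpace ℝ E] {n : ℕ}

/-! ### Poisson summation over the leading short vectors of a basis -/

theorem sum_unitri {m : ℕ} {a : Fin m → Fin m → ℝ} (h1 : ∀ i, a i i = 1)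
    (h0 : ∀ i j, i < j → a i j = 0) (x : Fin m → ℝ) (j : Fin m) :
    ∑ i, x i * a i j = x j + ∑ i, if j < i then a i j * x i else 0 := by
  have : ∀ i, x i * a i j = (if i = j then x j else 0) + if j < i then a i j * x i else 0 := by
    intro i
    rcases lt_trichotomy i j with h | rfl | h
    · simp [h0 i j h, h.ne, h.not_gt]
    · simp [h1]
    · simp [h, h.ne', mul_comm]
  simp_rw [this, sum_add_distrib]
  simp

theorem norm_sq_eq_triForm {b : Fin n → E} (hb : LinearIndependent ℝ b) (x : Fin n → ℤ) :
    ‖∑ i, (x i : ℝ) • b i‖ ^ 2 =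
      triForm (fun i => ‖gramSchmidt ℝ b i‖ ^ 2) (fun i j => gsCoeff b j i) 0 x := by
  rw [norm_sq_sum hb, triForm]
  refine sum_congr rfl fun j _ => ?_
  rw [sum_unitri (gsCoeff_self hb) (fun i j h => gsCoeff_of_lt b h), Pi.zero_apply, add_zero]

/-- Parseval in the span of the first `k` vectors. -/
theorem norm_sq_of_mem_span {k m : ℕ} {b : Fin (k + m) → E} (hb : LinearIndependent ℝ b) {z : E}
    (hz : z ∈ Submodule.span ℝ (Set.range fun i : Fin k => b (Fin.castAdd m i))) :
    ‖z‖ ^ 2 = ∑ i : Fin k, inner ℝ z (gramSchmidt ℝ b (Fin.castAdd m i)) ^ 2 /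
      ‖gramSchmidt ℝ b (Fin.castAdd m i)‖ ^ 2 := by
  obtain ⟨w, rfl⟩ := (Submodule.mem_span_range_iff_exists_fun ℝ).1 hz
  set x : Fin (k + m) → ℝ := Fin.append w 0 with hx
  have e : ∑ i, w i • b (Fin.castAdd m i) = ∑ i, x i • b i := by
    simp [Fin.sum_univ_add, hx]
  have h0 : ∀ j : Fin m, ∑ i, x i * gsCoeff b i (Fin.natAdd k j) = 0 := fun j => by
    have : ∀ i : Fin k, gsCoeff b (Fin.castAdd m i) (Fin.natAdd k j) = 0 := fun i =>
      gsCoeff_of_lt b (by simp only [Fin.lt_def, Fin.val_castAdd, Fin.val_natAdd]; omega)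
    simp [Fin.sum_univ_add, hx, this]
  rw [e, norm_sq_sum hb, Fin.sum_univ_add]
  simp only [h0]
  rw [show ∑ i : Fin m, ‖gramSchmidt ℝ b (Fin.natAdd k i)‖ ^ 2 * (0 : ℝ) ^ 2 = 0 by simp, add_zero]
  refine sum_congr rfl fun j _ => ?_
  have hpos := gs_norm_pos hb (Fin.castAdd m j)
  have : inner ℝ (∑ i, x i • b i) (gramSchmidt ℝ b (Fin.castAdd m j)) =
      ‖gramSchmidt ℝ b (Fin.castAdd m j)‖ ^ 2 * ∑ i, x i * gsCoeff b i (Fin.castAdd m j) := by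
    rw [sum_inner, mul_sum]
    refine sum_congr rfl fun i _ => ?_
    rw [real_inner_smul_left, gsCoeff, real_inner_self_eq_norm_sq]
    field_simp
  rw [this]
  field_simp

section Hybrid

variable {k m : ℕ} {b : Fin (k + m) → E} {c : Fin k → E}

theorem isDualCoord_inner (hb : LinearIndependent ℝ b)
    (hcb : ∀ l i, inner ℝ (c l) (b (Fin.castAdd m i)) = if l = i then 1 else 0) :
    IsDualCoord (fun i j : Fin k => gsCoeff b (Fin.castAdd m j) (Fin.castAdd m i))
      (fun η i => inner ℝ (∑ l, (η l : ℝ) • c l) (gramSchmidt ℝ b (Fin.castAdd m i))) := by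
  intro η i
  have h1 : inner ℝ (∑ l, (η l : ℝ) • c l) (b (Fin.castAdd m i)) = (η i : ℝ) := by
    rw [sum_inner]
    simp [real_inner_smul_left, hcb]
  rw [← h1]
  conv_rhs => rw [eq_sum_gsCoeff hb (Fin.castAdd m i), inner_sum, Fin.sum_univ_add]
  simp only [real_inner_smul_right]
  have h2 : ∀ j : Fin m, gsCoeff b (Fin.castAdd m i) (Fin.natAdd k j) = 0 := fun j =>
    gsCoeff_of_lt b (by simp only [Fin.lt_def, Fin.val_castAdd, Fin.val_natAdd]; omega)
  simp only [h2, zero_mul, sum_const_zero, add_zero]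
  set y : Fin k → ℝ := fun j =>
    inner ℝ (∑ l, (η l : ℝ) • c l) (gramSchmidt ℝ b (Fin.castAdd m j))
  have h3 : ∀ j : Fin k, gsCoeff b (Fin.castAdd m i) (Fin.castAdd m j) * y j =
      (if j = i then y i else 0) +
      if j < i then gsCoeff b (Fin.castAdd m i) (Fin.castAdd m j) * y j else 0 := by
    intro j
    rcases lt_trichotomy j i with h | rfl | h
    · simp [h, h.ne]
    · simp [gsCoeff_self hb]
    · simp [h.ne', h.not_gt, gsCoeff_of_lt b (show Fin.castAdd m i < Fin.castAdd m j from h)]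
  refine Eq.trans ?_ (sum_congr rfl fun j _ => (h3 j).symm)
  simp [sum_add_distrib, y]

/-- The orthogonal splitting of the lattice vector with coordinates `(ξ, y)`. -/
theorem norm_sq_append (hb : LinearIndependent ℝ b) (ξ : Fin k → ℤ) (y : Fin m → ℤ) :
    ‖∑ i, ((Fin.append ξ y i : ℤ) : ℝ) • b i‖ ^ 2 =
      triForm (fun i => ‖gramSchmidt ℝ b (Fin.castAdd m i)‖ ^ 2)
        (fun i j => gsCoeff b (Fin.castAdd m j) (Fin.castAdd m i))
        (fun i => ∑ j, gsCoeff b (Fin.natAdd k j) (Fin.castAdd m i) * (y j : ℝ)) ξ +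
      ∑ j : Fin m, ‖gramSchmidt ℝ b (Fin.natAdd k j)‖ ^ 2 *
        (∑ i, (y i : ℝ) * gsCoeff b (Fin.natAdd k i) (Fin.natAdd k j)) ^ 2 := by
  rw [norm_sq_sum hb, Fin.sum_univ_add]
  congr 1
  · refine sum_congr rfl fun j _ => ?_
    rw [Fin.sum_univ_add]
    simp only [Fin.append_left, Fin.append_right]
    rw [sum_unitri (a := fun i j : Fin k => gsCoeff b (Fin.castAdd m i) (Fin.castAdd m j))
      (fun i => gsCoeff_self hb _) (fun i j h => gsCoeff_of_lt b h)]
    simp only [mul_comm (y _ : ℝ)]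
  · refine sum_congr rfl fun j _ => ?_
    have h2 : ∀ i : Fin k, gsCoeff b (Fin.castAdd m i) (Fin.natAdd k j) = 0 := fun i =>
      gsCoeff_of_lt b (by simp only [Fin.lt_def, Fin.val_castAdd, Fin.val_natAdd]; omega)
    rw [Fin.sum_univ_add]
    simp [h2]

/-- Poisson summation over the sublattice spanned by the first `k` vectors turns the theta sum of
the lattice into a sum of `exp (-π Q₁) cos (2 π Q₂)`, which is at least `1`: the part of the theta
sum that lies in the sublattice becomes a theta sum of the dual lattice. -/
theorem theta_hybrid (hb : LinearIndependent ℝ b)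
    (hc : ∀ l, c l ∈ Submodule.span ℝ (Set.range fun i : Fin k => b (Fin.castAdd m i)))
    (hcb : ∀ l i, inner ℝ (c l) (b (Fin.castAdd m i)) = if l = i then 1 else 0)
    {Q1 Q2 : (Fin (k + m) → ℤ) → ℝ} (hs : Summable fun x => Real.exp (-(Real.pi * Q1 x)))
    (hQ1 : ∀ x, Q1 x = ∑ j : Fin m, ‖gramSchmidt ℝ b (Fin.natAdd k j)‖ ^ 2 *
        (∑ i, (x (Fin.natAdd k i) : ℝ) * gsCoeff b (Fin.natAdd k i) (Fin.natAdd k j)) ^ 2 +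
      ‖∑ l, (x (Fin.castAdd m l) : ℝ) • c l‖ ^ 2)
    (hQ2 : ∀ x, Q2 x = ∑ l, ∑ j : Fin m, ∑ i : Fin k,
      gsCoeff b (Fin.natAdd k j) (Fin.castAdd m i) *
        inner ℝ (c l) (gramSchmidt ℝ b (Fin.castAdd m i)) *
        (x (Fin.castAdd m l) * x (Fin.natAdd k j))) :
    (∏ i : Fin k, ‖gramSchmidt ℝ b (Fin.castAdd m i)‖) *
        ∑' x : Fin (k + m) → ℤ, Real.exp (-(Real.pi * ‖∑ i, (x i : ℝ) • b i‖ ^ 2)) =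
      ∑' x, Real.exp (-(Real.pi * Q1 x)) * Real.cos (2 * Real.pi * Q2 x) ∧
    1 ≤ ∑' x, Real.exp (-(Real.pi * Q1 x)) * Real.cos (2 * Real.pi * Q2 x) := by
  set γ : ℝ := ∏ i : Fin k, ‖gramSchmidt ℝ b (Fin.castAdd m i)‖ with hγ
  have hγ0 : 0 < γ := prod_pos fun i _ => gs_norm_pos hb _
  set A : Fin k → ℝ := fun i => ‖gramSchmidt ℝ b (Fin.castAdd m i)‖ ^ 2 with hA
  have hA0 : ∀ i, 0 < A i := fun i => pow_pos (gs_norm_pos hb _) 2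
  have hγA : ∏ i, Real.sqrt (A i) = γ :=
    prod_congr rfl fun i _ => Real.sqrt_sq (norm_nonneg _)
  set o : Fin k → Fin k → ℝ := fun i j => gsCoeff b (Fin.castAdd m j) (Fin.castAdd m i) with ho
  set t : (Fin m → ℤ) → Fin k → ℝ := fun y i =>
    ∑ j, gsCoeff b (Fin.natAdd k j) (Fin.castAdd m i) * (y j : ℝ) with ht
  set R : (Fin m → ℤ) → ℝ := fun y => ∑ j : Fin m, ‖gramSchmidt ℝ b (Fin.natAdd k j)‖ ^ 2 *
        (∑ i, (y i : ℝ) * gsCoeff b (Fin.natAdd k i) (Fin.natAdd k j)) ^ 2 with hR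
  set ζ : (Fin k → ℤ) → Fin k → ℝ := fun η i =>
    inner ℝ (∑ l, (η l : ℝ) • c l) (gramSchmidt ℝ b (Fin.castAdd m i)) with hζ
  have hdual : IsDualCoord o ζ := isDualCoord_inner hb hcb
  have hpars : ∀ η : Fin k → ℤ, ∑ i, ζ η i ^ 2 / A i = ‖∑ l, (η l : ℝ) • c l‖ ^ 2 := fun η =>
    (norm_sq_of_mem_span hb (Submodule.sum_mem _ fun l _ => Submodule.smul_mem _ _ (hc l))).symm
  -- the coordinates on the dual of the sublattice, followed by the remaining coordinates
  let e := Fin.appendEquiv (α := ℤ) k m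
  have he : ∀ q, e q = Fin.append q.1 q.2 := fun q => rfl
  have eQ1 : ∀ q, Q1 (e q) = R q.2 + ∑ i, ζ q.1 i ^ 2 / A i := fun q => by
    rw [hQ1, hpars, he]; simp [hR]
  have eQ2 : ∀ q, Q2 (e q) = ∑ i, ζ q.1 i * t q.2 i := fun q => by
    rw [hQ2, he]
    simp only [Fin.append_left, Fin.append_right]
    have h1 : ∀ i, ζ q.1 i * t q.2 i = ∑ l, ∑ j : Fin m,
        gsCoeff b (Fin.natAdd k j) (Fin.castAdd m i) *
        inner ℝ (c l) (gramSchmidt ℝ b (Fin.castAdd m i)) * (q.1 l * q.2 j) := fun i => by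
      simp only [hζ, ht, sum_inner, sum_mul_sum, real_inner_smul_left]
      exact sum_congr rfl fun l _ => sum_congr rfl fun j _ => by ring
    simp_rw [h1]
    symm
    rw [sum_comm]
    refine sum_congr rfl fun l _ => ?_
    rw [sum_comm]
  have hN : Summable fun x : Fin (k + m) → ℤ =>
      Real.exp (-(Real.pi * ‖∑ i, (x i : ℝ) • b i‖ ^ 2)) := by
    simp_rw [norm_sq_eq_triForm hb, mul_triForm]
    exact (triForm_summable (fun i => mul_pos Real.pi_pos (pow_pos (gs_norm_pos hb i) 2)) _ _).1
  have hNe : ∀ ξ y, Real.exp (-(Real.pi * ‖∑ i, ((e (ξ, y) i : ℤ) : ℝ) • b i‖ ^ 2)) =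
      Real.exp (-(Real.pi * R y)) * Real.exp (-(Real.pi * triForm A o (t y) ξ)) := fun ξ y => by
    rw [he, norm_sq_append hb, ← Real.exp_add]
    congr 1
    simp only [hA, ho, ht, hR]
    ring
  have hsplit : ∑' x : Fin (k + m) → ℤ, Real.exp (-(Real.pi * ‖∑ i, (x i : ℝ) • b i‖ ^ 2)) =
      ∑' y, Real.exp (-(Real.pi * R y)) * ∑' ξ, Real.exp (-(Real.pi * triForm A o (t y) ξ)) := by
    rw [← ((Equiv.prodComm _ _).trans e).tsum_eq]
    refine (((Equiv.prodComm _ _).trans e).summable_iff.2 hN).tsum_prod.trans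
      (tsum_congr fun y => ?_)
    rw [← tsum_mul_left]
    exact tsum_congr fun ξ => hNe ξ y
  have hH : Summable fun x => Complex.exp (-(Real.pi * Q1 x : ℝ) +
      ((2 * Real.pi * Q2 x : ℝ) : ℂ) * Complex.I) := by
    rw [← summable_norm_iff]
    exact hs.congr fun x => (norm_cexp_add _ _).symm
  have hmain : ((∑' x : Fin (k + m) → ℤ,
      Real.exp (-(Real.pi * ‖∑ i, (x i : ℝ) • b i‖ ^ 2)) : ℝ) : ℂ) =
      (γ⁻¹ : ℝ) * ∑' x, Complex.exp (-(Real.pi * Q1 x : ℝ) +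
      ((2 * Real.pi * Q2 x : ℝ) : ℂ) * Complex.I) := by
    rw [hsplit, Complex.ofReal_tsum, ← ((Equiv.prodComm _ _).trans e).tsum_eq,
      ← tsum_mul_left]
    refine Eq.trans ?_
      ((((Equiv.prodComm _ _).trans e).summable_iff.2 hH).mul_left _).tsum_prod.symm
    refine tsum_congr fun y => ?_
    rw [Complex.ofReal_mul, poisson_tri hA0 o (t y) hdual, hγA, mul_left_comm, tsum_mul_left]
    congr 1
    rw [← tsum_mul_left]
    refine tsum_congr fun η => ?_
    change _ = Complex.exp (-(Real.pi * Q1 (e (η, y)) : ℝ) +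
      ((2 * Real.pi * Q2 (e (η, y)) : ℝ) : ℂ) * Complex.I)
    rw [eQ1, eQ2, Complex.ofReal_exp, ← Complex.exp_add]
    congr 1
    push_cast
    ring
  have hre : γ * ∑' x : Fin (k + m) → ℤ, Real.exp (-(Real.pi * ‖∑ i, (x i : ℝ) • b i‖ ^ 2)) =
      ∑' x, Real.exp (-(Real.pi * Q1 x)) * Real.cos (2 * Real.pi * Q2 x) := by
    have h1 := congrArg (fun z : ℂ => γ * z.re) hmain
    simp only [Complex.ofReal_re, Complex.re_ofReal_mul] at h1
    rw [h1, mul_inv_cancel_left₀ hγ0.ne', ← (Complex.hasSum_re hH.hasSum).tsum_eq]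
    refine tsum_congr fun x => ?_
    rw [Complex.exp_re]
    simp
  -- the points of the sublattice alone contribute, by Poisson summation, the theta sum of the dual
  -- lattice divided by `γ`, whose zero vector contributes `1`
  refine ⟨hre, hre ▸ ?_⟩
  have hsub : ∑' ξ, Real.exp (-(Real.pi * triForm A o 0 ξ)) ≤
      ∑' x : Fin (k + m) → ℤ, Real.exp (-(Real.pi * ‖∑ i, (x i : ℝ) • b i‖ ^ 2)) := by
    have hinj : Function.Injective fun ξ : Fin k → ℤ => e (ξ, 0) := fun ξ ξ' h => by
      simpa using e.injective h
    have h0 : ∀ ξ, Real.exp (-(Real.pi * triForm A o 0 ξ)) =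
        Real.exp (-(Real.pi * ‖∑ i, ((e (ξ, 0) i : ℤ) : ℝ) • b i‖ ^ 2)) := fun ξ => by
      have ht0 : t 0 = 0 := by ext i; simp [ht]
      have hR0 : R 0 = 0 := by simp [hR]
      rw [hNe, ht0, hR0]; simp
    simp_rw [h0]
    exact tsum_comp_le_tsum_of_inj hN (fun _ => (Real.exp_pos _).le) hinj
  have hdualsum : γ * ∑' ξ, Real.exp (-(Real.pi * triForm A o 0 ξ)) =
      ∑' η, Real.exp (-∑ i, Real.pi / A i * ζ η i ^ 2) := by
    have h1 := poisson_tri hA0 o 0 hdual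
    have h2 : ∀ η, Complex.exp (-(Real.pi * ∑ i, ζ η i ^ 2 / A i : ℝ) +
        ((2 * Real.pi * ∑ i, ζ η i * (0 : Fin k → ℝ) i : ℝ) : ℂ) * Complex.I) =
        (Real.exp (-∑ i, Real.pi / A i * ζ η i ^ 2) : ℝ) := fun η => by
      rw [Complex.ofReal_exp]
      congr 1
      have : Real.pi * ∑ i, ζ η i ^ 2 / A i = ∑ i, Real.pi / A i * ζ η i ^ 2 := by
        rw [mul_sum]; exact sum_congr rfl fun i _ => by ring
      rw [this]
      simp
    simp_rw [h2] at h1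
    rw [← Complex.ofReal_tsum, hγA, ← Complex.ofReal_mul, Complex.ofReal_inj] at h1
    rw [h1, mul_inv_cancel_left₀ hγ0.ne']
  refine le_trans ?_ (mul_le_mul_of_nonneg_left hsub hγ0.le)
  rw [hdualsum]
  have h3 := (hdual.summable fun i => div_pos Real.pi_pos (hA0 i)).le_tsum 0
    fun _ _ => (Real.exp_pos _).le
  refine le_trans (le_of_eq ?_) h3
  simp [hζ]

end Hybrid

end GramSchmidtLLL

namespace ArakelovAlg

set_option linter.unusedSectionVars false

open GramSchmidtLLL Finset

variable {E : Type*} [NormedAddCommGroup E] [InnerProductSpace ℝ E] {n : ℕ}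

/-! ### The quadratic forms of the Poisson step -/

/-- `Q` consists of the forms obtained from the basis `b` by Poisson summation over the span of the
first `k` vectors, where `k` is the number of leading Gram-Schmidt vectors shorter than `1`, and `c`
is the basis of that span dual to `b₁, …, b_k`. -/
structure HybridForms (b : Fin n → E) {k : ℕ} (hk : k ≤ n) (c : Fin k → E) (Q : Forms n) :
    Prop where
  small : ∀ i : Fin n, i.val < k → ‖InnerProductSpace.gramSchmidt ℝ b i‖ < 1
  large : ∀ i : Fin n, i.val = k → 1 ≤ ‖InnerProductSpace.gramSchmidt ℝ b i‖
  mem_span : ∀ l, c l ∈ Submodule.span ℝ (Set.range fun i : Fin k => b (Fin.castLE hk i))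
  dual : ∀ l i, inner ℝ (c l) (b (Fin.castLE hk i)) = if l = i then 1 else 0
  diag_eq : ∀ i, Q.diag i = if h : i.val < k then
    ‖InnerProductSpace.gramSchmidt ℝ c ⟨i, h⟩‖ ^ 2 else ‖InnerProductSpace.gramSchmidt ℝ b i‖ ^ 2
  off_eq : ∀ i j, Q.off i j = if hi : i.val < k then
    (if hj : j.val < k then gsCoeff c ⟨j, hj⟩ ⟨i, hi⟩ else 0) else gsCoeff b j i
  mixed_eq : ∀ l j, Q.mixed l j = if hl : l.val < k then (if j.val < k then 0 else
    ∑ i : Fin k, gsCoeff b j (Fin.castLE hk i) *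
      inner ℝ (c ⟨l, hl⟩) (InnerProductSpace.gramSchmidt ℝ b (Fin.castLE hk i))) else 0
  γ_eq : Q.γ = Real.sqrt (∏ i : Fin k,
    ‖InnerProductSpace.gramSchmidt ℝ b (Fin.castLE hk i)‖ ^ 2)

/-- The real part of the form `Q`. -/
noncomputable def Forms.q1 (Q : Forms n) (x : Fin n → ℤ) : ℝ := triForm Q.diag Q.off 0 x

/-- Half the imaginary part of the form `Q`. -/
noncomputable def Forms.q2 (Q : Forms n) (x : Fin n → ℤ) : ℝ :=
  ∑ l, ∑ j, Q.mixed l j * ((x l : ℝ) * x j)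

theorem dual_linearIndependent {k : ℕ} {c d : Fin k → E}
    (h : ∀ l i, inner ℝ (c l) (d i) = if l = i then (1 : ℝ) else 0) : LinearIndependent ℝ c := by
  rw [Fintype.linearIndependent_iff]
  intro g hg i
  have := congrArg (fun z => inner ℝ z (d i)) hg
  simpa [sum_inner, real_inner_smul_left, h] using this

/-- The Gram-Schmidt vectors of a dual basis are not too short. -/
theorem one_le_norm_gs_dual {k : ℕ} {c d : Fin k → E}
    (h : ∀ l i, inner ℝ (c l) (d i) = if l = i then (1 : ℝ) else 0) (i : Fin k) :
    1 ≤ ‖InnerProductSpace.gramSchmidt ℝ c i‖ * ‖d i‖ := by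
  have h0 : ∀ z ∈ Submodule.span ℝ (c '' Set.Iio i), inner ℝ z (d i) = (0 : ℝ) := by
    intro z hz
    induction hz using Submodule.span_induction with
    | mem x hx =>
      obtain ⟨j, hj, rfl⟩ := hx
      rw [h, if_neg (ne_of_lt hj)]
    | zero => exact inner_zero_left _
    | add x y _ _ hx hy => rw [inner_add_left, hx, hy, add_zero]
    | smul a x _ hx => rw [real_inner_smul_left, hx, mul_zero]
  have h1 := h0 _ (sub_gs_mem c i)
  rw [inner_sub_left, h, if_pos rfl, sub_eq_zero] at h1
  rw [h1]
  exact real_inner_le_norm _ _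

namespace HybridForms

variable {b : Fin n → E} {k : ℕ} {hk : k ≤ n} {c : Fin k → E} {Q : Forms n}

theorem linearIndependent (H : HybridForms b hk c Q) : LinearIndependent ℝ c :=
  dual_linearIndependent H.dual

theorem diag_pos (H : HybridForms b hk c Q) (hb : LinearIndependent ℝ b) (i : Fin n) :
    0 < Q.diag i := by
  rw [H.diag_eq]
  split_ifs with h
  · exact pow_pos (gs_norm_pos H.linearIndependent _) 2
  · exact pow_pos (gs_norm_pos hb _) 2

theorem γ_pos (H : HybridForms b hk c Q) (hb : LinearIndependent ℝ b) : 0 < Q.γ := by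
  rw [H.γ_eq]
  exact Real.sqrt_pos.2 (prod_pos fun i _ => pow_pos (gs_norm_pos hb _) 2)

theorem summable_q1 (H : HybridForms b hk c Q) (hb : LinearIndependent ℝ b) {a : ℝ} (ha : 0 < a) :
    Summable fun x => Real.exp (-(a * Q.q1 x)) := by
  simp_rw [Forms.q1, mul_triForm]
  exact (triForm_summable (fun i => mul_pos ha (H.diag_pos hb i)) _ _).1

theorem theta (H : HybridForms b hk c Q) (hb : LinearIndependent ℝ b) :
    Q.γ * ∑' x : Fin n → ℤ, Real.exp (-(Real.pi * ‖∑ i, (x i : ℝ) • b i‖ ^ 2)) =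
      ∑' x, Real.exp (-(Real.pi * Q.q1 x)) * Real.cos (2 * Real.pi * Q.q2 x) ∧
    1 ≤ ∑' x, Real.exp (-(Real.pi * Q.q1 x)) * Real.cos (2 * Real.pi * Q.q2 x) := by
  have hs := H.summable_q1 hb Real.pi_pos
  have hc := H.linearIndependent
  obtain ⟨m, rfl⟩ := Nat.exists_eq_add_of_le hk
  have hγ : Q.γ = ∏ i : Fin k, ‖InnerProductSpace.gramSchmidt ℝ b (Fin.castAdd m i)‖ := by
    rw [H.γ_eq, prod_pow]
    exact Real.sqrt_sq (prod_nonneg fun i _ => norm_nonneg _)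
  rw [hγ]
  have nlt : ∀ (i : Fin k) (j : Fin m), ¬ Fin.natAdd k j < Fin.castAdd m i := fun i j => by
    simp only [Fin.lt_def, Fin.val_castAdd, Fin.val_natAdd]; omega
  have hlt : ∀ i j : Fin k, (Fin.castAdd m i < Fin.castAdd m j) = (i < j) := fun _ _ => rfl
  refine theta_hybrid hb H.mem_span H.dual hs (fun x => ?_) fun x => ?_
  · rw [norm_sq_eq_triForm hc, Forms.q1, triForm, Fin.sum_univ_add, add_comm]
    congr 1
    · refine sum_congr rfl fun j _ => ?_
      rw [sum_unitri
        (a := fun i j : Fin m => gsCoeff b (Fin.natAdd k i) (Fin.natAdd k j))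
        (x := fun i => (x (Fin.natAdd k i) : ℝ))
        (fun i => gsCoeff_self hb _) (fun i j h => gsCoeff_of_lt b (by simpa using h)),
        Fin.sum_univ_add]
      simp [H.diag_eq, H.off_eq, nlt]
    · refine sum_congr rfl fun i _ => ?_
      rw [Fin.sum_univ_add]
      simp [H.diag_eq, H.off_eq, hlt]
  · rw [Forms.q2, Fin.sum_univ_add]
    simp [H.mixed_eq, Fin.sum_univ_add, sum_mul]
    rfl

/-- Reducedness bounds the pivots of the form from below, in terms of the dimension only. -/
theorem diag_ge (H : HybridForms b hk c Q) (hb : LinearIndependent ℝ b) (hr : LLLReduced b)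
    (i : Fin n) : 1 / 2 ^ i.val ≤ Q.diag i := by
  rw [H.diag_eq]
  split_ifs with h
  · have h1 := one_le_norm_gs_dual H.dual ⟨i, h⟩
    have h2 := norm_sq_le_of_size hb (hr.size i)
    have h3 : ∑ j ∈ Iic i, ‖InnerProductSpace.gramSchmidt ℝ b j‖ ^ 2 ≤ (i.val : ℝ) + 1 := by
      refine (sum_le_card_nsmul _ _ 1 fun j hj => ?_).trans (by simp)
      exact pow_le_one₀ (norm_nonneg _) (H.small j (lt_of_le_of_lt (Fin.le_def.1 (mem_Iic.1 hj)) h)).le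
    have h4 : (i.val : ℝ) + 1 ≤ 2 ^ i.val := by exact_mod_cast Nat.lt_two_pow_self
    set g := ‖InnerProductSpace.gramSchmidt ℝ c ⟨i, h⟩‖
    have h5 : (1 : ℝ) ≤ (g * ‖b i‖) ^ 2 := one_le_pow₀ h1
    rw [div_le_iff₀ (by positivity)]
    rw [mul_pow] at h5
    exact h5.trans (mul_le_mul_of_nonneg_left (h2.trans (h3.trans h4)) (sq_nonneg g))
  · push Not at h
    have hkn : k < n := lt_of_le_of_lt h i.isLt
    have h1 := hr.norm_gs_le (i := ⟨k, hkn⟩) (j := i) h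
    have h2 : (1 : ℝ) ≤ ‖InnerProductSpace.gramSchmidt ℝ b ⟨k, hkn⟩‖ ^ 2 :=
      one_le_pow₀ (H.large _ rfl)
    rw [div_le_iff₀ (by positivity)]
    have h3 : (2 : ℝ) ^ (i.val - k) ≤ 2 ^ i.val := pow_le_pow_right₀ (by norm_num) (Nat.sub_le _ _)
    have := mul_le_mul_of_nonneg_right h3
      (sq_nonneg ‖InnerProductSpace.gramSchmidt ℝ b i‖)
    simp only at h1
    linarith

/-- Reducedness bounds the off-diagonal coefficients in terms of the dimension only, although the
dual vectors themselves can be arbitrarily long. -/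
theorem abs_off_le (H : HybridForms b hk c Q) (hb : LinearIndependent ℝ b) (hr : LLLReduced b)
    {i j : Fin n} (hij : i < j) : |Q.off i j| ≤ 8 ^ n := by
  have h8 : (1 : ℝ) ≤ 8 ^ n := one_le_pow₀ (by norm_num)
  rw [H.off_eq]
  split_ifs with hi hj
  · have hc := H.linearIndependent
    obtain ⟨m, rfl⟩ := Nat.exists_eq_add_of_le hk
    set gs := fun l : Fin k => InnerProductSpace.gramSchmidt ℝ b (Fin.castAdd m l) with hgs
    have hgs0 : ∀ l, 0 < ‖gs l‖ := fun l => gs_norm_pos hb _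
    -- the coordinates of `c j` in the orthogonal basis, up to scaling
    set w : Fin k → ℝ := fun l => inner ℝ (c ⟨j, hj⟩) (gs l) with hw
    have hwl : ∀ l : Fin k, w l = (if l = (⟨j, hj⟩ : Fin k) then 1 else 0) - ∑ p : Fin k, if p < l
        then gsCoeff b (Fin.castAdd m l) (Fin.castAdd m p) * w p else 0 := by
      intro l
      have h := isDualCoord_inner hb H.dual (Pi.single ⟨j, hj⟩ 1) l
      have hz : ∑ q : Fin k, (((Pi.single ⟨j, hj⟩ 1 : Fin k → ℤ) q : ℤ) : ℝ) • c q =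
          c ⟨j, hj⟩ := by
        simp [Pi.single_apply]
      simp only [hz] at h
      rw [Pi.single_apply] at h
      push_cast at h
      exact eq_sub_of_add_eq h
    -- forward substitution in the unipotent system `hwl` with coefficients at most `1 / 2`
    have hw0 : ∀ l : Fin k, l.val < j.val → w l = 0 := by
      intro l
      induction l using WellFoundedLT.induction with
      | _ l ih =>
        intro hl
        rw [hwl, if_neg (by rintro rfl; exact lt_irrefl _ hl), sum_eq_zero, sub_zero]
        intro p _
        split_ifs with hm
        · rw [ih p hm (lt_trans hm hl), mul_zero]
        · rfl
    have hwb : ∀ l : Fin k, |w l| ≤ 2 ^ l.val := by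
      intro l
      induction l using WellFoundedLT.induction with
      | _ l ih =>
        have h1 : |∑ p : Fin k, if p < l
            then gsCoeff b (Fin.castAdd m l) (Fin.castAdd m p) * w p else 0| ≤
            ∑ p : Fin k, if p.val < l.val then (2 : ℝ) ^ p.val / 2 else 0 := by
          refine (abs_sum_le_sum_abs _ _).trans (sum_le_sum fun p _ => ?_)
          by_cases hp : p < l
          · rw [if_pos hp, if_pos (Fin.lt_def.1 hp), abs_mul]
            have := mul_le_mul (hr.size (Fin.castAdd m l) (Fin.castAdd m p) hp) (ih p hp)
              (abs_nonneg _) (by norm_num)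
            linarith
          · rw [if_neg hp, if_neg (mt Fin.lt_def.2 hp), abs_zero]
        have h2 : ∑ p : Fin k, (if p.val < l.val then (2 : ℝ) ^ p.val / 2 else 0) =
            (2 ^ l.val - 1) / 2 := by
          rw [Fin.sum_univ_eq_sum_range (fun p => if p < l.val then (2 : ℝ) ^ p / 2 else 0),
            ← sum_filter, show (range k).filter (· < l.val) = range l.val by
              ext p; simp only [mem_filter, mem_range]; have := l.isLt; omega,
            ← sum_div, geom_sum_eq (by norm_num)]
          norm_num
        have h3 : |(if l = (⟨j, hj⟩ : Fin k) then (1 : ℝ) else 0)| ≤ 1 := by split_ifs <;> simp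
        have h4 : (1 : ℝ) ≤ 2 ^ l.val := one_le_pow₀ (by norm_num)
        rw [hwl]
        refine (abs_sub _ _).trans ?_
        linarith
    have hcj : ‖c ⟨j, hj⟩‖ ^ 2 = ∑ l, w l ^ 2 / ‖gs l‖ ^ 2 :=
      norm_sq_of_mem_span hb (H.mem_span _)
    have hbi := norm_sq_le_of_size hb (hr.size i)
    have h1 := one_le_norm_gs_dual H.dual ⟨i, hi⟩
    have h2 := abs_gsCoeff_le hc ⟨j, hj⟩ ⟨i, hi⟩
    have hpos := gs_norm_pos hc ⟨i, hi⟩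
    -- `c j` involves only the Gram-Schmidt vectors from index `j` on, `b i` only those up to `i < j`,
    -- and in a reduced basis the former are not much shorter than the latter
    have hprod : (‖c ⟨j, hj⟩‖ * ‖b i‖) ^ 2 ≤ (8 ^ (k + m)) ^ 2 := by
      rw [mul_pow, hcj]
      refine (mul_le_mul_of_nonneg_left hbi (by positivity)).trans ?_
      rw [sum_mul_sum]
      have hterm : ∀ l ∈ (univ : Finset (Fin k)), ∀ p ∈ Iic i, w l ^ 2 / ‖gs l‖ ^ 2 *
          ‖InnerProductSpace.gramSchmidt ℝ b p‖ ^ 2 ≤ 8 ^ (k + m) := by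
        intro l _ p hp
        by_cases hl : l.val < j.val
        · rw [hw0 l hl]; simp
        · push Not at hl
          have hpl : p ≤ Fin.castAdd m l :=
            (mem_Iic.1 hp).trans (hij.le.trans (Fin.le_def.2 hl))
          have h3 := hr.norm_gs_le' hpl
          have h4 : w l ^ 2 ≤ 4 ^ (k + m) := by
            rw [← sq_abs]
            refine (pow_le_pow_left₀ (abs_nonneg _) (hwb l) 2).trans ?_
            rw [← pow_mul, mul_comm, pow_mul]
            norm_num
            exact pow_le_pow_right₀ (by norm_num) (by omega)
          rw [div_mul_eq_mul_div, div_le_iff₀ (pow_pos (hgs0 l) 2),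
            show (8 : ℝ) = 4 * 2 by norm_num, mul_pow, mul_assoc]
          exact mul_le_mul h4 h3 (sq_nonneg _) (by positivity)
      refine (sum_le_sum fun l hl => sum_le_card_nsmul _ _ _ (hterm l hl)).trans ?_
      simp only [sum_const, card_univ, Fintype.card_fin, nsmul_eq_mul, Fin.card_Iic]
      have h5 : (k : ℝ) ≤ 2 ^ (k + m) := by
        exact_mod_cast (Nat.le_add_right k m).trans Nat.lt_two_pow_self.le
      have h6 : ((i.val + 1 : ℕ) : ℝ) ≤ 2 ^ (k + m) := by
        exact_mod_cast (Nat.succ_le_of_lt i.isLt).trans Nat.lt_two_pow_self.le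
      have h7 : (k : ℝ) * (i.val + 1 : ℕ) ≤ 4 ^ (k + m) := by
        refine (mul_le_mul h5 h6 (by positivity) (by positivity)).trans ?_
        rw [← mul_pow]; norm_num
      have h9 : (4 : ℝ) ^ (k + m) ≤ 8 ^ (k + m) :=
        pow_le_pow_left₀ (by norm_num) (by norm_num) _
      rw [← mul_assoc, sq]
      exact mul_le_mul_of_nonneg_right (h7.trans h9) (by positivity)
    refine h2.trans ?_
    rw [div_le_iff₀ hpos]
    have h3 := le_of_sq_le_sq hprod (by positivity)
    have h4 : Fin.castLE hk ⟨i, hi⟩ = i := rfl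
    rw [h4] at h1
    have hb0 : 0 < ‖b i‖ := norm_pos_iff.2 (hb.ne_zero i)
    nlinarith [norm_nonneg (c ⟨j, hj⟩)]
  · simp
  · exact (hr.size j i hij).trans (by linarith)

/-- The `Q₁`-theta sum is bounded in terms of the dimension only. -/
theorem tsum_q1_le (H : HybridForms b hk c Q) (hb : LinearIndependent ℝ b) (hr : LLLReduced b) :
    ∑' x, Real.exp (-Q.q1 x) ≤ 4 ^ n * 2 ^ (n * (n - 1) / 2) := by
  refine (triForm_summable (fun i => H.diag_pos hb i) _ _).2.trans ?_
  have h1 : ∀ i ∈ (univ : Finset (Fin n)), 2 * (1 + 1 / Q.diag i) ≤ 4 * 2 ^ i.val := by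
    intro i _
    have h2 := H.diag_ge hb hr i
    have h3 : 1 / Q.diag i ≤ 2 ^ i.val := by
      rw [div_le_iff₀ (H.diag_pos hb i)]
      rwa [div_le_iff₀ (by positivity), mul_comm] at h2
    have h4 : (1 : ℝ) ≤ 2 ^ i.val := one_le_pow₀ (by norm_num)
    linarith
  refine (prod_le_prod (fun i _ => ?_) h1).trans ?_
  · have := H.diag_pos hb i
    positivity
  · rw [prod_mul_distrib, prod_const, card_univ, Fintype.card_fin, prod_pow_eq_pow_sum,
      Fin.sum_univ_eq_sum_range (fun i => i), sum_range_id]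

/-- Truncating the sum at `Q₁ ≤ M` costs at most `exp (-(π - 1) M)` times a constant depending on
the dimension. -/
theorem truncation (H : HybridForms b hk c Q) (hb : LinearIndependent ℝ b) (hr : LLLReduced b)
    {M : ℝ} {s : Finset (Fin n → ℤ)} (hs : ∀ x, x ∈ s ↔ Q.q1 x ≤ M) :
    |∑' x, Real.exp (-(Real.pi * Q.q1 x)) * Real.cos (2 * Real.pi * Q.q2 x) -
      ∑ x ∈ s, Real.exp (-(Real.pi * Q.q1 x)) * Real.cos (2 * Real.pi * Q.q2 x)| ≤
    Real.exp (-((Real.pi - 1) * M)) * (4 ^ n * 2 ^ (n * (n - 1) / 2)) := by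
  set f : (Fin n → ℤ) → ℝ := fun x =>
    Real.exp (-(Real.pi * Q.q1 x)) * Real.cos (2 * Real.pi * Q.q2 x) with hf
  have hfb : ∀ x, ‖f x‖ ≤ Real.exp (-(Real.pi * Q.q1 x)) := fun x => by
    rw [hf, norm_mul, Real.norm_eq_abs, Real.abs_exp]
    exact mul_le_of_le_one_right (Real.exp_pos _).le (Real.abs_cos_le_one _)
  have hfs : Summable f := Summable.of_norm_bounded (H.summable_q1 hb Real.pi_pos) hfb
  have hq : Summable fun x => Real.exp (-Q.q1 x) := by
    simpa using H.summable_q1 hb one_pos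
  set C := Real.exp (-((Real.pi - 1) * M)) with hC
  have hg : ∀ x : {x // x ∉ s}, ‖f x‖ ≤ C * Real.exp (-Q.q1 x) := fun x => by
    refine (hfb x).trans ?_
    rw [hC, ← Real.exp_add, Real.exp_le_exp]
    have h1 : M < Q.q1 x := not_le.1 fun h => x.2 ((hs _).2 h)
    have h2 : (0 : ℝ) < Real.pi - 1 := by linarith [Real.pi_gt_three]
    nlinarith
  have hsub := (hq.mul_left C).subtype (fun x => x ∉ s)
  rw [← hfs.sum_add_tsum_subtype_compl s, add_sub_cancel_left]
  refine (tsum_of_norm_bounded (f := fun x : {x // x ∉ s} => f x) hsub.hasSum hg).trans ?_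
  refine ((hq.mul_left C).tsum_subtype_le _ (fun x => x ∉ s)
    (fun x => mul_nonneg (Real.exp_pos _).le (Real.exp_pos _).le)).trans ?_
  rw [tsum_mul_left]
  exact mul_le_mul_of_nonneg_left (H.tsum_q1_le hb hr) (Real.exp_pos _).le

end HybridForms

end ArakelovAlg

namespace ArakelovAlg

set_option linter.unusedSectionVars false

open GramSchmidtLLL Finset

variable {n : ℕ}

/-! ### Running time of the Poisson step -/

theorem leadingSmall_runs (m : ℕ) (A : Fin m → ℝ) : Runs (leadingSmall m A) (m * 4) fun k =>
    (∀ i : Fin m, i.val < k.val → A i < 1) ∧ ∀ i : Fin m, i.val = k.val → 1 ≤ A i := by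
  induction m with
  | zero => exact Runs.pure ⟨fun i => i.elim0, fun i => i.elim0⟩
  | succ m ih =>
    have hb : bits 1 = 2 := by decide
    refine Runs.le (T := 2 + (1 + (m * 4 + 1))) (Runs.le (Runs.prim_bind (Runs.prim_bind
      (T := m * 4 + 1) ?_)) (by omega)) (by omega)
    by_cases h : A 0 < 1
    · simp only [Int.cast_one, h, decide_true, if_true]
      refine (ih fun i => A i.succ).bind fun k hk => Runs.prim ⟨fun i => ?_, fun i => ?_⟩
      · refine Fin.cases (fun _ => h) (fun i hi => hk.1 i ?_) i
        simpa using hi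
      · refine Fin.cases (fun h0 => ?_) (fun i hi => hk.2 i ?_) i
        · simp at h0
        · simpa using hi
    · simp only [Int.cast_one, h, decide_false, Bool.false_eq_true, if_false]
      refine Runs.le (Runs.pure ⟨fun i hi => ?_, fun i hi => ?_⟩) (Nat.zero_le _)
      · simp at hi
      · rw [show i = 0 from Fin.ext hi]; exact not_lt.1 h

/-- Cramer's rule for the dual basis. -/
theorem inner_cramer {E : Type*} [NormedAddCommGroup E] [InnerProductSpace ℝ E] {k : ℕ}
    {b : Fin k → E} (hb : LinearIndependent ℝ b) (l j : Fin k) :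
    inner ℝ (∑ i, ((Matrix.of fun p q => if q = i then (if p = l then (1 : ℝ) else 0) else
      inner ℝ (b p) (b q)).det / (Matrix.of fun p q => inner ℝ (b p) (b q)).det) • b i) (b j) =
    if l = j then (1 : ℝ) else 0 := by
  set G : Matrix (Fin k) (Fin k) ℝ := Matrix.of fun p q => inner ℝ (b p) (b q) with hG
  have hdet : G.det ≠ 0 := by
    have : G.det = ∏ i, ‖InnerProductSpace.gramSchmidt ℝ b i‖ ^ 2 := det_gram_eq hb
    rw [this]
    exact (prod_pos fun i _ => pow_pos (gs_norm_pos hb i) 2).ne'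
  have h1 : ∀ i, (Matrix.of fun p q => if q = i then (if p = l then (1 : ℝ) else 0) else
      inner ℝ (b p) (b q)).det = Matrix.cramer G (Pi.single l 1) i := fun i => by
    rw [Matrix.cramer_apply]
    congr 1
    ext p q
    simp [Matrix.updateCol_apply, Pi.single_apply, hG]
  have h2 := congrFun (Matrix.mulVec_cramer G (Pi.single l (1 : ℝ))) j
  rw [Matrix.mulVec, dotProduct, Pi.smul_apply, Pi.single_apply, smul_eq_mul] at h2
  rw [sum_inner]
  simp_rw [h1, real_inner_smul_left, div_mul_eq_mul_div]
  rw [← sum_div, div_eq_iff hdet]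
  refine Eq.trans (sum_congr rfl fun i _ => ?_) (h2.trans ?_)
  · rw [hG, Matrix.of_apply, real_inner_comm, mul_comm]
  · rw [mul_comm]
    congr 1
    simp only [eq_comm]

theorem filter_val_lt_succ {m : ℕ} (i : Fin m) : (univ.filter fun j : Fin m => j.val < i + 1) =
    insert i (univ.filter fun j : Fin m => j.val < i) := by
  ext j
  simp only [mem_filter, mem_univ, true_and, mem_insert, Fin.ext_iff]
  omega

/-- A linear combination, computed one term at a time. -/
theorem foldFin_subSmul_runs {inp : Input n} (h : inp.Wf) {k : ℕ} (y : Fin k → ℝ)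
    (b : Fin k → Vec inp.r) :
    Runs (foldFin k (fun i x => subSmul inp x (y i) (b i)) (fun _ => (0, 0))) (k * (5 * n + 1))
      (· = ∑ i, (-y i) • b i) := by
  refine Runs.mono (Runs.foldFin (c := 5 * n)
    (fun m s => s = ∑ i with i.val < m, (-y i) • b i) (fun i s hs => ?_) _ ?_) le_rfl ?_
  · refine (subSmul_runs h _ _ _).imp ?_
    rintro _ rfl
    rw [filter_val_lt_succ, sum_insert (by simp), ← hs, neg_smul]
    abel
  · simp; rfl
  · rintro s rfl
    rw [filter_true_of_mem fun i _ => i.isLt]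

theorem foldFin_rmul_runs {k : ℕ} (a : Fin k → ℝ) :
    Runs (foldFin k (fun i p => rmul p (a i)) 1) (k * 2) (· = ∏ i, a i) := by
  refine Runs.mono (Runs.foldFin (c := 1)
    (fun m s => s = ∏ i with i.val < m, a i) (fun i s hs => Runs.prim ?_) _ ?_) le_rfl ?_
  · rw [filter_val_lt_succ, prod_insert (by simp), ← hs, mul_comm]
  · simp
  · rintro s rfl
    rw [filter_true_of_mem fun i _ => i.isLt]

/-- The dual basis by Cramer's rule: a number of real operations that depends on the dimension alone. -/
theorem dualBasis_runs (n : ℕ) : ∃ D : ℕ, ∀ (inp : Input n), inp.Wf → ∀ (k : ℕ), k ≤ n →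
    ∀ (b : Fin k → Vec inp.r), LinearIndependent ℝ (fun i => toE inp.deg (b i)) →
    ∀ (G : Fin k → Fin k → ℝ),
    (G = fun i j => inner ℝ (toE inp.deg (b i)) (toE inp.deg (b j))) →
    Runs (do
      let dG ← rdet k G
      tab k fun l => do
        let y ← tab k fun i => do
          let e ← rdet k fun p q => if q = i then (if p = l then 1 else 0) else G p q
          rneg (← rdiv e dG)
        foldFin k (fun i x => subSmul inp x (y i) (b i)) (fun _ => (0, 0))) D fun c =>
      (∀ l, toE inp.deg (c l) ∈ Submodule.span ℝ (Set.range fun i => toE inp.deg (b i))) ∧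
      ∀ l i, inner ℝ (toE inp.deg (c l)) (toE inp.deg (b i)) = if l = i then (1 : ℝ) else 0 := by
  choose d hd using rdet_runs
  set D := ∑ m ∈ range (n + 1), d m with hD
  have hdD : ∀ {k}, k ≤ n → d k ≤ D := fun hk =>
    single_le_sum (f := d) (fun _ _ => Nat.zero_le _) (mem_range.2 (Nat.lt_succ_of_le hk))
  refine ⟨D + n * (n * (D + 2 + 1) + n * (5 * n + 1) + 1), fun inp h k hk b hb G hG => ?_⟩
  refine ((hd k G).le (hdD hk)).bind_eq (Runs.mono (Runs.tab (c := n * (D + 2 + 1) +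
    n * (5 * n + 1)) (P := fun l c => c = ∑ i, ((Matrix.of fun p q => if q = i then
      (if p = l then (1 : ℝ) else 0) else G p q).det / (Matrix.of G).det) • b i)
    fun l => ?_) (Nat.mul_le_mul_right _ hk) fun c hc => ?_)
  · refine Runs.bind_eq (Runs.le (Runs.tab_eq (c := D + 2) (g := fun i => -((Matrix.of fun p q =>
      if q = i then (if p = l then (1 : ℝ) else 0) else G p q).det / (Matrix.of G).det))
      fun i => ?_) (Nat.mul_le_mul_right _ hk)) ?_
    · exact ((hd k _).le (hdD hk)).bind_eq (Runs.le (Runs.prim_bind (Runs.prim rfl)) le_rfl)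
    · refine (foldFin_subSmul_runs h _ _).mono (Nat.mul_le_mul_right _ hk) ?_
      rintro _ rfl
      simp only [neg_neg]
  · have hcl : ∀ l, toE inp.deg (c l) = ∑ i, ((Matrix.of fun p q => if q = i then
        (if p = l then (1 : ℝ) else 0) else G p q).det / (Matrix.of G).det) •
        toE inp.deg (b i) := fun l => by
      rw [hc l, map_sum]
      simp only [map_smul]
    refine ⟨fun l => ?_, fun l i => ?_⟩
    · rw [hcl]
      exact Submodule.sum_mem _ fun i _ => Submodule.smul_mem _ _ (Submodule.subset_span ⟨i, rfl⟩)
    · rw [hcl, hG]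
      exact inner_cramer hb l i

theorem Runs.bind_assoc {α β γ : Type} {x : Comp α} {f : α → Comp β} {g : β → Comp γ}
    {P : β → Prop} {Q : γ → Prop} {T₁ T₂ : ℕ} (h₁ : Runs (x >>= f) T₁ P)
    (h₂ : ∀ b, P b → Runs (g b) T₂ Q) : Runs (x >>= fun a => f a >>= g) (T₁ + T₂) Q := by
  have : (x >>= fun a => f a >>= g) = ((x >>= f) >>= g) := by
    rcases x with _ | ⟨a, t⟩
    · rfl
    · change Option.bind (Option.bind (f a) fun p => Option.bind (g p.1) fun q =>
        some (q.1, p.2 + q.2)) (fun q => some (q.1, t + q.2)) =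
        Option.bind (Option.bind (f a) fun q => some (q.1, t + q.2)) fun p =>
          Option.bind (g p.1) fun q => some (q.1, p.2 + q.2)
      rcases f a with _ | ⟨b, t'⟩
      · rfl
      · simp only [Option.bind_some]
        rcases g b with _ | ⟨c, t''⟩
        · rfl
        · simp [add_assoc]
  rw [this]
  exact h₁.bind h₂

/-- The Poisson step only uses real arithmetic, so its time depends on the dimension alone. -/
theorem poissonForms_runs (n : ℕ) : ∃ T : ℕ, ∀ (inp : Input n), inp.Wf →
    ∀ (b : Fin n → Vec inp.r), LinearIndependent ℝ (fun i => toE inp.deg (b i)) →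
    Runs (poissonForms inp b) T fun Q => ∃ (k : ℕ) (hk : k ≤ n)
      (c : Fin k → EuclideanSpace ℝ (Fin inp.r × Fin 2)),
      HybridForms (fun i => toE inp.deg (b i)) hk c Q := by
  obtain ⟨D, hD⟩ := dualBasis_runs n
  refine ⟨gsTime n n + (n * (9 * n + 1) + (n * (n * (18 * n + 1 + 1) + 1) + (n * 4 +
    (n * (n * (9 * n + 1) + 1) + (D + (gsTime n n + (n * (9 * n + 1) +
    (n * (n * (18 * n + 1 + 1) + 1) + (n * (n * (9 * n + 1) + 1) + (n * (0 + 1) +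
    (n * (n * (0 + 1) + 1) + (n * (n * (n * (1 + 2) + 1) + 1) + (n * 2 + (1 + 0)))))))))))))),
    fun inp h b hb => ?_⟩
  set B := fun i => toE inp.deg (b i) with hB
  refine (gramSchmidt_runs h le_rfl b).bind fun bs hbs => ?_
  refine Runs.bind_eq (v := fun i => ‖InnerProductSpace.gramSchmidt ℝ B i‖ ^ 2)
    (Runs.tab_eq fun i => (innerProd_runs h _ _).imp ?_) ?_
  · rintro _ rfl
    rw [hbs, real_inner_self_eq_norm_sq]
  refine Runs.bind_eq (v := gsCoeff B) (Runs.tab_eq fun i => Runs.tab_eq fun j =>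
    (projCoeff_runs h _ _).imp ?_) ?_
  · rintro _ rfl
    rw [hbs]; rfl
  refine (leadingSmall_runs n _).bind fun k hk => ?_
  have hkn : (k : ℕ) ≤ n := Nat.le_of_lt_succ k.isLt
  set em : Fin k → Fin n := Fin.castLE hkn with hem
  refine Runs.bind_eq (v := fun i j => inner ℝ (B (em i)) (B (em j)))
    (Runs.le (Runs.tab_eq fun i => Runs.le (Runs.tab_eq fun j => innerProd_runs h _ _)
      (Nat.mul_le_mul_right _ hkn)) (Nat.mul_le_mul_right _ hkn)) ?_
  refine Runs.bind_assoc (hD inp h k hkn (fun i => b (em i))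
    (hb.comp _ (Fin.castLE_injective hkn)) _ rfl) fun c hc => ?_
  set c' := fun i => toE inp.deg (c i) with hc'
  refine ((gramSchmidt_runs h hkn c).le (Nat.mul_le_mul_right _ hkn)).bind fun cs hcs => ?_
  refine Runs.bind_eq (v := fun i => ‖InnerProductSpace.gramSchmidt ℝ c' i‖ ^ 2)
    (Runs.le (Runs.tab_eq fun i => (innerProd_runs h _ _).imp ?_)
      (Nat.mul_le_mul_right _ hkn)) ?_
  · rintro _ rfl
    rw [hcs, real_inner_self_eq_norm_sq]
  refine Runs.bind_eq (v := gsCoeff c') (Runs.le (Runs.tab_eq fun i => Runs.le (Runs.tab_eq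
    fun j => (projCoeff_runs h _ _).imp ?_) (Nat.mul_le_mul_right _ hkn))
    (Nat.mul_le_mul_right _ hkn)) ?_
  · rintro _ rfl
    rw [hcs]; rfl
  refine Runs.bind_eq (v := fun l i => inner ℝ (c' l) (InnerProductSpace.gramSchmidt ℝ B (em i)))
    (Runs.le (Runs.tab_eq fun l => Runs.le (Runs.tab_eq fun i => (innerProd_runs h _ _).imp ?_)
      (Nat.mul_le_mul_right _ hkn)) (Nat.mul_le_mul_right _ hkn)) ?_
  · rintro _ rfl
    rw [hbs]
  refine Runs.bind_eq (v := fun i : Fin n => if h : i.val < k.val then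
    ‖InnerProductSpace.gramSchmidt ℝ c' ⟨i, h⟩‖ ^ 2 else ‖InnerProductSpace.gramSchmidt ℝ B i‖ ^ 2)
    (Runs.tab_eq fun i => ?_) ?_
  · split_ifs with hi
    · exact Runs.pure rfl
    · exact Runs.pure rfl
  refine Runs.bind_eq (v := fun i j : Fin n => if hi : i.val < k.val then
    (if hj : j.val < k.val then gsCoeff c' ⟨j, hj⟩ ⟨i, hi⟩ else 0) else gsCoeff B j i)
    (Runs.tab_eq fun i => Runs.tab_eq fun j => ?_) ?_
  · split_ifs
    all_goals exact Runs.pure rfl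
  refine Runs.bind_eq (v := fun l j : Fin n => if hl : l.val < k.val then (if j.val < k.val then 0 else
    ∑ i : Fin k, gsCoeff B j (em i) *
      inner ℝ (c' ⟨l, hl⟩) (InnerProductSpace.gramSchmidt ℝ B (em i))) else 0)
    (Runs.tab_eq fun l => Runs.tab_eq fun j => ?_) ?_
  · split_ifs
    · exact Runs.le (Runs.pure rfl) (Nat.zero_le _)
    · exact Runs.le (Runs.rsum_eq fun i => Runs.prim rfl) (Nat.mul_le_mul_right _ hkn)
    · exact Runs.le (Runs.pure rfl) (Nat.zero_le _)
  refine Runs.bind_eq (Runs.le (foldFin_rmul_runs _) (Nat.mul_le_mul_right _ hkn)) ?_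
  refine Runs.prim_bind (Runs.pure ⟨k, hkn, c', ?_⟩)
  exact
    { small := fun i hi => by
        have := hk.1 i hi
        by_contra hcon
        push Not at hcon
        exact absurd this (not_lt.2 (one_le_pow₀ hcon))
      large := fun i hi => by
        have := hk.2 i hi
        by_contra hcon
        push Not at hcon
        exact absurd this (not_le.2 (pow_lt_one₀ (norm_nonneg _) hcon two_ne_zero))
      mem_span := hc.1
      dual := hc.2
      diag_eq := fun i => rfl
      off_eq := fun i j => rfl
      mixed_eq := fun l j => rfl
      γ_eq := rfl }

end ArakelovAlg

namespace ArakelovAlg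

set_option linter.unusedSectionVars false

open GramSchmidtLLL Finset

variable {n : ℕ}

/-! ### Fincke–Pohst enumeration -/

theorem bits_one : bits 1 = 2 := by decide

/-- A loop over an interval of integers that collects lists. The relation `R y` describes the elements
found in pass `y`; as it determines `y`, the passes find disjoint lists. -/
theorem forRange_runs {β : Type} {f : ℤ → Comp (List β)} {c B L : ℕ} {R : ℤ → β → Prop}
    {G : β → Prop} (hR : ∀ y y' z, R y z → R y' z → y = y') {m : ℕ} {y₀ : ℤ}
    (hf : ∀ y, y₀ ≤ y → y < y₀ + m → Runs (f y) c fun l => l.Nodup ∧ l.length ≤ L ∧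
      (∀ z, z ∈ l ↔ R y z) ∧ ∀ z ∈ l, G z)
    (hB : ∀ y, y₀ ≤ y → y < y₀ + m → bits y ≤ B) :
    Runs (forRange f m y₀) (m * (c + (B + 2) + (L + 1))) fun l => l.Nodup ∧ l.length ≤ m * L ∧
      (∀ z, z ∈ l ↔ ∃ y, y₀ ≤ y ∧ y < y₀ + m ∧ R y z) ∧ ∀ z ∈ l, G z := by
  induction m generalizing y₀ with
  | zero =>
    refine (Runs.pure ⟨List.nodup_nil, by simp, fun z => ?_, by simp⟩).le (Nat.zero_le _)
    constructor
    · simp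
    · rintro ⟨y, h1, h2, -⟩; push_cast at h2; omega
  | succ m ih =>
    push_cast at hf hB
    refine Runs.le (Runs.bind (T₂ := (B + 2) + (m * (c + (B + 2) + (L + 1)) + (L + 1)))
      (hf y₀ le_rfl (by omega)) fun l hl => Runs.le (Runs.prim_bind ((ih (y₀ := y₀ + 1)
      (fun y h1 h2 => hf y (by omega) (by omega))
      (fun y h1 h2 => hB y (by omega) (by omega))).bind fun l' hl' =>
        Runs.le (Runs.prim ?_) (Nat.succ_le_succ hl.2.1))) ?_) ?_
    · obtain ⟨hn, hlen, hmem, hG⟩ := hl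
      obtain ⟨hn', hlen', hmem', hG'⟩ := hl'
      refine ⟨List.nodup_append.2 ⟨hn, hn', ?_⟩, ?_, fun z => ?_, fun z hz => ?_⟩
      · rintro z hz z' hz' rfl
        obtain ⟨y, h1, -, h3⟩ := (hmem' z).1 hz'
        have := hR _ _ _ ((hmem z).1 hz) h3
        omega
      · rw [List.length_append, Nat.succ_mul]; omega
      · rw [List.mem_append, hmem, hmem']
        push_cast
        constructor
        · rintro (h | ⟨y, h1, h2, h3⟩)
          · exact ⟨y₀, le_rfl, by omega, h⟩
          · exact ⟨y, by omega, by omega, h3⟩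
        · rintro ⟨y, h1, h2, h3⟩
          rcases h1.eq_or_lt with rfl | h
          · exact Or.inl h3
          · exact Or.inr ⟨y, by omega, by omega, h3⟩
      · rcases List.mem_append.1 hz with h | h
        · exact hG z h
        · exact hG' z h
    · have := hB y₀ le_rfl (by omega)
      rw [bits_one]; omega
    · rw [Nat.succ_mul]; omega

/-- `∑_{j > i} o_ij x_j`. -/
noncomputable def Forms.centre (Q : Forms n) (x : Fin n → ℤ) (i : Fin n) : ℝ :=
  ∑ j, if i < j then Q.off i j * (x j : ℝ) else 0

/-- The part of `Q₁` that involves the pivots with index less than `m`. -/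
noncomputable def Forms.partialForm (Q : Forms n) (m : ℕ) (x : Fin n → ℤ) : ℝ :=
  ∑ i : Fin n with i.val < m, Q.diag i * ((x i : ℝ) + Q.centre x i) ^ 2

theorem Forms.q1_eq (Q : Forms n) (x : Fin n → ℤ) : Q.q1 x = Q.partialForm n x := by
  rw [Forms.partialForm, filter_true_of_mem fun i _ => i.isLt, Forms.q1, triForm]
  simp [Forms.centre]

theorem Forms.partialForm_succ (Q : Forms n) {m : ℕ} (hm : m < n) (x : Fin n → ℤ) :
    Q.partialForm (m + 1) x =
      Q.diag ⟨m, hm⟩ * ((x ⟨m, hm⟩ : ℝ) + Q.centre x ⟨m, hm⟩) ^ 2 + Q.partialForm m x := by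
  rw [Forms.partialForm, Forms.partialForm]
  have := filter_val_lt_succ (⟨m, hm⟩ : Fin n)
  simp only at this
  rw [this, sum_insert (by simp)]

theorem Forms.partialForm_nonneg {Q : Forms n} (hD : ∀ i, 0 ≤ Q.diag i) (m : ℕ) (x : Fin n → ℤ) :
    0 ≤ Q.partialForm m x :=
  sum_nonneg fun i _ => mul_nonneg (hD i) (sq_nonneg _)

theorem Forms.centre_congr (Q : Forms n) {x z : Fin n → ℤ} {i : Fin n}
    (h : ∀ j, i < j → z j = x j) : Q.centre z i = Q.centre x i := by
  refine sum_congr rfl fun j _ => ?_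
  split_ifs with hj
  · rw [h j hj]
  · rfl

theorem centre_runs (Q : Forms n) {x : Fin n → ℤ} {i : Fin n} {E : ℕ}
    (hx : ∀ j, i < j → |x j| ≤ 2 ^ E) :
    Runs (centre Q x i) (n * (E + 3 + 2)) (· = Q.centre x i) := by
  refine Runs.rsum_eq (c := E + 3) fun j => ?_
  split_ifs with h
  · exact Runs.le (Runs.prim_bind (Runs.prim rfl)) (by have := bits_le (hx j h); omega)
  · exact Runs.le (Runs.pure rfl) (Nat.zero_le _)

/-- The bounds on the form that hold after Poisson summation of a reduced basis. -/
structure Forms.Bounded (Q : Forms n) : Prop where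
  diag_ge : ∀ i : Fin n, 1 / 2 ^ i.val ≤ Q.diag i
  abs_off_le : ∀ {i j : Fin n}, i < j → |Q.off i j| ≤ 8 ^ n

theorem Forms.Bounded.diag_pos {Q : Forms n} (h : Q.Bounded) (i : Fin n) : 0 < Q.diag i :=
  lt_of_lt_of_le (by positivity) (h.diag_ge i)

theorem Forms.Bounded.abs_centre_le {Q : Forms n} (h : Q.Bounded) {x : Fin n → ℤ} {i : Fin n}
    {E : ℕ} (hx : ∀ j, i < j → |x j| ≤ 2 ^ E) : |Q.centre x i| ≤ 2 ^ (4 * n + E) := by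
  have h1 : ∀ j ∈ (univ : Finset (Fin n)),
      |if i < j then Q.off i j * (x j : ℝ) else 0| ≤ 8 ^ n * 2 ^ E := by
    intro j _
    split_ifs with hj
    · rw [abs_mul]
      refine mul_le_mul (h.abs_off_le hj) ?_ (abs_nonneg _) (by positivity)
      exact_mod_cast hx j hj
    · rw [abs_zero]; positivity
  refine (abs_sum_le_sum_abs _ _).trans ((sum_le_card_nsmul _ _ _ h1).trans ?_)
  rw [card_univ, Fintype.card_fin, nsmul_eq_mul, pow_add, ← mul_assoc,
    show 4 * n = n + 3 * n by ring, pow_add, pow_mul]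
  norm_num
  exact_mod_cast Nat.lt_two_pow_self.le

theorem Forms.Bounded.sqrt_le {Q : Forms n} (h : Q.Bounded) {T : ℝ} {X : ℕ}
    (hT : T * 2 ^ n ≤ X) (hT0 : 0 ≤ T) (i : Fin n) : Real.sqrt (T / Q.diag i) ≤ X := by
  rw [Real.sqrt_le_left (Nat.cast_nonneg X)]
  have h1 : T / Q.diag i ≤ T * 2 ^ n := by
    rw [div_le_iff₀ (h.diag_pos i), mul_assoc]
    refine le_mul_of_one_le_right hT0 ?_
    have h2 := h.diag_ge i
    rw [div_le_iff₀ (by positivity)] at h2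
    have h3 : (2 : ℝ) ^ i.val ≤ 2 ^ n := pow_le_pow_right₀ (by norm_num) i.isLt.le
    nlinarith [h.diag_pos i]
  refine (h1.trans hT).trans ?_
  exact_mod_cast Nat.le_self_pow two_ne_zero X

/-- The enumeration fixes the coordinates from the last to the first. Each coordinate lies in an interval
of length at most `2 * X`, since the pivots are at least `2 ^ (-n)`; its centre grows only by a constant
factor from one coordinate to the next, since the off-diagonal coefficients are bounded. -/
theorem enumerate_runs (n m : ℕ) : ∃ c : ℕ → ℕ, PolyBdd c ∧ ∀ (X : ℕ) (Q : Forms n) (hm : m ≤ n)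
    (x : Fin n → ℤ) (T : ℝ), Q.Bounded → 0 ≤ T → T * 2 ^ n ≤ X →
    (∀ j : Fin n, m ≤ j.val → |x j| ≤ 2 ^ (X + (n - m) * (4 * n + 1))) →
    Runs (enumerate Q m hm x T) (c X) fun l => l.Nodup ∧ l.length ≤ (2 * X + 1) ^ m ∧
      (∀ z, z ∈ l ↔ (∀ j : Fin n, m ≤ j.val → z j = x j) ∧ Q.partialForm m z ≤ T) ∧
      ∀ z ∈ l, ∀ j, |z j| ≤ 2 ^ (X + n * (4 * n + 1)) := by
  induction m with
  | zero =>
    refine ⟨fun _ => 0, by fun_prop, fun X Q hm x T hQ hT hTX hx => Runs.pure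
      ⟨List.nodup_singleton x, by simp, fun z => ?_, fun z hz j => ?_⟩⟩
    · rw [List.mem_singleton, funext_iff]
      simp [Forms.partialForm, hT]
    · rw [List.mem_singleton.1 hz]
      exact hx j (Nat.zero_le _)
  | succ m ih =>
    obtain ⟨c, hc, H⟩ := ih
    set Y : ℕ → ℕ := fun X => X + n * (4 * n + 1) + 1 with hY
    refine ⟨fun X => n * (Y X + 3 + 2) + (8 + 6 * (Y X + 6)
      + (2 * X + 1) * (Y X + 6 + c X + (Y X + 2 + 2) + ((2 * X + 1) ^ m + 1))), by fun_prop,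
      fun X Q hm x T hQ hT hTX hx => ?_⟩
    have hmn : m < n := hm
    set i : Fin n := ⟨m, hmn⟩ with hi
    -- the coordinates fixed so far are at most `2 ^ E`
    set E := X + (n - (m + 1)) * (4 * n + 1) with hE
    have hEs : E + (4 * n + 1) = X + (n - m) * (4 * n + 1) := by
      rw [hE, show n - m = n - (m + 1) + 1 by omega]; ring
    have hEY : E + (4 * n + 1) + 1 ≤ Y X := by
      rw [hEs, hY]
      have : (n - m) * (4 * n + 1) ≤ n * (4 * n + 1) := Nat.mul_le_mul_right _ (Nat.sub_le _ _)
      simp only; omega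
    have hxi : ∀ j, i < j → |x j| ≤ 2 ^ E := fun j hj => hx j hj
    set U := Q.centre x i with hU
    set Z := Real.sqrt (T / Q.diag i) with hZ
    have hUb : |U| ≤ 2 ^ (4 * n + E) := hQ.abs_centre_le hxi
    have hZ0 : 0 ≤ Z := Real.sqrt_nonneg _
    have hZX : Z ≤ X := hQ.sqrt_le hTX hT i
    have hZb : Z ≤ 2 ^ (4 * n + E) := by
      refine hZX.trans ?_
      exact_mod_cast (Nat.lt_two_pow_self (n := X)).le.trans
        (Nat.pow_le_pow_right (by norm_num) (by omega))
    have hUb' := abs_le.1 hUb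
    -- the admissible values of the `m`-th coordinate
    have hmemZ : ∀ y : ℤ, Q.diag i * ((y : ℝ) + U) ^ 2 ≤ T ↔
        ⌈-(Z + U)⌉ ≤ y ∧ y ≤ ⌊Z - U⌋ := by
      intro y
      rw [Int.ceil_le, Int.le_floor, mul_comm, ← le_div_iff₀ (hQ.diag_pos i),
        Real.sq_le (div_nonneg hT (hQ.diag_pos i).le)]
      constructor <;> rintro ⟨h1, h2⟩ <;> constructor <;> linarith
    have hlo : |⌈-(Z + U)⌉| ≤ 2 ^ (4 * n + E + 2) := by
      have h1 := Int.le_ceil (-(Z + U))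
      have h2 := Int.ceil_lt_add_one (-(Z + U))
      have h3 : (1 : ℝ) ≤ 2 ^ (4 * n + E) := one_le_pow₀ (by norm_num)
      have : |(⌈-(Z + U)⌉ : ℝ)| ≤ 2 ^ (4 * n + E + 2) := by
        rw [pow_add, abs_le]; constructor <;> linarith
      exact_mod_cast this
    have hhi : |⌊Z - U⌋| ≤ 2 ^ (4 * n + E + 2) := by
      have h1 := Int.floor_le (Z - U)
      have h2 := Int.lt_floor_add_one (Z - U)
      have h3 : (1 : ℝ) ≤ 2 ^ (4 * n + E) := one_le_pow₀ (by norm_num)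
      have : |(⌊Z - U⌋ : ℝ)| ≤ 2 ^ (4 * n + E + 2) := by
        rw [pow_add, abs_le]; constructor <;> linarith
      exact_mod_cast this
    set lo := ⌈-(Z + U)⌉ with hlo_def
    set hi' := ⌊Z - U⌋ with hhi_def
    have hhi1 : |hi' + 1| ≤ 2 ^ (4 * n + E + 3) := by
      have : (1 : ℤ) ≤ 2 ^ (4 * n + E + 2) := one_le_pow₀ (by norm_num)
      rw [abs_le] at hhi ⊢
      rw [pow_succ]; constructor <;> linarith
    have hcnt : (hi' + 1 - lo).toNat ≤ 2 * X + 1 := by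
      have h1 := Int.le_ceil (-(Z + U))
      have h2 := Int.floor_le (Z - U)
      have h3 : ((hi' : ℝ) - lo) ≤ 2 * X := by linarith
      have h4 : hi' - lo ≤ 2 * X := by exact_mod_cast h3
      omega
    have hrange : ∀ y, lo ≤ y → y < lo + ((hi' + 1 - lo).toNat : ℕ) → lo ≤ y ∧ y ≤ hi' := by
      intro y h1 h2
      refine ⟨h1, ?_⟩
      omega
    have hy : ∀ y, lo ≤ y ∧ y ≤ hi' → |y| ≤ 2 ^ (X + (n - m) * (4 * n + 1)) := by
      intro y h
      rw [← hEs, show E + (4 * n + 1) = 4 * n + E + 1 by ring]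
      rw [hlo_def, hhi_def, Int.ceil_le, Int.le_floor] at h
      have : |(y : ℝ)| ≤ 2 ^ (4 * n + E + 1) := by
        rw [pow_succ, abs_le]; constructor <;> linarith [h.1, h.2]
      exact_mod_cast this
    have hyY : ∀ y, lo ≤ y ∧ y ≤ hi' → bits y ≤ Y X + 2 := fun y h =>
      bits_le (abs_le_two_pow_mono (hy y h) (by omega))
    -- the passes of the loop
    set R : ℤ → (Fin n → ℤ) → Prop := fun y z =>
      (∀ j : Fin n, m ≤ j.val → z j = Function.update x i y j) ∧
        Q.partialForm m z ≤ T - Q.diag i * (((y : ℝ) + U) * ((y : ℝ) + U)) with hR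
    have hRi : ∀ {y z}, R y z → z i = y := fun {y z} h => by
      rw [h.1 i le_rfl, Function.update_self]
    have hbody := forRange_runs (f := fun y => do
        let a ← radd (← ofInt y) U
        let a2 ← rmul a a
        let T' ← rsub T (← rmul (Q.diag i) a2)
        enumerate Q m (Nat.le_of_succ_le hm) (Function.update x i y) T')
      (c := Y X + 6 + c X) (B := Y X + 2) (L := (2 * X + 1) ^ m) (R := R)
      (G := fun z => ∀ j, |z j| ≤ 2 ^ (X + n * (4 * n + 1))) (y₀ := lo)
      (m := (hi' + 1 - lo).toNat) (fun y y' z h h' => (hRi h).symm.trans (hRi h'))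
      (fun y h1 h2 => by
        have hyr := hrange y h1 h2
        have hyT := (hmemZ y).2 hyr
        refine Runs.le (Runs.prim_bind (Runs.prim_bind (Runs.prim_bind (Runs.prim_bind
          (Runs.prim_bind (T := c X) (H X Q _ _ _ hQ ?_ ?_ ?_)))))) ?_
        · rw [← sq]; linarith
        · refine le_trans (mul_le_mul_of_nonneg_right ?_ (by positivity)) hTX
          have : 0 ≤ Q.diag i * (((y : ℝ) + U) * ((y : ℝ) + U)) :=
            mul_nonneg (hQ.diag_pos i).le (mul_self_nonneg _)
          linarith
        · intro j hj
          rcases eq_or_ne j i with rfl | hji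
          · rw [Function.update_self]; exact hy y hyr
          · rw [Function.update_of_ne hji]
            have hlt : m + 1 ≤ j.val := by
              have : j.val ≠ m := fun h => hji (Fin.ext h)
              omega
            exact abs_le_two_pow_mono (hx j hlt) (by omega)
        · have := hyY y hyr
          omega)
      (fun y h1 h2 => hyY y (hrange y h1 h2))
    refine Runs.le (Runs.bind_eq (centre_runs Q hxi) (Runs.prim_bind (Runs.prim_bind
      (Runs.prim_bind (Runs.prim_bind (Runs.prim_bind (Runs.prim_bind (Runs.prim_bind
      (Runs.prim_bind (Runs.prim_bind (T := (2 * X + 1) * (Y X + 6 + c X + (Y X + 2 + 2) +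
        ((2 * X + 1) ^ m + 1)))
      (Runs.mono hbody (Nat.mul_le_mul_right _ hcnt) ?_))))))))))) ?_
    · rintro l ⟨h1, h2, h3, h4⟩
      refine ⟨h1, h2.trans ?_, fun z => ?_, h4⟩
      · rw [pow_succ, mul_comm]
        exact Nat.mul_le_mul_left _ hcnt
      · rw [h3, Q.partialForm_succ hmn]
        constructor
        · rintro ⟨y, hy1, hy2, hyR⟩
          have hzj : ∀ j : Fin n, m + 1 ≤ j.val → z j = x j := fun j hj => by
            rw [hyR.1 j (by omega), Function.update_of_ne]
            rintro rfl
            exact absurd hj (by simp [hi])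
          refine ⟨hzj, ?_⟩
          have hc : Q.centre z i = U := Q.centre_congr fun j hj => hzj j hj
          rw [hc, hRi hyR]
          have := hyR.2
          rw [← sq] at this
          linarith
        · rintro ⟨hzj, hz⟩
          have hc : Q.centre z i = U := Q.centre_congr fun j hj => hzj j hj
          have h0 := Forms.partialForm_nonneg (fun i => (hQ.diag_pos i).le) m z
          rw [hc] at hz
          have hr := (hmemZ (z i)).1 (by linarith)
          refine ⟨z i, hr.1, by omega, fun j hj => ?_, ?_⟩
          · rcases eq_or_ne j i with rfl | hji
            · rw [Function.update_self]
            · rw [Function.update_of_ne hji]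
              have : j.val ≠ m := fun h => hji (Fin.ext h)
              exact hzj j (by omega)
          · rw [← sq]; linarith
    · have e1 : bits lo ≤ Y X + 3 := (bits_le hlo).trans (by omega)
      have e2 : bits hi' ≤ Y X + 3 := (bits_le hhi).trans (by omega)
      have e3 : bits (hi' + 1) ≤ Y X + 4 := (bits_le hhi1).trans (by omega)
      have e4 := bits_one
      have e5 : n * (E + 3 + 2) ≤ n * (Y X + 3 + 2) := Nat.mul_le_mul_left _ (by omega)
      change n * (E + 3 + 2) + (1 + (1 + (1 + (1 + (bits lo + (1 + (bits hi' +
        ((bits hi' + bits 1) + ((bits (hi' + 1) + bits lo) + _))))))))) ≤ _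
      beta_reduce
      omega

end ArakelovAlg

namespace ArakelovAlg

set_option linter.unusedSectionVars false

open GramSchmidtLLL Finset

variable {n : ℕ}

/-! ### Summation of the enumerated terms and the error of the result -/

/-- The real part of `exp (-π Q(x))`. -/
noncomputable def Forms.summand (Q : Forms n) (x : Fin n → ℤ) : ℝ :=
  Real.exp (-(Real.pi * Q.q1 x)) * Real.cos (2 * Real.pi * Q.q2 x)

theorem term_runs (Q : Forms n) {x : Fin n → ℤ} {E : ℕ} (hx : ∀ j, |x j| ≤ 2 ^ E) :
    Runs (term Q x) (n * (E + 5 + n * (E + 5) + 2) + n * (n * (2 * E + 6 + 2) + 2) + 11)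
      (· = Q.summand x) := by
  have hb : ∀ j, bits (x j) ≤ E + 2 := fun j => bits_le (hx j)
  have h1 : Runs (rsum n fun i => do
      let a ← radd (← ofInt (x i)) (← centre Q x i)
      rmul (Q.diag i) (← rmul a a)) (n * (E + 5 + n * (E + 5) + 2)) (· = Q.q1 x) := by
    rw [Forms.q1_eq, Forms.partialForm, filter_true_of_mem fun i _ => i.isLt]
    refine Runs.rsum_eq fun i => Runs.le (Runs.prim_bind (Runs.bind_eq (centre_runs Q fun j _ => hx j)
      (Runs.prim_bind (Runs.prim_bind (Runs.prim ?_))))) ?_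
    · rw [sq]
    · have := hb i
      have e : n * (E + 3 + 2) = n * (E + 5) := rfl
      omega
  have h2 : Runs (rsum n fun l => rsum n fun j => do
      let a ← rmul (← ofInt (x l)) (← ofInt (x j))
      rmul (Q.mixed l j) a) (n * (n * (2 * E + 6 + 2) + 2)) (· = Q.q2 x) := by
    refine Runs.rsum_eq fun l => Runs.rsum_eq fun j => Runs.le (Runs.prim_bind (Runs.prim_bind
      (Runs.prim_bind (Runs.prim rfl)))) ?_
    have := hb l
    have := hb j
    omega
  have hb2 : bits 2 = 3 := by decide
  refine Runs.le (h1.bind_eq (h2.bind_eq (Runs.prim_bind (Runs.prim_bind (Runs.prim_bind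
    (Runs.prim_bind (Runs.prim_bind (Runs.prim_bind (Runs.prim_bind (Runs.prim_bind
    (Runs.prim ?_))))))))))) ?_
  · simp [Forms.summand]
  · rw [hb2]; omega

theorem sumTerms_runs (Q : Forms n) {c : ℕ} {l : List (Fin n → ℤ)}
    (h : ∀ x ∈ l, Runs (term Q x) c (· = Q.summand x)) :
    Runs (sumTerms Q l) (l.length * (c + 1)) (· = (l.map Q.summand).sum) := by
  induction l with
  | nil => exact (Runs.pure (by simp)).le (Nat.zero_le _)
  | cons x l ih =>
    refine Runs.le ((h x (by simp)).bind_eq ((ih fun y hy => h y (by simp [hy])).bind_eq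
      (Runs.prim (by simp)))) ?_
    rw [List.length_cons, Nat.succ_mul]; omega

/-- The radius up to which the terms are summed. -/
noncomputable def radius (n : ℕ) (δ : ℝ) : ℝ :=
  (Real.log (1 / δ) + (n + 1) * Real.log 3 + ((n * (n + 1) / 2 - 1 : ℕ) : ℝ) * Real.log 2) /
    (Real.pi - 1)

theorem radius_nonneg (n : ℕ) {δ : ℝ} (h0 : 0 < δ) (h1 : δ < 1) : 0 ≤ radius n δ := by
  have hpi : (0 : ℝ) < Real.pi - 1 := by linarith [Real.pi_gt_three]
  have : 0 ≤ Real.log (1 / δ) := Real.log_nonneg (by rw [le_div_iff₀ h0]; linarith)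
  have h3 := Real.log_nonneg (show (1 : ℝ) ≤ 3 by norm_num)
  have h2 := Real.log_nonneg (show (1 : ℝ) ≤ 2 by norm_num)
  unfold radius
  positivity

theorem radius_le (n : ℕ) (hn : 1 ≤ n) {δ : ℝ} (h0 : 0 < δ) (h1 : δ < 1) :
    radius n δ ≤ Real.log (1 / δ) + (n + 2) ^ 2 * 3 := by
  have : 0 ≤ Real.log (1 / δ) := Real.log_nonneg (by rw [le_div_iff₀ h0]; linarith)
  have h3 : Real.log 3 ≤ 2 := (Real.log_le_sub_one_of_pos (by norm_num)).trans (by norm_num)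
  have h2 : Real.log 2 ≤ 1 := (Real.log_le_sub_one_of_pos (by norm_num)).trans (by norm_num)
  have h2' : 0 ≤ Real.log 2 := Real.log_nonneg (by norm_num)
  have hk : ((n * (n + 1) / 2 - 1 : ℕ) : ℝ) ≤ (n + 2) ^ 2 := by
    have : n * (n + 1) / 2 - 1 ≤ (n + 2) ^ 2 :=
      (Nat.sub_le _ _).trans ((Nat.div_le_self _ _).trans (by nlinarith))
    exact_mod_cast this
  have hn' : (1 : ℝ) ≤ n := by exact_mod_cast hn
  unfold radius
  rw [div_le_iff₀ (by linarith [Real.pi_gt_three])]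
  have hpi : 1 ≤ Real.pi - 1 := by linarith [Real.pi_gt_three]
  have hkk : (0 : ℝ) ≤ ((n * (n + 1) / 2 - 1 : ℕ) : ℝ) := Nat.cast_nonneg _
  have e1 : ((n : ℝ) + 1) * Real.log 3 ≤ (n + 1) * 2 := by gcongr
  have e2 : ((n * (n + 1) / 2 - 1 : ℕ) : ℝ) * Real.log 2 ≤ (n + 2) ^ 2 * 1 := by gcongr
  have e3 : 0 ≤ Real.log (1 / δ) + ((n : ℝ) + 2) ^ 2 * 3 := by positivity
  nlinarith

theorem cutoff_runs (n : ℕ) (hn : 1 ≤ n) : ∃ T : ℕ, ∀ δ, Runs (cutoff n δ) T (· = radius n δ) := by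
  refine ⟨_, fun δ => Runs.prim_bind (Runs.prim_bind (Runs.prim_bind (Runs.prim_bind (Runs.prim_bind
    (Runs.prim_bind (Runs.prim_bind (Runs.prim_bind (Runs.prim_bind (Runs.prim_bind (Runs.prim_bind
    (Runs.prim_bind (Runs.prim_bind (Runs.prim_bind (Runs.prim_bind (Runs.prim ?_)))))))))))))))⟩
  have h : (n : ℤ) * (n + 1) / 2 - 1 = ((n * (n + 1) / 2 - 1 : ℕ) : ℤ) := by
    have : 1 ≤ n * (n + 1) / 2 := by
      rw [Nat.le_div_iff_mul_le (by norm_num)]; nlinarith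
    rw [Nat.cast_sub this]
    push_cast
    rfl
  rw [h, radius]
  push_cast
  ring

/-- The radius is chosen such that the truncation error is at most `(2 / 3) ^ (n + 1) * δ`. -/
theorem exp_radius (n : ℕ) (hn : 1 ≤ n) {δ : ℝ} (h0 : 0 < δ) :
    Real.exp (-((Real.pi - 1) * radius n δ)) * (4 ^ n * 2 ^ (n * (n - 1) / 2)) =
      (2 / 3) ^ (n + 1) * δ := by
  have hpi : Real.pi - 1 ≠ 0 := by linarith [Real.pi_gt_three]
  set k := n * (n + 1) / 2 - 1 with hk
  have hka : k + 1 = n * (n - 1) / 2 + n := by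
    have h1 : (n + 1) * n / 2 = n * (n - 1) / 2 + n := Nat.triangle_succ n
    rw [mul_comm] at h1
    omega
  have h2 : (2 : ℝ) ^ k * 2 = 2 ^ (n * (n - 1) / 2) * 2 ^ n := by
    rw [← pow_succ, hka, pow_add]
  have h3 : Real.exp (-((Real.pi - 1) * radius n δ)) = δ * (3 ^ (n + 1))⁻¹ * (2 ^ k)⁻¹ := by
    rw [radius, mul_div_cancel₀ _ hpi, ← Real.log_rpow (by norm_num), ← Real.log_rpow (by norm_num),
      one_div, Real.log_inv, neg_add, neg_add, neg_neg, Real.exp_add, Real.exp_add, Real.exp_log h0,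
      Real.exp_neg, Real.exp_neg, Real.exp_log (by positivity), Real.exp_log (by positivity),
      Real.rpow_natCast, ← Nat.cast_succ, Real.rpow_natCast]
  have h4 : (2 : ℝ) ^ (n * (n - 1) / 2) = 2 ^ k * 2 / 2 ^ n := by
    rw [h2]; field_simp
  rw [h3, h4, show (4 : ℝ) = 2 * 2 by norm_num, mul_pow, div_pow]
  field_simp
  ring

/-- Perturbation of the logarithm. -/
theorem abs_log_sub_log_le {F S ε δ : ℝ} (hF : 1 ≤ F) (h : |F - S| ≤ ε) (hε : ε ≤ 8 / 27 * δ)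
    (hδ : 0 < δ) (hδ1 : δ < 1) : |Real.log S - Real.log F| ≤ δ := by
  rw [abs_le] at h
  have hS : 19 / 27 ≤ S := by linarith [h.2]
  have hS0 : 0 < S := by linarith
  have hF0 : 0 < F := by linarith
  have h1 := Real.log_le_sub_one_of_pos (div_pos hS0 hF0)
  have h2 := Real.log_le_sub_one_of_pos (div_pos hF0 hS0)
  rw [Real.log_div hS0.ne' hF0.ne'] at h1
  rw [Real.log_div hF0.ne' hS0.ne'] at h2
  have h3 : S / F - 1 ≤ δ := by
    rw [sub_le_iff_le_add, div_le_iff₀ hF0]; nlinarith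
  have h4 : F / S - 1 ≤ δ := by
    rw [sub_le_iff_le_add, div_le_iff₀ hS0]; nlinarith
  rw [abs_le]
  constructor <;> linarith

/-- The last two steps of the algorithm, for a reduced basis `b`. -/
theorem shortVectors_runs (n : ℕ) (hn : 2 ≤ n) : ∃ c : ℕ → ℕ, PolyBdd c ∧ ∀ (X : ℕ) (inp : Input n),
    inp.Wf → ∀ (b : Fin n → Vec inp.r), LinearIndependent ℝ (fun i => toE inp.deg (b i)) →
    LLLReduced (fun i => toE inp.deg (b i)) → 0 < inp.δ → inp.δ < 1 → radius n inp.δ * 2 ^ n ≤ X →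
    Runs (do
      let Q ← poissonForms inp b
      let M ← cutoff n inp.δ
      let l ← enumerate Q n le_rfl (fun _ => 0) M
      let S ← sumTerms Q l
      rlog (← rdiv S Q.γ)) (c X) fun out => |out - Real.log (∑' x : Fin n → ℤ,
        Real.exp (-(Real.pi * ‖∑ i, (x i : ℝ) • toE inp.deg (b i)‖ ^ 2)))| ≤ inp.δ := by
  obtain ⟨T₁, hT₁⟩ := poissonForms_runs n
  obtain ⟨T₂, hT₂⟩ := cutoff_runs n (by omega)
  obtain ⟨c, hc, hen⟩ := enumerate_runs n n
  set E : ℕ → ℕ := fun X => X + n * (4 * n + 1) with hE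
  refine ⟨fun X => T₁ + (T₂ + (c X + ((2 * X + 1) ^ n * ((n * (E X + 5 + n * (E X + 5) + 2) +
    n * (n * (2 * E X + 6 + 2) + 2) + 11) + 1) + (1 + 1)))), by fun_prop,
    fun X inp h b hb hr h0 h1 hX => ?_⟩
  set B := fun i => toE inp.deg (b i) with hB
  have hr0 := radius_nonneg n h0 h1
  refine (hT₁ inp h b hb).bind fun Q ⟨k, hk, cc, H⟩ => ?_
  have hQ : Q.Bounded := ⟨H.diag_ge hb hr, H.abs_off_le hb hr⟩
  refine (hT₂ _).bind_eq ((hen X Q le_rfl _ _ hQ hr0 hX (by simp)).bind fun l hl => ?_)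
  obtain ⟨hnd, hlen, hmem, hG⟩ := hl
  refine Runs.bind_eq (Runs.le (sumTerms_runs Q fun x hx => term_runs Q (hG x hx))
    (Nat.mul_le_mul_right _ hlen)) (Runs.prim_bind (Runs.prim ?_))
  have hs : ∀ x, x ∈ l.toFinset ↔ Q.q1 x ≤ radius n inp.δ := fun x => by
    rw [List.mem_toFinset, hmem, Q.q1_eq]
    simp
  have htr := H.truncation hb hr hs
  rw [exp_radius n (by omega) h0] at htr
  obtain ⟨hth, hge⟩ := H.theta hb
  have hγ := H.γ_pos hb
  have hsum : (l.map Q.summand).sum = ∑ x ∈ l.toFinset, Q.summand x :=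
    (List.sum_toFinset _ hnd).symm
  have hε : (2 / 3 : ℝ) ^ (n + 1) * inp.δ ≤ 8 / 27 * inp.δ := by
    refine mul_le_mul_of_nonneg_right ?_ h0.le
    refine (pow_le_pow_of_le_one (by norm_num) (by norm_num) (show 3 ≤ n + 1 by omega)).trans ?_
    norm_num
  have hlog := abs_log_sub_log_le hge htr hε h0 h1
  have hS0 : ∑ x ∈ l.toFinset, Q.summand x ≠ 0 := by
    have := (abs_le.1 (htr.trans hε)).2
    have h2 : (0 : ℝ) < ∑ x ∈ l.toFinset, Q.summand x := by
      unfold Forms.summand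
      linarith
    exact h2.ne'
  have hth0 : ∑' x : Fin n → ℤ, Real.exp (-(Real.pi * ‖∑ i, (x i : ℝ) • B i‖ ^ 2)) ≠ 0 := by
    intro h0
    rw [h0, mul_zero] at hth
    linarith
  rw [hsum, Real.log_div hS0 hγ.ne']
  rw [← hth, Real.log_mul hγ.ne' hth0] at hlog
  refine le_trans (le_of_eq ?_) hlog
  congr 1
  unfold Forms.summand
  ring

end ArakelovAlg

namespace ArakelovAlg

set_option linter.unusedSectionVars false

open GramSchmidtLLL NumberField

variable {n r : ℕ} {F : Type*} [Field F] [NumberField F]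

/-! ### Theta sums of ideals and the whole algorithm -/

theorem fVec_sum_zsmul (p : Fin r ≃ InfinitePlace F) (u : Fin r → ℝ) (y : Fin n → F)
    (x : Fin n → ℤ) : fVec p u (∑ i, x i • y i) = ∑ i, (x i : ℝ) • fVec p u (y i) := by
  rw [map_sum]
  exact Finset.sum_congr rfl fun i _ => by rw [map_zsmul, Int.cast_smul_eq_zsmul]

/-- The theta sum over coordinates does not depend on the basis. -/
theorem Rep.theta_eq {ω : Module.Basis (Fin n) ℤ (𝓞 F)} (p : Fin r ≃ InfinitePlace F)
    {u : Fin r → ℝ} (hu : ∀ σ, 0 < u σ) {J : IdealRep n} {S : Submodule ℤ F} (hJ : Rep ω J S) :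
    ∑' x : Fin n → ℤ, Real.exp (-(Real.pi * ‖∑ i, (x i : ℝ) • fVec p u (repVec ω J i)‖ ^ 2)) =
      ∑' f : S, Real.exp (-(Real.pi * ‖fVec p u (f : F)‖ ^ 2)) := by
  let φ : (Fin n → ℤ) → S := fun x => ⟨∑ i, x i • repVec ω J i, by
    rw [← hJ.span_eq, Submodule.mem_span_range_iff_exists_fun]
    exact ⟨x, rfl⟩⟩
  have hφ : Function.Bijective φ := by
    constructor
    · intro x y h
      have h1 : fVec p u (∑ i, x i • repVec ω J i) = fVec p u (∑ i, y i • repVec ω J i) :=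
        congrArg (fun f : S => fVec p u (f : F)) h
      rw [fVec_sum_zsmul, fVec_sum_zsmul, ← sub_eq_zero, ← Finset.sum_sub_distrib] at h1
      simp only [← sub_smul] at h1
      have h2 := Fintype.linearIndependent_iff.1 (hJ.linearIndependent p hu) _ h1
      funext i
      have := h2 i
      rw [sub_eq_zero] at this
      exact_mod_cast this
    · rintro ⟨f, hf⟩
      rw [← hJ.span_eq, Submodule.mem_span_range_iff_exists_fun] at hf
      obtain ⟨x, hx⟩ := hf
      exact ⟨x, Subtype.ext hx⟩
  rw [← (Equiv.ofBijective φ hφ).tsum_eq]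
  refine tsum_congr fun x => ?_
  rw [← fVec_sum_zsmul]
  rfl

theorem theta_scaleS (p : Fin r ≃ InfinitePlace F) (v : Fin r → ℝ) {h : F} (hh : h ≠ 0)
    (T : Submodule ℤ F) :
    ∑' f : scaleS h⁻¹ T, Real.exp (-(Real.pi * ‖fVec p (fun σ => p σ h * v σ) (f : F)‖ ^ 2)) =
      ∑' f : T, Real.exp (-(Real.pi * ‖fVec p v (f : F)‖ ^ 2)) := by
  let φ : T → scaleS h⁻¹ T := fun f => ⟨h⁻¹ * f, (mem_scaleS (inv_ne_zero hh)).2 (by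
    rw [inv_inv, mul_inv_cancel_left₀ hh]; exact f.2)⟩
  have hφ : Function.Bijective φ := by
    constructor
    · intro x y hxy
      have : h⁻¹ * (x : F) = h⁻¹ * y := congrArg Subtype.val hxy
      exact Subtype.ext (mul_left_cancel₀ (inv_ne_zero hh) this)
    · rintro ⟨f, hf⟩
      rw [mem_scaleS (inv_ne_zero hh), inv_inv] at hf
      exact ⟨⟨h * f, hf⟩, Subtype.ext (inv_mul_cancel_left₀ hh f)⟩
  rw [← (Equiv.ofBijective φ hφ).tsum_eq]
  refine tsum_congr fun f => ?_
  change Real.exp (-(Real.pi * ‖fVec p (fun σ => p σ h * v σ) (h⁻¹ * (f : F))‖ ^ 2)) = _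
  rw [norm_fVec_sq, norm_fVec_sq]
  congr 3
  refine Finset.sum_congr rfl fun σ _ => ?_
  have h1 : p σ h ≠ 0 := (map_ne_zero (p σ)).2 hh
  rw [map_mul, map_inv₀]
  congr 2
  field_simp

/-- The algorithm computes the logarithm of the theta sum of `v T` up to `δ`, in time polynomial in
`X`, which bounds the logarithmic size of the data and the radius of the enumeration. -/
theorem computeH0_runs (n : ℕ) (hn : 2 ≤ n) (hn' : 0 < n) : ∃ c : ℕ → ℕ, PolyBdd c ∧
    ∀ (X : ℕ) (F : Type*) [Field F] [NumberField F] (ω : Module.Basis (Fin n) ℤ (𝓞 F)) (r : ℕ)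
    (p : Fin r ≃ InfinitePlace F) (num : Fin n → Fin n → ℤ) (den : ℕ) (v : InfinitePlace F → ℝ)
    (δ : ℝ) (T : Submodule ℤ F), (∀ i (w : InfinitePlace F), w (ω i : F) ≤ 2 ^ X) →
    |(discr F : ℝ)| ≤ 2 ^ X → (∀ w, 0 < v w) → (∀ w, |Real.log (v w)| ≤ 2 ^ X) →
    Rep ω ⟨num, den⟩ T → (IdealRep.mk num den).Sized X → Stable T →
    0 < δ → δ < 1 → radius n δ * 2 ^ n ≤ X →
    Runs (computeH0 hn' (mkInput ω p num den v δ)) (c X) fun out =>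
      |out - Real.log (∑' f : T, Real.exp (-(Real.pi * ‖fVec p (fun σ => v (p σ)) (f : F)‖ ^ 2)))| ≤
        δ := by
  obtain ⟨c₁, g₁, hc₁, hg₁, H₁⟩ := goodDivisor_runs n hn hn'
  obtain ⟨c₂, hc₂, H₂⟩ := normRoot_runs n
  obtain ⟨c₃, g₃, hc₃, -, H₃⟩ := lllBasis_runs n hn'
  obtain ⟨c₄, hc₄, H₄⟩ := shortVectors_runs n hn
  refine ⟨fun X => c₁ X + ((n + 2) + (1 + (1 + (1 + (c₂ (g₁ X) + (1 + (n * 2 + (c₃ (g₁ X + X) +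
    c₄ X)))))))), by fun_prop,
    fun X F _ _ ω r p num den v δ T hω hD hv hlogv hI hIX hT hδ0 hδ1 hX => ?_⟩
  have hwf := mkInput_wf ω p num den v δ
  have hr : r ≤ n := hwf.r_le
  set inp := mkInput ω p num den v δ with hinp
  refine Runs.bind (H₁ X F ω r p num den v δ T hω hD hv hlogv hI hIX hT) ?_
  rintro ⟨d, J, s⟩ ⟨-, h, hh, hJ, hJX, hs, hspread⟩
  replace hJ : Rep ω J (scaleS h⁻¹ T) := hJ
  replace hJX : J.Sized (g₁ X) := hJX
  replace hs : s = fun σ => p σ h * v (p σ) * Real.exp (d / n) * J.root := hs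
  replace hspread : ∀ σ τ : Fin r, s σ ≤ 2 ^ g₁ X * s τ := hspread
  have hroot := J.root_pos
  set u : Fin r → ℝ := fun σ => p σ h * v (p σ) with hu
  have hu0 : ∀ σ, 0 < u σ := fun σ => mul_pos (InfinitePlace.pos_iff.2 hh) (hv _)
  -- the last step divides `s` by `e^(d/n) N(J)^(1/n)`, which leaves the metric of an isometric lattice
  have hus : ∀ σ : Fin r, s σ = u σ * (Real.exp (d / n) * J.root) := fun σ => by rw [hs]; ring
  have huspread : ∀ σ τ, u σ ≤ 2 ^ (g₁ X + X) * u τ := fun σ τ => by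
    have h1 : u σ * (Real.exp (d / n) * J.root) ≤
        2 ^ g₁ X * (u τ * (Real.exp (d / n) * J.root)) := hus σ ▸ hus τ ▸ hspread σ τ
    rw [← mul_assoc (2 ^ g₁ X), mul_le_mul_iff_left₀ (by positivity)] at h1
    refine h1.trans (mul_le_mul_of_nonneg_right ?_ (hu0 τ).le)
    exact pow_le_pow_right₀ one_le_two (by omega)
  have hu_runs : Runs (tab r fun σ => rmul (Real.exp (-(d / n)) * J.root⁻¹) (s σ)) (n * 2)
      (· = u) := by
    refine Runs.le (Runs.tab_eq (c := 1) fun σ => Runs.prim ?_) (Nat.mul_le_mul_right 2 hr)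
    refine (congrArg _ (hus σ)).trans ?_
    rw [Real.exp_neg]
    field_simp
  refine Runs.le (Runs.prim_bind (Runs.prim_bind (Runs.prim_bind (Runs.prim_bind
    (Runs.bind_eq (H₂ (g₁ X) F ω J _ hJ hJX).2 (Runs.prim_bind (Runs.bind_eq (v := u) hu_runs
    (Runs.bind (H₃ (g₁ X + X) F ω r p num den v δ J _ u
      (fun i w => (hω i w).trans (pow_le_pow_right₀ one_le_two (by omega))) hJ
      ⟨fun a b => abs_le_two_pow_mono (hJX.1 a b) (by omega),
        abs_le_two_pow_mono hJX.2 (by omega)⟩ hu0 huspread)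
    (T₂ := c₄ X) ?_)))))))) ?_
  · rintro ⟨N, b⟩ ⟨hR, -, hL, hb⟩
    replace hR : Rep ω ⟨N, J.den⟩ (scaleS h⁻¹ T) := hR
    replace hL : LLLReduced (fun j => fVec p u (repVec ω ⟨N, J.den⟩ j)) := hL
    replace hb : b = fun j => placeVec p u (repVec ω ⟨N, J.den⟩ j) := hb
    subst hb
    have hLI := hR.linearIndependent p hu0
    refine Runs.imp (H₄ X inp hwf _ hLI hL hδ0 hδ1 hX) fun out hout => ?_
    -- multiplication by `h` is an isometry between the two lattices
    rw [← theta_scaleS p (fun σ => v (p σ)) hh T, ← hR.theta_eq p hu0]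
    exact hout
  · have := bits_natCast_le n
    omega

/-! ### From divisors to lattices -/

/-- The numerators of a basis of a nonzero fractional ideal have nonzero determinant, since the ideal
contains a multiple of the ring of integers. -/
theorem rep_of_isIdealBasis (ω : Module.Basis (Fin n) ℤ (𝓞 F)) (p : Fin r ≃ InfinitePlace F)
    (I : (FractionalIdeal (nonZeroDivisors (𝓞 F)) F)ˣ) {num : Fin n → Fin n → ℤ} {den : ℕ}
    (h : IsIdealBasis ω I num den) :
    Rep ω ⟨num, den⟩ (((I : FractionalIdeal (nonZeroDivisors (𝓞 F)) F) :
      Submodule (𝓞 F) F).restrictScalars ℤ) := by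
  set S := ((I : FractionalIdeal (nonZeroDivisors (𝓞 F)) F) :
      Submodule (𝓞 F) F).restrictScalars ℤ with hS
  have hmem : ∀ x, x ∈ S ↔ x ∈ (I : FractionalIdeal (nonZeroDivisors (𝓞 F)) F) := fun x => Iff.rfl
  have hspan : Submodule.span ℤ (Set.range (repVec ω ⟨num, den⟩)) = S := by
    ext x
    rw [hmem, h.2, Submodule.mem_span_range_iff_exists_fun]
    simp only [repVec, elt_apply, zsmul_eq_mul, Int.cast_natCast, eq_comm (b := x)]
  have hden : (0 : ℤ) < (⟨num, den⟩ : IdealRep n).den := Int.natCast_pos.2 h.1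
  refine ⟨hden, fun hdet => ?_, hspan⟩
  obtain ⟨a, haI, ha⟩ : ∃ a ∈ S, a ≠ 0 := by
    by_contra hcon
    push Not at hcon
    refine I.ne_zero ((FractionalIdeal.eq_zero_iff).2 fun x hx => hcon x hx)
  have hle : Submodule.span ℤ (Set.range fun i => a * (ω i : F)) ≤
      Submodule.span ℤ (Set.range (repVec ω ⟨num, den⟩)) := by
    rw [hspan, Submodule.span_le]
    rintro _ ⟨i, rfl⟩
    change a * (ω i : F) ∈ ((I : FractionalIdeal (nonZeroDivisors (𝓞 F)) F) : Submodule (𝓞 F) F)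
    rw [mul_comm]
    exact Submodule.smul_mem _ (ω i) haI
  obtain ⟨P, hP⟩ := exists_int_matrix hle
  have h1 := vol_mul_left p (fun _ => 1) a fun i => (ω i : F)
  rw [hP, vol_sum, vol_basis, vol_repVec ω p _ _ hden, IdealRep.nrm, hdet] at h1
  simp only [Int.cast_zero, abs_zero, zero_div, mul_zero, one_mul] at h1
  have h2 : (0 : ℝ) < |(discr F : ℝ)| := zero_lt_one.trans_le one_le_abs_discr
  have h3 := placeNorm_elt_pos p ha
  have h4 : 0 < |(discr F : ℝ)| * placeNorm p (fun σ => p σ a) ^ 2 := by positivity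
  norm_num at h1
  rcases h1 with h1 | h1
  · exact absurd h1 (by exact_mod_cast discr_ne_zero F)
  · exact h3.ne' h1

theorem h0_eq (p : Fin r ≃ InfinitePlace F) (W : ArakelovDivisor F) : W.h0 =
    Real.log (∑' f : (((W.ideal : FractionalIdeal (nonZeroDivisors (𝓞 F)) F) :
      Submodule (𝓞 F) F).restrictScalars ℤ),
      Real.exp (-(Real.pi * ‖fVec p (fun σ => W.u (p σ)) (f : F)‖ ^ 2))) := by
  rw [ArakelovDivisor.h0]
  congr 1
  refine tsum_congr fun f => ?_
  rw [norm_fVec_sq, ArakelovDivisor.sqNorm, ← p.sum_comp, neg_mul]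

/-- A polynomial time bound in `X` gives one in any `L ≥ 1` that dominates `X` up to a constant. -/
theorem PolyBdd.exists_pow {f : ℕ → ℕ} (hf : PolyBdd f) (a : ℕ) : ∃ C : ℕ, ∀ (L : ℝ) (X : ℕ),
    1 ≤ L → (X : ℝ) ≤ a * L + 1 → (f X : ℝ) ≤ C * L ^ C := by
  obtain ⟨-, k, hk⟩ := hf
  refine ⟨(a + 3) ^ k + k, fun L X hL hX => ?_⟩
  have h1 : (f X : ℝ) ≤ (X + 2) ^ k := by exact_mod_cast hk X
  have h2 : (X : ℝ) + 2 ≤ (a + 3) * L := by linarith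
  calc (f X : ℝ) ≤ (X + 2) ^ k := h1
    _ ≤ ((a + 3) * L) ^ k := pow_le_pow_left₀ (by positivity) h2 k
    _ = (a + 3) ^ k * L ^ k := mul_pow _ _ _
    _ ≤ ((a + 3) ^ k + k) * L ^ ((a + 3) ^ k + k) := by
        gcongr
        · linarith [(Nat.cast_nonneg k : (0 : ℝ) ≤ k)]
        · omega
    _ = _ := by push_cast; rfl

end ArakelovAlg

theorem proposition5p4 (n : ℕ) (hn : 2 ≤ n) (c : ℕ) :
    ∃ C : ℕ, ∀ (F : Type*) [Field F] [NumberField F],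
      Module.finrank ℚ F = n →
      ∀ (ω : Module.Basis (Fin n) ℤ (NumberField.RingOfIntegers F)) (r : ℕ)
        (p : Fin r ≃ NumberField.InfinitePlace F)
        (W : ArakelovDivisor F) (num : Fin n → Fin n → ℤ) (den : ℕ) (δ : ℝ),
      ArakelovAlg.IsIdealBasis ω W.ideal num den →
      ArakelovAlg.SizeLE ω num den W.u ((|NumberField.discr F| : ℝ) ^ c) →
      0 < δ → δ < 1 →
      ∃ (out : ℝ) (T : ℕ),
        ArakelovAlg.HaltsWith
          (ArakelovAlg.computeH0 (lt_of_lt_of_le Nat.zero_lt_two hn)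
            (ArakelovAlg.mkInput ω p num den W.u δ)) out T ∧
        |out - W.h0| ≤ δ ∧
        (T : ℝ) ≤ C * ((1 + Real.log (1 / δ)) * Real.log |(NumberField.discr F : ℝ)|) ^ C := by
  obtain ⟨f, hf, H⟩ := ArakelovAlg.computeH0_runs n hn (lt_of_lt_of_le Nat.zero_lt_two hn)
  set a : ℕ := 2 * (c + 1) + 2 ^ n * (1 + 3 * (n + 2) ^ 2) with ha
  obtain ⟨C, hC⟩ := hf.exists_pow a
  refine ⟨C, fun F _ _ hF ω r p W num den δ hI hsize hδ0 hδ1 => ?_⟩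
  set D : ℝ := |(NumberField.discr F : ℝ)| with hD
  set L : ℝ := (1 + Real.log (1 / δ)) * Real.log D with hL
  have hD3 : (3 : ℝ) ≤ D := by
    have h1 := NumberField.abs_discr_gt_two (K := F) (by omega)
    have h2 : (3 : ℤ) ≤ |NumberField.discr F| := by omega
    rw [hD]
    exact_mod_cast h2
  have hD0 : 0 < D := by linarith
  have hlogD : 1 ≤ Real.log D := by
    rw [Real.le_log_iff_exp_le hD0]
    linarith [Real.exp_one_lt_d9]
  have hδl : 0 ≤ Real.log (1 / δ) := Real.log_nonneg (by rw [le_div_iff₀ hδ0]; linarith)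
  have hL1 : 1 + Real.log (1 / δ) ≤ L := le_mul_of_one_le_right (by linarith) hlogD
  have hL2 : Real.log D ≤ L := le_mul_of_one_le_left (by linarith) (by linarith)
  have hLone : 1 ≤ L := by linarith
  set X : ℕ := ⌈a * L⌉₊ with hX
  have hXl : (a : ℝ) * L ≤ X := Nat.le_ceil _
  have hXu : (X : ℝ) ≤ a * L + 1 := (Nat.ceil_lt_add_one (by positivity)).le
  have haR : (a : ℝ) = 2 * (c + 1) + 2 ^ n * (1 + 3 * (n + 2) ^ 2) := by rw [ha]; push_cast; rfl
  have hpow : ∀ m : ℕ, m ≤ c + 1 → D ^ m ≤ 2 ^ X := by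
    intro m hm
    rw [← Real.log_le_log_iff (by positivity) (by positivity), Real.log_pow, Real.log_pow]
    have h2 : (1 : ℝ) / 2 ≤ Real.log 2 := by linarith [Real.log_two_gt_d9]
    have hm' : (m : ℝ) ≤ c + 1 := by exact_mod_cast hm
    have h3 : 2 * ((c : ℝ) + 1) * L ≤ X := by
      refine le_trans (mul_le_mul_of_nonneg_right ?_ (by linarith)) hXl
      rw [haR]
      have : (0 : ℝ) ≤ 2 ^ n * (1 + 3 * ((n : ℝ) + 2) ^ 2) := by positivity
      linarith
    calc (m : ℝ) * Real.log D ≤ (c + 1) * L := by gcongr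
      _ ≤ X * (1 / 2) := by linarith
      _ ≤ X * Real.log 2 := by gcongr
  have hDc : D ^ c ≤ 2 ^ X := hpow c (by omega)
  obtain ⟨h1, h2, h3, h4⟩ := hsize
  have hint : ∀ z : ℤ, |(z : ℝ)| ≤ D ^ c → |z| ≤ 2 ^ X := fun z hz => by
    have := hz.trans hDc
    exact_mod_cast this
  have hrad : ArakelovAlg.radius n δ * 2 ^ n ≤ X := by
    refine le_trans ?_ hXl
    have h5 := ArakelovAlg.radius_le n (by omega) hδ0 hδ1
    have h6 : Real.log (1 / δ) + ((n : ℝ) + 2) ^ 2 * 3 ≤ (1 + 3 * ((n : ℝ) + 2) ^ 2) * L := by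
      nlinarith [sq_nonneg ((n : ℝ) + 2)]
    calc ArakelovAlg.radius n δ * 2 ^ n ≤ (1 + 3 * ((n : ℝ) + 2) ^ 2) * L * 2 ^ n := by
          gcongr; exact h5.trans h6
      _ = 2 ^ n * (1 + 3 * ((n : ℝ) + 2) ^ 2) * L := by ring
      _ ≤ a * L := by
          refine mul_le_mul_of_nonneg_right ?_ (by linarith)
          rw [haR]
          have : (0 : ℝ) ≤ 2 * ((c : ℝ) + 1) := by positivity
          linarith
  obtain ⟨out, T, hrun, hT, hout⟩ := H X F ω r p num den W.u δ _ (fun i w => (h1 i w).trans hDc)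
    (by simpa using hpow 1 (by omega)) W.u_pos (fun w => (h4 w).trans hDc)
    (ArakelovAlg.rep_of_isIdealBasis ω p W.ideal hI)
    ⟨fun j i => hint _ (h2 j i), hint _ (by simpa using h3)⟩
    (fun b x hx => Submodule.smul_mem
      ((W.ideal : FractionalIdeal (nonZeroDivisors (𝓞 F)) F) : Submodule (𝓞 F) F) b hx)
    hδ0 hδ1 hrad
  refine ⟨out, T, hrun, ?_, ?_⟩
  · rw [ArakelovAlg.h0_eq p W]
    exact hout
  · exact le_trans (by exact_mod_cast hT) (hC L X hLone hXu)
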